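/- Let $\mathbb T=U(1)^m$, let $\xi_1,\dots,\xi_m$ be the vector fields generating a $\mathbb T$-action, let $\mathcal R=S^{-1}\mathbb R[\lambda_1,\dots,\lambda_m]$ with $S$ the set of nonzero homogeneous polynomials, and let $D=d-\sum_j\lambda_j\iota_{\xi_j}$ be the Cartan–Weil differential on $\mathbb T$-invariant forms. Let $\mathcal Z$ be a local $\mathbb T$-orbifold with corners (a $\mathbb T$-orbifold with corners whose dimension may vary between components) and $\pi:E\to\mathcal Z$ a $\mathbb T$-equivariant real vector bundle, with sphere bundle $\pi_S:S(E)=(E\setminus 0)/\mathbb R_{>0}\to\mathcal Z$ and orientation local system $\operatorname{Or}(E)$. For a form $\eta$ on $E$ put $\eta^{(k)}=\lim_{s\to\infty}s^k\mu_{1/s}^*\big(\eta-\sum_{j<k}\eta^{(j)}\big)$, where $\mu_a$ is multiplication by $a$ in the fibres. A form $q\in\Omega(E;\mathcal R)^{\mathbb T}$ is a *quadratic localizing form* if $q^{(2)}=q$ and: (a) $q=\sum_k q_k/\langle\zeta_k,\lambda\rangle$ is a finite sum with $q_k$ invariant real $1$-forms and $0\ne\zeta_k\in\mathbb Q^m$,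 where $\langle\zeta,\lambda\rangle=\sum_j\zeta^j\lambda_j$; (b) $f=\sum_j\lambda_j\iota_{\xi_j}q$ is a real-valued non-negative function whose zero set is the zero section; (c) $f^{(0)}=f^{(1)}=0$ and $f^{(2)}$ is a positive definite quadratic form on each fibre. Its *Segre form* is $\sigma=\pi_*(e^{Dq})$, where $e^{Dq}=e^{-f}\sum_i (dq)^i/i!$ and $\pi_*$ is integration over the fibre. An *equivariant angular form* for $E$ is an invariant form $\phi$ on $S(E)$ with coefficients in $\pi_S^*\operatorname{Or}(E)^\vee\otimes\mathbb R[\lambda_1,\dots,\lambda_m]$ such that $\pi_{S*}\phi=1$ and $D\phi=-\pi_S^*e$ for an invariant form $e$ on $\mathcal Z$ with coefficients in $\operatorname{Or}(E)^\vee\otimes\mathbb R[\lambda_1,\dots,\lambda_m]$, the *associated Euler form*. (Fibres of $S(E)$ are oriented as boundaries of balls; fibre integration inserts the fibre directions in the first slots.) **Lemma.** Let $q$ be a quadratic localizing form for $E$ with Segre form $\sigma$, and let $\phi$ be an equivariant angular form for $E$ with associated Euler form $e$. Then the fibre integrals defining $\sigma$ converge, and there is a form $\epsilon\in\Omega(\mathcal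 Z;\mathcal R)^{\mathbb T}$ such that $$\sigma\cdot e=1+D\epsilon .$$ Suppose moreover that $\mathcal Z$ is compact and that a boundary condition for $E$ is given, i.e. a $\mathbb T$-equivariant vector bundle $\pi':E'\to\mathcal Z'$ over a local $\mathbb T$-orbifold with corners and an equivariant cartesian square formed by $h:\partial E\to E'$ over $g:\partial\mathcal Z\to\mathcal Z'$, the dimension of the total space of $E'$ being strictly less than that of $\partial E$. If $q|_{\partial E}=h^*q'$ for some invariant $\mathcal R$-valued form $q'$ on $E'$ and $\phi|_{S(\partial E)}=S(h)^*\phi'$ for some invariant twisted form $\phi'$ on $S(E')$, then $\epsilon$ can be chosen such that, in addition, $\epsilon|_{\partial\mathcal Z}=g^*\epsilon'$ for some $\epsilon'\in\Omega(\mathcal Z';\mathcal R)^{\mathbb T}$. -/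

import Mathlib

open CategoryTheory MeasureTheory Filter
open scoped Topology ContDiff

noncomputable section

/-! ## Coefficients -/

/-- The multiplicative set of nonzero homogeneous polynomials in `ℝ[λ₁, …, λₘ]`. -/
def homogeneousSubmonoid (m : ℕ) : Submonoid (MvPolynomial (Fin m) ℝ) where
  carrier := {p | p ≠ 0 ∧ ∃ n : ℕ, p.IsHomogeneous n}
  one_mem' := ⟨one_ne_zero, 0, MvPolynomial.isHomogeneous_one _ _⟩
  mul_mem' := by
    rintro a b ⟨ha, k, hk⟩ ⟨hb, l, hl⟩
    exact ⟨mul_ne_zero ha hb, k + l, hk.mul hl⟩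

/-- The coefficient ring `𝓡 = S⁻¹ ℝ[λ₁, …, λₘ]`. -/
abbrev EqRing (m : ℕ) : Type := Localization (homogeneousSubmonoid m)

/-- The generator `λⱼ` of the coefficient ring. -/
def lam {m : ℕ} (j : Fin m) : EqRing m :=
  algebraMap (MvPolynomial (Fin m) ℝ) (EqRing m) (MvPolynomial.X j)

/-- The linear form `⟨ζ, λ⟩ = ∑ⱼ ζⱼ λⱼ` of a rational weight `ζ`. -/
def weightForm {m : ℕ} (ζ : Fin m → ℚ) : EqRing m := ∑ j, ((ζ j : ℚ) : ℝ) • lam j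

/-! ## Calculus for functions with values in a real vector space without topology

Forms with coefficients in `𝓡` take values in `𝓡 ⊗ ⋀ V*`.  A smooth function into such a space is
locally a finite sum of smooth real functions times constant vectors; limits, derivatives and
integrals are computed after applying real linear functionals. -/

/-- `F` is, locally in `S`, a finite sum of smooth real functions times constant vectors. -/
def IsSmoothOn {V M : Type*} [NormedAddCommGroup V] [NormedSpace ℝ V] [AddCommGroup M] [Module ℝ M]
    (F : V → M) (S : Set V) : Prop :=
  ∀ x ∈ S, ∃ U ∈ 𝓝 x, ∃ (n : ℕ) (c : Fin n → M) (f : Fin n → V → ℝ),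
    (∀ k, ContDiffOn ℝ ∞ (f k) (U ∩ S)) ∧ ∀ y ∈ U ∩ S, F y = ∑ k, f k y • c k

open Classical in
/-- The limit of `F` along `l`, tested against linear functionals (`0` if there is none). -/
def vlim {α M : Type*} [AddCommGroup M] [Module ℝ M] (l : Filter α) (F : α → M) : M :=
  if h : ∃ y : M, ∀ L : M →ₗ[ℝ] ℝ, Tendsto (fun a => L (F a)) l (𝓝 (L y)) then h.choose else 0

open Classical in
/-- The derivative of `F` at `x` within `S` in the direction `v`, tested against linear
functionals (`0` if there is none). -/
def vderiv {V M : Type*} [NormedAddCommGroup V] [NormedSpace ℝ V] [AddCommGroup M] [Module ℝ M]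
    (F : V → M) (S : Set V) (x v : V) : M :=
  if h : ∃ y : M, ∀ L : M →ₗ[ℝ] ℝ, L y = fderivWithin ℝ (fun z => L (F z)) S x v
  then h.choose else 0

/-- `F` has integral `y`, tested against linear functionals. -/
def HasVIntegral {α M : Type*} [MeasurableSpace α] [AddCommGroup M] [Module ℝ M]
    (μ : Measure α) (F : α → M) (y : M) : Prop :=
  ∀ L : M →ₗ[ℝ] ℝ, Integrable (fun a => L (F a)) μ ∧ ∫ a, L (F a) ∂μ = L y

open Classical in
/-- The integral of `F`, tested against linear functionals (`0` if it does not converge). -/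
def vintegral {α M : Type*} [MeasurableSpace α] [AddCommGroup M] [Module ℝ M]
    (μ : Measure α) (F : α → M) : M :=
  if h : ∃ y : M, HasVIntegral μ F y then h.choose else 0

/-! ## Exterior algebra -/

/-- Exterior forms (of mixed degree) on `V` with coefficients in `𝓡`: the exterior algebra of the
module of `𝓡`-valued covectors. -/
abbrev EForm (m : ℕ) (V : Type) [AddCommGroup V] [Module ℝ V] : Type :=
  ExteriorAlgebra (EqRing m) (V →ₗ[ℝ] EqRing m)

namespace EForm

variable {m : ℕ} {V W : Type} [AddCommGroup V] [Module ℝ V] [AddCommGroup W] [Module ℝ W]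

/-- A real covector as a form of degree one. -/
def covector (m : ℕ) (β : V →ₗ[ℝ] ℝ) : EForm m V :=
  ExteriorAlgebra.ι (EqRing m) ((Algebra.linearMap ℝ (EqRing m)) ∘ₗ β)

/-- Evaluation of `𝓡`-valued covectors at a vector. -/
def evalAt (m : ℕ) (v : V) : (V →ₗ[ℝ] EqRing m) →ₗ[EqRing m] EqRing m where
  toFun β := β v
  map_add' _ _ := rfl
  map_smul' _ _ := rfl

/-- Contraction `ι_v ψ`, i.e. insertion of `v` in the first slot. -/
def contract (v : V) (ψ : EForm m V) : EForm m V :=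
  CliffordAlgebra.contractLeft (R := EqRing m) (M := V →ₗ[ℝ] EqRing m) (Q := 0) (evalAt m v) ψ

/-- Precomposition of covectors with a linear map. -/
def precomp (m : ℕ) (A : V →ₗ[ℝ] W) :
    (W →ₗ[ℝ] EqRing m) →ₗ[EqRing m] (V →ₗ[ℝ] EqRing m) where
  toFun β := β ∘ₗ A
  map_add' _ _ := rfl
  map_smul' _ _ := rfl

/-- Pullback of exterior forms along a linear map. -/
def pull (A : V →ₗ[ℝ] W) (ψ : EForm m W) : EForm m V := ExteriorAlgebra.map (precomp m A) ψ

/-- The exterior forms with coefficients in `ℝ[λ₁, …, λₘ]`: the real subalgebra generated by the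
`λⱼ` and the real covectors. -/
def polynomialPart (m : ℕ) (V : Type) [AddCommGroup V] [Module ℝ V] : Subalgebra ℝ (EForm m V) :=
  Algebra.adjoin ℝ
    (Set.range (fun j : Fin m => algebraMap (EqRing m) (EForm m V) (lam j)) ∪
      Set.range (fun β : V →ₗ[ℝ] ℝ => covector m β))

end EForm

/-! ## Orbifolds with corners and torus actions

An orbifold with corners is presented by a proper étale groupoid whose object space is a disjoint
union of charts, each chart being a relatively open subset of a polyhedral quadrant.  A torus
action on the orbifold is recorded by adding to the groupoid the arrows `g · x → y` for all `g` in
the torus; such an arrow from `x` to `y` has *weight* `g`, and the arrows of weight `1` form the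
original étale groupoid.  (The enlarged groupoid presents the quotient stack together with its map
to `BT`; this is the same datum as a torus action on the orbifold and covers actions which do not
lift to the chosen object space.) -/

/-- A disjoint union of charts `dom i` in vector spaces `V i`, with boundary defining linear
functions `wall i k`. -/
structure ChartSystem where
  ι : Type
  V : ι → Type
  [normed : ∀ i, NormedAddCommGroup (V i)]
  [space : ∀ i, NormedSpace ℝ (V i)]
  [findim : ∀ i, FiniteDimensional ℝ (V i)]
  Face : ι → Type
  wall : ∀ i, Face i → V i →L[ℝ] ℝ
  dom : ∀ i, Set (V i)

attribute [instance] ChartSystem.normed ChartSystem.space ChartSystem.findim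

/-- A point of the object space, the disjoint union of the chart domains. -/
@[ext]
structure ChartSystem.Obj (C : ChartSystem) where
  chart : C.ι
  pt : C.V chart
  mem : pt ∈ C.dom chart

/-- The topology of the disjoint union. -/
instance (C : ChartSystem) : TopologicalSpace C.Obj :=
  TopologicalSpace.induced (fun x => (⟨x.chart, x.pt, x.mem⟩ : Σ i, C.dom i)) inferInstance

/-- A groupoid of weighted arrows on a chart system.  `jac a` is the differential at the source of
`a` of the local diffeomorphism given by the arrows near `a` of the same weight, `fund i j` is the
fundamental vector field `ξⱼ` on the chart `i`; see `TGroupoid.IsOrbifold` for the conditions which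
determine `jac` and `fund`. -/
structure TGroupoid (m : ℕ) extends ChartSystem where
  [groupoid : Groupoid.{0} toChartSystem.Obj]
  wt : ∀ {x y : toChartSystem.Obj}, (x ⟶ y) → (Fin m → Circle)
  wt_id : ∀ x : toChartSystem.Obj, wt (𝟙 x) = 1
  wt_comp : ∀ {x y z : toChartSystem.Obj} (a : x ⟶ y) (b : y ⟶ z), wt (a ≫ b) = wt b * wt a
  jac : ∀ {x y : toChartSystem.Obj}, (x ⟶ y) → (V x.chart →L[ℝ] V y.chart)
  jac_id : ∀ x : toChartSystem.Obj, jac (𝟙 x) = ContinuousLinearMap.id ℝ _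
  jac_comp : ∀ {x y z : toChartSystem.Obj} (a : x ⟶ y) (b : y ⟶ z),
    jac (a ≫ b) = (jac b).comp (jac a)
  fund : ∀ i, Fin m → V i → V i
  [arrTop : TopologicalSpace (Σ p : toChartSystem.Obj × toChartSystem.Obj, (p.1 ⟶ p.2))]

attribute [instance] TGroupoid.groupoid

namespace TGroupoid

variable {m : ℕ}

/-- The space of arrows. -/
abbrev Arr (X : TGroupoid m) : Type := Σ p : X.Obj × X.Obj, (p.1 ⟶ p.2)

instance (X : TGroupoid m) : TopologicalSpace X.Arr := X.arrTop

/-- `L` is a continuous family of arrows parametrized by `(τ, x')` near `(0, x)` and extending the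
arrow `a` at `x`; the arrow `L (τ, x')` starts at `x'`, has weight `exp(iτ)` times that of `a`, and
its target `Θ (τ, x')` depends smoothly on `(τ, x')`. -/
def IsSection (X : TGroupoid m) {x y : X.Obj} (a : x ⟶ y) (U : Set ((Fin m → ℝ) × X.V x.chart))
    (L : (Fin m → ℝ) × X.V x.chart → X.Arr) (Θ : (Fin m → ℝ) × X.V x.chart → X.V y.chart) : Prop :=
  U ∈ 𝓝 (0, x.pt) ∧
  ContinuousOn L (U ∩ {p | p.2 ∈ X.dom x.chart}) ∧
  L (0, x.pt) = ⟨(x, y), a⟩ ∧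
  ContDiffOn ℝ ∞ Θ (U ∩ {p | p.2 ∈ X.dom x.chart}) ∧
  ∀ p ∈ U, ∀ hp : p.2 ∈ X.dom x.chart, ∃ (hΘ : Θ p ∈ X.dom y.chart)
    (b : (⟨x.chart, p.2, hp⟩ : X.Obj) ⟶ (⟨y.chart, Θ p, hΘ⟩ : X.Obj)),
    L p = ⟨(⟨x.chart, p.2, hp⟩, ⟨y.chart, Θ p, hΘ⟩), b⟩ ∧
      X.wt b = fun j => Circle.exp (p.1 j) * X.wt a j

/-- The conditions under which a groupoid of weighted arrows presents a (local) orbifold with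
corners with an action of the torus `U(1)ᵐ`. The dimension may vary from chart to chart. -/
structure IsOrbifold (X : TGroupoid m) : Prop where
  countable : Countable X.ι
  finite_faces : ∀ i, Finite (X.Face i)
  /-- every chart is a relatively open subset of a quadrant -/
  walls_indep : ∀ i, LinearIndependent ℝ (X.wall i)
  dom_open : ∀ i, ∃ O : Set (X.V i), IsOpen O ∧ X.dom i = O ∩ {v | ∀ k, 0 ≤ X.wall i k v}
  /-- the arrows form a Hausdorff second countable space with continuous structure maps -/
  hausdorff : T2Space X.Arr
  second_countable : SecondCountableTopology X.Arr
  continuous_one : Continuous fun x : X.Obj => (⟨(x, x), 𝟙 x⟩ : X.Arr)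
  continuous_inv : Continuous fun a : X.Arr => (⟨(a.1.2, a.1.1), Groupoid.inv a.2⟩ : X.Arr)
  continuous_comp : Continuous fun c : {c : X.Arr × X.Arr // c.1.1.2 = c.2.1.1} =>
    (⟨(c.1.1.1.1, c.1.2.1.2), c.1.1.2 ≫ eqToHom c.2 ≫ c.1.2.2⟩ : X.Arr)
  /-- for every torus element `g`, arrows of weight `g` out of a point exist, and near a given
  arrow they are uniquely parametrized by the weight and the source -/
  etale : IsLocalHomeomorph fun a : X.Arr => (X.wt a.2, a.1.1)
  etale_surjective : Function.Surjective fun a : X.Arr => (X.wt a.2, a.1.1)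
  /-- properness; the torus being compact, this is properness of the groupoid of weight one
  arrows -/
  proper : IsProperMap fun a : X.Arr => a.1
  /-- smoothness of the target map, whose differential is given by `jac` and `fund` -/
  smooth : ∀ {x y : X.Obj} (a : x ⟶ y), ∃ U L Θ, X.IsSection a U L Θ ∧
    HasFDerivWithinAt Θ
      ((X.jac a).comp (ContinuousLinearMap.snd ℝ (Fin m → ℝ) (X.V x.chart)) +
        ∑ j, ((ContinuousLinearMap.proj (R := ℝ) j).comp
          (ContinuousLinearMap.fst ℝ (Fin m → ℝ) (X.V x.chart))).smulRight
            (X.fund y.chart j (y.pt)))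
      (U ∩ {p | p.2 ∈ X.dom x.chart}) (0, x.pt)

/-- Compactness of the orbifold: its coarse space, the space of objects modulo arrows of weight
one, is compact. -/
def IsCompact (X : TGroupoid m) : Prop :=
  CompactSpace (Quot fun x y : X.Obj => ∃ a : x ⟶ y, X.wt a = 1)

/-! ### Differential forms -/

/-- A family of (not necessarily smooth or invariant) differential forms on the charts. -/
abbrev RawForm (X : TGroupoid m) : Type := ∀ i, X.V i → EForm m (X.V i)

/-- `ψ` is an invariant differential form on the part `S` of `X`, twisted by the sign character `χ`
of the groupoid: it is smooth on the charts and compatible with all arrows.  Compatibility with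
arrows of weight one says that `ψ` is a form on the orbifold, compatibility with the others that it
is invariant under the torus. -/
structure IsFormOn (X : TGroupoid m) (S : ∀ i, Set (X.V i))
    (χ : ∀ {x y : X.Obj}, (x ⟶ y) → ℝ) (ψ : X.RawForm) : Prop where
  smooth : ∀ i, IsSmoothOn (ψ i) (S i)
  invariant : ∀ {x y : X.Obj} (a : x ⟶ y),
    x.pt ∈ S x.chart → y.pt ∈ S y.chart →
    EForm.pull (X.jac a).toLinearMap (ψ y.chart (y.pt)) = χ a • ψ x.chart (x.pt)

/-- `ψ ∈ Ω(X; 𝓡)^T`. -/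
def IsForm (X : TGroupoid m) (ψ : X.RawForm) : Prop := X.IsFormOn X.dom (fun _ => 1) ψ

/-- The exterior derivative `dψ = ∑ᵦ dxᵦ ∧ ∂ᵦψ`, derivatives being taken within `S`. -/
def extD (X : TGroupoid m) (S : ∀ i, Set (X.V i)) (ψ : X.RawForm) : X.RawForm := fun i x =>
  ∑ b, EForm.covector m ((Module.finBasis ℝ (X.V i)).coord b) *
    vderiv (ψ i) (S i) x (Module.finBasis ℝ (X.V i) b)

/-- `∑ⱼ λⱼ ι_{ξⱼ} ψ`. -/
def moment (X : TGroupoid m) (ψ : X.RawForm) : X.RawForm := fun i x =>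
  ∑ j, lam j • EForm.contract (X.fund i j x) (ψ i x)

/-- The Cartan–Weil differential `D = d - ∑ⱼ λⱼ ι_{ξⱼ}`. -/
def cartanD (X : TGroupoid m) (S : ∀ i, Set (X.V i)) (ψ : X.RawForm) : X.RawForm :=
  X.extD S ψ - X.moment ψ

open Classical in
/-- The value of the form `ψ` at a point where it is a real number. -/
def realValue (X : TGroupoid m) (ψ : X.RawForm) (i : X.ι) (x : X.V i) : ℝ :=
  if h : ∃ r : ℝ, ψ i x = algebraMap ℝ (EForm m (X.V i)) r then h.choose else 0

/-- `exp(Dη) = exp(-f) ∑ₖ (dη)ᵏ / k!`, for `η` a sum of one-forms for which `f = ∑ⱼ λⱼ ι_{ξⱼ} η`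
is a real valued function.  (`dη` is of degree two, so that the omitted terms vanish.) -/
def expD (X : TGroupoid m) (S : ∀ i, Set (X.V i)) (η : X.RawForm) : X.RawForm := fun i x =>
  Real.exp (-(X.realValue (X.moment η) i x)) •
    ∑ k ∈ Finset.range (Module.finrank ℝ (X.V i) + 1),
      ((k.factorial : ℝ)⁻¹) • (X.extD S η i x) ^ k

/-- `ψ` is a real one-form on the charts. -/
def IsRealOneForm (X : TGroupoid m) (ψ : X.RawForm) : Prop :=
  ∀ i, ∀ x ∈ X.dom i, ∃ β : X.V i →ₗ[ℝ] ℝ, ψ i x = EForm.covector m β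

/-! ### The boundary -/

/-- The charts of the boundary: the walls of the charts. -/
abbrev boundaryCharts (X : TGroupoid m) : ChartSystem where
  ι := Σ i, X.Face i
  V c := (X.wall c.1 c.2).ker
  Face c := {k : X.Face c.1 // k ≠ c.2}
  wall c k := (X.wall c.1 k.1).comp (X.wall c.1 c.2).ker.subtypeL
  dom c := {v | (v : X.V c.1) ∈ X.dom c.1}

/-- A point of the boundary as a point of `X`. -/
abbrev ofBoundary (X : TGroupoid m) (x : X.boundaryCharts.Obj) : X.Obj :=
  ⟨x.chart.1, x.pt.1, x.mem⟩

/-- The boundary defining function of the chosen wall at a point of the boundary. -/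
abbrev wallAt (X : TGroupoid m) (x : X.boundaryCharts.Obj) : X.V (X.ofBoundary x).chart →L[ℝ] ℝ :=
  X.wall x.chart.1 x.chart.2

/-- An arrow of the boundary is an arrow of `X` that carries the chosen wall at its source to the
chosen wall at its target. -/
@[ext]
structure BoundaryHom (X : TGroupoid m) (x y : X.boundaryCharts.Obj) where
  arrow : X.ofBoundary x ⟶ X.ofBoundary y
  wall_arrow : ∃ c : ℝ, 0 < c ∧ ∀ u, X.wallAt y (X.jac arrow u) = c * X.wallAt x u

instance (X : TGroupoid m) : Groupoid.{0} X.boundaryCharts.Obj where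
  Hom x y := X.BoundaryHom x y
  id x := ⟨𝟙 (X.ofBoundary x), 1, one_pos, fun u => by
    rw [X.jac_id, ContinuousLinearMap.id_apply, one_mul]⟩
  comp {x y z} a b := ⟨a.arrow ≫ b.arrow, by
    obtain ⟨c, hc, h⟩ := a.wall_arrow
    obtain ⟨d, hd, k⟩ := b.wall_arrow
    refine ⟨d * c, mul_pos hd hc, fun u => ?_⟩
    rw [X.jac_comp, ContinuousLinearMap.comp_apply, k, h, mul_assoc]⟩
  id_comp a := BoundaryHom.ext (Category.id_comp a.arrow)
  comp_id a := BoundaryHom.ext (Category.comp_id a.arrow)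
  assoc a b c := BoundaryHom.ext (Category.assoc a.arrow b.arrow c.arrow)
  inv {x y} a := ⟨Groupoid.inv a.arrow, by
    obtain ⟨c, hc, h⟩ := a.wall_arrow
    refine ⟨c⁻¹, inv_pos.mpr hc, fun u => ?_⟩
    have e : X.jac a.arrow (X.jac (Groupoid.inv a.arrow) u) = u := by
      rw [← ContinuousLinearMap.comp_apply, ← X.jac_comp, Groupoid.inv_comp, X.jac_id,
        ContinuousLinearMap.id_apply]
    have h2 := h (X.jac (Groupoid.inv a.arrow) u)
    rw [e] at h2
    rw [h2, inv_mul_cancel_left₀ hc.ne']⟩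
  inv_comp a := BoundaryHom.ext (Groupoid.inv_comp a.arrow)
  comp_inv a := BoundaryHom.ext (Groupoid.comp_inv a.arrow)

theorem jac_boundary_mem (X : TGroupoid m) {x y : X.boundaryCharts.Obj} (a : X.BoundaryHom x y)
    (u : X.boundaryCharts.V x.chart) :
    X.jac a.arrow u.1 ∈ (X.wall y.chart.1 y.chart.2).ker := by
  obtain ⟨c, -, h⟩ := a.wall_arrow
  have hu : X.wallAt x u.1 = 0 := u.2
  have h' := h u.1
  rw [hu, mul_zero] at h'
  exact h'

/-- The differential of an arrow of the boundary. -/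
def boundaryJac (X : TGroupoid m) {x y : X.boundaryCharts.Obj} (a : X.BoundaryHom x y) :
    X.boundaryCharts.V x.chart →L[ℝ] X.boundaryCharts.V y.chart :=
  ((X.jac a.arrow).comp (X.wall x.chart.1 x.chart.2).ker.subtypeL).codRestrict
    (X.wall y.chart.1 y.chart.2).ker (fun u => X.jac_boundary_mem a u)

open Classical in
/-- The boundary `∂X` of `X`. -/
abbrev boundary (X : TGroupoid m) : TGroupoid m where
  toChartSystem := X.boundaryCharts
  wt a := X.wt (BoundaryHom.arrow a)
  wt_id x := X.wt_id (X.ofBoundary x)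
  wt_comp a b := X.wt_comp (BoundaryHom.arrow a) (BoundaryHom.arrow b)
  jac a := X.boundaryJac a
  jac_id x := ContinuousLinearMap.ext fun u =>
    Subtype.ext (congrArg (fun f => f u.1) (X.jac_id (X.ofBoundary x)))
  jac_comp a b := ContinuousLinearMap.ext fun u =>
    Subtype.ext (congrArg (fun f => f u.1)
      (X.jac_comp (BoundaryHom.arrow a) (BoundaryHom.arrow b)))
  -- the fundamental vector fields are tangent to the walls
  fund c j v := if h : X.fund c.1 j v.1 ∈ (X.wall c.1 c.2).ker then ⟨_, h⟩ else 0
  arrTop := TopologicalSpace.induced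
    (fun a => (a.1, (⟨(X.ofBoundary a.1.1, X.ofBoundary a.1.2), BoundaryHom.arrow a.2⟩ : X.Arr)))
    inferInstance

end TGroupoid

/-! ## Equivariant vector bundles -/

/-- The standard fibre of rank `r`. -/
abbrev Fib (r : ℕ) : Type := EuclideanSpace ℝ (Fin r)

/-- A vector bundle over `X` with an action of all weighted arrows (thus a torus equivariant vector
bundle on the orbifold), trivialized over the charts.  `act a` is the action of the arrow `a`;
`dact a w` is the derivative of the action at `a`, along arrows of the same weight, in the direction
`w`; `inf i j x` is the fibre component of the fundamental vector field of the total space.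
See `TBundle.IsSmooth` for the conditions which determine `dact` and `inf`. -/
structure TBundle {m : ℕ} (X : TGroupoid m) where
  rank : X.ι → ℕ
  act : ∀ {x y : X.Obj}, (x ⟶ y) → (Fib (rank x.chart) →L[ℝ] Fib (rank y.chart))
  act_id : ∀ x : X.Obj, act (𝟙 x) = ContinuousLinearMap.id ℝ _
  act_comp : ∀ {x y z : X.Obj} (a : x ⟶ y) (b : y ⟶ z), act (a ≫ b) = (act b).comp (act a)
  dact : ∀ {x y : X.Obj}, (x ⟶ y) →
    (X.V x.chart →L[ℝ] (Fib (rank x.chart) →L[ℝ] Fib (rank y.chart)))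
  dact_id : ∀ x : X.Obj, dact (𝟙 x) = 0
  dact_comp : ∀ {x y z : X.Obj} (a : x ⟶ y) (b : y ⟶ z) (w : X.V x.chart),
    dact (a ≫ b) w = (dact b (X.jac a w)).comp (act a) + (act b).comp (dact a w)
  inf : ∀ i, Fin m → X.V i → (Fib (rank i) →L[ℝ] Fib (rank i))

namespace TBundle

variable {m : ℕ} {X : TGroupoid m}

/-- The action of the arrows on the fibres is smooth, with derivatives given by `dact` and `inf`. -/
def IsSmooth (E : TBundle X) : Prop :=
  ∀ {x y : X.Obj} (a : x ⟶ y), ∃ U L Θ, X.IsSection a U L Θ ∧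
    ∃ Ψ : (Fin m → ℝ) × X.V x.chart → (Fib (E.rank x.chart) →L[ℝ] Fib (E.rank y.chart)),
      ContDiffOn ℝ ∞ Ψ (U ∩ {p | p.2 ∈ X.dom x.chart}) ∧
      (∀ p ∈ U, ∀ (hp : p.2 ∈ X.dom x.chart) (hΘ : Θ p ∈ X.dom y.chart)
        (b : (⟨x.chart, p.2, hp⟩ : X.Obj) ⟶ (⟨y.chart, Θ p, hΘ⟩ : X.Obj)),
        L p = ⟨(⟨x.chart, p.2, hp⟩, ⟨y.chart, Θ p, hΘ⟩), b⟩ → E.act b = Ψ p) ∧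
      HasFDerivWithinAt Ψ
        ((E.dact a).comp (ContinuousLinearMap.snd ℝ (Fin m → ℝ) (X.V x.chart)) +
          ∑ j, ((ContinuousLinearMap.proj (R := ℝ) j).comp
            (ContinuousLinearMap.fst ℝ (Fin m → ℝ) (X.V x.chart))).smulRight
              ((E.inf y.chart j (y.pt)).comp (E.act a)))
        (U ∩ {p | p.2 ∈ X.dom x.chart}) (0, x.pt)

/-- The total space of `E` has constant dimension `N`. -/
def HasTotalDim (E : TBundle X) (N : ℕ) : Prop :=
  ∀ i, (X.dom i).Nonempty → Module.finrank ℝ (X.V i) + E.rank i = N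

/-- The sign of the determinant of a linear map between standard fibres of the same rank. -/
def detSign {r s : ℕ} (A : Fib r →L[ℝ] Fib s) : ℝ :=
  if h : r = s then
    ((SignType.sign (Matrix.det fun p q : Fin r =>
      A (EuclideanSpace.single q 1) (Fin.cast h p)) : SignType) : ℝ)
  else 0

/-- The orientation character of `E`. Forms twisted by it are the forms with values in the
orientation local system `Or(E)` (or its dual), written in the orientations of the charts. -/
def orient (E : TBundle X) : ∀ {x y : X.Obj}, (x ⟶ y) → ℝ := fun a => detSign (E.act a)

/-- The charts of the total space of `E`. -/
abbrev totalCharts (E : TBundle X) : ChartSystem where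
  ι := X.ι
  V i := X.V i × Fib (E.rank i)
  Face := X.Face
  wall i k := (X.wall i k).comp (ContinuousLinearMap.fst ℝ _ _)
  dom i := {p | p.1 ∈ X.dom i}

/-- The projection `π : E → X` on objects. -/
abbrev proj (E : TBundle X) (x : E.totalCharts.Obj) : X.Obj := ⟨x.chart, x.pt.1, x.mem⟩

/-- The fibre coordinate of a point of the total space. -/
abbrev vec (E : TBundle X) (x : E.totalCharts.Obj) : Fib (E.rank (E.proj x).chart) := x.pt.2

/-- An arrow of the total space is an arrow of `X` together with a vector in the fibre over its
source. -/
@[ext]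
structure TotalHom (E : TBundle X) (x y : E.totalCharts.Obj) where
  arrow : E.proj x ⟶ E.proj y
  act_arrow : E.act arrow (E.vec x) = E.vec y

instance (E : TBundle X) : Groupoid.{0} E.totalCharts.Obj where
  Hom x y := E.TotalHom x y
  id x := ⟨𝟙 (E.proj x), by rw [E.act_id, ContinuousLinearMap.id_apply]⟩
  comp a b := ⟨a.arrow ≫ b.arrow, by
    rw [E.act_comp, ContinuousLinearMap.comp_apply, a.act_arrow, b.act_arrow]⟩
  id_comp a := TotalHom.ext (Category.id_comp a.arrow)
  comp_id a := TotalHom.ext (Category.comp_id a.arrow)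
  assoc a b c := TotalHom.ext (Category.assoc a.arrow b.arrow c.arrow)
  inv {x y} a := ⟨Groupoid.inv a.arrow, by
    rw [← a.act_arrow, ← ContinuousLinearMap.comp_apply, ← E.act_comp, Groupoid.comp_inv,
      E.act_id, ContinuousLinearMap.id_apply]⟩
  inv_comp a := TotalHom.ext (Groupoid.inv_comp a.arrow)
  comp_inv a := TotalHom.ext (Groupoid.comp_inv a.arrow)

/-- The differential of the action of an arrow on the total space. -/
def totalJac (E : TBundle X) {x y : E.totalCharts.Obj} (a : E.TotalHom x y) :
    E.totalCharts.V x.chart →L[ℝ] E.totalCharts.V y.chart :=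
  ((X.jac a.arrow).comp (ContinuousLinearMap.fst ℝ _ _)).prod
    ((E.act a.arrow).comp (ContinuousLinearMap.snd ℝ _ _) +
      ((E.dact a.arrow).flip (E.vec x)).comp (ContinuousLinearMap.fst ℝ _ _))

/-- The total space of `E`. -/
abbrev total (E : TBundle X) : TGroupoid m where
  toChartSystem := E.totalCharts
  wt a := X.wt (TotalHom.arrow a)
  wt_id x := X.wt_id (E.proj x)
  wt_comp a b := X.wt_comp (TotalHom.arrow a) (TotalHom.arrow b)
  jac a := E.totalJac a
  jac_id x := by
    refine ContinuousLinearMap.ext fun p => Prod.ext ?_ ?_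
    · exact congrArg (fun f => f p.1) (X.jac_id (E.proj x))
    · change E.act (𝟙 (E.proj x)) p.2 + E.dact (𝟙 (E.proj x)) p.1 (E.vec x) = p.2
      rw [E.dact_id, E.act_id]
      exact add_zero p.2
  jac_comp {x y z} a b := by
    refine ContinuousLinearMap.ext fun p => Prod.ext ?_ ?_
    · exact congrArg (fun f => f p.1) (X.jac_comp (TotalHom.arrow a) (TotalHom.arrow b))
    · have h1 : E.act (TotalHom.arrow a ≫ TotalHom.arrow b) p.2 =
          E.act (TotalHom.arrow b) (E.act (TotalHom.arrow a) p.2) :=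
        congrArg (fun f => f p.2) (E.act_comp (TotalHom.arrow a) (TotalHom.arrow b))
      have h2 : E.dact (TotalHom.arrow a ≫ TotalHom.arrow b) p.1 (E.vec x) =
          E.dact (TotalHom.arrow b) (X.jac (TotalHom.arrow a) p.1)
            (E.act (TotalHom.arrow a) (E.vec x)) +
          E.act (TotalHom.arrow b) (E.dact (TotalHom.arrow a) p.1 (E.vec x)) :=
        congrArg (fun f => f (E.vec x)) (E.dact_comp (TotalHom.arrow a) (TotalHom.arrow b) p.1)
      rw [TotalHom.act_arrow a] at h2
      have h3 := map_add (E.act (TotalHom.arrow b)) (E.act (TotalHom.arrow a) p.2)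
        (E.dact (TotalHom.arrow a) p.1 (E.vec x))
      change E.act (TotalHom.arrow a ≫ TotalHom.arrow b) p.2 +
          E.dact (TotalHom.arrow a ≫ TotalHom.arrow b) p.1 (E.vec x) =
        E.act (TotalHom.arrow b) (E.act (TotalHom.arrow a) p.2 +
            E.dact (TotalHom.arrow a) p.1 (E.vec x)) +
          E.dact (TotalHom.arrow b) (X.jac (TotalHom.arrow a) p.1) (E.vec y)
      refine (congrArg₂ (· + ·) h1 h2).trans (Eq.trans ?_ (congrArg (· + _) h3.symm))
      exact (congrArg (_ + ·) (add_comm _ _)).trans (add_assoc _ _ _).symm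
  fund i j p := (X.fund i j p.1, E.inf i j p.1 p.2)
  arrTop := TopologicalSpace.induced
    (fun a => (a.1, (⟨(E.proj a.1.1, E.proj a.1.2), TotalHom.arrow a.2⟩ : X.Arr))) inferInstance

/-- The restriction of `E` to the boundary; its total space is the boundary `∂E` of the total
space. -/
abbrev boundary (E : TBundle X) : TBundle X.boundary where
  rank c := E.rank c.1
  act a := E.act (TGroupoid.BoundaryHom.arrow a)
  act_id x := E.act_id (X.ofBoundary x)
  act_comp a b :=
    E.act_comp (TGroupoid.BoundaryHom.arrow a) (TGroupoid.BoundaryHom.arrow b)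
  dact {x _} a := (E.dact (TGroupoid.BoundaryHom.arrow a)).comp
    (X.wall x.chart.1 x.chart.2).ker.subtypeL
  dact_id x := ContinuousLinearMap.ext fun w =>
    congrArg (fun f => f w.1) (E.dact_id (X.ofBoundary x))
  dact_comp a b w :=
    E.dact_comp (TGroupoid.BoundaryHom.arrow a) (TGroupoid.BoundaryHom.arrow b) w.1
  inf c j v := E.inf c.1 j v.1

/-- The complement of the zero section. -/
def punctured (E : TBundle X) : ∀ i, Set (E.total.V i) := fun i => {p | p.1 ∈ X.dom i ∧ p.2 ≠ 0}

/-! ### Fibre integration -/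

/-- The differential of the inclusion of a slice `V × {v}`. -/
def slice (V : Type) [AddCommGroup V] [Module ℝ V] (r : ℕ) : V →ₗ[ℝ] V × Fib r :=
  LinearMap.inl ℝ V (Fib r)

/-- The form on the base obtained from `ψ` by inserting the standard basis `e₁, …, eᵣ` of the fibre
in the first `r` slots. -/
def fibreTop {V : Type} [AddCommGroup V] [Module ℝ V] {r : ℕ} (ψ : EForm m (V × Fib r)) : EForm m V :=
  EForm.pull (slice V r) ((List.finRange r).foldl
    (fun α k => EForm.contract ((0 : V), (EuclideanSpace.single k (1 : ℝ) : Fib r)) α) ψ)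

/-- Integration `π_*` over the fibres of `E → X`. -/
def fibreIntegral (E : TBundle X) (ψ : E.total.RawForm) : X.RawForm := fun i x =>
  vintegral (volume : Measure (Fib (E.rank i))) fun v => fibreTop (V := X.V i) (ψ i (x, v))

/-- The integrals defining `fibreIntegral` converge. -/
def FibreIntegrable (E : TBundle X) (ψ : E.total.RawForm) : Prop :=
  ∀ i, ∀ x ∈ X.dom i, ∃ y : EForm m (X.V i),
    HasVIntegral (volume : Measure (Fib (E.rank i)))
      (fun v => fibreTop (V := X.V i) (ψ i (x, v))) y

/-- The covector `∑ₖ vₖ dvₖ` at the point `v` of the fibre. -/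
def radialCovector (V : Type) [AddCommGroup V] [Module ℝ V] {r : ℕ} (v : Fib r) :
    V × Fib r →ₗ[ℝ] ℝ :=
  (innerSL ℝ v).toLinearMap ∘ₗ LinearMap.snd ℝ V (Fib r)

/-- Integration over the fibres of the sphere bundle `S(E) → X`.  The unit sphere is oriented as
the boundary of the unit ball, so that the restriction to it of a form `α` on the fibre is the
coefficient of `∑ₖ vₖ dvₖ ∧ α` times the surface measure. -/
def sphereIntegral (E : TBundle X) (φ : E.total.RawForm) : X.RawForm := fun i x =>
  vintegral (volume : Measure (Fib (E.rank i))).toSphere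
    fun v : Metric.sphere (0 : Fib (E.rank i)) 1 =>
      fibreTop (V := X.V i) (EForm.covector m (radialCovector (X.V i) v.1) * φ i (x, v.1))

/-- Pullback along `π : E → X`. -/
def pullBase (E : TBundle X) (e : X.RawForm) : E.total.RawForm := fun i p =>
  EForm.pull (LinearMap.fst ℝ (X.V i) (Fib (E.rank i))) (e i p.1)

/-- Pullback along multiplication by `s` in the fibres. -/
def scalePull (E : TBundle X) (s : ℝ) (ψ : E.total.RawForm) : E.total.RawForm := fun i p =>
  EForm.pull (LinearMap.prodMap (LinearMap.id : X.V i →ₗ[ℝ] X.V i)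
      (s • (LinearMap.id : Fib (E.rank i) →ₗ[ℝ] Fib (E.rank i))))
    (ψ i (p.1, s • p.2))

/-! ### Quadratic localizing forms -/

/-- The `k`-homogeneous component of `η` around the zero section:
`η⁽ᵏ⁾ = lim_{s → ∞} sᵏ μ_{1/s}^* (η - ∑_{j < k} η⁽ʲ⁾)`, where `μ_a` is multiplication by `a`. -/
def homPart (E : TBundle X) (η : E.total.RawForm) (k : ℕ) : E.total.RawForm := fun i p =>
  vlim atTop fun s : ℝ => s ^ k • E.scalePull s⁻¹ (η - ∑ j : Fin k, E.homPart η j) i p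
termination_by k
decreasing_by exact j.2

/-- `q ∈ Ω(E; 𝓡)^T` is quadratic: `q⁽²⁾ = q`. -/
def IsQuadratic (E : TBundle X) (q : E.total.RawForm) : Prop :=
  ∀ i, ∀ p ∈ E.total.dom i, E.homPart q 2 i p = q i p

/-- The form `q` localizes to the zero section. -/
structure IsLocalizing (E : TBundle X) (q : E.total.RawForm) : Prop where
  /-- `q = ∑ₖ qₖ / ⟨ζₖ, λ⟩` for invariant real one-forms `qₖ` and nonzero rational weights `ζₖ`;
  here `c k` is the inverse of `⟨ζₖ, λ⟩`. -/
  decomposition : ∃ (n : ℕ) (ζ : Fin n → Fin m → ℚ) (c : Fin n → EqRing m)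
    (η : Fin n → E.total.RawForm),
    (∀ k, ζ k ≠ 0 ∧ c k * weightForm (ζ k) = 1 ∧ E.total.IsForm (η k) ∧
      E.total.IsRealOneForm (η k)) ∧
    ∀ i, ∀ p ∈ E.total.dom i, q i p = ∑ k, c k • η k i p
  /-- `f = ∑ⱼ λⱼ ι_{ξⱼ} q` is a real nonnegative function vanishing exactly on the zero section. -/
  moment_real : ∀ i, ∀ p ∈ E.total.dom i, ∃ r : ℝ, 0 ≤ r ∧ (r = 0 ↔ p.2 = 0) ∧
    E.total.moment q i p = algebraMap ℝ _ r
  /-- `f⁽⁰⁾ = f⁽¹⁾ = 0`, and `f⁽²⁾` is a positive definite quadratic form on each fibre. -/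
  homPart_zero : ∀ i, ∀ p ∈ E.total.dom i, E.homPart (E.total.moment q) 0 i p = 0
  homPart_one : ∀ i, ∀ p ∈ E.total.dom i, E.homPart (E.total.moment q) 1 i p = 0
  homPart_two : ∀ i, ∀ x ∈ X.dom i, ∃ Q : QuadraticForm ℝ (Fib (E.rank i)), Q.PosDef ∧
    ∀ v, E.homPart (E.total.moment q) 2 i (x, v) = algebraMap ℝ _ (Q v)

/-- The equivariant Segre form `σ = π_*(exp(Dq))`. -/
def segre (E : TBundle X) (q : E.total.RawForm) : X.RawForm :=
  E.fibreIntegral (E.total.expD E.total.dom q)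

/-! ### Angular forms -/

/-- Invariant forms on the sphere bundle `S(E) = (E ∖ 0) / ℝ_{>0}` with coefficients in the
pullback of `Or(E)`, given by their pullback to `E ∖ 0`: these are the twisted invariant forms on
`E ∖ 0` which are invariant under positive dilations and annihilated by contraction with the radial
vector field. -/
structure IsSphereForm (E : TBundle X) (φ : E.total.RawForm) : Prop where
  form : E.total.IsFormOn E.punctured (fun a => E.orient (TotalHom.arrow a)) φ
  dilation : ∀ s : ℝ, 0 < s → ∀ i, ∀ p ∈ E.punctured i, E.scalePull s φ i p = φ i p
  radial : ∀ i, ∀ p ∈ E.punctured i,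
    EForm.contract ((0, p.2) : X.V i × Fib (E.rank i)) (φ i p) = 0

/-- `φ` is an equivariant angular form for `E` with associated Euler form `e`: both are twisted by
`Or(E)` and have coefficients in `ℝ[λ₁, …, λₘ]`, the integral of `φ` over the fibres of `S(E)` is
`1`, and `Dφ = -π_S^* e`. -/
structure IsAngularForm (E : TBundle X) (φ : E.total.RawForm) (e : X.RawForm) : Prop where
  sphere_form : E.IsSphereForm φ
  polynomial : ∀ i, ∀ p ∈ E.punctured i,
    φ i p ∈ EForm.polynomialPart m (X.V i × Fib (E.rank i))
  euler_form : X.IsFormOn X.dom E.orient e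
  euler_polynomial : ∀ i, ∀ x ∈ X.dom i, e i x ∈ EForm.polynomialPart m (X.V i)
  integral_one : ∀ i, ∀ x ∈ X.dom i, E.sphereIntegral φ i x = 1
  differential : ∀ i, ∀ p ∈ E.punctured i,
    E.total.cartanD E.punctured φ i p = -E.pullBase e i p

end TBundle

/-! ## Maps and boundary conditions -/

/-- The underlying data on objects of a map of orbifolds: a cover of the charts of `X` by sets `O a`,
and maps from these to charts of `Y`. -/
structure OrbMapData {m : ℕ} (X Y : TGroupoid m) where
  κ : Type
  chart : κ → X.ι
  O : ∀ a, Set (X.V (chart a))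
  subset_dom : ∀ a, O a ⊆ X.dom (chart a)
  tgtChart : κ → Y.ι
  f : ∀ a, X.V (chart a) → Y.V (tgtChart a)
  mapsTo : ∀ a, Set.MapsTo (f a) (O a) (Y.dom (tgtChart a))

namespace OrbMapData

variable {m : ℕ} {X Y : TGroupoid m}

/-- The objects of the refinement of `X` given by the cover. -/
abbrev Cov (g : OrbMapData X Y) : Type := Σ a, g.O a

/-- The refinement map on objects. -/
def ref (g : OrbMapData X Y) (w : g.Cov) : X.Obj := ⟨g.chart w.1, w.2.1, g.subset_dom w.1 w.2.2⟩

/-- The map to `Y` on objects of the refinement. -/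
def img (g : OrbMapData X Y) (w : g.Cov) : Y.Obj :=
  ⟨g.tgtChart w.1, g.f w.1 w.2.1, g.mapsTo w.1 w.2.2⟩

/-- The arrows of the refinement. -/
abbrev CovArr (g : OrbMapData X Y) : Type := Σ p : g.Cov × g.Cov, (g.ref p.1 ⟶ g.ref p.2)

instance (g : OrbMapData X Y) : TopologicalSpace g.CovArr :=
  TopologicalSpace.induced
    (fun a => (a.1, (⟨(g.ref a.1.1, g.ref a.1.2), a.2⟩ : X.Arr))) inferInstance

end OrbMapData

/-- A torus equivariant map `X → Y` of orbifolds, as a fraction: a weight preserving functor to `Y`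
from the refinement of `X` given by an open cover. -/
structure OrbMap {m : ℕ} (X Y : TGroupoid m) extends OrbMapData X Y where
  map : ∀ {w w' : toOrbMapData.Cov}, (toOrbMapData.ref w ⟶ toOrbMapData.ref w') →
    (toOrbMapData.img w ⟶ toOrbMapData.img w')
  map_id : ∀ w : toOrbMapData.Cov, map (𝟙 (toOrbMapData.ref w)) = 𝟙 (toOrbMapData.img w)
  map_comp : ∀ {w w' w'' : toOrbMapData.Cov} (a : toOrbMapData.ref w ⟶ toOrbMapData.ref w')
    (b : toOrbMapData.ref w' ⟶ toOrbMapData.ref w''), map (w := w) (w' := w'') (a ≫ b) =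
      map a ≫ map b
  wt_map : ∀ {w w' : toOrbMapData.Cov} (a : toOrbMapData.ref w ⟶ toOrbMapData.ref w'),
    Y.wt (map a) = X.wt a

namespace OrbMap

variable {m : ℕ} {X Y : TGroupoid m}

/-- The sets `O a` form an open cover and the functor is smooth. -/
structure IsSmooth (g : OrbMap X Y) : Prop where
  isOpen : ∀ a, ∃ O' : Set (X.V (g.chart a)), IsOpen O' ∧ g.O a = O' ∩ X.dom (g.chart a)
  cover : ∀ x : X.Obj, ∃ w : g.Cov, g.ref w = x
  smooth : ∀ a, ContDiffOn ℝ ∞ (g.f a) (g.O a)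
  continuous_map : Continuous fun a : g.CovArr =>
    (⟨(g.img a.1.1, g.img a.1.2), g.map a.2⟩ : Y.Arr)

end OrbMap

/-- A map of equivariant vector bundles which is an isomorphism on the fibres, i.e. a cartesian
square, over the map `g` of orbifolds. -/
structure CartesianMap {m : ℕ} {X Y : TGroupoid m} (E : TBundle X) (E' : TBundle Y)
    (g : OrbMap X Y) where
  lin : ∀ a, X.V (g.chart a) → (Fib (E.rank (g.chart a)) →L[ℝ] Fib (E'.rank (g.tgtChart a)))
  bijective : ∀ a, ∀ x ∈ g.O a, Function.Bijective (lin a x)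
  smooth : ∀ a, ContDiffOn ℝ ∞ (lin a) (g.O a)
  equivariant : ∀ {w w' : g.Cov} (b : g.ref w ⟶ g.ref w'),
    (E'.act (g.map b)).comp (lin w.1 w.2.1) = (lin w'.1 w'.2.1).comp (E.act b)

namespace CartesianMap

variable {m : ℕ} {X Y : TGroupoid m} {E : TBundle X} {E' : TBundle Y} {g : OrbMap X Y}

/-- The map `(x, v) ↦ (g x, h_x v)` of total spaces over the set `O a`. -/
def tot (h : CartesianMap E E' g) (a : g.κ) :
    X.V (g.chart a) × Fib (E.rank (g.chart a)) →
      Y.V (g.tgtChart a) × Fib (E'.rank (g.tgtChart a)) :=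
  fun p => (g.f a p.1, h.lin a p.1 p.2)

/-- The pullback `h^* ψ'`, on the part of `E` over `O a`. -/
def pullTot (h : CartesianMap E E' g) (ψ' : E'.total.RawForm) (a : g.κ)
    (p : X.V (g.chart a) × Fib (E.rank (g.chart a))) :
    EForm m (X.V (g.chart a) × Fib (E.rank (g.chart a))) :=
  EForm.pull (fderivWithin ℝ (h.tot a) {p | p.1 ∈ g.O a} p).toLinearMap
    (ψ' (g.tgtChart a) (h.tot a p))

end CartesianMap

/-- A boundary condition for the vector bundle `E → Z`: a vector bundle `E' → Z'` and a cartesian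
square `h : ∂E → E'` over `g : ∂Z → Z'`, where the dimension of the total space of `E'` is strictly
less than that of `∂E`. -/
structure BoundaryCondition {m : ℕ} {Z : TGroupoid m} (E : TBundle Z) where
  Z' : TGroupoid m
  isOrbifold : Z'.IsOrbifold
  E' : TBundle Z'
  smooth_bundle : E'.IsSmooth
  g : OrbMap Z.boundary Z'
  smooth_map : g.IsSmooth
  h : CartesianMap E.boundary E' g
  dim : ℕ
  dim' : ℕ
  totalDim : E.boundary.HasTotalDim dim
  totalDim' : E'.HasTotalDim dim'
  dim_lt : dim' < dim

namespace BoundaryCondition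

variable {m : ℕ} {Z : TGroupoid m} {E : TBundle Z}

/-- Restriction of a form on `E` to the boundary `∂E`. -/
def restrictTotal (ψ : E.total.RawForm) : E.boundary.total.RawForm := fun c p =>
  EForm.pull (LinearMap.prodMap (Z.wall c.1 c.2).ker.subtype
      (LinearMap.id : Fib (E.rank c.1) →ₗ[ℝ] Fib (E.rank c.1)))
    (ψ c.1 ((p.1 : Z.V c.1), p.2))

/-- Restriction of a form on `Z` to the boundary `∂Z`. -/
def restrictBase (ψ : Z.RawForm) : Z.boundary.RawForm := fun c v =>
  EForm.pull (Z.wall c.1 c.2).ker.subtype (ψ c.1 (v : Z.V c.1))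

/-- `q` satisfies the boundary condition: `q|_{∂E} = h^* q'` for some `q' ∈ Ω(E'; 𝓡)^T`. -/
def Satisfies (B : BoundaryCondition E) (q : E.total.RawForm) : Prop :=
  ∃ q' : B.E'.total.RawForm, B.E'.total.IsForm q' ∧
    ∀ a, ∀ x ∈ B.g.O a, ∀ v,
      restrictTotal q (B.g.chart a) (x, v) = B.h.pullTot q' a (x, v)

/-- `φ|_{∂S(E)} = S(h)^* φ'` for some invariant form `φ'` on `S(E')`; the twisted coefficients are
pulled back by the identification of the orientations of the fibres given by `h`. -/
def SatisfiesSphere (B : BoundaryCondition E) (φ : E.total.RawForm) : Prop :=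
  ∃ φ' : B.E'.total.RawForm, B.E'.IsSphereForm φ' ∧
    ∀ a, ∀ x ∈ B.g.O a, ∀ v, v ≠ 0 →
      restrictTotal φ (B.g.chart a) (x, v) =
        TBundle.detSign (B.h.lin a x) • B.h.pullTot φ' a (x, v)

/-- `ε|_{∂Z} = g^* ε'` for some `ε' ∈ Ω(Z'; 𝓡)^T`. -/
def IsPulledBack (B : BoundaryCondition E) (ε : Z.RawForm) : Prop :=
  ∃ ε' : B.Z'.RawForm, B.Z'.IsForm ε' ∧
    ∀ a, ∀ x ∈ B.g.O a,
      restrictBase ε (B.g.chart a) x =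
        EForm.pull (fderivWithin ℝ (B.g.f a) (B.g.O a) x).toLinearMap
          (ε' (B.g.tgtChart a) (B.g.f a x))

end BoundaryCondition

end

set_option linter.unusedSectionVars false
set_option linter.unusedVariables false

section

/-! ## Algebra of forms -/

instance EqRing.nontrivial (m : ℕ) : Nontrivial (EqRing m) := by
  refine (IsLocalization.injective (EqRing m) (M := homogeneousSubmonoid m) ?_).nontrivial
  intro p hp
  exact mem_nonZeroDivisors_of_ne_zero hp.1

namespace EForm

variable {m : ℕ} {V W V' : Type} [AddCommGroup V] [Module ℝ V] [AddCommGroup W] [Module ℝ W]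
  [AddCommGroup V'] [Module ℝ V'] {r : ℕ}

theorem _root_.ext_functional {M : Type*} [AddCommGroup M] [Module ℝ M] {x y : M}
    (h : ∀ L : M →ₗ[ℝ] ℝ, L x = L y) : x = y := by
  rw [← sub_eq_zero, ← Module.forall_dual_apply_eq_zero_iff ℝ]
  intro L
  rw [map_sub, sub_eq_zero]
  exact h L

theorem real_algebraMap_injective : Function.Injective (algebraMap ℝ (EForm m V)) := by
  rw [IsScalarTower.algebraMap_eq ℝ (EqRing m) (EForm m V), RingHom.coe_comp]
  exact (ExteriorAlgebra.algebraMap_leftInverse _).injective.comp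
    (algebraMap ℝ (EqRing m)).injective

/-- A covector with values in the coefficient ring as a form. -/
noncomputable abbrev one (β : V →ₗ[ℝ] EqRing m) : EForm m V := ExteriorAlgebra.ι (EqRing m) β

/-- Contraction as a linear map. -/
noncomputable abbrev dcontract (d : Module.Dual (EqRing m) (V →ₗ[ℝ] EqRing m)) :
    EForm m V →ₗ[EqRing m] EForm m V :=
  CliffordAlgebra.contractLeft (R := EqRing m) (M := V →ₗ[ℝ] EqRing m) (Q := 0) d

/-- The grading involution. -/
noncomputable abbrev inv (ψ : EForm m V) : EForm m V :=
  CliffordAlgebra.involute (R := EqRing m) (M := V →ₗ[ℝ] EqRing m) (Q := 0) ψ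

theorem dcontract_one_mul (d : Module.Dual (EqRing m) (V →ₗ[ℝ] EqRing m))
    (β : V →ₗ[ℝ] EqRing m) (ψ : EForm m V) :
    dcontract d (one β * ψ) = d β • ψ - one β * dcontract d ψ :=
  CliffordAlgebra.contractLeft_ι_mul _ _ _

theorem inv_one_mul (β : V →ₗ[ℝ] EqRing m) (ψ : EForm m V) :
    inv (one β * ψ) = -(one β * inv ψ) := by
  have : inv (one β) = -one β := CliffordAlgebra.involute_ι _
  rw [inv, map_mul]
  change inv (one β) * _ = _
  rw [this, neg_mul]

/-- Induction on products of covectors. -/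
theorem left_induction {P : EForm m V → Prop} (scalar : ∀ c : EqRing m, P (algebraMap _ _ c))
    (add : ∀ a b, P a → P b → P (a + b)) (mul : ∀ β a, P a → P (one β * a)) (ψ : EForm m V) :
    P ψ := by
  induction ψ using CliffordAlgebra.left_induction with
  | algebraMap c => exact scalar c
  | add x y hx hy => exact add x y hx hy
  | ι_mul x β h => exact mul β x h

theorem smul_mul (c : EqRing m) (a b : EForm m V) : c • a * b = c • (a * b) :=
  Algebra.smul_mul_assoc c a b

theorem form_smul_zero (c : EqRing m) : c • (0 : EForm m V) = 0 := by
  have := smul_mul c (0 : EForm m V) 0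
  rw [mul_zero, mul_zero] at this
  exact this.symm

theorem mul_smul_right (c : EqRing m) (a b : EForm m V) : a * c • b = c • (a * b) :=
  Algebra.mul_smul_comm c a b

theorem dcontract_mul (d : Module.Dual (EqRing m) (V →ₗ[ℝ] EqRing m)) (a b : EForm m V) :
    dcontract d (a * b) = dcontract d a * b + inv a * dcontract d b := by
  induction a using left_induction with
  | scalar c =>
    have h1 : dcontract d (algebraMap _ _ c * b) = algebraMap _ _ c * dcontract d b :=
      CliffordAlgebra.contractLeft_algebraMap_mul _ _ _
    have h2 : dcontract d (algebraMap (EqRing m) (EForm m V) c) = 0 :=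
      CliffordAlgebra.contractLeft_algebraMap _ _ _
    have h3 : inv (algebraMap (EqRing m) (EForm m V) c) = algebraMap _ _ c := AlgHom.commutes _ _
    rw [h1, h2, h3, zero_mul, zero_add]
  | add x y hx hy =>
    have h : inv (x + y) = inv x + inv y := map_add CliffordAlgebra.involute x y
    rw [add_mul, map_add, map_add, hx, hy, h, add_mul, add_mul]
    abel
  | mul β x hx =>
    rw [mul_assoc, dcontract_one_mul, dcontract_one_mul, hx, inv_one_mul]
    rw [sub_mul, smul_mul, mul_add, neg_mul, mul_assoc, mul_assoc]
    abel

theorem contract_eq (v : V) (ψ : EForm m V) : contract v ψ = dcontract (evalAt m v) ψ := rfl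

theorem contract_one_mul (v : V) (β : V →ₗ[ℝ] EqRing m) (ψ : EForm m V) :
    contract v (one β * ψ) = β v • ψ - one β * contract v ψ := dcontract_one_mul _ _ _

theorem contract_mul (v : V) (a b : EForm m V) :
    contract v (a * b) = contract v a * b + inv a * contract v b := dcontract_mul _ _ _

theorem contract_algebraMap (v : V) (c : EqRing m) :
    contract v (algebraMap (EqRing m) (EForm m V) c) = 0 :=
  CliffordAlgebra.contractLeft_algebraMap _ _ _

theorem contract_real_one (v : V) : contract v (1 : EForm m V) = 0 :=
  CliffordAlgebra.contractLeft_one _ _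

theorem contract_one (v : V) (β : V →ₗ[ℝ] EqRing m) :
    contract v (one β) = algebraMap (EqRing m) (EForm m V) (β v) :=
  CliffordAlgebra.contractLeft_ι _ _ _

theorem evalAt_add (v w : V) : evalAt m (v + w) = evalAt m v + evalAt m w :=
  LinearMap.ext fun β => map_add β v w

theorem evalAt_smul (c : ℝ) (v : V) : evalAt m (c • v) = c • evalAt m v :=
  LinearMap.ext fun β => map_smul β c v

theorem contract_add_left (v w : V) (ψ : EForm m V) :
    contract (v + w) ψ = contract v ψ + contract w ψ := by
  rw [contract_eq, evalAt_add, dcontract, map_add]; rfl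

theorem dcontract_smul_left (c : ℝ) (d : Module.Dual (EqRing m) (V →ₗ[ℝ] EqRing m))
    (ψ : EForm m V) : dcontract (c • d) ψ = c • dcontract d ψ := by
  exact congrArg (fun F => F ψ) (LinearMap.map_smul_of_tower (CliffordAlgebra.contractLeft
    (R := EqRing m) (M := V →ₗ[ℝ] EqRing m) (Q := 0)) c d)

theorem contract_smul_left (c : ℝ) (v : V) (ψ : EForm m V) :
    contract (c • v) ψ = c • contract v ψ := by
  rw [contract_eq, evalAt_smul, dcontract_smul_left]; rfl

theorem contract_zero_left (ψ : EForm m V) : contract (0 : V) ψ = 0 := by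
  have := contract_smul_left 0 (0 : V) ψ
  simpa using this

theorem contract_add (v : V) (a b : EForm m V) : contract v (a + b) = contract v a + contract v b :=
  map_add (dcontract (evalAt m v)) a b

theorem contract_real_smul (v : V) (c : ℝ) (a : EForm m V) :
    contract v (c • a) = c • contract v a :=
  LinearMap.map_smul_of_tower (dcontract (evalAt m v)) c a

theorem contract_contract (v : V) (a : EForm m V) : contract v (contract v a) = 0 :=
  CliffordAlgebra.contractLeft_contractLeft _ _

theorem contract_comm (v w : V) (a : EForm m V) :
    contract v (contract w a) = -contract w (contract v a) :=
  CliffordAlgebra.contractLeft_comm _ _ _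

/-- Contraction as a bilinear map over `ℝ`. -/
noncomputable def contractBilin (m : ℕ) (V : Type) [AddCommGroup V] [Module ℝ V] :
    V →ₗ[ℝ] EForm m V →ₗ[ℝ] EForm m V :=
  LinearMap.mk₂ ℝ (fun v ψ => contract v ψ) contract_add_left contract_smul_left contract_add
    (fun c v ψ => contract_real_smul v c ψ)

theorem contractBilin_apply (v : V) (ψ : EForm m V) : contractBilin m V v ψ = contract v ψ := rfl

/-! ### Pullback -/

/-- Pullback as a homomorphism of algebras. -/
noncomputable def pullHom (m : ℕ) (A : V →ₗ[ℝ] W) : EForm m W →ₐ[EqRing m] EForm m V :=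
  ExteriorAlgebra.map (precomp m A)

theorem pull_eq_pullHom (A : V →ₗ[ℝ] W) (a : EForm m W) : pull A a = pullHom m A a := rfl

theorem pull_one (A : V →ₗ[ℝ] W) (β : W →ₗ[ℝ] EqRing m) :
    pull A (one β) = one (β ∘ₗ A) := ExteriorAlgebra.map_apply_ι _ _

theorem pull_mul (A : V →ₗ[ℝ] W) (a b : EForm m W) : pull A (a * b) = pull A a * pull A b := by
  unfold pull; exact map_mul _ a b

theorem pull_add (A : V →ₗ[ℝ] W) (a b : EForm m W) : pull A (a + b) = pull A a + pull A b := by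
  unfold pull; exact map_add _ a b

theorem pull_sub (A : V →ₗ[ℝ] W) (a b : EForm m W) : pull A (a - b) = pull A a - pull A b := by
  unfold pull; exact map_sub _ a b

theorem pull_smul (A : V →ₗ[ℝ] W) (c : EqRing m) (a : EForm m W) :
    pull A (c • a) = c • pull A a := by
  unfold pull; exact map_smul _ c a

theorem pull_real_smul (A : V →ₗ[ℝ] W) (c : ℝ) (a : EForm m W) :
    pull A (c • a) = c • pull A a := by
  simp only [pull_eq_pullHom]
  exact LinearMap.map_smul_of_tower (pullHom m A).toLinearMap c a

theorem pull_algebraMap (A : V →ₗ[ℝ] W) (c : EqRing m) :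
    pull A (algebraMap (EqRing m) (EForm m W) c) = algebraMap _ _ c := by
  unfold pull; exact AlgHom.commutes _ c

theorem pull_real_one (A : V →ₗ[ℝ] W) : pull A (1 : EForm m W) = 1 := by
  unfold pull; exact map_one _

theorem pull_zero (A : V →ₗ[ℝ] W) : pull A (0 : EForm m W) = 0 := by
  unfold pull; exact map_zero _

theorem pull_pow (A : V →ₗ[ℝ] W) (a : EForm m W) (k : ℕ) : pull A (a ^ k) = pull A a ^ k := by
  unfold pull; exact map_pow _ a k

theorem pull_sum {κ : Type*} (A : V →ₗ[ℝ] W) (s : Finset κ) (a : κ → EForm m W) :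
    pull A (∑ k ∈ s, a k) = ∑ k ∈ s, pull A (a k) := by
  unfold pull; exact map_sum _ a s

/-- Pullback as a real linear map. -/
noncomputable def pullLin (m : ℕ) (A : V →ₗ[ℝ] W) : EForm m W →ₗ[ℝ] EForm m V where
  toFun := pull A
  map_add' := pull_add A
  map_smul' := pull_real_smul A

theorem pull_pull (A : V →ₗ[ℝ] W) (B : W →ₗ[ℝ] V') (a : EForm m V') :
    pull A (pull B a) = pull (B ∘ₗ A) a := by
  induction a using left_induction with
  | scalar c => rw [pull_algebraMap, pull_algebraMap, pull_algebraMap]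
  | add x y hx hy => rw [pull_add, pull_add, pull_add, hx, hy]
  | mul β x hx => rw [pull_mul, pull_mul, pull_mul, hx, pull_one, pull_one, pull_one]; rfl

theorem pull_id (a : EForm m V) : pull LinearMap.id a = a := by
  induction a using left_induction with
  | scalar c => rw [pull_algebraMap]
  | add x y hx hy => rw [pull_add, hx, hy]
  | mul β x hx => rw [pull_mul, hx, pull_one]; rfl

theorem dcontract_pull (A : V →ₗ[ℝ] W) (d : Module.Dual (EqRing m) (V →ₗ[ℝ] EqRing m))
    (a : EForm m W) : dcontract d (pull A a) = pull A (dcontract (d ∘ₗ precomp m A) a) := by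
  induction a using left_induction with
  | scalar c =>
    have h1 : dcontract d (algebraMap (EqRing m) (EForm m V) c) = 0 :=
      CliffordAlgebra.contractLeft_algebraMap _ _ _
    have h2 : dcontract (d ∘ₗ precomp m A) (algebraMap (EqRing m) (EForm m W) c) = 0 :=
      CliffordAlgebra.contractLeft_algebraMap _ _ _
    rw [pull_algebraMap, h1, h2, pull_zero]
  | add x y hx hy => rw [pull_add, map_add, hx, hy, map_add, pull_add]
  | mul β x hx =>
    rw [pull_mul, pull_one, dcontract_one_mul, dcontract_one_mul, hx, pull_sub, pull_smul, pull_mul,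
      pull_one]
    rfl

theorem contract_pull (A : V →ₗ[ℝ] W) (v : V) (a : EForm m W) :
    contract v (pull A a) = pull A (contract (A v) a) := dcontract_pull A _ a

/-! ### Vertical top part -/

theorem covector_eq (β : V →ₗ[ℝ] ℝ) :
    covector m β = one ((Algebra.linearMap ℝ (EqRing m)) ∘ₗ β) := rfl

theorem algebraMap_smul_form (c : ℝ) (ψ : EForm m V) :
    algebraMap ℝ (EqRing m) c • ψ = c • ψ := algebraMap_smul (EqRing m) c ψ

theorem contract_covector_mul (v : V) (β : V →ₗ[ℝ] ℝ) (ψ : EForm m V) :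
    contract v (covector m β * ψ) = β v • ψ - covector m β * contract v ψ := by
  rw [covector_eq, contract_one_mul]
  rw [LinearMap.comp_apply, Algebra.linearMap_apply, algebraMap_smul_form]

theorem pull_covector (A : V →ₗ[ℝ] W) (β : W →ₗ[ℝ] ℝ) :
    pull A (covector m β) = covector m (β ∘ₗ A) := by
  rw [covector_eq, pull_one]; rfl

theorem covector_mul_self (β : V →ₗ[ℝ] ℝ) : covector m β * covector m β = 0 :=
  ExteriorAlgebra.ι_sq_zero _

theorem one_mul_one_swap (β γ : V →ₗ[ℝ] EqRing m) : one β * one γ = -(one γ * one β) :=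
  eq_neg_of_add_eq_zero_left (ExteriorAlgebra.ι_add_mul_swap _ _)

/-- Splitting of a form along a vector `e` and a covector `d` with `d e = 1`. -/
theorem eq_pull_add_covector_mul_contract (e : V) (d : V →ₗ[ℝ] ℝ) (ψ : EForm m V) :
    ψ = pull (LinearMap.id - d.smulRight e) ψ + covector m d * contract e ψ := by
  induction ψ using left_induction with
  | scalar c => rw [pull_algebraMap, contract_algebraMap, mul_zero, add_zero]
  | add x y hx hy =>
    rw [pull_add, contract_add, mul_add]
    nth_rewrite 1 [hx, hy]
    abel
  | mul β x hx =>
    have h1 : pull (LinearMap.id - d.smulRight e) (one β) =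
        one β - β e • covector m d := by
      rw [pull_one, covector_eq, ← map_smul, ← map_sub]
      congr 1
      ext v
      simp [Algebra.smul_def, mul_comm]
    have h2 : pull (LinearMap.id - d.smulRight e) x = x - covector m d * contract e x :=
      eq_sub_of_add_eq hx.symm
    rw [pull_mul, h1, h2, contract_one_mul]
    have h3 : covector m d * (one β * contract e x) = -(one β * (covector m d * contract e x)) := by
      rw [← mul_assoc, ← mul_assoc, covector_eq, one_mul_one_swap, neg_mul]
    have h4 : covector m d * (covector m d * contract e x) = 0 := by
      rw [← mul_assoc, covector_mul_self, zero_mul]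
    rw [sub_mul, mul_sub, mul_sub, mul_sub, smul_mul, smul_mul, h3, h4, mul_smul_right, form_smul_zero]
    abel

theorem pull_eq_self_of_contract_eq_zero (e : V) (d : V →ₗ[ℝ] ℝ) (ψ : EForm m V)
    (h : contract e ψ = 0) : pull (LinearMap.id - d.smulRight e) ψ = ψ := by
  have := eq_pull_add_covector_mul_contract e d ψ
  rw [h, mul_zero, add_zero] at this
  exact this.symm

/-- A form annihilated by all vertical vectors only depends on its restriction to the base. -/
theorem eq_pull_fst_of_contract_eq_zero (α : EForm m (V × Fib r))
    (h : ∀ k, contract ((0 : V), (EuclideanSpace.single k (1 : ℝ) : Fib r)) α = 0) :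
    pull (TBundle.slice V r ∘ₗ LinearMap.fst ℝ V (Fib r)) α = α := by
  classical
  have key : ∀ s : Finset (Fin r), pull (LinearMap.id - ∑ k ∈ s,
      (((EuclideanSpace.proj k : Fib r →L[ℝ] ℝ).toLinearMap ∘ₗ
        LinearMap.snd ℝ V (Fib r)).smulRight
          ((0 : V), (EuclideanSpace.single k (1 : ℝ) : Fib r)))) α = α := by
    intro s
    induction s using Finset.induction_on with
    | empty => rw [Finset.sum_empty, sub_zero, pull_id]
    | insert k s hk ih =>
      have h1 := pull_eq_self_of_contract_eq_zero _
        ((EuclideanSpace.proj k : Fib r →L[ℝ] ℝ).toLinearMap ∘ₗ LinearMap.snd ℝ V (Fib r)) α (h k)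
      nth_rewrite 2 [← ih]
      nth_rewrite 2 [← h1]
      rw [pull_pull]
      congr 1
      rw [Finset.sum_insert hk]
      refine LinearMap.ext fun p => ?_
      simp only [LinearMap.sub_apply, LinearMap.add_apply, LinearMap.id_apply, LinearMap.comp_apply,
        LinearMap.smulRight_apply, LinearMap.sum_apply, LinearMap.snd_apply]
      have h0 : ((EuclideanSpace.proj k : Fib r →L[ℝ] ℝ).toLinearMap (p - ∑ i ∈ s,
          ((EuclideanSpace.proj i : Fib r →L[ℝ] ℝ).toLinearMap p.2) •
            ((0 : V), (EuclideanSpace.single i (1 : ℝ) : Fib r))).2) =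
          (EuclideanSpace.proj k : Fib r →L[ℝ] ℝ).toLinearMap p.2 := by
        simp only [Prod.snd_sub, Prod.snd_sum, Prod.smul_snd, map_sub, map_sum, map_smul]
        rw [Finset.sum_eq_zero, sub_zero]
        intro i hi
        have : k ≠ i := fun h => hk (h ▸ hi)
        simp [this]
      rw [h0]
      abel
  have h2 := key Finset.univ
  convert h2 using 2
  refine LinearMap.ext fun p => Prod.ext ?_ ?_
  · simp [TBundle.slice, Prod.fst_sum]
  · have : p.2 = ∑ k, p.2 k • (EuclideanSpace.single k (1 : ℝ) : Fib r) := by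
      have := (EuclideanSpace.basisFun (Fin r) ℝ).sum_repr p.2
      simpa using this.symm
    simp only [TBundle.slice, LinearMap.comp_apply, LinearMap.inl_apply, LinearMap.sub_apply,
      LinearMap.id_apply, LinearMap.sum_apply, LinearMap.smulRight_apply, Prod.snd_sub,
      Prod.snd_sum, Prod.smul_snd]
    exact (sub_eq_zero.mpr this).symm

/-- Contraction with multivectors. -/
noncomputable def multiContract (m : ℕ) (V : Type) [AddCommGroup V] [Module ℝ V] :
    ExteriorAlgebra ℝ V →ₐ[ℝ] Module.End ℝ (EForm m V) :=
  ExteriorAlgebra.lift ℝ ⟨contractBilin m V, fun v => LinearMap.ext fun ψ => contract_contract v ψ⟩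

theorem multiContract_ι (v : V) (ψ : EForm m V) :
    multiContract m V (ExteriorAlgebra.ι ℝ v) ψ = contract v ψ := by
  rw [multiContract, ExteriorAlgebra.lift_ι_apply]; rfl

/-- The iterated contraction with vertical vectors `u 0, u 1, …` as an alternating map. -/
noncomputable def vertContract (r : ℕ) (ψ : EForm m (V × Fib r)) :
    (Fib r) [⋀^Fin r]→ₗ[ℝ] EForm m (V × Fib r) :=
  (((LinearMap.applyₗ ψ).comp (multiContract m (V × Fib r)).toLinearMap).compAlternatingMap
    (ExteriorAlgebra.ιMulti ℝ r)).compLinearMap (LinearMap.inr ℝ V (Fib r)) |>.domDomCongr Fin.revPerm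

theorem foldl_contract_eq {κ : Type} (l : List κ) (u : κ → V) (ψ : EForm m V) :
    l.foldl (fun α k => contract (u k) α) ψ =
      multiContract m V ((l.reverse.map fun k => ExteriorAlgebra.ι ℝ (u k)).prod) ψ := by
  induction l generalizing ψ with
  | nil => simp
  | cons k l ih =>
    rw [List.foldl_cons, ih]
    simp only [List.reverse_cons, List.map_append, List.prod_append, List.map_cons, List.map_nil,
      List.prod_cons, List.prod_nil, mul_one, map_mul, Module.End.mul_apply, multiContract_ι]

theorem vertContract_apply (ψ : EForm m (V × Fib r)) (u : Fin r → Fib r) :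
    vertContract r ψ u =
      (List.finRange r).foldl (fun α k => contract ((0 : V), u k) α) ψ := by
  rw [foldl_contract_eq, vertContract]
  simp only [AlternatingMap.domDomCongr_apply, AlternatingMap.compLinearMap_apply,
    LinearMap.compAlternatingMap_apply, LinearMap.comp_apply, ExteriorAlgebra.ιMulti_apply,
    AlgHom.toLinearMap_apply, LinearMap.applyₗ_apply_apply]
  congr 3
  rw [List.finRange_reverse, List.map_map, List.ofFn_eq_map]
  rfl

theorem fibreTop_eq (ψ : EForm m (V × Fib r)) :
    TBundle.fibreTop ψ = pull (TBundle.slice V r)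
      (vertContract r ψ fun k => (EuclideanSpace.single k (1 : ℝ) : Fib r)) := by
  rw [vertContract_apply]; rfl

theorem _root_.AlternatingMap.apply_comp_basis {N M ι : Type*} [AddCommGroup N] [Module ℝ N]
    [AddCommGroup M] [Module ℝ M] [Fintype ι] [DecidableEq ι] (g : N [⋀^ι]→ₗ[ℝ] M)
    (e : Module.Basis ι ℝ N) (A : N →ₗ[ℝ] N) :
    g (fun i => A (e i)) = LinearMap.det A • g e := by
  refine ext_functional fun L => ?_
  have h := (L.compAlternatingMap g).eq_smul_basis_det e
  have h1 := congrArg (fun F => F (fun i => A (e i))) h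
  simp only [LinearMap.compAlternatingMap_apply, AlternatingMap.smul_apply, smul_eq_mul] at h1
  rw [h1, map_smul, smul_eq_mul, mul_comm]
  congr 1
  rw [show (fun i => A (e i)) = A ∘ e from rfl, Module.Basis.det_comp, Module.Basis.det_self,
    mul_one]

/-- The standard basis of the standard fibre. -/
noncomputable abbrev fibBasis (r : ℕ) : Module.Basis (Fin r) ℝ (Fib r) :=
  (EuclideanSpace.basisFun (Fin r) ℝ).toBasis

theorem fibBasis_apply (k : Fin r) : fibBasis r k = EuclideanSpace.single k (1 : ℝ) := by
  simp [fibBasis]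

theorem vertContract_single (ψ : EForm m (V × Fib r)) (A : Fib r →ₗ[ℝ] Fib r) :
    vertContract r ψ (fun k => A (EuclideanSpace.single k (1 : ℝ))) =
      LinearMap.det A • vertContract r ψ (fun k => EuclideanSpace.single k (1 : ℝ)) := by
  have := (vertContract r ψ).apply_comp_basis (fibBasis r) A
  simp only [fibBasis_apply] at this
  rw [this]
  congr 2
  ext1 k
  exact fibBasis_apply k

theorem foldl_contract_comm {κ : Type} (l : List κ) (u : κ → V) (w : V) (ψ : EForm m V) :
    l.foldl (fun α k => contract (u k) α) (contract w ψ) =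
      (-1 : ℝ) ^ l.length • contract w (l.foldl (fun α k => contract (u k) α) ψ) := by
  induction l generalizing ψ with
  | nil => simp
  | cons k l ih =>
    rw [List.foldl_cons, List.foldl_cons, contract_comm, ← neg_one_smul ℝ (contract w _)]
    have h := ih (contract (u k) ψ)
    have h2 : ∀ (c : ℝ) (χ : EForm m V), l.foldl (fun α k => contract (u k) α) (c • χ) =
        c • l.foldl (fun α k => contract (u k) α) χ := by
      intro c χ
      rw [foldl_contract_eq, foldl_contract_eq, map_smul]
    rw [h2, h, smul_smul, List.length_cons, pow_succ, mul_comm]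

theorem foldl_contract_mem {κ : Type} (l : List κ) (u : κ → V) (k : κ) (hk : k ∈ l)
    (ψ : EForm m V) : contract (u k) (l.foldl (fun α k => contract (u k) α) ψ) = 0 := by
  induction l generalizing ψ with
  | nil => simp at hk
  | cons j l ih =>
    rw [List.foldl_cons]
    rcases List.mem_cons.mp hk with rfl | h
    · have := foldl_contract_comm l u (u k) ψ
      rw [this, contract_real_smul, contract_contract, smul_zero]
    · exact ih h _

/-- The iterated contraction with the standard basis of the fibre. -/
noncomputable def vtop (ψ : EForm m (V × Fib r)) : EForm m (V × Fib r) :=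
  (List.finRange r).foldl
    (fun α k => contract ((0 : V), (EuclideanSpace.single k (1 : ℝ) : Fib r)) α) ψ

theorem fibreTop_eq_pull_vtop (ψ : EForm m (V × Fib r)) :
    TBundle.fibreTop ψ = pull (TBundle.slice V r) (vtop ψ) := rfl

theorem pull_fst_fibreTop (ψ : EForm m (V × Fib r)) :
    pull (LinearMap.fst ℝ V (Fib r)) (TBundle.fibreTop ψ) = vtop ψ := by
  rw [fibreTop_eq_pull_vtop, pull_pull]
  refine eq_pull_fst_of_contract_eq_zero _ fun k => ?_
  exact foldl_contract_mem _ (fun k => ((0 : V), (EuclideanSpace.single k (1 : ℝ) : Fib r))) k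
    (List.mem_finRange k) ψ

/-- Transformation of the vertical top part under a block triangular map. -/
theorem fibreTop_pull (J : V × Fib r →ₗ[ℝ] W × Fib r) (B : V →ₗ[ℝ] W) (A : Fib r →ₗ[ℝ] Fib r)
    (hB : ∀ p, (J p).1 = B p.1) (hA : ∀ u, J (0, u) = (0, A u)) (ψ : EForm m (W × Fib r)) :
    TBundle.fibreTop (pull J ψ) = LinearMap.det A • pull B (TBundle.fibreTop ψ) := by
  have h1 : vtop (pull J ψ) = pull J (LinearMap.det A • vtop ψ) := by
    have h2 := vertContract_single ψ A
    rw [vertContract_apply, vertContract_apply] at h2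
    rw [vtop, vtop, ← h2]
    have : ∀ (l : List (Fin r)) (χ : EForm m (W × Fib r)), l.foldl
        (fun α k => contract ((0 : V), (EuclideanSpace.single k (1 : ℝ) : Fib r)) α) (pull J χ) =
        pull J (l.foldl
        (fun α k => contract ((0 : W), A (EuclideanSpace.single k (1 : ℝ) : Fib r)) α) χ) := by
      intro l
      induction l with
      | nil => intro χ; rfl
      | cons k l ih => intro χ; rw [List.foldl_cons, List.foldl_cons, contract_pull, ih, hA]
    exact this _ _
  rw [fibreTop_eq_pull_vtop, h1, ← pull_fst_fibreTop, pull_real_smul, pull_real_smul, pull_pull,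
    pull_pull]
  congr 2
  refine LinearMap.ext fun w => ?_
  simp [hB, TBundle.slice]

/-- The vertical top part as a real linear map. -/
noncomputable def fibreTopLin (m : ℕ) (V : Type) [AddCommGroup V] [Module ℝ V] (r : ℕ) :
    EForm m (V × Fib r) →ₗ[ℝ] EForm m V :=
  pullLin m (TBundle.slice V r) ∘ₗ multiContract m (V × Fib r)
    (((List.finRange r).reverse.map fun k =>
      ExteriorAlgebra.ι ℝ ((0 : V), (EuclideanSpace.single k (1 : ℝ) : Fib r))).prod)

theorem fibreTopLin_apply (ψ : EForm m (V × Fib r)) :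
    fibreTopLin m V r ψ = TBundle.fibreTop ψ := by
  rw [fibreTop_eq_pull_vtop, vtop, foldl_contract_eq]; rfl

theorem vtop_mul (ψ χ : EForm m (V × Fib r))
    (h : ∀ k, contract ((0 : V), (EuclideanSpace.single k (1 : ℝ) : Fib r)) χ = 0) :
    vtop (ψ * χ) = vtop ψ * χ := by
  have : ∀ (l : List (Fin r)) (ψ : EForm m (V × Fib r)), l.foldl
        (fun α k => contract ((0 : V), (EuclideanSpace.single k (1 : ℝ) : Fib r)) α) (ψ * χ) =
        l.foldl (fun α k => contract ((0 : V), (EuclideanSpace.single k (1 : ℝ) : Fib r)) α) ψ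
          * χ := by
    intro l
    induction l with
    | nil => intro χ; rfl
    | cons k l ih =>
      intro ψ; rw [List.foldl_cons, List.foldl_cons, contract_mul, h, mul_zero, add_zero, ih]
  exact this _ _

theorem contract_pull_fst (u : Fib r) (e : EForm m V) :
    contract ((0 : V), u) (pull (LinearMap.fst ℝ V (Fib r)) e) = 0 := by
  rw [contract_pull]
  have : (LinearMap.fst ℝ V (Fib r)) ((0 : V), u) = 0 := rfl
  rw [this, contract_zero_left, pull_zero]

theorem pull_slice_fst (e : EForm m V) :
    pull (TBundle.slice V r) (pull (LinearMap.fst ℝ V (Fib r)) e) = e := by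
  rw [pull_pull]; exact pull_id e

theorem fibreTop_mul_pull_fst (ψ : EForm m (V × Fib r)) (e : EForm m V) :
    TBundle.fibreTop (ψ * pull (LinearMap.fst ℝ V (Fib r)) e) = TBundle.fibreTop ψ * e := by
  rw [fibreTop_eq_pull_vtop, vtop_mul _ _ fun k => contract_pull_fst _ _, pull_mul,
    pull_slice_fst]
  rfl

theorem fibreTop_pull_fst (hr : 0 < r) (e : EForm m V) :
    TBundle.fibreTop (pull (LinearMap.fst ℝ V (Fib r)) e) = 0 := by
  have h : ∀ (l : List (Fin r)), l ≠ [] → l.foldl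
      (fun α k => contract ((0 : V), (EuclideanSpace.single k (1 : ℝ) : Fib r)) α)
        (pull (LinearMap.fst ℝ V (Fib r)) e) = 0 := by
    intro l hl
    cases l with
    | nil => exact absurd rfl hl
    | cons k l =>
      rw [List.foldl_cons, contract_pull_fst, foldl_contract_eq, map_zero]
  rw [fibreTop_eq_pull_vtop, vtop, h _ (by
    intro h0
    have := congrArg List.length h0
    rw [List.length_finRange, List.length_nil] at this
    exact hr.ne' this), pull_zero]

theorem fibreTop_covector_fst_mul (b : V →ₗ[ℝ] ℝ) (ψ : EForm m (V × Fib r)) :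
    TBundle.fibreTop (covector m (b ∘ₗ LinearMap.fst ℝ V (Fib r)) * ψ) =
      (-1 : ℝ) ^ r • (covector m b * TBundle.fibreTop ψ) := by
  have h : ∀ (l : List (Fin r)) (ψ : EForm m (V × Fib r)), l.foldl
      (fun α k => contract ((0 : V), (EuclideanSpace.single k (1 : ℝ) : Fib r)) α)
        (covector m (b ∘ₗ LinearMap.fst ℝ V (Fib r)) * ψ) =
      (-1 : ℝ) ^ l.length • (covector m (b ∘ₗ LinearMap.fst ℝ V (Fib r)) * l.foldl
      (fun α k => contract ((0 : V), (EuclideanSpace.single k (1 : ℝ) : Fib r)) α) ψ) := by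
    intro l
    induction l with
    | nil => intro ψ; simp
    | cons k l ih =>
      intro ψ
      rw [List.foldl_cons, contract_covector_mul]
      simp only [LinearMap.comp_apply, LinearMap.fst_apply, map_zero, zero_smul, zero_sub,
        List.foldl_cons]
      rw [← mul_neg, ih, foldl_contract_eq l (fun k =>
        ((0 : V), (EuclideanSpace.single k (1 : ℝ) : Fib r))), map_neg, ← foldl_contract_eq, mul_neg,
        smul_neg, List.length_cons, pow_succ, mul_neg_one, neg_smul]
  rw [fibreTop_eq_pull_vtop, vtop, h, pull_real_smul, pull_mul, pull_covector, List.length_finRange]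
  rfl

theorem fibreTop_contract (ξ : V × Fib r) (ψ : EForm m (V × Fib r)) :
    TBundle.fibreTop (contract ξ ψ) = (-1 : ℝ) ^ r • contract ξ.1 (TBundle.fibreTop ψ) := by
  rw [fibreTop_eq_pull_vtop, vtop,
    foldl_contract_comm _ (fun k => ((0 : V), (EuclideanSpace.single k (1 : ℝ) : Fib r))),
    pull_real_smul, List.length_finRange]
  congr 1
  change pull _ (contract ξ (vtop ψ)) = _
  rw [← pull_fst_fibreTop, contract_pull, pull_slice_fst]
  rfl

/-- Forms annihilated by a nonzero vertical vector have no vertical top part. -/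
theorem fibreTop_eq_zero (u : Fib r) (hu : u ≠ 0) (ψ : EForm m (V × Fib r))
    (h : contract ((0 : V), u) ψ = 0) : TBundle.fibreTop ψ = 0 := by
  have hr : 0 < r := by
    rcases Nat.eq_zero_or_pos r with rfl | h'
    · exact absurd (Subsingleton.elim u 0) hu
    · exact h'
  obtain ⟨n, rfl⟩ : ∃ n, r = n + 1 := ⟨r - 1, (Nat.succ_pred_eq_of_pos hr).symm⟩
  have he : (EuclideanSpace.single 0 (1 : ℝ) : Fib (n + 1)) ≠ 0 := by simp
  obtain ⟨A, hA⟩ := SeparatingDual.exists_continuousLinearEquiv_apply_eq (R := ℝ) he hu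
  have h1 := vertContract_single ψ A.toLinearEquiv.toLinearMap
  have h2 : vertContract (n + 1) ψ (fun k => A.toLinearEquiv.toLinearMap
      (EuclideanSpace.single k (1 : ℝ))) = 0 := by
    rw [vertContract_apply, List.finRange_succ, List.foldl_cons]
    change List.foldl _ (contract ((0 : V), A (EuclideanSpace.single 0 1)) ψ) _ = 0
    rw [hA, h]
    rw [foldl_contract_eq _ (fun k => ((0 : V), A.toLinearEquiv.toLinearMap
      (EuclideanSpace.single k (1 : ℝ)))), map_zero]
  rw [h2] at h1
  have h3 : LinearMap.det A.toLinearEquiv.toLinearMap ≠ 0 :=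
    (LinearEquiv.isUnit_det' A.toLinearEquiv).ne_zero
  have h4 := (smul_eq_zero.mp h1.symm).resolve_left h3
  rw [fibreTop_eq, h4, pull_zero]

/-! ### Nilpotency -/

theorem sum_pow_eq_zero {A κ : Type*} [Ring A] (s : Finset κ) (x : κ → A)
    (hsq : ∀ k, x k * x k = 0) (hc : ∀ j k, Commute (x j) (x k)) (n : ℕ) (hn : s.card + 1 ≤ n) :
    (∑ k ∈ s, x k) ^ n = 0 := by
  classical
  induction s using Finset.induction_on generalizing n with
  | empty => rw [Finset.sum_empty, zero_pow (by rw [Finset.card_empty] at hn; omega)]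
  | insert k s hk ih =>
    rw [Finset.card_insert_of_notMem hk] at hn
    obtain ⟨p, rfl⟩ : ∃ p, n = p + 1 := ⟨n - 1, by omega⟩
    have hcs : Commute (x k) (∑ k ∈ s, x k) := Commute.sum_right _ _ _ fun j _ => hc k j
    have : ∀ p : ℕ, (x k + ∑ j ∈ s, x j) ^ (p + 1) =
        (∑ j ∈ s, x j) ^ (p + 1) + (p + 1 : ℕ) • (x k * (∑ j ∈ s, x j) ^ p) := by
      intro p
      induction p with
      | zero => simp [add_comm]
      | succ p ihp =>
        set S := ∑ j ∈ s, x j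
        rw [pow_succ', ihp]
        have e1 : x k * (x k * S ^ p) = 0 := by rw [← mul_assoc, hsq, zero_mul]
        have e2 : S * (x k * S ^ p) = x k * S ^ (p + 1) := by
          rw [← mul_assoc, ← hcs.eq, mul_assoc, pow_succ']
        rw [add_mul, mul_add, mul_add, mul_smul_comm, mul_smul_comm, e1, e2, smul_zero, add_zero,
          ← pow_succ', succ_nsmul' _ (p + 1)]
        abel
    rw [Finset.sum_insert hk, this, ih (p + 1) (by omega), ih p (by omega)]
    simp

theorem one_mul_one_commute (a b c d : V →ₗ[ℝ] EqRing m) :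
    Commute (one a * one b) (one c * one d) := by
  have e : ∀ x y : V →ₗ[ℝ] EqRing m, one x * one y = -(one y * one x) := one_mul_one_swap
  have : ∀ x : V →ₗ[ℝ] EqRing m, Commute (one a * one b) (one x) := by
    intro x
    change one a * one b * one x = one x * (one a * one b)
    rw [mul_assoc, e b x, mul_neg, ← mul_assoc, e a x, neg_mul, neg_neg, mul_assoc]
  exact (this c).mul_right (this d)

theorem one_mul_one_sq (a b : V →ₗ[ℝ] EqRing m) : one a * one b * (one a * one b) = 0 := by
  have h1 : one b * (one a * one b) = -(one a * (one b * one b)) := by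
    rw [← mul_assoc, one_mul_one_swap b a, neg_mul, mul_assoc]
  rw [mul_assoc, h1, show one b * one b = 0 from ExteriorAlgebra.ι_sq_zero _]
  simp

/-! ### Parts of degree zero and one -/

/-- The part of degree zero. -/
noncomputable def degZero (m : ℕ) (V : Type) [AddCommGroup V] [Module ℝ V] :
    EForm m V →ₐ[EqRing m] EqRing m := ExteriorAlgebra.algebraMapInv

theorem degZero_algebraMap (c : EqRing m) :
    degZero m V (algebraMap (EqRing m) (EForm m V) c) = c := AlgHom.commutes _ _

theorem degZero_one (β : V →ₗ[ℝ] EqRing m) : degZero m V (one β) = 0 := by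
  unfold degZero ExteriorAlgebra.algebraMapInv
  exact ExteriorAlgebra.lift_ι_apply _ _ _ _

theorem degZero_pull (A : V →ₗ[ℝ] W) (ψ : EForm m W) :
    degZero m V (pull A ψ) = degZero m W ψ := by
  induction ψ using left_induction with
  | scalar c => rw [pull_algebraMap, degZero_algebraMap, degZero_algebraMap]
  | add x y hx hy => rw [pull_add, map_add, map_add, hx, hy]
  | mul β x hx => rw [pull_mul, map_mul, map_mul, pull_one, degZero_one, degZero_one, zero_mul,
      zero_mul]

/-- The part of degree one. -/
noncomputable def degOne (ψ : EForm m V) : V →ₗ[ℝ] EqRing m where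
  toFun v := degZero m V (contract v ψ)
  map_add' v w := by rw [contract_add_left, map_add]
  map_smul' c v := by
    rw [contract_smul_left]
    exact LinearMap.map_smul_of_tower (degZero m V).toLinearMap c _

theorem degOne_apply (ψ : EForm m V) (v : V) : degOne ψ v = degZero m V (contract v ψ) := rfl

theorem degOne_one (β : V →ₗ[ℝ] EqRing m) : degOne (one β) = β := by
  refine LinearMap.ext fun v => ?_
  rw [degOne_apply, contract_one, degZero_algebraMap]

theorem degOne_pull (A : V →ₗ[ℝ] W) (ψ : EForm m W) : degOne (pull A ψ) = degOne ψ ∘ₗ A := by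
  refine LinearMap.ext fun v => ?_
  rw [degOne_apply, contract_pull, degZero_pull]; rfl

/-- The part of degree one as a linear map. -/
noncomputable def degOneLin (m : ℕ) (V : Type) [AddCommGroup V] [Module ℝ V] :
    EForm m V →ₗ[ℝ] V →ₗ[ℝ] EqRing m where
  toFun := degOne
  map_add' ψ χ := LinearMap.ext fun v => by
    simp only [LinearMap.add_apply, degOne_apply, contract_add, map_add]
  map_smul' c ψ := LinearMap.ext fun v => by
    rw [degOne_apply, contract_real_smul]
    exact LinearMap.map_smul_of_tower (degZero m V).toLinearMap c _

end EForm

end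

section

/-! ## Calculus within sets -/

theorem two_le_smooth : (2 : WithTop ℕ∞) ≤ ∞ := WithTop.coe_le_coe.mpr le_top

/-- `g` is smooth within `S` near `x`. -/
def CNear {V E : Type*} [NormedAddCommGroup V] [NormedSpace ℝ V] [NormedAddCommGroup E]
    [NormedSpace ℝ E] (g : V → E) (S : Set V) (x : V) : Prop :=
  ∃ U, IsOpen U ∧ x ∈ U ∧ ContDiffOn ℝ ∞ g (U ∩ S)

/-- `F` is near `x` within `S` a finite sum of smooth functions times constant vectors. -/
def SmoothNear {V M : Type*} [NormedAddCommGroup V] [NormedSpace ℝ V] [AddCommGroup M] [Module ℝ M]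
    (F : V → M) (S : Set V) (x : V) : Prop :=
  ∃ U, IsOpen U ∧ x ∈ U ∧ ∃ (n : ℕ) (c : Fin n → M) (f : Fin n → V → ℝ),
    (∀ k, ContDiffOn ℝ ∞ (f k) (U ∩ S)) ∧ ∀ y ∈ U ∩ S, F y = ∑ k, f k y • c k

/-- Sets in which derivatives are unique and second derivatives are symmetric. -/
structure GoodSet {V : Type*} [NormedAddCommGroup V] [NormedSpace ℝ V] (S : Set V) : Prop where
  uniqueDiffOn : UniqueDiffOn ℝ S
  subset_closure : S ⊆ closure (interior S)

section

variable {V V' W M N P E E' : Type*} [NormedAddCommGroup V] [NormedSpace ℝ V]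
  [NormedAddCommGroup V'] [NormedSpace ℝ V']
  [AddCommGroup M] [Module ℝ M] [AddCommGroup N] [Module ℝ N] [AddCommGroup P] [Module ℝ P]
  [NormedAddCommGroup E] [NormedSpace ℝ E] [NormedAddCommGroup E'] [NormedSpace ℝ E']
  {S S' : Set V} {x : V}

theorem GoodSet.of_convex {C O : Set V} (hC : Convex ℝ C) (h : (interior C).Nonempty)
    (hO : IsOpen O) : GoodSet (O ∩ C) where
  uniqueDiffOn := by
    rw [Set.inter_comm]
    exact (uniqueDiffOn_convex hC h).inter hO
  subset_closure := by
    rintro x ⟨hx, hxC⟩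
    rw [interior_inter, hO.interior_eq]
    have : x ∈ closure (interior C) := by
      rw [hC.closure_interior_eq_closure_of_nonempty_interior h]; exact _root_.subset_closure hxC
    exact hO.inter_closure ⟨hx, this⟩

theorem GoodSet.inter_open (h : GoodSet S) {O : Set V} (hO : IsOpen O) : GoodSet (O ∩ S) where
  uniqueDiffOn := by rw [Set.inter_comm]; exact h.uniqueDiffOn.inter hO
  subset_closure := by
    rintro x ⟨hx, hxS⟩
    rw [interior_inter, hO.interior_eq]
    exact hO.inter_closure ⟨hx, h.subset_closure hxS⟩

namespace CNear

theorem of_contDiffOn {g : V → E} (h : ContDiffOn ℝ ∞ g S) : CNear g S x :=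
  ⟨Set.univ, isOpen_univ, trivial, h.mono fun _ h => h.2⟩

theorem of_contDiff {g : V → E} (h : ContDiff ℝ ∞ g) : CNear g S x := of_contDiffOn h.contDiffOn

theorem const (c : E) : CNear (fun _ : V => c) S x := of_contDiff contDiff_const

theorem mono {g : V → E} (h : CNear g S x) (hS : S' ⊆ S) : CNear g S' x := by
  obtain ⟨U, hU, hx, hg⟩ := h
  exact ⟨U, hU, hx, hg.mono fun y hy => ⟨hy.1, hS hy.2⟩⟩

theorem congr {g g' : V → E} (h : CNear g S x) {O : Set V} (hO : IsOpen O) (hx : x ∈ O)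
    (hgg : ∀ y ∈ O ∩ S, g' y = g y) : CNear g' S x := by
  obtain ⟨U, hU, hxU, hg⟩ := h
  refine ⟨U ∩ O, hU.inter hO, ⟨hxU, hx⟩, ?_⟩
  exact (hg.mono fun y hy => ⟨hy.1.1, hy.2⟩).congr fun y hy => hgg y ⟨hy.1.2, hy.2⟩

theorem contDiffOn {g : V → E} (h : ∀ x ∈ S, CNear g S x) : ContDiffOn ℝ ∞ g S := by
  intro x hx
  obtain ⟨U, hU, hxU, hg⟩ := h x hx
  have := hg x ⟨hxU, hx⟩
  rwa [Set.inter_comm, contDiffWithinAt_inter (hU.mem_nhds hxU)] at this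

theorem contDiffWithinAt {g : V → E} (h : CNear g S x) (hx : x ∈ S) :
    ContDiffWithinAt ℝ ∞ g S x := by
  obtain ⟨U, hU, hxU, hg⟩ := h
  have := hg x ⟨hxU, hx⟩
  rwa [Set.inter_comm, contDiffWithinAt_inter (hU.mem_nhds hxU)] at this

theorem differentiableWithinAt {g : V → E} (h : CNear g S x) (hx : x ∈ S) :
    DifferentiableWithinAt ℝ g S x := (h.contDiffWithinAt hx).differentiableWithinAt (by simp)

theorem continuousWithinAt {g : V → E} (h : CNear g S x) (hx : x ∈ S) :
    ContinuousWithinAt g S x := (h.contDiffWithinAt hx).continuousWithinAt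

theorem pair {g : V → E} {h : V → E'} (hg : CNear g S x) (hh : CNear h S x) :
    CNear (fun y => (g y, h y)) S x := by
  obtain ⟨U, hU, hxU, hg⟩ := hg
  obtain ⟨U', hU', hxU', hh⟩ := hh
  exact ⟨U ∩ U', hU.inter hU', ⟨hxU, hxU'⟩, (hg.mono fun y hy => ⟨hy.1.1, hy.2⟩).prodMk
    (hh.mono fun y hy => ⟨hy.1.2, hy.2⟩)⟩

theorem comp {g : V' → E} {T : Set V'} {Θ : V → V'} (hΘ : CNear Θ S x) (hx : x ∈ S)
    (hg : CNear g T (Θ x)) {O : Set V} (hO : IsOpen O) (hxO : x ∈ O)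
    (hmaps : ∀ y ∈ O ∩ S, Θ y ∈ T) : CNear (fun y => g (Θ y)) S x := by
  have hc := hΘ.continuousWithinAt hx
  obtain ⟨U, hU, hxU, hΘ⟩ := hΘ
  obtain ⟨U', hU', hxU', hg⟩ := hg
  have h1 := hc.preimage_mem_nhdsWithin (hU'.mem_nhds hxU')
  obtain ⟨O', hO', hxO', hsub⟩ := mem_nhdsWithin.mp h1
  refine ⟨U ∩ O ∩ O', (hU.inter hO).inter hO', ⟨⟨hxU, hxO⟩, hxO'⟩, ?_⟩
  refine hg.comp (hΘ.mono fun y hy => ⟨hy.1.1.1, hy.2⟩) fun y hy => ?_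
  exact ⟨hsub ⟨hy.1.2, hy.2⟩, hmaps y ⟨hy.1.1.2, hy.2⟩⟩

theorem post {g : V → E} {h : E → E'} (hh : ContDiff ℝ ∞ h) (hg : CNear g S x) :
    CNear (fun y => h (g y)) S x := by
  obtain ⟨U, hU, hxU, hg⟩ := hg
  exact ⟨U, hU, hxU, hh.comp_contDiffOn hg⟩

theorem add {g h : V → E} (hg : CNear g S x) (hh : CNear h S x) :
    CNear (fun y => g y + h y) S x := post (h := fun p : E × E => p.1 + p.2) (by fun_prop) (hg.pair hh)

theorem mul {g h : V → ℝ} (hg : CNear g S x) (hh : CNear h S x) :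
    CNear (fun y => g y * h y) S x := post (h := fun p : ℝ × ℝ => p.1 * p.2) (by fun_prop) (hg.pair hh)

theorem clm_apply {g : V → E →L[ℝ] E'} {h : V → E} (hg : CNear g S x) (hh : CNear h S x) :
    CNear (fun y => g y (h y)) S x :=
  post (h := fun p : (E →L[ℝ] E') × E => p.1 p.2) (by fun_prop) (hg.pair hh)

theorem sum {κ : Type*} (s : Finset κ) {g : κ → V → E} (h : ∀ k ∈ s, CNear (g k) S x) :
    CNear (fun y => ∑ k ∈ s, g k y) S x := by
  classical
  induction s using Finset.induction_on with
  | empty => simpa using const (0 : E)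
  | insert k s hk ih =>
    simp only [Finset.sum_insert hk]
    exact (h k (Finset.mem_insert_self k s)).add (ih fun j hj => h j (Finset.mem_insert_of_mem hj))

theorem fderivWithin {g : V → E} (h : CNear g S x) (hS : UniqueDiffOn ℝ S) :
    CNear (fun y => fderivWithin ℝ g S y) S x := by
  obtain ⟨U, hU, hxU, hg⟩ := h
  have hS' : UniqueDiffOn ℝ (U ∩ S) := by rw [Set.inter_comm]; exact hS.inter hU
  refine ⟨U, hU, hxU, (hg.fderivWithin hS' (m := ∞) (by simp)).congr fun y hy => ?_⟩
  rw [Set.inter_comm, fderivWithin_inter (hU.mem_nhds hy.1)]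

end CNear

theorem smoothNear_iff {F : V → M} : IsSmoothOn F S ↔ ∀ x ∈ S, SmoothNear F S x := by
  constructor
  · intro h x hx
    obtain ⟨U, hU, n, c, f, hf, hF⟩ := h x hx
    obtain ⟨U', hU', hO, hxU'⟩ := mem_nhds_iff.mp hU
    exact ⟨U', hO, hxU', n, c, f, fun k => (hf k).mono fun y hy => ⟨hU' hy.1, hy.2⟩,
      fun y hy => hF y ⟨hU' hy.1, hy.2⟩⟩
  · intro h x hx
    obtain ⟨U, hU, hxU, n, c, f, hf, hF⟩ := h x hx
    exact ⟨U, hU.mem_nhds hxU, n, c, f, hf, hF⟩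

namespace SmoothNear

theorem of_fintype {F : V → M} {κ : Type*} [Fintype κ] {U : Set V} (hU : IsOpen U) (hx : x ∈ U)
    (c : κ → M) (f : κ → V → ℝ) (hf : ∀ k, ContDiffOn ℝ ∞ (f k) (U ∩ S))
    (hF : ∀ y ∈ U ∩ S, F y = ∑ k, f k y • c k) : SmoothNear F S x := by
  refine ⟨U, hU, hx, Fintype.card κ, c ∘ (Fintype.equivFin κ).symm,
    f ∘ (Fintype.equivFin κ).symm, fun k => hf _, fun y hy => ?_⟩
  rw [hF y hy]
  exact ((Fintype.equivFin κ).symm.sum_comp fun k => f k y • c k).symm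

theorem congr {F F' : V → M} (h : SmoothNear F S x) {O : Set V} (hO : IsOpen O) (hx : x ∈ O)
    (hFF : ∀ y ∈ O ∩ S, F' y = F y) : SmoothNear F' S x := by
  obtain ⟨U, hU, hxU, n, c, f, hf, hF⟩ := h
  refine ⟨U ∩ O, hU.inter hO, ⟨hxU, hx⟩, n, c, f, fun k => (hf k).mono fun y hy => ⟨hy.1.1, hy.2⟩,
    fun y hy => ?_⟩
  rw [hFF y ⟨hy.1.2, hy.2⟩, hF y ⟨hy.1.1, hy.2⟩]

theorem mono {F : V → M} (h : SmoothNear F S x) (hS : S' ⊆ S) : SmoothNear F S' x := by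
  obtain ⟨U, hU, hxU, n, c, f, hf, hF⟩ := h
  exact ⟨U, hU, hxU, n, c, f, fun k => (hf k).mono fun y hy => ⟨hy.1, hS hy.2⟩,
    fun y hy => hF y ⟨hy.1, hS hy.2⟩⟩

theorem const (c : M) : SmoothNear (fun _ : V => c) S x :=
  of_fintype (κ := Unit) isOpen_univ trivial (fun _ => c) (fun _ _ => 1)
    (fun _ => contDiffOn_const) fun y _ => by simp

theorem comp {F : V' → M} {T : Set V'} {Θ : V → V'} (hΘ : CNear Θ S x) (hx : x ∈ S)
    (hF : SmoothNear F T (Θ x)) {O : Set V} (hO : IsOpen O) (hxO : x ∈ O)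
    (hmaps : ∀ y ∈ O ∩ S, Θ y ∈ T) : SmoothNear (fun y => F (Θ y)) S x := by
  have hc := hΘ.continuousWithinAt hx
  obtain ⟨U, hU, hxU, hΘ⟩ := hΘ
  obtain ⟨U', hU', hxU', n, c, f, hf, hF⟩ := hF
  have h1 := hc.preimage_mem_nhdsWithin (hU'.mem_nhds hxU')
  obtain ⟨O', hO', hxO', hsub⟩ := mem_nhdsWithin.mp h1
  have key : ∀ y ∈ (U ∩ O ∩ O') ∩ S, Θ y ∈ U' ∩ T := fun y hy =>
    ⟨hsub ⟨hy.1.2, hy.2⟩, hmaps y ⟨hy.1.1.2, hy.2⟩⟩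
  exact ⟨U ∩ O ∩ O', (hU.inter hO).inter hO', ⟨⟨hxU, hxO⟩, hxO'⟩, n, c, fun k y => f k (Θ y),
    fun k => (hf k).comp (hΘ.mono fun y hy => ⟨hy.1.1.1, hy.2⟩) key, fun y hy => hF _ (key y hy)⟩

theorem _root_.LinearMap.bilin_sum (B : M →ₗ[ℝ] N →ₗ[ℝ] P) {κ κ' : Type*} [Fintype κ] [Fintype κ']
    (f : κ → ℝ) (c : κ → M) (g : κ' → ℝ) (d : κ' → N) :
    B (∑ k, f k • c k) (∑ l, g l • d l) =
      ∑ p : κ × κ', (f p.1 * g p.2) • B (c p.1) (d p.2) := by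
  rw [LinearMap.map_sum₂, Fintype.sum_prod_type]
  refine Finset.sum_congr rfl fun k _ => ?_
  rw [map_sum]
  refine Finset.sum_congr rfl fun l _ => ?_
  rw [map_smul, map_smul, LinearMap.smul_apply, smul_smul, mul_comm]

theorem bilin (B : M →ₗ[ℝ] N →ₗ[ℝ] P) {F : V → M} {G : V → N} (hF : SmoothNear F S x)
    (hG : SmoothNear G S x) : SmoothNear (fun y => B (F y) (G y)) S x := by
  obtain ⟨U, hU, hxU, n, c, f, hf, hF⟩ := hF
  obtain ⟨U', hU', hxU', n', c', f', hf', hG⟩ := hG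
  refine of_fintype (κ := Fin n × Fin n') (hU.inter hU') ⟨hxU, hxU'⟩ (fun k => B (c k.1) (c' k.2))
    (fun k y => f k.1 y * f' k.2 y) (fun k => ?_) fun y hy => ?_
  · exact ((hf k.1).mono fun y hy => ⟨hy.1.1, hy.2⟩).mul ((hf' k.2).mono fun y hy => ⟨hy.1.2, hy.2⟩)
  · rw [hF y ⟨hy.1.1, hy.2⟩, hG y ⟨hy.1.2, hy.2⟩, LinearMap.bilin_sum]

theorem lin (A : M →ₗ[ℝ] N) {F : V → M} (hF : SmoothNear F S x) :
    SmoothNear (fun y => A (F y)) S x := by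
  obtain ⟨U, hU, hxU, n, c, f, hf, hF⟩ := hF
  refine ⟨U, hU, hxU, n, A ∘ c, f, hf, fun y hy => ?_⟩
  simp only [hF y hy, map_sum, map_smul, Function.comp_apply]

theorem of_real {g : V → ℝ} (h : CNear g S x) (c : M) : SmoothNear (fun y => g y • c) S x := by
  obtain ⟨U, hU, hxU, hg⟩ := h
  exact of_fintype (κ := Unit) hU hxU (fun _ => c) (fun _ => g) (fun _ => hg) fun y _ => by simp

theorem self {g : V → ℝ} (h : CNear g S x) : SmoothNear g S x := by
  simpa using of_real h (1 : ℝ)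

theorem smul {g : V → ℝ} (h : CNear g S x) {F : V → M} (hF : SmoothNear F S x) :
    SmoothNear (fun y => g y • F y) S x := bilin (LinearMap.lsmul ℝ M) (self h) hF

theorem sum {κ : Type*} (s : Finset κ) {F : κ → V → M} (h : ∀ k ∈ s, SmoothNear (F k) S x) :
    SmoothNear (fun y => ∑ k ∈ s, F k y) S x := by
  classical
  induction s using Finset.induction_on with
  | empty => simpa using const (0 : M)
  | insert k s hk ih =>
    obtain ⟨U, hU, hxU, n, c, f, hf, hF⟩ := h k (Finset.mem_insert_self k s)
    obtain ⟨U', hU', hxU', n', c', f', hf', hG⟩ := ih fun j hj => h j (Finset.mem_insert_of_mem hj)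
    refine of_fintype (κ := Fin n ⊕ Fin n') (hU.inter hU') ⟨hxU, hxU'⟩ (Sum.elim c c')
      (Sum.elim f f') ?_ fun y hy => ?_
    · rintro (k | k)
      · exact (hf k).mono fun y hy => ⟨hy.1.1, hy.2⟩
      · exact (hf' k).mono fun y hy => ⟨hy.1.2, hy.2⟩
    · have hG' : ∑ k ∈ s, F k y = ∑ k, f' k y • c' k := hG y ⟨hy.1.2, hy.2⟩
      rw [Finset.sum_insert hk, hF y ⟨hy.1.1, hy.2⟩, hG', Fintype.sum_sum_type]
      rfl

theorem of_cnear [FiniteDimensional ℝ E] {g : V → E} (h : CNear g S x) : SmoothNear g S x := by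
  obtain ⟨U, hU, hxU, hg⟩ := h
  let b := Module.finBasis ℝ E
  refine of_fintype hU hxU b (fun k y => b.coord k (g y)) (fun k => ?_) fun y _ => ?_
  · exact (LinearMap.toContinuousLinearMap (b.coord k)).contDiff.comp_contDiffOn hg
  · exact (b.sum_repr (g y)).symm

theorem functional {F : V → M} (hF : SmoothNear F S x) (L : M →ₗ[ℝ] ℝ) :
    CNear (fun y => L (F y)) S x := by
  obtain ⟨U, hU, hxU, n, c, f, hf, hF⟩ := hF
  refine ⟨U, hU, hxU, ContDiffOn.congr (f := fun y => ∑ k, f k y * L (c k)) ?_ fun y hy => ?_⟩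
  · exact ContDiffOn.sum fun k _ => (hf k).mul contDiffOn_const
  · rw [hF y hy, map_sum]; simp

end SmoothNear

theorem vderiv_eq_of_forall {F : V → M} {v : V} {y : M}
    (h : ∀ L : M →ₗ[ℝ] ℝ, L y = fderivWithin ℝ (fun z => L (F z)) S x v) : vderiv F S x v = y := by
  have hex : ∃ y : M, ∀ L : M →ₗ[ℝ] ℝ, L y = fderivWithin ℝ (fun z => L (F z)) S x v := ⟨y, h⟩
  rw [vderiv, dif_pos hex]
  refine ext_functional fun L => ?_
  rw [hex.choose_spec L, h L]

theorem vderiv_of_sum {F : V → M} {κ : Type*} [Fintype κ] {U : Set V} (hU : IsOpen U) (hxU : x ∈ U)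
    (hx : x ∈ S) (hS : UniqueDiffWithinAt ℝ S x) (c : κ → M) (f : κ → V → ℝ)
    (hf : ∀ k, ContDiffOn ℝ ∞ (f k) (U ∩ S)) (hF : ∀ y ∈ U ∩ S, F y = ∑ k, f k y • c k) (v : V) :
    vderiv F S x v = ∑ k, fderivWithin ℝ (f k) S x v • c k := by
  refine vderiv_eq_of_forall fun L => ?_
  have hd : ∀ k, DifferentiableWithinAt ℝ (f k) S x := fun k =>
    CNear.differentiableWithinAt ⟨U, hU, hxU, hf k⟩ hx
  have h1 : (fun z => L (F z)) =ᶠ[𝓝[S] x] fun z => ∑ k, f k z * L (c k) := by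
    filter_upwards [inter_mem_nhdsWithin S (hU.mem_nhds hxU)] with z hz
    rw [hF z ⟨hz.2, hz.1⟩, map_sum]; simp
  rw [h1.fderivWithin_eq (h1.self_of_nhdsWithin hx), fderivWithin_fun_sum hS fun k _ => (hd k).mul_const _]
  simp only [sum_apply, map_sum, map_smul, smul_eq_mul]
  refine Finset.sum_congr rfl fun k _ => ?_
  rw [fderivWithin_mul_const hS (hd k)]
  simp [mul_comm]

theorem vderiv_spec {F : V → M} (hF : SmoothNear F S x) (hx : x ∈ S) (hS : UniqueDiffOn ℝ S)
    (v : V) (L : M →ₗ[ℝ] ℝ) : L (vderiv F S x v) = fderivWithin ℝ (fun z => L (F z)) S x v := by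
  have hF' := hF
  obtain ⟨U, hU, hxU, n, c, f, hf, hF⟩ := hF
  have hex : ∃ y : M, ∀ L : M →ₗ[ℝ] ℝ, L y = fderivWithin ℝ (fun z => L (F z)) S x v := by
    refine ⟨∑ k, fderivWithin ℝ (f k) S x v • c k, fun L => ?_⟩
    have h := vderiv_of_sum (F := fun z => L (F z)) hU hxU hx (hS x hx) (fun k => L (c k)) f hf
      (fun y hy => by rw [hF y hy, map_sum]; simp) v
    rw [map_sum]
    simp only [map_smul]
    rw [← h]
    refine vderiv_eq_of_forall fun L' => ?_
    have h2 : ∀ t, L' t = t * L' 1 := fun t => by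
      rw [← smul_eq_mul, ← map_smul, smul_eq_mul, mul_one]
    have hd : DifferentiableWithinAt ℝ (fun z => L (F z)) S x :=
      (hF'.functional L).differentiableWithinAt hx
    rw [h2]
    have : (fun z => L' (L (F z))) = fun z => L (F z) * L' 1 := funext fun z => h2 _
    rw [this, fderivWithin_mul_const (hS x hx) hd]
    simp [mul_comm]
  rw [vderiv, dif_pos hex]
  exact hex.choose_spec L

open Classical in
theorem dite_choose_congr {M : Type*} [Zero M] {p q : M → Prop} (h : p = q) :
    (if h : ∃ y, p y then h.choose else 0) = if h : ∃ y, q y then h.choose else 0 := by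
  subst h; rfl

theorem vderiv_congr {F F' : V → M} (hx : x ∈ S) (h : F' =ᶠ[𝓝[S] x] F) (v : V) :
    vderiv F' S x v = vderiv F S x v := by
  have : ∀ L : M →ₗ[ℝ] ℝ, fderivWithin ℝ (fun z => L (F' z)) S x v =
      fderivWithin ℝ (fun z => L (F z)) S x v := by
    intro L
    have h' : (fun z => L (F' z)) =ᶠ[𝓝[S] x] fun z => L (F z) := h.mono fun z hz => by simp only [hz]
    rw [h'.fderivWithin_eq (h'.self_of_nhdsWithin hx)]
  exact dite_choose_congr (funext fun y => by simp only [this])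

theorem vderiv_congr_set {F : V → M} {O : Set V} (hO : IsOpen O) (hx : x ∈ O) (v : V) :
    vderiv F (O ∩ S) x v = vderiv F S x v := by
  have : ∀ L : M →ₗ[ℝ] ℝ, fderivWithin ℝ (fun z => L (F z)) (O ∩ S) x v =
      fderivWithin ℝ (fun z => L (F z)) S x v := by
    intro L
    rw [Set.inter_comm, fderivWithin_inter (hO.mem_nhds hx)]
  exact dite_choose_congr (funext fun y => by simp only [this])

/-- The derivative as a linear map. -/
noncomputable def vderivLin (F : V → M) (hF : SmoothNear F S x) (hx : x ∈ S)
    (hS : UniqueDiffOn ℝ S) : V →ₗ[ℝ] M where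
  toFun v := vderiv F S x v
  map_add' v w := ext_functional fun L => by
    rw [map_add]; simp only [vderiv_spec hF hx hS, map_add]
  map_smul' c v := ext_functional fun L => by
    rw [map_smul]; simp only [vderiv_spec hF hx hS, map_smul, RingHom.id_apply]

theorem vderiv_real {g : V → ℝ} (h : CNear g S x) (hx : x ∈ S) (hS : UniqueDiffOn ℝ S) (v : V) :
    vderiv g S x v = fderivWithin ℝ g S x v := by
  obtain ⟨U, hU, hxU, hg⟩ := h
  have := vderiv_of_sum (F := g) (κ := Unit) hU hxU hx (hS x hx) (fun _ => (1 : ℝ)) (fun _ => g)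
    (fun _ => hg) (fun y _ => by simp) v
  simpa using this

theorem vderiv_cnear [FiniteDimensional ℝ E] {g : V → E} (h : CNear g S x) (hx : x ∈ S)
    (hS : UniqueDiffOn ℝ S) (v : V) : vderiv g S x v = fderivWithin ℝ g S x v := by
  refine ext_functional fun L => ?_
  rw [vderiv_spec (SmoothNear.of_cnear h) hx hS]
  have := (LinearMap.toContinuousLinearMap L).hasFDerivAt.comp_hasFDerivWithinAt x
    (h.differentiableWithinAt hx).hasFDerivWithinAt
  exact congrArg (fun A => A v) (this.fderivWithin (hS x hx))

theorem vderiv_bilin (B : M →ₗ[ℝ] N →ₗ[ℝ] P) {F : V → M} {G : V → N} (hF : SmoothNear F S x)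
    (hG : SmoothNear G S x) (hx : x ∈ S) (hS : UniqueDiffOn ℝ S) (v : V) :
    vderiv (fun y => B (F y) (G y)) S x v =
      B (vderiv F S x v) (G x) + B (F x) (vderiv G S x v) := by
  obtain ⟨U, hU, hxU, n, c, f, hf, hF⟩ := hF
  obtain ⟨U', hU', hxU', n', c', f', hf', hG⟩ := hG
  have hd : ∀ k, DifferentiableWithinAt ℝ (f k) S x := fun k =>
    CNear.differentiableWithinAt ⟨U, hU, hxU, hf k⟩ hx
  have hd' : ∀ k, DifferentiableWithinAt ℝ (f' k) S x := fun k =>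
    CNear.differentiableWithinAt ⟨U', hU', hxU', hf' k⟩ hx
  rw [vderiv_of_sum hU hxU hx (hS x hx) c f hf hF, vderiv_of_sum hU' hxU' hx (hS x hx) c' f' hf' hG,
    hF x ⟨hxU, hx⟩, hG x ⟨hxU', hx⟩,
    vderiv_of_sum (κ := Fin n × Fin n') (hU.inter hU') ⟨hxU, hxU'⟩ hx (hS x hx)
      (fun k => B (c k.1) (c' k.2)) (fun k y => f k.1 y * f' k.2 y)]
  · rw [LinearMap.bilin_sum, LinearMap.bilin_sum, ← Finset.sum_add_distrib]
    refine Finset.sum_congr rfl fun k _ => ?_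
    rw [fderivWithin_fun_mul (hS x hx) (hd _) (hd' _), ← add_smul]
    simp only [add_apply, smul_apply, smul_eq_mul]
    congr 1
    ring
  · exact fun k => ((hf k.1).mono fun y hy => ⟨hy.1.1, hy.2⟩).mul
      ((hf' k.2).mono fun y hy => ⟨hy.1.2, hy.2⟩)
  · intro y hy
    rw [hF y ⟨hy.1.1, hy.2⟩, hG y ⟨hy.1.2, hy.2⟩, LinearMap.bilin_sum]

theorem vderiv_lin (A : M →ₗ[ℝ] N) {F : V → M} (hF : SmoothNear F S x) (hx : x ∈ S)
    (hS : UniqueDiffOn ℝ S) (v : V) :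
    vderiv (fun y => A (F y)) S x v = A (vderiv F S x v) := by
  refine ext_functional fun L => ?_
  rw [vderiv_spec (hF.lin A) hx hS]
  exact (vderiv_spec hF hx hS v (L ∘ₗ A)).symm

theorem vderiv_sum {κ : Type*} (s : Finset κ) {F : κ → V → M} (h : ∀ k ∈ s, SmoothNear (F k) S x)
    (hx : x ∈ S) (hS : UniqueDiffOn ℝ S) (v : V) :
    vderiv (fun y => ∑ k ∈ s, F k y) S x v = ∑ k ∈ s, vderiv (F k) S x v := by
  refine ext_functional fun L => ?_
  rw [vderiv_spec (SmoothNear.sum s h) hx hS]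
  simp only [map_sum]
  rw [fderivWithin_fun_sum (hS x hx) fun k hk => ((h k hk).functional L).differentiableWithinAt hx,
    sum_apply]
  exact Finset.sum_congr rfl fun k hk => (vderiv_spec (h k hk) hx hS v L).symm

theorem vderiv_const (c : M) (hx : x ∈ S) (hS : UniqueDiffOn ℝ S) (v : V) :
    vderiv (fun _ => c) S x v = 0 := by
  refine ext_functional fun L => ?_
  rw [vderiv_spec (SmoothNear.const c) hx hS]
  simp

theorem vderiv_smul {g : V → ℝ} (hg : CNear g S x) {F : V → M} (hF : SmoothNear F S x) (hx : x ∈ S)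
    (hS : UniqueDiffOn ℝ S) (v : V) : vderiv (fun y => g y • F y) S x v =
      fderivWithin ℝ g S x v • F x + g x • vderiv F S x v := by
  have := vderiv_bilin (LinearMap.lsmul ℝ M) (SmoothNear.self hg) hF hx hS v
  rwa [vderiv_real hg hx hS] at this

theorem vderiv_comp {F : V' → M} {T : Set V'} {Θ : V → V'} (hΘ : CNear Θ S x) (hx : x ∈ S)
    (hS : UniqueDiffOn ℝ S) (hT : UniqueDiffOn ℝ T)
    (hF : SmoothNear F T (Θ x)) {O : Set V} (hO : IsOpen O) (hxO : x ∈ O)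
    (hmaps : ∀ y ∈ O ∩ S, Θ y ∈ T) (v : V) :
    vderiv (fun y => F (Θ y)) S x v = vderiv F T (Θ x) (fderivWithin ℝ Θ S x v) := by
  refine ext_functional fun L => ?_
  have hΘx := hmaps x ⟨hxO, hx⟩
  rw [vderiv_spec (SmoothNear.comp hΘ hx hF hO hxO hmaps) hx hS, vderiv_spec hF hΘx hT]
  have h1 := ((hF.functional L).differentiableWithinAt hΘx).hasFDerivWithinAt
  have h2 := (hΘ.differentiableWithinAt hx).hasFDerivWithinAt
  have h3 : HasFDerivWithinAt Θ (fderivWithin ℝ Θ S x) (O ∩ S) x := h2.mono fun y hy => hy.2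
  have h4 := h1.comp x h3 hmaps
  have h5 : HasFDerivWithinAt (fun y => L (F (Θ y)))
      ((fderivWithin ℝ (fun z => L (F z)) T (Θ x)).comp (fderivWithin ℝ Θ S x)) S x := by
    rwa [Set.inter_comm, hasFDerivWithinAt_inter (hO.mem_nhds hxO)] at h4
  exact congrArg (fun A => A v) (h5.fderivWithin (hS x hx))

theorem SmoothNear.vderiv {F : V → M} (hF : SmoothNear F S x) (hS : UniqueDiffOn ℝ S) (v : V) :
    SmoothNear (fun y => vderiv F S y v) S x := by
  obtain ⟨U, hU, hxU, n, c, f, hf, hF⟩ := hF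
  refine ⟨U, hU, hxU, n, c, fun k y => fderivWithin ℝ (f k) S y v, fun k => ?_, fun y hy =>
    vderiv_of_sum hU hy.1 hy.2 (hS y hy.2) c f hf hF v⟩
  refine CNear.contDiffOn fun y hy => ?_
  have : CNear (f k) S y := ⟨U, hU, hy.1, hf k⟩
  exact ((this.fderivWithin hS).clm_apply (CNear.const v)).mono Set.inter_subset_right

theorem vderiv_symm {F : V → M} (hF : SmoothNear F S x) (hx : x ∈ S) (hS : GoodSet S) (v w : V) :
    vderiv (fun y => vderiv F S y v) S x w = vderiv (fun y => vderiv F S y w) S x v := by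
  refine ext_functional fun L => ?_
  have hU := hS.uniqueDiffOn
  rw [vderiv_spec (hF.vderiv hU v) hx hU, vderiv_spec (hF.vderiv hU w) hx hU]
  have hc := (hF.functional L)
  have hsym : IsSymmSndFDerivWithinAt ℝ (fun z => L (F z)) S x :=
    (hc.contDiffWithinAt hx).isSymmSndFDerivWithinAt (by
      rw [minSmoothness_of_isRCLikeNormedField]; exact two_le_smooth) hU (hS.subset_closure hx) hx
  have key : ∀ v w, fderivWithin ℝ (fun z => L (_root_.vderiv F S z v)) S x w =
      fderivWithin ℝ (fderivWithin ℝ (fun z => L (F z)) S) S x w v := by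
    intro v w
    obtain ⟨U, hUo, hxU, n, c, f, hf, hF⟩ := hF
    have h1 : (fun z => L (_root_.vderiv F S z v)) =ᶠ[𝓝[S] x]
        fun z => fderivWithin ℝ (fun z => L (F z)) S z v := by
      filter_upwards [inter_mem_nhdsWithin S (hUo.mem_nhds hxU)] with z hz
      exact vderiv_spec ⟨U, hUo, hz.2, n, c, f, hf, hF⟩ hz.1 hU v L
    rw [h1.fderivWithin_eq (h1.self_of_nhdsWithin hx)]
    have h2 := ((hc.fderivWithin hU).differentiableWithinAt hx).hasFDerivWithinAt
    have h3 := (ContinuousLinearMap.apply ℝ ℝ v).hasFDerivAt.comp_hasFDerivWithinAt x h2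
    exact congrArg (fun A => A w) (h3.fderivWithin (hU x hx))
  rw [key, key]
  exact hsym.eq w v

end

end

section

/-! ## The exterior derivative -/

namespace EForm

variable {m : ℕ} {V W : Type} [NormedAddCommGroup V] [NormedSpace ℝ V] [FiniteDimensional ℝ V]
  [NormedAddCommGroup W] [NormedSpace ℝ W] [FiniteDimensional ℝ W] {S : Set V} {x : V}

/-- Multiplication of forms as a real bilinear map. -/
noncomputable abbrev mulBilin (m : ℕ) (V : Type) [AddCommGroup V] [Module ℝ V] :
    EForm m V →ₗ[ℝ] EForm m V →ₗ[ℝ] EForm m V := LinearMap.mul ℝ (EForm m V)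

/-- The covector map as a real linear map. -/
noncomputable def covectorLin (m : ℕ) (V : Type) [AddCommGroup V] [Module ℝ V] :
    (V →ₗ[ℝ] ℝ) →ₗ[ℝ] EForm m V where
  toFun := covector m
  map_add' β γ := by
    rw [covector_eq, covector_eq, covector_eq, LinearMap.comp_add]
    exact map_add (ExteriorAlgebra.ι (EqRing m)) _ _
  map_smul' c β := by
    rw [covector_eq, covector_eq, LinearMap.comp_smul]
    exact LinearMap.map_smul_of_tower (ExteriorAlgebra.ι (EqRing m)) c _

theorem covectorLin_apply (β : V →ₗ[ℝ] ℝ) : covectorLin m V β = covector m β := rfl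

/-- One-forms as a real linear map. -/
noncomputable def oneLin (m : ℕ) (V : Type) [AddCommGroup V] [Module ℝ V] :
    (V →ₗ[ℝ] EqRing m) →ₗ[ℝ] EForm m V where
  toFun := one
  map_add' β γ := map_add _ β γ
  map_smul' c β := LinearMap.map_smul_of_tower (ExteriorAlgebra.ι (EqRing m)) c β

theorem oneLin_apply (β : V →ₗ[ℝ] EqRing m) : oneLin m V β = one β := rfl

/-- The exterior derivative. -/
noncomputable def dform (F : V → EForm m V) (S : Set V) (x : V) : EForm m V :=
  ∑ b, covector m ((Module.finBasis ℝ V).coord b) * vderiv F S x (Module.finBasis ℝ V b)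

/-- The antisymmetrization of a linear map with values in forms, in terms of a basis. -/
theorem sum_covector_mul_basis {κ κ' : Type*} [Fintype κ] [Fintype κ'] (e : Module.Basis κ ℝ V)
    (e' : Module.Basis κ' ℝ V) (D : V →ₗ[ℝ] EForm m V) :
    ∑ b, covector m (e.coord b) * D (e b) = ∑ b, covector m (e'.coord b) * D (e' b) := by
  have h1 : ∀ b, e.coord b = ∑ c, e.coord b (e' c) • e'.coord c := fun b => by
    exact (e'.sum_dual_apply_smul_coord (e.coord b)).symm
  have h2 : ∀ c, e' c = ∑ b, e.coord b (e' c) • e b := fun c => (e.sum_repr (e' c)).symm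
  have h3 : ∀ b, covector m (e.coord b) = ∑ c, e.coord b (e' c) • covector m (e'.coord c) := by
    intro b
    rw [← covectorLin_apply, h1 b, map_sum]
    simp only [map_smul, covectorLin_apply, ← h1]
  have h4 : ∀ c, D (e' c) = ∑ b, e.coord b (e' c) • D (e b) := by
    intro c
    conv_lhs => rw [h2 c, map_sum]
    simp only [map_smul]
  simp only [h4, Finset.mul_sum]
  rw [Finset.sum_comm]
  refine Finset.sum_congr rfl fun b _ => ?_
  rw [h3, Finset.sum_mul]
  refine Finset.sum_congr rfl fun c _ => ?_
  rw [smul_mul_assoc, mul_smul_comm]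

theorem dform_basis {κ : Type*} [Fintype κ] (e : Module.Basis κ ℝ V) {F : V → EForm m V}
    (hF : SmoothNear F S x) (hx : x ∈ S) (hS : UniqueDiffOn ℝ S) :
    dform F S x = ∑ b, covector m (e.coord b) * vderiv F S x (e b) :=
  sum_covector_mul_basis (Module.finBasis ℝ V) e (vderivLin F hF hx hS)

theorem smoothNear_dform {F : V → EForm m V} (hF : SmoothNear F S x) (hS : UniqueDiffOn ℝ S) :
    SmoothNear (dform F S) S x :=
  SmoothNear.sum _ fun b _ => SmoothNear.bilin (mulBilin m V) (SmoothNear.const _) (hF.vderiv hS _)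

theorem _root_.SmoothNear.fmul {F G : V → EForm m W} (hF : SmoothNear F S x)
    (hG : SmoothNear G S x) : SmoothNear (fun y => F y * G y) S x :=
  SmoothNear.bilin (mulBilin m W) hF hG

theorem _root_.SmoothNear.fpow {F : V → EForm m W} (hF : SmoothNear F S x) (k : ℕ) :
    SmoothNear (fun y => F y ^ k) S x := by
  induction k with
  | zero => simpa using SmoothNear.const (1 : EForm m W)
  | succ k ih => simpa only [pow_succ] using ih.fmul hF

theorem dform_congr {F F' : V → EForm m V} (hx : x ∈ S) (h : F' =ᶠ[𝓝[S] x] F) :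
    dform F' S x = dform F S x :=
  Finset.sum_congr rfl fun b _ => by rw [vderiv_congr hx h]

theorem dform_congr_set {F : V → EForm m V} {O : Set V} (hO : IsOpen O) (hx : x ∈ O) :
    dform F (O ∩ S) x = dform F S x :=
  Finset.sum_congr rfl fun b _ => by rw [vderiv_congr_set hO hx]

theorem one_mul_eq (β : V →ₗ[ℝ] EqRing m) (ψ : EForm m V) : one β * ψ = inv ψ * one β := by
  induction ψ using left_induction with
  | scalar c =>
    have h : inv (algebraMap (EqRing m) (EForm m V) c) = algebraMap _ _ c := AlgHom.commutes _ _
    rw [h]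
    exact (Algebra.commutes c (one β)).symm
  | add a b ha hb =>
    have h : inv (a + b) = inv a + inv b := map_add CliffordAlgebra.involute a b
    rw [mul_add, ha, hb, h, add_mul]
  | mul γ a ha => rw [inv_one_mul, ← mul_assoc, one_mul_one_swap, neg_mul, mul_assoc, ha, neg_mul,
      mul_assoc]

/-- Even forms. -/
def IsEven (ψ : EForm m V) : Prop := inv ψ = ψ

omit [FiniteDimensional ℝ V] in
theorem inv_mul (a b : EForm m V) : inv (a * b) = inv a * inv b :=
  map_mul CliffordAlgebra.involute a b

theorem IsEven.mul {a b : EForm m V} (ha : IsEven a) (hb : IsEven b) : IsEven (a * b) := by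
  unfold IsEven at *
  rw [inv_mul, ha, hb]

theorem isEven_one : IsEven (1 : EForm m V) := map_one CliffordAlgebra.involute

theorem IsEven.pow {a : EForm m V} (ha : IsEven a) (k : ℕ) : IsEven (a ^ k) := by
  induction k with
  | zero => rw [pow_zero]; exact isEven_one
  | succ k ih => rw [pow_succ]; exact ih.mul ha

theorem IsEven.covector_mul {a : EForm m V} (ha : IsEven a) (β : V →ₗ[ℝ] ℝ) :
    covector m β * a = a * covector m β := by
  rw [covector_eq, one_mul_eq, ha]

/-- The Leibniz rule for an even first factor. -/
theorem dform_mul {F G : V → EForm m V} (hF : SmoothNear F S x) (hG : SmoothNear G S x)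
    (hx : x ∈ S) (hS : UniqueDiffOn ℝ S) (he : IsEven (F x)) :
    dform (fun y => F y * G y) S x = dform F S x * G x + F x * dform G S x := by
  unfold dform
  rw [Finset.sum_mul, Finset.mul_sum, ← Finset.sum_add_distrib]
  refine Finset.sum_congr rfl fun b _ => ?_
  have h := vderiv_bilin (mulBilin m V) hF hG hx hS (Module.finBasis ℝ V b)
  simp only [LinearMap.mul_apply'] at h
  rw [h, mul_add, mul_assoc, ← mul_assoc (F x), ← he.covector_mul, mul_assoc]

theorem dform_smul {g : V → ℝ} {G : V → EForm m V} (hg : CNear g S x) (hG : SmoothNear G S x)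
    (hx : x ∈ S) (hS : UniqueDiffOn ℝ S) :
    dform (fun y => g y • G y) S x =
      covector m (fderivWithin ℝ g S x).toLinearMap * G x + g x • dform G S x := by
  have h1 : covector m (fderivWithin ℝ g S x).toLinearMap = ∑ b,
      (fderivWithin ℝ g S x (Module.finBasis ℝ V b)) • covector m ((Module.finBasis ℝ V).coord b) := by
    have : (fderivWithin ℝ g S x).toLinearMap = ∑ b,
      (fderivWithin ℝ g S x (Module.finBasis ℝ V b)) • (Module.finBasis ℝ V).coord b := by
      exact ((Module.finBasis ℝ V).sum_dual_apply_smul_coord _).symm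
    conv_lhs => rw [this]
    rw [← covectorLin_apply, map_sum]
    simp only [map_smul, covectorLin_apply]
  unfold dform
  rw [h1, Finset.sum_mul, Finset.smul_sum, ← Finset.sum_add_distrib]
  refine Finset.sum_congr rfl fun b _ => ?_
  rw [vderiv_smul hg hG hx hS, mul_add, mul_smul_comm, mul_smul_comm, smul_mul_assoc]

theorem dform_sum {κ : Type*} (s : Finset κ) {F : κ → V → EForm m V}
    (h : ∀ k ∈ s, SmoothNear (F k) S x) (hx : x ∈ S) (hS : UniqueDiffOn ℝ S) :
    dform (fun y => ∑ k ∈ s, F k y) S x = ∑ k ∈ s, dform (F k) S x := by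
  unfold dform
  rw [Finset.sum_comm]
  refine Finset.sum_congr rfl fun b _ => ?_
  rw [vderiv_sum s h hx hS, Finset.mul_sum]

theorem antisymm_sum {κ : Type*} [Fintype κ] (β : κ → V →ₗ[ℝ] ℝ) (H : κ → κ → EForm m V)
    (hH : ∀ a b, H a b = H b a) :
    ∑ a, covector m (β a) * ∑ b, covector m (β b) * H a b = 0 := by
  have h : ∀ a b, covector m (β a) * (covector m (β b) * H a b) =
      -(covector m (β b) * (covector m (β a) * H b a)) := by
    intro a b
    rw [← mul_assoc, ← mul_assoc, hH a b, covector_eq, covector_eq, one_mul_one_swap, neg_mul]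
  have h2 : ∑ a, covector m (β a) * ∑ b, covector m (β b) * H a b =
      -∑ a, covector m (β a) * ∑ b, covector m (β b) * H a b := by
    simp only [Finset.mul_sum]
    conv_lhs => rw [Finset.sum_comm]
    rw [← Finset.sum_neg_distrib]
    refine Finset.sum_congr rfl fun b _ => ?_
    rw [← Finset.sum_neg_distrib]
    exact Finset.sum_congr rfl fun a _ => h a b
  have h3 := add_eq_zero_iff_eq_neg.mpr h2
  rw [← two_smul ℝ] at h3
  exact (smul_eq_zero.mp h3).resolve_left two_ne_zero

/-- `d² = 0`. -/
theorem dform_dform {F : V → EForm m V} (hF : SmoothNear F S x) (hx : x ∈ S) (hS : GoodSet S) :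
    dform (dform F S) S x = 0 := by
  have h1 : ∀ v, vderiv (dform F S) S x v = ∑ b, covector m ((Module.finBasis ℝ V).coord b) *
      vderiv (fun y => vderiv F S y (Module.finBasis ℝ V b)) S x v := by
    intro v
    have h2 : ∀ b, SmoothNear (fun y => covector m ((Module.finBasis ℝ V).coord b) *
        vderiv F S y (Module.finBasis ℝ V b)) S x := fun b =>
      (SmoothNear.const _).fmul (hF.vderiv hS.uniqueDiffOn _)
    unfold dform
    rw [vderiv_sum _ (fun b _ => h2 b) hx hS.uniqueDiffOn]
    refine Finset.sum_congr rfl fun b _ => ?_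
    exact vderiv_lin (mulBilin m V (covector m ((Module.finBasis ℝ V).coord b)))
      (hF.vderiv hS.uniqueDiffOn _) hx hS.uniqueDiffOn v
  rw [dform]
  simp only [h1]
  exact antisymm_sum _ _ fun a b => vderiv_symm hF hx hS _ _

/-- The exterior derivative of a one-form. -/
theorem dform_one {β : V → V →ₗ[ℝ] EqRing m} (hβ : SmoothNear β S x) (hx : x ∈ S)
    (hS : UniqueDiffOn ℝ S) : dform (fun y => one (β y)) S x =
      ∑ b, covector m ((Module.finBasis ℝ V).coord b) *
        one (vderiv β S x (Module.finBasis ℝ V b)) := by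
  unfold dform
  refine Finset.sum_congr rfl fun b _ => ?_
  congr 1
  exact vderiv_lin (oneLin m V) hβ hx hS _

theorem isEven_covector_mul_one (β : V →ₗ[ℝ] ℝ) (γ : V →ₗ[ℝ] EqRing m) :
    IsEven (covector m β * one γ) := by
  have : ∀ γ : V →ₗ[ℝ] EqRing m, inv (one γ) = -one γ := fun γ => CliffordAlgebra.involute_ι _
  unfold IsEven
  rw [inv_mul, covector_eq, this, this, neg_mul_neg]

theorem isEven_sum {κ : Type*} (s : Finset κ) (a : κ → EForm m V) (h : ∀ k ∈ s, IsEven (a k)) :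
    IsEven (∑ k ∈ s, a k) := by
  unfold IsEven at *
  rw [inv, map_sum]
  exact Finset.sum_congr rfl fun k hk => h k hk

theorem isEven_dform_one {β : V → V →ₗ[ℝ] EqRing m} (hβ : SmoothNear β S x) (hx : x ∈ S)
    (hS : UniqueDiffOn ℝ S) : IsEven (dform (fun y => one (β y)) S x) := by
  rw [dform_one hβ hx hS]
  exact isEven_sum _ _ fun b _ => isEven_covector_mul_one _ _

theorem dform_one_pow_eq_zero {β : V → V →ₗ[ℝ] EqRing m} (hβ : SmoothNear β S x) (hx : x ∈ S)
    (hS : UniqueDiffOn ℝ S) {n : ℕ} (hn : Module.finrank ℝ V + 1 ≤ n) :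
    dform (fun y => one (β y)) S x ^ n = 0 := by
  rw [dform_one hβ hx hS]
  refine sum_pow_eq_zero _ _ (fun b => ?_) (fun a b => ?_) _ (by simpa using hn)
  · rw [covector_eq]; exact one_mul_one_sq _ _
  · rw [covector_eq, covector_eq]; exact one_mul_one_commute _ _ _ _

/-- Evaluation of covectors at a vector, as a bilinear map. -/
noncomputable def evalBilin (m : ℕ) (V : Type) [AddCommGroup V] [Module ℝ V] :
    (V →ₗ[ℝ] EqRing m) →ₗ[ℝ] V →ₗ[ℝ] EqRing m := LinearMap.id

/-- The exterior derivative of one-forms commutes with pullback. -/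
theorem dform_one_pull {Θ : V → W} {T : Set W} (hΘ : CNear Θ S x) (hx : x ∈ S) (hS : GoodSet S)
    (hT : UniqueDiffOn ℝ T) {O : Set V} (hO : IsOpen O) (hxO : x ∈ O)
    (hmaps : ∀ y ∈ O ∩ S, Θ y ∈ T) {β : W → W →ₗ[ℝ] EqRing m} (hβ : SmoothNear β T (Θ x))
    {γ : V → V →ₗ[ℝ] EqRing m} (hγs : SmoothNear γ S x)
    (hγ : ∀ y ∈ O ∩ S, γ y = β (Θ y) ∘ₗ (fderivWithin ℝ Θ S y).toLinearMap) :
    dform (fun y => one (γ y)) S x =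
      pull (fderivWithin ℝ Θ S x).toLinearMap (dform (fun y => one (β y)) T (Θ x)) := by
  have hU := hS.uniqueDiffOn
  have hΘx := hmaps x ⟨hxO, hx⟩
  set A := (fderivWithin ℝ Θ S x).toLinearMap with hA
  set e := Module.finBasis ℝ V
  set e' := Module.finBasis ℝ W
  -- derivative of `γ`
  have hγv : ∀ v, vderiv γ S x v = vderiv β T (Θ x) (A v) ∘ₗ A +
      β (Θ x) ∘ₗ (fderivWithin ℝ (fderivWithin ℝ Θ S) S x v).toLinearMap := by
    intro v
    refine LinearMap.ext fun w => ?_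
    have h1 : vderiv γ S x v w = vderiv (fun y => γ y w) S x v :=
      (vderiv_lin (LinearMap.applyₗ w : (V →ₗ[ℝ] EqRing m) →ₗ[ℝ] EqRing m) hγs hx hU v).symm
    have h2 : (fun y => γ y w) =ᶠ[𝓝[S] x]
        fun y => evalBilin m W (β (Θ y)) (fderivWithin ℝ Θ S y w) := by
      filter_upwards [inter_mem_nhdsWithin S (hO.mem_nhds hxO)] with y hy
      rw [hγ y ⟨hy.2, hy.1⟩]; rfl
    have h3 : CNear (fun y => fderivWithin ℝ Θ S y w) S x :=
      (hΘ.fderivWithin hU).clm_apply (CNear.const w)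
    have h4 : SmoothNear (fun y => β (Θ y)) S x := SmoothNear.comp hΘ hx hβ hO hxO hmaps
    rw [h1, vderiv_congr hx h2, vderiv_bilin _ h4 (SmoothNear.of_cnear h3) hx hU,
      vderiv_comp hΘ hx hU hT hβ hO hxO hmaps, vderiv_cnear h3 hx hU]
    have h5 := ((hΘ.fderivWithin hU).differentiableWithinAt hx).hasFDerivWithinAt
    have h6 := (ContinuousLinearMap.apply ℝ W w).hasFDerivAt.comp_hasFDerivWithinAt x h5
    have h7 : fderivWithin ℝ (fun y => fderivWithin ℝ Θ S y w) S x v =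
        fderivWithin ℝ (fderivWithin ℝ Θ S) S x v w :=
      congrArg (fun B => B v) (h6.fderivWithin (hU x hx))
    rw [h7]
    rfl
  have hsym : ∀ v w, fderivWithin ℝ (fderivWithin ℝ Θ S) S x v w =
      fderivWithin ℝ (fderivWithin ℝ Θ S) S x w v := by
    have : IsSymmSndFDerivWithinAt ℝ Θ S x :=
      (hΘ.contDiffWithinAt hx).isSymmSndFDerivWithinAt (by
        rw [minSmoothness_of_isRCLikeNormedField]; exact two_le_smooth) hU
        (hS.subset_closure hx) hx
    exact fun v w => this.eq v w
  rw [dform_one hγs hx hU, dform_one hβ hΘx hT, pull_sum]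
  -- the second order terms cancel
  have hcov : ∀ η : V →ₗ[ℝ] EqRing m, one η = ∑ c, η (e c) • covector m (e.coord c) := by
    intro η
    have : η = ∑ c, η (e c) • ((Algebra.linearMap ℝ (EqRing m)) ∘ₗ e.coord c) := by
      refine e.ext fun c => ?_
      simp [Finsupp.single_apply, LinearMap.sum_apply]
    refine (congrArg one this).trans ((map_sum (ExteriorAlgebra.ι (EqRing m)) _ _).trans ?_)
    refine Finset.sum_congr rfl fun c _ => ?_
    exact map_smul (ExteriorAlgebra.ι (EqRing m)) _ _
  have hzero : ∑ b, covector m (e.coord b) * one (β (Θ x) ∘ₗ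
      (fderivWithin ℝ (fderivWithin ℝ Θ S) S x (e b)).toLinearMap) = 0 := by
    have := antisymm_sum (m := m) (fun b => e.coord b) (fun a b =>
      algebraMap (EqRing m) (EForm m V) (β (Θ x) (fderivWithin ℝ (fderivWithin ℝ Θ S) S x (e a) (e b))))
      (fun a b => by rw [hsym])
    rw [← this]
    refine Finset.sum_congr rfl fun b _ => ?_
    congr 1
    rw [hcov]
    refine Finset.sum_congr rfl fun c _ => ?_
    rw [← Algebra.commutes, ← Algebra.smul_def]
    rfl
  have hfirst : ∑ b, covector m (e.coord b) * one (vderiv β T (Θ x) (A (e b)) ∘ₗ A) =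
      ∑ c, pull A (covector m (e'.coord c) * one (vderiv β T (Θ x) (e' c))) := by
    have h1 : ∀ b, vderiv β T (Θ x) (A (e b)) =
        ∑ c, e'.coord c (A (e b)) • vderiv β T (Θ x) (e' c) := by
      intro b
      have h := congrArg (vderivLin β hβ hΘx hT) (e'.sum_repr (A (e b)))
      rw [map_sum] at h
      simp only [map_smul] at h
      exact h.symm
    have h2 : ∀ c, pull A (covector m (e'.coord c)) =
        ∑ b, e'.coord c (A (e b)) • covector m (e.coord b) := by
      intro c
      rw [pull_covector]
      have : e'.coord c ∘ₗ A = ∑ b, e'.coord c (A (e b)) • e.coord b := by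
        exact (e.sum_dual_apply_smul_coord (e'.coord c ∘ₗ A)).symm
      conv_lhs => rw [this]
      rw [← covectorLin_apply, map_sum]
      simp only [map_smul, covectorLin_apply]
    have h3 : ∀ b, one (vderiv β T (Θ x) (A (e b)) ∘ₗ A) =
        ∑ c, e'.coord c (A (e b)) • pull A (one (vderiv β T (Θ x) (e' c))) := by
      intro b
      rw [← pull_one, h1, ← oneLin_apply, map_sum, pull_sum]
      refine Finset.sum_congr rfl fun c _ => ?_
      rw [map_smul, pull_real_smul, oneLin_apply]
    simp only [h3, Finset.mul_sum, mul_smul_comm, pull_mul, h2, Finset.sum_mul, smul_mul_assoc]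
    exact Finset.sum_comm
  have hsum : ∑ b, covector m (e.coord b) * one (vderiv γ S x (e b)) =
      ∑ b, covector m (e.coord b) * one (vderiv β T (Θ x) (A (e b)) ∘ₗ A) +
      ∑ b, covector m (e.coord b) * one (β (Θ x) ∘ₗ
        (fderivWithin ℝ (fderivWithin ℝ Θ S) S x (e b)).toLinearMap) := by
    rw [← Finset.sum_add_distrib]
    refine Finset.sum_congr rfl fun b _ => ?_
    rw [hγv, ← mul_add, ← oneLin_apply, map_add]
    rfl
  rw [hsum, hzero, add_zero, hfirst]

end EForm

end

section

/-! ## Integrals depending on a parameter -/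

/-- Sets all of whose points have convex relative neighbourhoods. -/
def LocallyConvexSet {V : Type*} [NormedAddCommGroup V] [NormedSpace ℝ V] (S : Set V) : Prop :=
  ∀ x ∈ S, ∃ U, IsOpen U ∧ x ∈ U ∧ Convex ℝ (U ∩ S)

section parametric

variable {V W E : Type} [NormedAddCommGroup V] [NormedSpace ℝ V] [NormedAddCommGroup W]
  [NormedSpace ℝ W] [MeasurableSpace W] [BorelSpace W]
  [NormedAddCommGroup E] [NormedSpace ℝ E] [CompleteSpace E]
  {S : Set V} {K : Set W} {μ : Measure W} [IsFiniteMeasureOnCompacts μ]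

/-- The partial derivative in the parameter. -/
noncomputable def paramDeriv (F : V × W → E) (S : Set V) (p : V × W) : V →L[ℝ] E :=
  (fderivWithin ℝ F (S ×ˢ Set.univ) p).comp (ContinuousLinearMap.inl ℝ V W)

theorem uniqueDiffOn_param (hS : UniqueDiffOn ℝ S) :
    UniqueDiffOn ℝ (S ×ˢ (Set.univ : Set W)) := hS.prod uniqueDiffOn_univ

theorem contDiffOn_paramDeriv (hS : UniqueDiffOn ℝ S) {F : V × W → E}
    (hF : ContDiffOn ℝ ∞ F (S ×ˢ Set.univ)) :
    ContDiffOn ℝ ∞ (paramDeriv F S) (S ×ˢ (Set.univ : Set W)) :=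
  (hF.fderivWithin (uniqueDiffOn_param hS) (m := ∞) (by simp)).clm_comp contDiffOn_const

theorem integrableOn_slice {F : V × W → E} (hF : ContinuousOn F (S ×ˢ Set.univ)) (hK : IsCompact K)
    {x : V} (hx : x ∈ S) : IntegrableOn (fun w => F (x, w)) K μ := by
  refine ContinuousOn.integrableOn_compact hK ?_
  exact hF.comp (f := fun w : W => (x, w)) (by fun_prop) fun w _ => Set.mk_mem_prod hx trivial

theorem hasFDerivWithinAt_integral (hS : UniqueDiffOn ℝ S) (hconv : LocallyConvexSet S)
    (hK : IsCompact K) {F : V × W → E} (hF : ContDiffOn ℝ ∞ F (S ×ˢ Set.univ)) {x : V}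
    (hx : x ∈ S) : HasFDerivWithinAt (fun y => ∫ w in K, F (y, w) ∂μ)
      (∫ w in K, paramDeriv F S (x, w) ∂μ) S x := by
  have hG := (contDiffOn_paramDeriv hS hF).continuousOn
  have hder : ∀ y ∈ S, ∀ w, HasFDerivWithinAt (fun y => F (y, w)) (paramDeriv F S (y, w)) S y := by
    intro y hy w
    have h1 : HasFDerivWithinAt F (fderivWithin ℝ F (S ×ˢ Set.univ) (y, w)) (S ×ˢ Set.univ)
        (y, w) := ((hF (y, w) ⟨hy, trivial⟩).differentiableWithinAt (by simp)).hasFDerivWithinAt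
    have h2 : HasFDerivWithinAt (fun y : V => (y, w)) (ContinuousLinearMap.inl ℝ V W) S y :=
      (hasFDerivAt_prodMk_left y w).hasFDerivWithinAt
    exact h1.comp y h2 fun z (hz : z ∈ S) => Set.mk_mem_prod hz (Set.mem_univ w)
  obtain ⟨U, hU, hxU, hUc⟩ := hconv x hx
  rw [hasFDerivWithinAt_iff_isLittleO, Asymptotics.isLittleO_iff]
  intro c hc
  set M := μ.real K with hM
  have hM0 : 0 ≤ M := measureReal_nonneg
  set ε := c / (M + 1)
  have hε : 0 < ε := by positivity
  have hεM : ε * M ≤ c := by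
    rw [div_mul_eq_mul_div, div_le_iff₀ (by positivity)]; nlinarith
  have htube : ∀ᶠ y in 𝓝 x, ∀ w ∈ K, y ∈ S →
      ‖paramDeriv F S (y, w) - paramDeriv F S (x, w)‖ ≤ ε := by
    refine hK.eventually_forall_of_forall_eventually
      (P := fun y w => y ∈ S → ‖paramDeriv F S (y, w) - paramDeriv F S (x, w)‖ ≤ ε) fun w _ => ?_
    have h1 := (hG (x, w) ⟨hx, trivial⟩)
    have h2 : ∀ᶠ z in 𝓝 (x, w), z ∈ S ×ˢ (Set.univ : Set W) →
        dist (paramDeriv F S z) (paramDeriv F S (x, w)) < ε / 2 := by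
      rw [← eventually_nhdsWithin_iff]
      exact h1 (Metric.ball_mem_nhds _ (half_pos hε))
    have h3 : Tendsto (fun z : V × W => (x, z.2)) (𝓝 (x, w)) (𝓝 (x, w)) :=
      (Continuous.tendsto' (by fun_prop) _ _ rfl)
    filter_upwards [h2, h3.eventually h2] with z hz hz' hzS
    have a1 := hz ⟨hzS, trivial⟩
    have a2 := hz' ⟨hx, trivial⟩
    rw [← dist_eq_norm]
    refine (dist_triangle_right _ _ (paramDeriv F S (x, w))).trans ?_
    linarith
  obtain ⟨δ, hδ, hball⟩ := Metric.mem_nhds_iff.mp (htube.and (hU.mem_nhds hxU))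
  have hC : Convex ℝ (Metric.ball x δ ∩ (U ∩ S)) := (convex_ball x δ).inter hUc
  filter_upwards [inter_mem_nhdsWithin S (Metric.ball_mem_nhds x hδ)] with y hy
  have hyC : y ∈ Metric.ball x δ ∩ (U ∩ S) := ⟨hy.2, (hball hy.2).2, hy.1⟩
  have hxC : x ∈ Metric.ball x δ ∩ (U ∩ S) := ⟨Metric.mem_ball_self hδ, hxU, hx⟩
  have hest : ∀ w ∈ K, ‖F (y, w) - F (x, w) - paramDeriv F S (x, w) (y - x)‖ ≤ ε * ‖y - x‖ := by
    intro w hw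
    refine hC.norm_image_sub_le_of_norm_hasFDerivWithin_le' (f := fun y => F (y, w))
      (f' := fun y => paramDeriv F S (y, w)) (fun z hz => ?_) (fun z hz => ?_) hxC hyC
    · exact (hder z hz.2.2 w).mono fun a ha => ha.2.2
    · exact (hball hz.1).1 w hw hz.2.2
  have i1 := integrableOn_slice (μ := μ) hF.continuousOn hK hy.1
  have i2 := integrableOn_slice (μ := μ) hF.continuousOn hK hx
  have i3 := integrableOn_slice (μ := μ) hG hK hx
  have e1 : (∫ w in K, paramDeriv F S (x, w) ∂μ) (y - x) =
      ∫ w in K, paramDeriv F S (x, w) (y - x) ∂μ := ContinuousLinearMap.integral_apply i3 _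
  have i4 : IntegrableOn (fun w => paramDeriv F S (x, w) (y - x)) K μ :=
    i3.apply_continuousLinearMap _
  have i5 : IntegrableOn (fun w => F (y, w) - F (x, w)) K μ := i1.sub i2
  rw [e1, ← integral_sub i1 i2, ← integral_sub i5 i4]
  refine (norm_setIntegral_le_of_norm_le_const hK.measure_lt_top hest).trans ?_
  rw [← hM, mul_right_comm]
  exact mul_le_mul_of_nonneg_right hεM (norm_nonneg _)

theorem fderivWithin_integral (hS : UniqueDiffOn ℝ S) (hconv : LocallyConvexSet S)
    (hK : IsCompact K) {F : V × W → E} (hF : ContDiffOn ℝ ∞ F (S ×ˢ Set.univ)) {x : V}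
    (hx : x ∈ S) : fderivWithin ℝ (fun y => ∫ w in K, F (y, w) ∂μ) S x =
      ∫ w in K, paramDeriv F S (x, w) ∂μ :=
  (hasFDerivWithinAt_integral hS hconv hK hF hx).fderivWithin (hS x hx)

theorem contDiffOn_integral_nat (hS : UniqueDiffOn ℝ S) (hconv : LocallyConvexSet S)
    (hK : IsCompact K) (n : ℕ) : ∀ {E : Type} [NormedAddCommGroup E] [NormedSpace ℝ E]
    [CompleteSpace E] {F : V × W → E}, ContDiffOn ℝ ∞ F (S ×ˢ Set.univ) →
    ContDiffOn ℝ n (fun y => ∫ w in K, F (y, w) ∂μ) S := by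
  induction n with
  | zero =>
    intro E _ _ _ F hF
    rw [Nat.cast_zero, contDiffOn_zero]
    exact fun x hx => (hasFDerivWithinAt_integral hS hconv hK hF hx).continuousWithinAt
  | succ n ih =>
    intro E _ _ _ F hF
    rw [Nat.cast_succ, contDiffOn_succ_iff_fderivWithin hS]
    refine ⟨fun x hx => (hasFDerivWithinAt_integral hS hconv hK hF hx).differentiableWithinAt,
      fun h => absurd h (by exact_mod_cast WithTop.coe_ne_top), ?_⟩
    exact (ih (contDiffOn_paramDeriv hS hF)).congr fun x hx =>
      fderivWithin_integral hS hconv hK hF hx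

theorem contDiffOn_integral (hS : UniqueDiffOn ℝ S) (hconv : LocallyConvexSet S)
    (hK : IsCompact K) {F : V × W → E} (hF : ContDiffOn ℝ ∞ F (S ×ˢ Set.univ)) :
    ContDiffOn ℝ ∞ (fun y => ∫ w in K, F (y, w) ∂μ) S :=
  contDiffOn_infty.mpr fun n => contDiffOn_integral_nat hS hconv hK n hF

end parametric

/-! ## Integrals of functions with values in a vector space -/

section vintegral

variable {α M N : Type*} [MeasurableSpace α] {μ : Measure α} [AddCommGroup M] [Module ℝ M]
  [AddCommGroup N] [Module ℝ N]

theorem HasVIntegral.eq {F : α → M} {y : M} (h : HasVIntegral μ F y) : vintegral μ F = y := by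
  have hex : ∃ y : M, HasVIntegral μ F y := ⟨y, h⟩
  rw [vintegral, dif_pos hex]
  exact ext_functional fun L => by rw [← (hex.choose_spec L).2, (h L).2]

theorem HasVIntegral.unique {F : α → M} {y z : M} (h : HasVIntegral μ F y)
    (h' : HasVIntegral μ F z) : y = z := h.eq.symm.trans h'.eq

theorem HasVIntegral.map {F : α → M} {y : M} (h : HasVIntegral μ F y) (A : M →ₗ[ℝ] N) :
    HasVIntegral μ (fun a => A (F a)) (A y) := fun L => h (L ∘ₗ A)

theorem HasVIntegral.add {F G : α → M} {y z : M} (h : HasVIntegral μ F y)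
    (h' : HasVIntegral μ G z) : HasVIntegral μ (fun a => F a + G a) (y + z) := fun L => by
  simp only [map_add]
  exact ⟨(h L).1.add (h' L).1, by rw [integral_add (h L).1 (h' L).1, (h L).2, (h' L).2]⟩

theorem HasVIntegral.zero : HasVIntegral μ (fun _ : α => (0 : M)) 0 := fun L => by simp

theorem HasVIntegral.sum {κ : Type*} (s : Finset κ) {F : κ → α → M} {y : κ → M}
    (h : ∀ k ∈ s, HasVIntegral μ (F k) (y k)) :
    HasVIntegral μ (fun a => ∑ k ∈ s, F k a) (∑ k ∈ s, y k) := fun L => by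
  simp only [map_sum]
  refine ⟨integrable_finsetSum _ fun k hk => (h k hk L).1, ?_⟩
  rw [integral_finsetSum _ fun k hk => (h k hk L).1]
  exact Finset.sum_congr rfl fun k hk => (h k hk L).2

theorem HasVIntegral.congr {F G : α → M} {y : M} (h : HasVIntegral μ F y) (hFG : G =ᵐ[μ] F) :
    HasVIntegral μ G y := fun L => by
  have : (fun a => L (G a)) =ᵐ[μ] fun a => L (F a) := hFG.mono fun a ha => by simp only [ha]
  exact ⟨(h L).1.congr this.symm, by rw [integral_congr_ae this, (h L).2]⟩

theorem HasVIntegral.smul_const {f : α → ℝ} (hf : Integrable f μ) (c : M) :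
    HasVIntegral μ (fun a => f a • c) ((∫ a, f a ∂μ) • c) := fun L => by
  simp only [map_smul, smul_eq_mul]
  exact ⟨hf.mul_const _, integral_mul_const _ _⟩

theorem HasVIntegral.of_sum {κ : Type*} [Fintype κ] {f : κ → α → ℝ} (hf : ∀ k, Integrable (f k) μ)
    (c : κ → M) : HasVIntegral μ (fun a => ∑ k, f k a • c k) (∑ k, (∫ a, f k a ∂μ) • c k) :=
  HasVIntegral.sum _ fun k _ => HasVIntegral.smul_const (hf k) (c k)

theorem HasVIntegral.vintegral {F : α → M} (h : ∃ y, HasVIntegral μ F y) :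
    HasVIntegral μ F (vintegral μ F) := by
  obtain ⟨y, hy⟩ := h; rwa [hy.eq]

/-- Coordinates on a finite dimensional subspace extend to the whole space. -/
theorem Submodule.exists_coordinates (P : Submodule ℝ M) [FiniteDimensional ℝ P] :
    ∃ (n : ℕ) (c : Fin n → M) (L : Fin n → M →ₗ[ℝ] ℝ), ∀ y ∈ P, y = ∑ k, L k y • c k := by
  obtain ⟨g, hg⟩ := P.subtype.exists_leftInverse_of_injective P.ker_subtype
  let b := Module.finBasis ℝ P
  refine ⟨_, fun k => (b k : M), fun k => b.coord k ∘ₗ g, fun y hy => ?_⟩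
  have h1 : g y = ⟨y, hy⟩ := congrArg (fun A => A ⟨y, hy⟩) hg
  have h2 := congrArg P.subtype (b.sum_repr ⟨y, hy⟩)
  rw [map_sum] at h2
  simp only [LinearMap.comp_apply, h1, Module.Basis.coord_apply]
  exact h2.symm

end vintegral

/-! ## Integration along the fibres of a product -/

section pushforward

variable {V : Type} [NormedAddCommGroup V] [NormedSpace ℝ V] {M N : Type*} [AddCommGroup M]
  [Module ℝ M] [AddCommGroup N] [Module ℝ N] {S : Set V} {r : ℕ} {F : V × Fib r → M}

/-- The part of `V × Fib r` above `S`. -/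
abbrev tube (S : Set V) (r : ℕ) : Set (V × Fib r) := {p | p.1 ∈ S}

theorem over_eq (S : Set V) (r : ℕ) : tube S r = S ×ˢ Set.univ := by ext p; simp

theorem uniqueDiffOn_over (hS : UniqueDiffOn ℝ S) : UniqueDiffOn ℝ (tube S r) := by
  rw [over_eq]; exact uniqueDiffOn_param hS

theorem GoodSet.tube (hS : GoodSet S) : GoodSet (tube S r) where
  uniqueDiffOn := uniqueDiffOn_over hS.uniqueDiffOn
  subset_closure := by
    rw [over_eq, interior_prod_eq, interior_univ, closure_prod_eq, closure_univ]
    exact Set.prod_mono_left hS.subset_closure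

/-- Smooth functions on `S × Fib r` whose support is, locally in `S`, bounded. -/
structure FibreCompact (F : V × Fib r → M) (S : Set V) : Prop where
  smooth : ∀ p ∈ tube S r, SmoothNear F (tube S r) p
  support : ∀ x ∈ S, ∃ U, IsOpen U ∧ x ∈ U ∧ ∃ R : ℝ, ∀ y ∈ U ∩ S, ∀ v, R < ‖v‖ → F (y, v) = 0

theorem FibreCompact.lin (h : FibreCompact F S) (A : M →ₗ[ℝ] N) :
    FibreCompact (fun p => A (F p)) S where
  smooth p hp := (h.smooth p hp).lin A
  support x hx := by
    obtain ⟨U, hU, hxU, R, hR⟩ := h.support x hx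
    exact ⟨U, hU, hxU, R, fun y hy v hv => by rw [hR y hy v hv, map_zero]⟩

theorem exists_coordinates_of_compact (h : ∀ p ∈ tube S r, SmoothNear F (tube S r) p)
    {x : V} (hx : x ∈ S) {K : Set (Fib r)} (hK : IsCompact K) :
    ∃ U, IsOpen U ∧ x ∈ U ∧ ∃ (n : ℕ) (c : Fin n → M) (L : Fin n → M →ₗ[ℝ] ℝ),
      ∀ y ∈ U ∩ S, ∀ v ∈ K, F (y, v) = ∑ k, L k (F (y, v)) • c k := by
  have key : ∃ U, IsOpen U ∧ x ∈ U ∧ ∃ P : Submodule ℝ M, FiniteDimensional ℝ P ∧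
      ∀ y ∈ U ∩ S, ∀ v ∈ K, F (y, v) ∈ P := by
    refine hK.induction_on (p := fun K => ∃ U, IsOpen U ∧ x ∈ U ∧ ∃ P : Submodule ℝ M,
      FiniteDimensional ℝ P ∧ ∀ y ∈ U ∩ S, ∀ v ∈ K, F (y, v) ∈ P) ?_ ?_ ?_ ?_
    · exact ⟨Set.univ, isOpen_univ, trivial, ⊥, inferInstance, fun y _ v hv => hv.elim⟩
    · rintro s t hst ⟨U, hU, hxU, P, hP, h⟩
      exact ⟨U, hU, hxU, P, hP, fun y hy v hv => h y hy v (hst hv)⟩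
    · rintro s t ⟨U, hU, hxU, P, hP, h⟩ ⟨U', hU', hxU', P', hP', h'⟩
      refine ⟨U ∩ U', hU.inter hU', ⟨hxU, hxU'⟩, P ⊔ P', inferInstance, fun y hy v hv => ?_⟩
      rcases hv with hv | hv
      · exact Submodule.mem_sup_left (h y ⟨hy.1.1, hy.2⟩ v hv)
      · exact Submodule.mem_sup_right (h' y ⟨hy.1.2, hy.2⟩ v hv)
    · intro v _
      obtain ⟨O, hO, hxO, n, c, f, -, hF⟩ := h (x, v) hx
      obtain ⟨U, O', hU, hO', hxU, hvO, hsub⟩ := isOpen_prod_iff.mp hO x v hxO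
      refine ⟨O', mem_nhdsWithin_of_mem_nhds (hO'.mem_nhds hvO), U, hU, hxU,
        Submodule.span ℝ (Set.range c), FiniteDimensional.span_of_finite ℝ (Set.finite_range c),
        fun y hy w hw => ?_⟩
      rw [hF (y, w) ⟨hsub ⟨hy.1, hw⟩, hy.2⟩]
      exact Submodule.sum_mem _ fun k _ => Submodule.smul_mem _ _ (Submodule.subset_span ⟨k, rfl⟩)
  obtain ⟨U, hU, hxU, P, hP, h⟩ := key
  obtain ⟨n, c, L, hL⟩ := Submodule.exists_coordinates P
  exact ⟨U, hU, hxU, n, c, L, fun y hy v hv => hL _ (h y hy v hv)⟩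

/-- Fibrewise compactly supported functions are locally given by finitely many real functions. -/
theorem FibreCompact.coordinates (h : FibreCompact F S) {x : V} (hx : x ∈ S) :
    ∃ U, IsOpen U ∧ x ∈ U ∧ ∃ R : ℝ, ∃ (n : ℕ) (c : Fin n → M) (L : Fin n → M →ₗ[ℝ] ℝ),
      (∀ y ∈ U ∩ S, ∀ v, F (y, v) = ∑ k, L k (F (y, v)) • c k) ∧
      ∀ y ∈ U ∩ S, ∀ v, R < ‖v‖ → F (y, v) = 0 := by
  obtain ⟨U, hU, hxU, R, hR⟩ := h.support x hx
  obtain ⟨U', hU', hxU', n, c, L, hL⟩ := exists_coordinates_of_compact h.smooth hx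
    (isCompact_closedBall (0 : Fib r) R)
  refine ⟨U ∩ U', hU.inter hU', ⟨hxU, hxU'⟩, R, n, c, L, fun y hy v => ?_, fun y hy v hv =>
    hR y ⟨hy.1.1, hy.2⟩ v hv⟩
  by_cases hv : R < ‖v‖
  · simp [hR y ⟨hy.1.1, hy.2⟩ v hv]
  · exact hL y ⟨hy.1.2, hy.2⟩ v (by simpa using hv)

theorem slice_contDiff {f : V × Fib r → ℝ} (hf : ContDiffOn ℝ ∞ f (tube S r)) {x : V} (hx : x ∈ S) :
    ContDiff ℝ ∞ fun v => f (x, v) := by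
  rw [← contDiffOn_univ]
  exact hf.comp (t := tube S r) (contDiff_prodMk_right x).contDiffOn fun v _ => hx

theorem slice_hasFDerivAt {f : V × Fib r → ℝ} (hf : ContDiffOn ℝ ∞ f (tube S r)) {x : V}
    (hx : x ∈ S) (v : Fib r) : HasFDerivAt (fun v => f (x, v))
      ((fderivWithin ℝ f (tube S r) (x, v)).comp (ContinuousLinearMap.inr ℝ V (Fib r))) v := by
  rw [← hasFDerivWithinAt_univ]
  have h1 : HasFDerivWithinAt f (fderivWithin ℝ f (tube S r) (x, v)) (tube S r) (x, v) :=
    ((hf (x, v) hx).differentiableWithinAt (by simp)).hasFDerivWithinAt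
  exact h1.comp v (hasFDerivAt_prodMk_right x v).hasFDerivWithinAt fun w _ => hx

theorem integrable_of_bounded_support {f : Fib r → ℝ} (hf : Continuous f) {R : ℝ}
    (h : ∀ v, R < ‖v‖ → f v = 0) : Integrable f volume := by
  refine hf.integrable_of_hasCompactSupport ?_
  exact HasCompactSupport.intro (isCompact_closedBall (0 : Fib r) R) fun v hv => h v (by simpa using hv)

theorem setIntegral_of_bounded_support {f : Fib r → ℝ} {R : ℝ}
    (h : ∀ v, R < ‖v‖ → f v = 0) : ∫ v in Metric.closedBall (0 : Fib r) R, f v = ∫ v, f v :=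
  setIntegral_eq_integral_of_forall_compl_eq_zero fun v hv => h v (by simpa using hv)

theorem integral_fderiv_eq_zero {g : Fib r → ℝ} (hg : ContDiff ℝ ∞ g) {R : ℝ}
    (h : ∀ v, R < ‖v‖ → g v = 0) (w : Fib r) :
    Integrable (fun v => fderiv ℝ g v w) ∧ ∫ v, fderiv ℝ g v w = 0 := by
  have h0 : ∀ v, R < ‖v‖ → fderiv ℝ g v w = 0 := by
    intro v hv
    have : g =ᶠ[𝓝 v] fun _ => 0 := by
      filter_upwards [(isOpen_lt continuous_const continuous_norm).mem_nhds hv] with u hu using h u hu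
    rw [this.fderiv_eq]; simp
  have hc : Continuous fun v => fderiv ℝ g v w :=
    (hg.continuous_fderiv (by simp)).clm_apply continuous_const
  have hi := integrable_of_bounded_support hc h0
  refine ⟨hi, ?_⟩
  have := integral_bilinear_hasLineDerivAt_right_eq_neg_left_of_integrable (μ := volume)
    (f := fun _ : Fib r => (1 : ℝ)) (f' := fun _ => 0) (g := g) (g' := fun v => fderiv ℝ g v w)
    (v := w) (B := ContinuousLinearMap.mul ℝ ℝ) (by simp) (by simpa using hi)
    (by simpa using integrable_of_bounded_support hg.continuous h)
    (fun x _ => ((hasFDerivAt_const (1 : ℝ) x).hasLineDerivAt w))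
    (fun x _ => ((hg.differentiable (by simp)) x).hasFDerivAt.hasLineDerivAt w)
  simpa using this

/-- The integral of `F` along the fibres. -/
noncomputable def push (F : V × Fib r → M) (x : V) : M := vintegral volume fun v => F (x, v)

theorem FibreCompact.functional (h : FibreCompact F S) (L : M →ₗ[ℝ] ℝ) :
    ContDiffOn ℝ ∞ (fun p => L (F p)) (tube S r) :=
  CNear.contDiffOn fun p hp => (h.smooth p hp).functional L

theorem FibreCompact.hasVIntegral_push (h : FibreCompact F S) {x : V} (hx : x ∈ S) :
    HasVIntegral volume (fun v => F (x, v)) (push F x) := by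
  obtain ⟨U, hU, hxU, R, n, c, L, hF, hR⟩ := h.coordinates hx
  refine HasVIntegral.vintegral ⟨_, (HasVIntegral.of_sum (f := fun k v => L k (F (x, v)))
    (fun k => ?_) c).congr (Eventually.of_forall fun v => hF x ⟨hxU, hx⟩ v)⟩
  refine integrable_of_bounded_support (R := R)
    (slice_contDiff (h.functional (L k)) hx).continuous fun v hv => ?_
  rw [hR x ⟨hxU, hx⟩ v hv, map_zero]

theorem FibreCompact.push_eq (h : FibreCompact F S) {x : V} (hx : x ∈ S) {U : Set V} {n : ℕ}
    {c : Fin n → M} {L : Fin n → M →ₗ[ℝ] ℝ} {R : ℝ}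
    (hF : ∀ y ∈ U ∩ S, ∀ v, F (y, v) = ∑ k, L k (F (y, v)) • c k)
    (hR : ∀ y ∈ U ∩ S, ∀ v, R < ‖v‖ → F (y, v) = 0) (hxU : x ∈ U) :
    push F x = ∑ k, (∫ v in Metric.closedBall (0 : Fib r) R, L k (F (x, v))) • c k := by
  have h0 : ∀ k v, R < ‖v‖ → L k (F (x, v)) = 0 := fun k v hv => by
    rw [hR x ⟨hxU, hx⟩ v hv, map_zero]
  refine (HasVIntegral.congr (F := fun v => ∑ k, L k (F (x, v)) • c k) ?_
    (Eventually.of_forall fun v => hF x ⟨hxU, hx⟩ v)).eq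
  simp only [setIntegral_of_bounded_support (h0 _)]
  exact HasVIntegral.of_sum (f := fun k v => L k (F (x, v)))
    (fun k => integrable_of_bounded_support
      (slice_contDiff (h.functional (L k)) hx).continuous (h0 k)) c

theorem FibreCompact.contDiffOn_integral (h : FibreCompact F S) (hS : UniqueDiffOn ℝ S)
    (hconv : LocallyConvexSet S) (L : M →ₗ[ℝ] ℝ) (R : ℝ) :
    ContDiffOn ℝ ∞ (fun y => ∫ v in Metric.closedBall (0 : Fib r) R, L (F (y, v))) S := by
  have := h.functional L
  rw [over_eq] at this
  exact _root_.contDiffOn_integral hS hconv (isCompact_closedBall _ _) this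

theorem FibreCompact.smoothNear_push (h : FibreCompact F S) (hS : UniqueDiffOn ℝ S)
    (hconv : LocallyConvexSet S) {x : V} (hx : x ∈ S) : SmoothNear (push F) S x := by
  obtain ⟨U, hU, hxU, R, n, c, L, hF, hR⟩ := h.coordinates hx
  exact ⟨U, hU, hxU, n, c, fun k y => ∫ v in Metric.closedBall (0 : Fib r) R, L k (F (y, v)),
    fun k => (h.contDiffOn_integral hS hconv (L k) R).mono Set.inter_subset_right,
    fun y hy => h.push_eq hy.2 hF hR hy.1⟩

theorem FibreCompact.vderiv_eq (h : FibreCompact F S) (hS : UniqueDiffOn ℝ S) {x : V} (hx : x ∈ S)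
    {U : Set V} (hU : IsOpen U) {n : ℕ} {c : Fin n → M} {L : Fin n → M →ₗ[ℝ] ℝ}
    (hF : ∀ y ∈ U ∩ S, ∀ v, F (y, v) = ∑ k, L k (F (y, v)) • c k) (hxU : x ∈ U) (v : Fib r)
    (u : V × Fib r) : vderiv F (tube S r) (x, v) u =
      ∑ k, fderivWithin ℝ (fun p => L k (F p)) (tube S r) (x, v) u • c k :=
  vderiv_of_sum (U := U ×ˢ Set.univ) (hU.prod isOpen_univ) ⟨hxU, trivial⟩ hx
    (uniqueDiffOn_over hS _ hx) c _ (fun k => (h.functional (L k)).mono Set.inter_subset_right)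
    (fun p hp => hF p.1 ⟨hp.1.1, hp.2⟩ p.2) u

/-- Differentiation under the integral sign. -/
theorem FibreCompact.vderiv_push (h : FibreCompact F S) (hS : UniqueDiffOn ℝ S)
    (hconv : LocallyConvexSet S) {x : V} (hx : x ∈ S) (u : V) :
    HasVIntegral volume (fun v => vderiv F (tube S r) (x, v) (u, 0)) (vderiv (push F) S x u) := by
  obtain ⟨U, hU, hxU, R, n, c, L, hF, hR⟩ := h.coordinates hx
  have h1 : vderiv (push F) S x u = ∑ k, (∫ v, fderivWithin ℝ (fun p => L k (F p)) (tube S r)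
      (x, v) (u, 0)) • c k := by
    rw [vderiv_of_sum hU hxU hx (hS x hx) c
      (fun k y => ∫ v in Metric.closedBall (0 : Fib r) R, L k (F (y, v)))
      (fun k => (h.contDiffOn_integral hS hconv (L k) R).mono Set.inter_subset_right)
      (fun y hy => h.push_eq hy.2 hF hR hy.1) u]
    refine Finset.sum_congr rfl fun k _ => ?_
    congr 1
    have hk := h.functional (L k)
    rw [over_eq] at hk
    rw [fderivWithin_integral hS hconv (isCompact_closedBall _ _) hk hx,
      ContinuousLinearMap.integral_apply (integrableOn_slice
        (contDiffOn_paramDeriv hS hk).continuousOn (isCompact_closedBall _ _) hx),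
      ← setIntegral_of_bounded_support (R := R)]
    · rw [over_eq]; rfl
    · intro v hv
      have : (fun p => L k (F p)) =ᶠ[𝓝[tube S r] (x, v)] fun _ => 0 := by
        have ho : IsOpen (U ×ˢ {v : Fib r | R < ‖v‖}) :=
          hU.prod (isOpen_lt continuous_const continuous_norm)
        filter_upwards [inter_mem_nhdsWithin (tube S r) (ho.mem_nhds ⟨hxU, hv⟩)] with p hp
        rw [show p = (p.1, p.2) from rfl, hR p.1 ⟨hp.2.1, hp.1⟩ p.2 hp.2.2, map_zero]
      rw [this.fderivWithin_eq (this.self_of_nhdsWithin hx)]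
      simp
  rw [h1]
  refine (HasVIntegral.of_sum (f := fun k v => fderivWithin ℝ (fun p => L k (F p)) (tube S r)
    (x, v) (u, 0)) (fun k => ?_) c).congr
    (Eventually.of_forall fun v => h.vderiv_eq hS hx hU hF hxU v (u, 0))
  have hk := (h.functional (L k)).fderivWithin (uniqueDiffOn_over hS) (m := ∞) (by simp)
  refine integrable_of_bounded_support (R := R) ?_ ?_
  · rw [← continuousOn_univ]
    exact (hk.continuousOn.clm_apply continuousOn_const).comp
      (f := fun v => (x, v)) (by fun_prop) fun v _ => hx
  · intro v hv
    have : (fun p => L k (F p)) =ᶠ[𝓝[tube S r] (x, v)] fun _ => 0 := by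
      have ho : IsOpen (U ×ˢ {v : Fib r | R < ‖v‖}) :=
        hU.prod (isOpen_lt continuous_const continuous_norm)
      filter_upwards [inter_mem_nhdsWithin (tube S r) (ho.mem_nhds ⟨hxU, hv⟩)] with p hp
      rw [show p = (p.1, p.2) from rfl, hR p.1 ⟨hp.2.1, hp.1⟩ p.2 hp.2.2, map_zero]
    rw [this.fderivWithin_eq (this.self_of_nhdsWithin hx)]
    simp

/-- Integrals of derivatives along the fibres vanish. -/
theorem FibreCompact.integral_vertical (h : FibreCompact F S) (hS : UniqueDiffOn ℝ S) {x : V}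
    (hx : x ∈ S) (w : Fib r) :
    HasVIntegral volume (fun v => vderiv F (tube S r) (x, v) (0, w)) 0 := by
  obtain ⟨U, hU, hxU, R, n, c, L, hF, hR⟩ := h.coordinates hx
  have key : ∀ k, Integrable (fun v => fderivWithin ℝ (fun p => L k (F p)) (tube S r)
      (x, v) (0, w)) ∧ ∫ v, fderivWithin ℝ (fun p => L k (F p)) (tube S r) (x, v) (0, w) = 0 := by
    intro k
    have hk := h.functional (L k)
    have h2 := integral_fderiv_eq_zero (slice_contDiff hk hx) (R := R)
      (fun v hv => by rw [hR x ⟨hxU, hx⟩ v hv, map_zero]) w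
    simp only [(slice_hasFDerivAt hk hx _).fderiv] at h2
    exact h2
  have := (HasVIntegral.of_sum (f := fun k v => fderivWithin ℝ (fun p => L k (F p)) (tube S r)
    (x, v) (0, w)) (fun k => (key k).1) c).congr
    (Eventually.of_forall fun v => h.vderiv_eq hS hx hU hF hxU v (0, w))
  simpa [(key _).2] using this

end pushforward

namespace EForm

variable {m : ℕ} {V : Type} [NormedAddCommGroup V] [NormedSpace ℝ V] [FiniteDimensional ℝ V]
  {S : Set V} {r : ℕ}

/-- The integral tube the fibre of a form. -/
noncomputable def fpush (ψ : V × Fib r → EForm m (V × Fib r)) (x : V) : EForm m V :=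
  vintegral volume fun v => TBundle.fibreTop (ψ (x, v))

theorem fpush_eq (ψ : V × Fib r → EForm m (V × Fib r)) :
    fpush ψ = push fun p => fibreTopLin m V r (ψ p) := by
  funext x
  simp only [fpush, push, fibreTopLin_apply]

theorem hasVIntegral_fpush {ψ : V × Fib r → EForm m (V × Fib r)} (h : FibreCompact ψ S) {x : V}
    (hx : x ∈ S) : HasVIntegral volume (fun v => TBundle.fibreTop (ψ (x, v))) (fpush ψ x) := by
  have := (h.lin (fibreTopLin m V r)).hasVIntegral_push hx
  simpa only [fpush_eq, fibreTopLin_apply] using this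

theorem smoothNear_fpush {ψ : V × Fib r → EForm m (V × Fib r)} (h : FibreCompact ψ S)
    (hS : UniqueDiffOn ℝ S) (hconv : LocallyConvexSet S) {x : V} (hx : x ∈ S) :
    SmoothNear (fpush ψ) S x := by
  rw [fpush_eq]
  exact (h.lin (fibreTopLin m V r)).smoothNear_push hS hconv hx

/-- Wedging with a covector of the base and then integrating, as a linear map. -/
noncomputable def baseWedge (m r : ℕ) (b : V →ₗ[ℝ] ℝ) : EForm m V →ₗ[ℝ] EForm m V :=
  (-1 : ℝ) ^ r • mulBilin m V (covector m b)

theorem baseWedge_apply (b : V →ₗ[ℝ] ℝ) (ψ : EForm m V) :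
    baseWedge m r b ψ = (-1 : ℝ) ^ r • (covector m b * ψ) := rfl

/-- Wedging with a covector and taking the vertical top part, as a linear map. -/
noncomputable def topWedge (m r : ℕ) (b : V × Fib r →ₗ[ℝ] ℝ) :
    EForm m (V × Fib r) →ₗ[ℝ] EForm m V :=
  fibreTopLin m V r ∘ₗ mulBilin m (V × Fib r) (covector m b)

theorem topWedge_apply (b : V × Fib r →ₗ[ℝ] ℝ) (ψ : EForm m (V × Fib r)) :
    topWedge m r b ψ = TBundle.fibreTop (covector m b * ψ) := fibreTopLin_apply _

theorem topWedge_base (b : V →ₗ[ℝ] ℝ) (ψ : EForm m (V × Fib r)) :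
    topWedge m r (b ∘ₗ LinearMap.fst ℝ V (Fib r)) ψ = baseWedge m r b (fibreTopLin m V r ψ) := by
  rw [topWedge_apply, baseWedge_apply, fibreTopLin_apply, fibreTop_covector_fst_mul]

/-- Fibre integration commutes with the exterior derivative. -/
theorem hasVIntegral_dform {ψ : V × Fib r → EForm m (V × Fib r)} (h : FibreCompact ψ S)
    (hS : UniqueDiffOn ℝ S) (hconv : LocallyConvexSet S) {x : V} (hx : x ∈ S) :
    HasVIntegral volume (fun v => TBundle.fibreTop (dform ψ (tube S r) (x, v)))
      ((-1 : ℝ) ^ r • dform (fpush ψ) S x) := by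
  let e := (Module.finBasis ℝ V).prod (fibBasis r)
  have he1 : ∀ b, e (Sum.inl b) = (Module.finBasis ℝ V b, 0) := fun b => by simp [e]
  have he2 : ∀ k, e (Sum.inr k) = (0, fibBasis r k) := fun b => by simp [e]
  have hc : ∀ b, e.coord (Sum.inl b) =
      (Module.finBasis ℝ V).coord b ∘ₗ LinearMap.fst ℝ V (Fib r) := fun b => by ext <;> simp [e]
  have h1 : ∀ v, TBundle.fibreTop (dform ψ (tube S r) (x, v)) =
      ∑ b, baseWedge m r ((Module.finBasis ℝ V).coord b)
          (vderiv (fun p => fibreTopLin m V r (ψ p)) (tube S r) (x, v) (Module.finBasis ℝ V b, 0)) +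
      ∑ k, topWedge m r (e.coord (Sum.inr k))
          (vderiv ψ (tube S r) (x, v) (0, fibBasis r k)) := by
    intro v
    have hxv : (x, v) ∈ tube S r := hx
    rw [dform_basis e (h.smooth _ hxv) hxv (uniqueDiffOn_over hS), ← fibreTopLin_apply, map_sum,
      Fintype.sum_sum_type]
    have hT : ∀ b (ψ : EForm m (V × Fib r)),
      fibreTopLin m V r (covector m b * ψ) = topWedge m r b ψ := fun _ _ => rfl
    simp only [hT, hc, he1, he2, topWedge_base,
      vderiv_lin (fibreTopLin m V r) (h.smooth _ hxv) hxv (uniqueDiffOn_over hS)]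
  have h2 := (HasVIntegral.sum Finset.univ (fun b _ => ((h.lin (fibreTopLin m V r)).vderiv_push hS
    hconv hx (Module.finBasis ℝ V b)).map (baseWedge m r ((Module.finBasis ℝ V).coord b)))).add
    (HasVIntegral.sum Finset.univ (fun k _ => (h.integral_vertical hS hx (fibBasis r k)).map
      (topWedge m r (e.coord (Sum.inr k)))))
  simp only [map_zero, Finset.sum_const_zero, add_zero] at h2
  have h3 : (-1 : ℝ) ^ r • dform (fpush ψ) S x = ∑ b, baseWedge m r ((Module.finBasis ℝ V).coord b)
        (vderiv (push fun p => fibreTopLin m V r (ψ p)) S x (Module.finBasis ℝ V b)) := by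
    rw [dform, Finset.smul_sum, fpush_eq]
    rfl
  rw [h3]
  exact h2.congr (Eventually.of_forall h1)

end EForm

end

/-! ## Polar coordinates -/

section polar

theorem integrable_volumeIoiPow_iff (n : ℕ) (u : ℝ → ℝ) :
    Integrable (fun t : Set.Ioi (0 : ℝ) => u t) (Measure.volumeIoiPow n) ↔
      IntegrableOn (fun t => t ^ n * u t) (Set.Ioi 0) := by
  rw [integrableOn_iff_comap_subtypeVal measurableSet_Ioi, Function.comp_def,
    Measure.volumeIoiPow, integrable_withDensity_iff_integrable_smul' (by fun_prop) (by simp)]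
  refine integrable_congr (Eventually.of_forall ?_)
  rintro ⟨x, hx : 0 < x⟩
  simp (disch := positivity) [ENNReal.toReal_ofReal]

theorem integral_volumeIoiPow (n : ℕ) (u : ℝ → ℝ) :
    ∫ t : Set.Ioi (0 : ℝ), u t ∂(Measure.volumeIoiPow n) = ∫ t in Set.Ioi 0, t ^ n * u t := by
  simp only [Measure.volumeIoiPow, ENNReal.ofReal]
  rw [integral_withDensity_eq_integral_smul (by fun_prop),
    integral_subtype_comap measurableSet_Ioi fun a ↦ Real.toNNReal (a ^ n) • u a]
  refine setIntegral_congr_fun measurableSet_Ioi fun x hx => ?_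
  rw [Set.mem_Ioi] at hx
  simp only [NNReal.smul_def, Real.coe_toNNReal _ (pow_nonneg hx.le n), smul_eq_mul]

theorem integrable_radial {n k : ℕ} {c : ℝ} (hc : 0 < c) {g : ℝ → ℝ}
    (hg : IntegrableOn (fun t => t ^ k * g t) (Set.Ioi 0)) :
    Integrable (fun t : Set.Ioi (0 : ℝ) => g (t.1 ^ 2 * c) * ((t.1 ^ (n + 1))⁻¹ * t.1 ^ (2 * (k + 1))))
      (Measure.volumeIoiPow n) ∧
    ∫ t : Set.Ioi (0 : ℝ), g (t.1 ^ 2 * c) * ((t.1 ^ (n + 1))⁻¹ * t.1 ^ (2 * (k + 1)))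
      ∂(Measure.volumeIoiPow n) = c⁻¹ ^ (k + 1) * (1 / 2 * ∫ t in Set.Ioi 0, t ^ k * g t) := by
  have h1 : IntegrableOn (fun t => (t * c) ^ k * g (t * c)) (Set.Ioi 0) := by
    have := (integrableOn_Ioi_comp_mul_right_iff (fun t => t ^ k * g t) 0 hc).mpr (by simpa using hg)
    simpa using this
  have h2 : ∫ t in Set.Ioi 0, (t * c) ^ k * g (t * c) = c⁻¹ * ∫ t in Set.Ioi 0, t ^ k * g t := by
    have := integral_comp_mul_right_Ioi (fun t => t ^ k * g t) 0 hc
    simpa using this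
  have e : Set.EqOn (fun t : ℝ => t ^ n * (g (t ^ 2 * c) * ((t ^ (n + 1))⁻¹ * t ^ (2 * (k + 1)))))
      (fun t : ℝ => (1 / 2 * c⁻¹ ^ k) * ((2 * t ^ ((2 : ℝ) - 1)) •
        ((t ^ (2 : ℝ) * c) ^ k * g (t ^ (2 : ℝ) * c)))) (Set.Ioi 0) := by
    intro t ht
    have ht : 0 < t := ht
    have : (2 : ℝ) - 1 = 1 := by norm_num
    simp only [this, Real.rpow_one, Real.rpow_two, smul_eq_mul, inv_pow]
    field_simp
    ring
  constructor
  · rw [integrable_volumeIoiPow_iff n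
      (fun t => g (t ^ 2 * c) * ((t ^ (n + 1))⁻¹ * t ^ (2 * (k + 1))))]
    refine IntegrableOn.congr_fun ?_ e.symm measurableSet_Ioi
    refine Integrable.const_mul ?_ _
    rw [← IntegrableOn]
    have := (integrableOn_Ioi_comp_rpow_iff (fun t => (t * c) ^ k * g (t * c))
      (p := 2) (by norm_num)).mpr h1
    simpa only [abs_two] using this
  · rw [integral_volumeIoiPow n (fun t => g (t ^ 2 * c) * ((t ^ (n + 1))⁻¹ * t ^ (2 * (k + 1)))),
      setIntegral_congr_fun measurableSet_Ioi e, integral_const_mul,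
      integral_comp_rpow_Ioi_of_pos (g := fun t => (t * c) ^ k * g (t * c)) (by norm_num), h2]
    ring

/-- The integral of a function which is homogeneous up to a function of a positive quadratic
function. -/
theorem integral_homogeneous {n k : ℕ} {Φ Q : Fib (n + 1) → ℝ}
    (hΦ : ContinuousOn Φ {0}ᶜ)
    (hΦh : ∀ s : ℝ, 0 < s → ∀ v, v ≠ 0 → s ^ (n + 1) * Φ (s • v) = s ^ (2 * (k + 1)) * Φ v)
    (hQc : ContinuousOn Q {0}ᶜ) (hQh : ∀ s : ℝ, 0 < s → ∀ v, v ≠ 0 → Q (s • v) = s ^ 2 * Q v)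
    (hQ : ∀ v, v ≠ 0 → 0 < Q v) {g : ℝ → ℝ} (hg : Continuous g)
    (hgi : IntegrableOn (fun t => t ^ k * g t) (Set.Ioi 0)) :
    Integrable (fun v => g (Q v) * Φ v) volume ∧
    ∫ v, g (Q v) * Φ v = (∫ θ : Metric.sphere (0 : Fib (n + 1)) 1, Φ θ.1 * (Q θ.1)⁻¹ ^ (k + 1)
      ∂(volume : Measure (Fib (n + 1))).toSphere) * (1 / 2 * ∫ t in Set.Ioi 0, t ^ k * g t) := by
  have hdim : Module.finrank ℝ (Fib (n + 1)) - 1 = n := by simp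
  have hs0 : ∀ θ : Metric.sphere (0 : Fib (n + 1)) 1, θ.1 ≠ 0 := fun θ h => by
    have := θ.2; rw [h] at this; simp at this
  have hsc : Continuous fun θ : Metric.sphere (0 : Fib (n + 1)) 1 => Φ θ.1 := by
    rw [← continuousOn_univ]
    exact hΦ.comp continuous_subtype_val.continuousOn fun θ _ => hs0 θ
  have hsq : Continuous fun θ : Metric.sphere (0 : Fib (n + 1)) 1 => Q θ.1 := by
    rw [← continuousOn_univ]
    exact hQc.comp continuous_subtype_val.continuousOn fun θ _ => hs0 θ
  have hcont : Continuous fun θ : Metric.sphere (0 : Fib (n + 1)) 1 => Φ θ.1 * (Q θ.1)⁻¹ ^ (k + 1) :=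
    hsc.mul ((hsq.inv₀ fun θ => (hQ _ (hs0 θ)).ne').pow _)
  -- the function on the product
  let H : Metric.sphere (0 : Fib (n + 1)) 1 × Set.Ioi (0 : ℝ) → ℝ := fun p =>
    Φ p.1.1 * (g (p.2.1 ^ 2 * Q p.1.1) * ((p.2.1 ^ (n + 1))⁻¹ * p.2.1 ^ (2 * (k + 1))))
  have hH : Continuous H := by
    have h1 : Continuous fun p : Metric.sphere (0 : Fib (n + 1)) 1 × Set.Ioi (0 : ℝ) => Φ p.1.1 :=
      hsc.comp continuous_fst
    have h2 : Continuous fun p : Metric.sphere (0 : Fib (n + 1)) 1 × Set.Ioi (0 : ℝ) => Q p.1.1 :=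
      hsq.comp continuous_fst
    have h3 : Continuous fun p : Metric.sphere (0 : Fib (n + 1)) 1 × Set.Ioi (0 : ℝ) => p.2.1 := by fun_prop
    exact h1.mul ((hg.comp ((h3.pow 2).mul h2)).mul
      (((h3.pow _).inv₀ fun p => (pow_pos p.2.2 _).ne').mul (h3.pow _)))
  have hHint : Integrable H ((volume : Measure (Fib (n + 1))).toSphere.prod (Measure.volumeIoiPow n)) := by
    rw [integrable_prod_iff hH.aestronglyMeasurable]
    constructor
    · exact Eventually.of_forall fun θ =>
        ((integrable_radial (n := n) (hQ _ (hs0 θ)) hgi).1.const_mul (Φ θ.1))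
    · have hga : IntegrableOn (fun t => t ^ k * |g t|) (Set.Ioi 0) := by
        refine IntegrableOn.congr_fun hgi.abs (fun t ht => ?_) measurableSet_Ioi
        simp only [abs_mul, abs_of_pos (pow_pos (Set.mem_Ioi.mp ht) k)]
      have e : (fun θ => ∫ t, ‖H (θ, t)‖ ∂(Measure.volumeIoiPow n)) = fun θ =>
          |Φ θ.1 * (Q θ.1)⁻¹ ^ (k + 1)| * (1 / 2 * ∫ t in Set.Ioi 0, t ^ k * |g t|) := by
        funext θ
        have h1 := (integrable_radial (n := n) (hQ _ (hs0 θ)) hga).2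
        have h2 : ∀ t : Set.Ioi (0 : ℝ), ‖H (θ, t)‖ = |Φ θ.1| *
            (|g (t.1 ^ 2 * Q θ.1)| * ((t.1 ^ (n + 1))⁻¹ * t.1 ^ (2 * (k + 1)))) := fun t => by
          have : 0 < t.1 := t.2
          simp only [H, Real.norm_eq_abs, abs_mul, abs_inv, abs_pow, abs_of_pos this]
        simp only [h2]
        rw [integral_const_mul, h1, abs_mul, abs_of_pos (pow_pos (inv_pos.mpr (hQ _ (hs0 θ))) _)]
        ring
      rw [e]
      exact (hcont.abs.mul continuous_const).integrable_of_hasCompactSupport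
        (HasCompactSupport.of_compactSpace _)
  have hmp := (volume : Measure (Fib (n + 1))).measurePreserving_homeomorphUnitSphereProd
  rw [hdim] at hmp
  have hemb := (homeomorphUnitSphereProd (Fib (n + 1))).measurableEmbedding
  have hcomp : ∀ v : ({0}ᶜ : Set (Fib (n + 1))), H (homeomorphUnitSphereProd (Fib (n + 1)) v) = g (Q v) * Φ v := by
    intro v
    obtain ⟨p, rfl⟩ := (homeomorphUnitSphereProd (Fib (n + 1))).symm.surjective v
    rw [Homeomorph.apply_symm_apply]
    have hv : (((homeomorphUnitSphereProd (Fib (n + 1))).symm p : ({0}ᶜ : Set (Fib (n + 1)))) : Fib (n + 1)) = p.2.1 • p.1.1 := by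
      simp
    have hp : 0 < p.2.1 := p.2.2
    rw [hv, hQh _ hp _ (hs0 p.1)]
    have h3 : Φ (p.2.1 • p.1.1) = (p.2.1 ^ (n + 1))⁻¹ * p.2.1 ^ (2 * (k + 1)) * Φ p.1.1 := by
      rw [mul_assoc, ← hΦh _ hp _ (hs0 p.1), inv_mul_cancel_left₀ (pow_pos hp _).ne']
    rw [h3]
    simp only [H]
    ring
  have hms : MeasurableSet ({0}ᶜ : Set (Fib (n + 1))) := (measurableSet_singleton _).compl
  have hres : (volume : Measure (Fib (n + 1))).restrict {0}ᶜ = volume := restrict_compl_singleton 0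
  constructor
  · have h1 : IntegrableOn (fun v => g (Q v) * Φ v) {0}ᶜ (volume : Measure (Fib (n + 1))) := by
      rw [integrableOn_iff_comap_subtypeVal hms]
      exact ((hmp.integrable_comp_emb hemb).mpr hHint).congr (Eventually.of_forall hcomp)
    rwa [IntegrableOn, hres] at h1
  · have h1 := integral_subtype_comap (μ := (volume : Measure (Fib (n + 1)))) hms
      fun v => g (Q v) * Φ v
    rw [hres] at h1
    have := hmp.integral_comp hemb H
    simp only [hcomp] at this
    rw [← h1, this, integral_prod _ hHint, ← integral_mul_const]
    refine integral_congr_ae (Eventually.of_forall fun θ => ?_)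
    change ∫ t, Φ θ.1 * _ ∂_ = _
    rw [integral_const_mul, (integrable_radial (n := n) (hQ _ (hs0 θ)) hgi).2]
    ring

end polar

/-! ## Cutoff functions -/

/-- A cutoff which vanishes for `t ≤ 1` and equals `1` for `t ≥ 2`. -/
noncomputable def innerCut (t : ℝ) : ℝ := Real.smoothTransition (t - 1)

/-- A cutoff which equals `1` for `t ≤ 2` and vanishes for `t ≥ 3`. -/
noncomputable def outerCut (t : ℝ) : ℝ := 1 - Real.smoothTransition (t - 2)

/-- The coefficients of the Taylor expansion of the outer cutoff at a nilpotent perturbation. -/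
noncomputable def weight (k : ℕ) (t : ℝ) : ℝ :=
  ((-1) ^ k * (k.factorial : ℝ)⁻¹) * iteratedDeriv k outerCut t

theorem contDiff_innerCut : ContDiff ℝ ∞ innerCut :=
  Real.smoothTransition.contDiff.comp (by fun_prop)

theorem contDiff_outerCut : ContDiff ℝ ∞ outerCut :=
  contDiff_const.sub (Real.smoothTransition.contDiff.comp (by fun_prop))

theorem contDiff_weight (k : ℕ) : ContDiff ℝ ∞ (weight k) := by
  refine contDiff_const.mul ?_
  rw [iteratedDeriv_eq_iterate]
  exact contDiff_outerCut.iterate_deriv k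

theorem innerCut_of_le {t : ℝ} (h : t ≤ 1) : innerCut t = 0 :=
  Real.smoothTransition.zero_of_nonpos (by linarith)

theorem innerCut_of_ge {t : ℝ} (h : 2 ≤ t) : innerCut t = 1 :=
  Real.smoothTransition.one_of_one_le (by linarith)

theorem weight_zero (t : ℝ) : weight 0 t = outerCut t := by simp [weight]

theorem outerCut_of_le {t : ℝ} (h : t ≤ 2) : outerCut t = 1 := by
  rw [outerCut, Real.smoothTransition.zero_of_nonpos (by linarith), sub_zero]

theorem outerCut_of_ge {t : ℝ} (h : 3 ≤ t) : outerCut t = 0 := by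
  rw [outerCut, Real.smoothTransition.one_of_one_le (by linarith), sub_self]

theorem hasDerivAt_weight (k : ℕ) (t : ℝ) :
    HasDerivAt (weight k) (-((k + 1 : ℕ) : ℝ) * weight (k + 1) t) t := by
  have h1 : HasDerivAt (iteratedDeriv k outerCut) (iteratedDeriv (k + 1) outerCut t) t := by
    rw [iteratedDeriv_succ]
    refine DifferentiableAt.hasDerivAt ?_
    rw [iteratedDeriv_eq_iterate]
    exact ((contDiff_outerCut.iterate_deriv k).differentiable (by simp)) t
  have h2 := h1.const_mul ((-1) ^ k * (k.factorial : ℝ)⁻¹)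
  refine h2.congr_deriv ?_
  simp only [weight]
  rw [Nat.factorial_succ]
  push_cast
  have : (k.factorial : ℝ) ≠ 0 := by positivity
  field_simp
  ring

theorem weight_of_gt {k : ℕ} {t : ℝ} (h : 3 < t) : weight k t = 0 := by
  have : outerCut =ᶠ[𝓝 t] fun _ => 0 := by
    filter_upwards [lt_mem_nhds h] with s hs using outerCut_of_ge hs.le
  rw [weight, (this.iteratedDeriv k).eq_of_nhds]
  simp

theorem weight_succ_of_lt {k : ℕ} {t : ℝ} (h : t < 2) : weight (k + 1) t = 0 := by
  have : outerCut =ᶠ[𝓝 t] fun _ => 1 := by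
    filter_upwards [gt_mem_nhds h] with s hs using outerCut_of_le hs.le
  rw [weight, (this.iteratedDeriv (k + 1)).eq_of_nhds]
  simp [iteratedDeriv_const]

theorem weight_of_ge_three {k : ℕ} {t : ℝ} (h : 3 ≤ t) : weight k t = 0 := by
  have hc : ContinuousOn (weight k) (closure (Set.Ioi 3)) :=
    (contDiff_weight k).continuous.continuousOn
  have := Set.EqOn.closure (f := weight k) (g := fun _ => 0)
    (fun t (ht : t ∈ Set.Ioi (3 : ℝ)) => weight_of_gt ht) (contDiff_weight k).continuous
    continuous_const
  exact this (by rw [closure_Ioi]; exact h)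

theorem integrableOn_of_vanishing {g : ℝ → ℝ} (hg : Continuous g) (h : ∀ t, 3 ≤ t → g t = 0)
    (k : ℕ) : IntegrableOn (fun t => t ^ k * g t) (Set.Ioi 0) ∧
      ∫ t in Set.Ioi 0, t ^ k * g t = ∫ t in (0 : ℝ)..3, t ^ k * g t := by
  have hc : Continuous fun t => t ^ k * g t := by fun_prop
  have hsub : Set.Ioc (0 : ℝ) 3 ⊆ Set.Ioi 0 := fun t ht => ht.1
  have h1 : IntegrableOn (fun t => t ^ k * g t) (Set.Ioc 0 3) :=
    (hc.integrableOn_Icc (a := 0) (b := 3)).mono_set Set.Ioc_subset_Icc_self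
  have h0 : ∀ t ∈ Set.Ioi (0 : ℝ) \ Set.Ioc 0 3, t ^ k * g t = 0 := fun t ht => by
    have : 3 ≤ t := by
      by_contra hlt; exact ht.2 ⟨ht.1, (not_le.mp hlt).le⟩
    rw [h t this, mul_zero]
  refine ⟨h1.of_forall_sdiff_eq_zero measurableSet_Ioi h0, ?_⟩
  rw [intervalIntegral.integral_of_le (by norm_num)]
  exact (setIntegral_eq_of_subset_of_forall_sdiff_eq_zero (μ := volume) measurableSet_Ioi hsub h0)

theorem integral_weight (k : ℕ) : ∫ t in Set.Ioi 0, t ^ k * weight (k + 1) t = ((k + 1 : ℕ) : ℝ)⁻¹ := by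
  have hI : ∀ k j : ℕ, ∫ t in Set.Ioi 0, t ^ j * weight k t = ∫ t in (0 : ℝ)..3, t ^ j * weight k t :=
    fun k j => (integrableOn_of_vanishing (contDiff_weight k).continuous
      (fun t ht => weight_of_ge_three ht) j).2
  rw [hI]
  induction k with
  | zero =>
    have h := intervalIntegral.integral_eq_sub_of_hasDerivAt (a := 0) (b := 3) (f := weight 0)
      (fun t _ => hasDerivAt_weight 0 t)
      (((contDiff_weight 1).continuous.const_mul _).intervalIntegrable _ _)
    rw [weight_of_ge_three le_rfl, weight_zero, outerCut_of_le (by norm_num)] at h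
    simp at h ⊢
    linarith
  | succ k ih =>
    have hd : ∀ t : ℝ, HasDerivAt (fun t => t ^ (k + 1) * weight (k + 1) t)
        (((k + 1 : ℕ) : ℝ) * (t ^ k * weight (k + 1) t) +
          -((k + 1 + 1 : ℕ) : ℝ) * (t ^ (k + 1) * weight (k + 1 + 1) t)) t := by
      intro t
      refine ((hasDerivAt_pow (k + 1) t).mul (hasDerivAt_weight (k + 1) t)).congr_deriv ?_
      rw [Nat.add_sub_cancel]
      ring
    have c1 := (contDiff_weight (k + 1)).continuous
    have c2 := (contDiff_weight (k + 1 + 1)).continuous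
    have i1 : Continuous fun t : ℝ => ((k + 1 : ℕ) : ℝ) * (t ^ k * weight (k + 1) t) := by fun_prop
    have i2 : Continuous fun t : ℝ =>
      -((k + 1 + 1 : ℕ) : ℝ) * (t ^ (k + 1) * weight (k + 1 + 1) t) := by fun_prop
    have h := intervalIntegral.integral_eq_sub_of_hasDerivAt (a := 0) (b := 3)
      (fun t _ => hd t) ((i1.add i2).intervalIntegrable _ _)
    rw [intervalIntegral.integral_add (i1.intervalIntegrable _ _) (i2.intervalIntegrable _ _),
      intervalIntegral.integral_const_mul, intervalIntegral.integral_const_mul, ih,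
      weight_of_ge_three le_rfl] at h
    have hk : ((k + 1 : ℕ) : ℝ) ≠ 0 := by positivity
    have hk2 : ((k + 1 + 1 : ℕ) : ℝ) ≠ 0 := by positivity
    rw [mul_inv_cancel₀ hk] at h
    simp only [mul_zero, zero_pow (Nat.succ_ne_zero k), zero_mul, sub_zero] at h
    field_simp
    linarith

theorem integral_exp_weight (k : ℕ) :
    IntegrableOn (fun t : ℝ => t ^ k * (Real.exp (-t) * (((k + 1).factorial : ℝ))⁻¹)) (Set.Ioi 0) ∧
    ∫ t in Set.Ioi (0 : ℝ), t ^ k * (Real.exp (-t) * (((k + 1).factorial : ℝ))⁻¹) =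
      ((k + 1 : ℕ) : ℝ)⁻¹ := by
  have hpos : (0 : ℝ) < (k : ℝ) + 1 := by positivity
  have e : Set.EqOn (fun t : ℝ => Real.exp (-t) * t ^ ((k : ℝ) + 1 - 1))
      (fun t => t ^ k * Real.exp (-t)) (Set.Ioi 0) := fun t ht => by
    simp only [add_sub_cancel_right, Real.rpow_natCast, mul_comm]
  have h1 := (Real.GammaIntegral_convergent hpos).congr_fun e measurableSet_Ioi
  have h2 := Real.Gamma_eq_integral hpos
  rw [setIntegral_congr_fun measurableSet_Ioi e, Real.Gamma_nat_eq_factorial] at h2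
  simp only [← mul_assoc]
  refine ⟨h1.mul_const _, ?_⟩
  rw [integral_mul_const, ← h2, Nat.factorial_succ]
  have : (k.factorial : ℝ) ≠ 0 := by positivity
  push_cast
  field_simp

theorem hasDerivAt_innerCut (t : ℝ) : HasDerivAt innerCut (deriv innerCut t) t :=
  ((contDiff_innerCut.differentiable (by simp)) t).hasDerivAt

theorem continuous_deriv_innerCut : Continuous (deriv innerCut) :=
  contDiff_innerCut.continuous_deriv (by simp)

theorem deriv_innerCut_of_ge {t : ℝ} (h : 3 ≤ t) : deriv innerCut t = 0 := by
  have : innerCut =ᶠ[𝓝 t] fun _ => 1 := by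
    filter_upwards [lt_mem_nhds (show (2 : ℝ) < t by linarith)] with s hs using innerCut_of_ge hs.le
  rw [this.deriv_eq]; simp

theorem integral_deriv_innerCut :
    IntegrableOn (fun t => t ^ 0 * deriv innerCut t) (Set.Ioi 0) ∧
      ∫ t in Set.Ioi 0, t ^ 0 * deriv innerCut t = 1 := by
  obtain ⟨h1, h2⟩ := integrableOn_of_vanishing continuous_deriv_innerCut
    (fun t ht => deriv_innerCut_of_ge ht) 0
  refine ⟨h1, h2.trans ?_⟩
  simp only [pow_zero, one_mul]
  rw [intervalIntegral.integral_eq_sub_of_hasDerivAt (fun t _ => hasDerivAt_innerCut t)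
    (continuous_deriv_innerCut.intervalIntegrable _ _), innerCut_of_ge (by norm_num),
    innerCut_of_le (by norm_num), sub_zero]

section

/-! ## The localizing kernel on a chart -/

theorem SmoothNear.of_inter_open {V M : Type*} [NormedAddCommGroup V] [NormedSpace ℝ V]
    [AddCommGroup M] [Module ℝ M] {F : V → M} {S O : Set V} {x : V} (hO : IsOpen O) (hx : x ∈ O)
    (h : SmoothNear F (O ∩ S) x) : SmoothNear F S x := by
  obtain ⟨U, hU, hxU, n, c, f, hf, hF⟩ := h
  refine ⟨U ∩ O, hU.inter hO, ⟨hxU, hx⟩, n, c, f, fun k => (hf k).mono ?_, fun y hy => hF y ?_⟩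
  · exact fun y hy => ⟨hy.1.1, hy.1.2, hy.2⟩
  · exact ⟨hy.1.1, hy.1.2, hy.2⟩

/-- The coefficients of the localizing kernel. -/
noncomputable def coef (k : ℕ) (t : ℝ) : ℝ := weight k t - if k = 0 then 1 - innerCut t else 0

theorem coef_succ (k : ℕ) (t : ℝ) : coef (k + 1) t = weight (k + 1) t := by simp [coef]

theorem contDiff_coef (k : ℕ) : ContDiff ℝ ∞ (coef k) := by
  refine (contDiff_weight k).sub ?_
  split_ifs
  · exact contDiff_const.sub contDiff_innerCut
  · exact contDiff_const

theorem coef_of_le {k : ℕ} {t : ℝ} (h : t ≤ 1) : coef k t = 0 := by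
  cases k with
  | zero => simp [coef, weight_zero, outerCut_of_le (h.trans one_le_two), innerCut_of_le h]
  | succ k => rw [coef_succ, weight_succ_of_lt (by linarith)]

theorem coef_of_ge {k : ℕ} {t : ℝ} (h : 3 ≤ t) : coef k t = 0 := by
  rw [coef, weight_of_ge_three h, innerCut_of_ge (by linarith)]; simp

theorem hasDerivAt_coef (k : ℕ) (t : ℝ) :
    HasDerivAt (coef k) (-((k + 1 : ℕ) : ℝ) * coef (k + 1) t +
      if k = 0 then deriv innerCut t else 0) t := by
  rw [coef_succ]
  have h1 := hasDerivAt_weight k t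
  by_cases hk : k = 0
  · have h2 := h1.sub ((hasDerivAt_innerCut t).const_sub 1)
    rw [if_pos hk, ← sub_neg_eq_add]
    refine h2.congr_of_eventuallyEq (Eventually.of_forall fun s => ?_)
    simp [coef, hk]
  · rw [if_neg hk, add_zero]
    refine h1.congr_of_eventuallyEq (Eventually.of_forall fun s => ?_)
    simp [coef, hk]

namespace EForm

variable {m : ℕ} {V W : Type} [AddCommGroup V] [Module ℝ V] [AddCommGroup W] [Module ℝ W]

theorem form_smul_def (c : EqRing m) (a : EForm m V) :
    c • a = algebraMap (EqRing m) (EForm m V) c * a := Algebra.smul_def c a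

theorem form_smul_add (c : EqRing m) (a b : EForm m V) : c • (a + b) = c • a + c • b := by
  rw [form_smul_def, form_smul_def, form_smul_def, mul_add]

theorem form_smul_neg (c : EqRing m) (a : EForm m V) : c • (-a) = -(c • a) := by
  rw [form_smul_def, form_smul_def, mul_neg]

theorem form_smul_real (c : EqRing m) (t : ℝ) (a : EForm m V) : c • t • a = t • c • a := by
  rw [form_smul_def, form_smul_def, mul_smul_comm]

/-- `∑ⱼ λⱼ ι_{ξⱼ}` at a point. -/
noncomputable def momAt (ξ : Fin m → V) (ψ : EForm m V) : EForm m V :=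
  ∑ j, lam j • contract (ξ j) ψ

/-- `∑ⱼ λⱼ ι_{ξⱼ}` as a linear map. -/
noncomputable def momLin (ξ : Fin m → V) : EForm m V →ₗ[ℝ] EForm m V where
  toFun := momAt ξ
  map_add' a b := by
    unfold momAt
    rw [← Finset.sum_add_distrib]
    refine Finset.sum_congr rfl fun j _ => ?_
    rw [contract_add, form_smul_add]
  map_smul' c a := by
    unfold momAt
    rw [RingHom.id_apply, Finset.smul_sum]
    refine Finset.sum_congr rfl fun j _ => ?_
    rw [contract_real_smul, form_smul_real]

theorem momLin_apply (ξ : Fin m → V) (ψ : EForm m V) : momLin ξ ψ = momAt ξ ψ := rfl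

theorem momAt_mul (ξ : Fin m → V) {a : EForm m V} (ha : inv a = a) (b : EForm m V) :
    momAt ξ (a * b) = momAt ξ a * b + a * momAt ξ b := by
  unfold momAt
  rw [Finset.sum_mul, Finset.mul_sum, ← Finset.sum_add_distrib]
  refine Finset.sum_congr rfl fun j _ => ?_
  rw [contract_mul, ha, form_smul_add, smul_mul, mul_smul_right]

theorem inv_pow_of_even {a : EForm m V} (ha : inv a = a) (k : ℕ) : inv (a ^ k) = a ^ k := by
  have : inv (a ^ k) = inv a ^ k := map_pow CliffordAlgebra.involute a k
  rw [this, ha]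

theorem momAt_real_one (ξ : Fin m → V) : momAt ξ (1 : EForm m V) = 0 := by
  unfold momAt
  refine Finset.sum_eq_zero fun j _ => ?_
  rw [contract_real_one, form_smul_zero]

theorem one_mul_involute (β : V →ₗ[ℝ] EqRing m) (ψ : EForm m V) : one β * ψ = inv ψ * one β := by
  induction ψ using left_induction with
  | scalar c =>
    have h : inv (algebraMap (EqRing m) (EForm m V) c) = algebraMap _ _ c := AlgHom.commutes _ _
    rw [h]
    exact (Algebra.commutes c (one β)).symm
  | add a b ha hb =>
    have h : inv (a + b) = inv a + inv b := map_add CliffordAlgebra.involute a b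
    rw [mul_add, ha, hb, h, add_mul]
  | mul γ a ha => rw [inv_one_mul, ← mul_assoc, one_mul_one_swap, neg_mul, mul_assoc, ha, neg_mul,
      mul_assoc]

/-- Contraction of powers of an even form whose contraction is a covector. -/
theorem momAt_pow (ξ : Fin m → V) {a : EForm m V} (ha : inv a = a) {β : V →ₗ[ℝ] ℝ}
    (h : momAt ξ a = -covector m β) (k : ℕ) :
    momAt ξ (a ^ k) = -((k : ℝ) • (covector m β * a ^ (k - 1))) := by
  have hc : ∀ j, a ^ j * covector m β = covector m β * a ^ j := fun j => by
    rw [covector_eq, one_mul_involute, inv_pow_of_even ha]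
  induction k with
  | zero => rw [pow_zero, momAt_real_one]; simp
  | succ k ih =>
    rw [pow_succ, momAt_mul ξ (inv_pow_of_even ha k), ih, h, mul_neg, hc, neg_mul, smul_mul_assoc,
      mul_assoc, Nat.add_sub_cancel]
    have : (k : ℝ) • (covector m β * (a ^ (k - 1) * a)) = (k : ℝ) • (covector m β * a ^ k) := by
      cases k with
      | zero => simp
      | succ k => rw [Nat.add_sub_cancel, ← pow_succ]
    rw [this, Nat.cast_succ, add_smul, one_smul, neg_add]

variable {r : ℕ}

theorem fibreTop_smul (c : EqRing m) (ψ : EForm m (V × Fib r)) :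
    TBundle.fibreTop (c • ψ) = c • TBundle.fibreTop ψ := by
  have h := fibreTop_mul_pull_fst ψ (algebraMap (EqRing m) (EForm m V) c)
  rw [pull_algebraMap, ← Algebra.commutes, ← Algebra.smul_def, ← Algebra.commutes,
    ← Algebra.smul_def] at h
  exact h

theorem fibreTop_momAt (ξ : Fin m → V × Fib r) (ψ : EForm m (V × Fib r)) :
    TBundle.fibreTop (momAt ξ ψ) =
      (-1 : ℝ) ^ r • momAt (fun j => (ξ j).1) (TBundle.fibreTop ψ) := by
  unfold momAt
  rw [← fibreTopLin_apply, map_sum, Finset.smul_sum]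
  refine Finset.sum_congr rfl fun j _ => ?_
  rw [fibreTopLin_apply, fibreTop_smul, fibreTop_contract, form_smul_real]

end EForm

end

section

theorem FibreCompact.sum {V : Type} {M κ : Type*} [NormedAddCommGroup V] [NormedSpace ℝ V] [AddCommGroup M]
    [Module ℝ M] {S : Set V} {r : ℕ} (s : Finset κ) {F : κ → V × Fib r → M}
    (h : ∀ k ∈ s, FibreCompact (F k) S) : FibreCompact (fun p => ∑ k ∈ s, F k p) S := by
  classical
  refine ⟨fun p hp => SmoothNear.sum s fun k hk => (h k hk).smooth p hp, fun x hx => ?_⟩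
  induction s using Finset.induction_on with
  | empty => exact ⟨Set.univ, isOpen_univ, trivial, 0, by simp⟩
  | insert a s ha ih =>
    obtain ⟨U, hU, hxU, R, hR⟩ := ih fun k hk => h k (Finset.mem_insert_of_mem hk)
    obtain ⟨U', hU', hxU', R', hR'⟩ := (h a (Finset.mem_insert_self a s)).support x hx
    refine ⟨U ∩ U', hU.inter hU', ⟨hxU, hxU'⟩, max R R', fun y hy v hv => ?_⟩
    rw [Finset.sum_insert ha, hR' y ⟨hy.1.2, hy.2⟩ v ((le_max_right _ _).trans_lt hv),
      hR y ⟨hy.1.1, hy.2⟩ v ((le_max_left _ _).trans_lt hv), add_zero]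

theorem HasVIntegral.sub {α M : Type*} [MeasurableSpace α] {μ : Measure α} [AddCommGroup M]
    [Module ℝ M] {F G : α → M} {y z : M} (h : HasVIntegral μ F y) (h' : HasVIntegral μ G z) :
    HasVIntegral μ (fun a => F a - G a) (y - z) := fun L => by
  simp only [map_sub]
  exact ⟨(h L).1.sub (h' L).1, by rw [integral_sub (h L).1 (h' L).1, (h L).2, (h' L).2]⟩

section cutoff

variable {V : Type} [NormedAddCommGroup V] [NormedSpace ℝ V] {M : Type*} [AddCommGroup M]
  [Module ℝ M] {S : Set V} {r : ℕ} {f : V × Fib r → ℝ}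

/-- A smooth function, homogeneous of degree two on the fibres. -/
structure IsFibreQuadratic (f : V × Fib r → ℝ) (S : Set V) : Prop where
  smooth : ∀ p ∈ tube S r, CNear f (tube S r) p
  hom : ∀ x ∈ S, ∀ s : ℝ, 0 < s → ∀ v, f (x, s • v) = s ^ 2 * f (x, v)

namespace IsFibreQuadratic

theorem contDiffOn (hf : IsFibreQuadratic f S) : ContDiffOn ℝ ∞ f (tube S r) :=
  CNear.contDiffOn hf.smooth

theorem zero (hf : IsFibreQuadratic f S) {x : V} (hx : x ∈ S) : f (x, 0) = 0 := by
  have := hf.hom x hx 2 two_pos 0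
  rw [smul_zero] at this
  linarith

/-- Positivity is uniform locally on the base. -/
theorem lower_bound (hf : IsFibreQuadratic f S) {x : V} (hx : x ∈ S)
    (hpos : ∀ v, v ≠ 0 → 0 < f (x, v)) :
    ∃ U, IsOpen U ∧ x ∈ U ∧ ∃ c : ℝ, 0 < c ∧ ∀ y ∈ U ∩ S, ∀ v, c * ‖v‖ ^ 2 ≤ f (y, v) := by
  have hK := isCompact_sphere (0 : Fib r) 1
  have hc := (slice_contDiff hf.contDiffOn hx).continuous
  obtain ⟨a, ha, hmin⟩ := hK.exists_forall_le' hc.continuousOn (a := 0) fun v hv => hpos v fun h => by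
    rw [h] at hv; simp at hv
  have htube : ∀ᶠ y in 𝓝 x, ∀ v ∈ Metric.sphere (0 : Fib r) 1, y ∈ S → a / 2 < f (y, v) := by
    refine hK.eventually_forall_of_forall_eventually
      (P := fun y v => y ∈ S → a / 2 < f (y, v)) fun v hv => ?_
    have h1 := (hf.smooth (x, v) hx).continuousWithinAt hx
    have h2 : ∀ᶠ p in 𝓝[tube S r] (x, v), a / 2 < f p :=
      h1.eventually (lt_mem_nhds (by linarith [hmin v hv]))
    exact eventually_nhdsWithin_iff.mp h2
  obtain ⟨U, hU, hUo, hxU⟩ := mem_nhds_iff.mp htube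
  refine ⟨U, hUo, hxU, a / 2, half_pos ha, fun y hy v => ?_⟩
  rcases eq_or_ne v 0 with rfl | hv
  · rw [hf.zero hy.2]; simp
  · have hn := norm_pos_iff.mpr hv
    have h1 := hU hy.1 (‖v‖⁻¹ • v) (by simp [norm_smul, hn.ne']) hy.2
    rw [hf.hom y hy.2 _ (inv_pos.mpr hn)] at h1
    have h2 := mul_le_mul_of_nonneg_left h1.le (sq_nonneg ‖v‖)
    rw [← mul_assoc, ← mul_pow, mul_inv_cancel₀ hn.ne', one_pow, one_mul] at h2
    linarith

/-- Euler's formula. -/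
theorem euler (hf : IsFibreQuadratic f S) {x : V} (hx : x ∈ S) (v : Fib r) :
    fderivWithin ℝ f (tube S r) (x, v) (0, v) = 2 * f (x, v) := by
  have h1 := slice_hasFDerivAt hf.contDiffOn hx ((1 : ℝ) • v)
  have h2 : HasDerivAt (fun s : ℝ => s • v) ((1 : ℝ) • v) 1 := (hasDerivAt_id (1 : ℝ)).smul_const v
  have h3 := h1.comp_hasDerivAt (1 : ℝ) h2
  have h4 : HasDerivAt (fun s : ℝ => s ^ 2 * f (x, v)) (2 * f (x, v)) 1 := by
    simpa using (hasDerivAt_pow 2 (1 : ℝ)).mul_const (f (x, v))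
  have h5 : (fun s : ℝ => s ^ 2 * f (x, v)) =ᶠ[𝓝 1] (fun v => f (x, v)) ∘ fun s : ℝ => s • v := by
    filter_upwards [lt_mem_nhds (one_pos (α := ℝ))] with s hs
    exact (hf.hom x hx s hs v).symm
  have h6 := (h3.congr_of_eventuallyEq h5).unique h4
  simpa using h6

end IsFibreQuadratic

/-- Cutting off in terms of a quadratic function on the fibres. -/
theorem fibreCompact_cutoff (hf : IsFibreQuadratic f S) {c : ℝ → ℝ} (hc : ContDiff ℝ ∞ c)
    (hc1 : ∀ t, t ≤ 1 → c t = 0) (hc3 : ∀ t, 3 ≤ t → c t = 0) {G : V × Fib r → M}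
    (hG : ∀ p : V × Fib r, p.1 ∈ S → p.2 ≠ 0 → SmoothNear G (tube S r) p) {ψ : V → ℝ}
    (hψ : ∀ x ∈ S, CNear ψ S x)
    (hpos : ∀ x ∈ S, (∀ v, v ≠ 0 → 0 < f (x, v)) ∨ ∃ U, IsOpen U ∧ x ∈ U ∧ ∀ y ∈ U ∩ S, ψ y = 0) :
    FibreCompact (fun p => ψ p.1 • c (f p) • G p) S where
  smooth := by
    rintro ⟨x, v⟩ hp
    have hcf : CNear (fun p => c (f p)) (tube S r) (x, v) := (hf.smooth _ hp).post hc
    have hψ' : CNear (fun p : V × Fib r => ψ p.1) (tube S r) (x, v) :=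
      CNear.comp (CNear.of_contDiff contDiff_fst) hp (hψ x hp) isOpen_univ trivial
        fun y hy => hy.2
    rcases eq_or_ne v 0 with rfl | hv
    · have h1 : ∀ᶠ p in 𝓝[tube S r] (x, (0 : Fib r)), f p < 1 :=
        ((hf.smooth _ hp).continuousWithinAt hp).eventually
          (gt_mem_nhds (by rw [hf.zero hp]; exact one_pos))
      obtain ⟨O, hO, hxO, hsub⟩ := mem_nhdsWithin.mp h1
      refine (SmoothNear.const (0 : M)).congr hO hxO fun p hp => ?_
      have : f p < 1 := hsub hp
      rw [hc1 _ this.le, zero_smul, smul_zero]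
    · exact SmoothNear.smul hψ' (SmoothNear.smul hcf (hG _ hp hv))
  support := by
    intro x hx
    rcases hpos x hx with h | ⟨U, hU, hxU, h⟩
    · obtain ⟨U, hU, hxU, a, ha, hb⟩ := hf.lower_bound hx h
      refine ⟨U, hU, hxU, max 1 (3 / a), fun y hy v hv => ?_⟩
      have h1 : 1 < ‖v‖ := (le_max_left _ _).trans_lt hv
      have h2 : 3 < a * ‖v‖ := by
        have := (le_max_right _ _).trans_lt hv
        rwa [div_lt_iff₀ ha, mul_comm] at this
      have h3 := hb y hy v
      rw [hc3 _ (by nlinarith [mul_pos ha (one_pos.trans h1)]), zero_smul, smul_zero]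
    · exact ⟨U, hU, hxU, 0, fun y hy v _ => by rw [h y hy, zero_smul]⟩

end cutoff

namespace EForm

variable {m : ℕ} {V : Type} [NormedAddCommGroup V] [NormedSpace ℝ V] [FiniteDimensional ℝ V]
  {S : Set V} {f : V → ℝ} {Ω φ : V → EForm m V}

omit [FiniteDimensional ℝ V] in
theorem real_smul_mul (c : ℝ) (a b : EForm m V) : c • a * b = c • (a * b) := smul_mul_assoc c a b

omit [FiniteDimensional ℝ V] in
theorem covector_smul (c : ℝ) (β : V →ₗ[ℝ] ℝ) : covector m (c • β) = c • covector m β :=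
  map_smul (covectorLin m V) c β

/-- Multiplication from the right as a linear map. -/
noncomputable def mulRightLin (e : EForm m V) : EForm m V →ₗ[ℝ] EForm m V :=
  (mulBilin m V).flip e

omit [FiniteDimensional ℝ V] in
theorem mulRightLin_apply (e a : EForm m V) : mulRightLin e a = a * e := rfl

/-- The localizing kernel. -/
noncomputable def kernel (N : ℕ) (f : V → ℝ) (Ω φ : V → EForm m V) (p : V) : EForm m V := ∑ k ∈ Finset.range N, coef k (f p) • (Ω p ^ k * φ p)

theorem dform_const {S : Set V} {x : V} (hx : x ∈ S) (hS : UniqueDiffOn ℝ S) (c : EForm m V) :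
    dform (fun _ => c) S x = 0 :=
  Finset.sum_eq_zero fun b _ => by rw [vderiv_const c hx hS, mul_zero]

theorem dform_pow {F : V → EForm m V} {x : V} (hF : SmoothNear F S x) (hx : x ∈ S)
    (hS : UniqueDiffOn ℝ S) (he : IsEven (F x)) (hd : dform F S x = 0) (k : ℕ) :
    dform (fun y => F y ^ k) S x = 0 := by
  induction k with
  | zero => simp only [pow_zero]; exact dform_const hx hS 1
  | succ k ih =>
    simp only [pow_succ]
    rw [dform_mul (hF.fpow k) hF hx hS (he.pow k), ih, hd, zero_mul, mul_zero, add_zero]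

/-- The Cartan differential of the kernel. -/
theorem cartan_kernel (hS : UniqueDiffOn ℝ S) {p : V} (hp : p ∈ S) (hfc : CNear f S p) (hΩ : SmoothNear Ω (S) p)
    (hφ : SmoothNear φ (S) p) (he : IsEven (Ω p)) (hdΩ : dform Ω (S) p = 0)
    {Ξ : Fin m → V}
    (hmΩ : momAt Ξ (Ω p) = -covector m (fderivWithin ℝ f (S) p).toLinearMap)
    {ε : EForm m (V)} (hDφ : dform φ (S) p - momAt Ξ (φ p) = -ε) {n : ℕ}
    (hn : Ω p ^ n = 0) :
    dform (kernel (n + 1) f Ω φ) (S) p - momAt Ξ (kernel (n + 1) f Ω φ p) =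
      deriv innerCut (f p) •
        (covector m (fderivWithin ℝ f (S) p).toLinearMap * φ p) -
      ∑ k ∈ Finset.range (n + 1), coef k (f p) • (Ω p ^ k * ε) := by
  set df := fderivWithin ℝ f (S) p with hdf
  have hcf : ∀ k, CNear (fun y => coef k (f y)) (S) p := fun k => hfc.post (contDiff_coef k)
  have hG : ∀ k, SmoothNear (fun y => Ω y ^ k * φ y) (S) p := fun k => (hΩ.fpow k).fmul hφ
  have hd : ∀ k, fderivWithin ℝ (fun y => coef k (f y)) (S) p =
      (-((k + 1 : ℕ) : ℝ) * coef (k + 1) (f p) + if k = 0 then deriv innerCut (f p) else 0) • df := by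
    intro k
    exact ((hasDerivAt_coef k (f p)).comp_hasFDerivWithinAt p
      (hfc.differentiableWithinAt hp).hasFDerivWithinAt).fderivWithin (hS p hp)
  have h1 : dform (kernel (n + 1) f Ω φ) (S) p = ∑ k ∈ Finset.range (n + 1),
      ((-((k + 1 : ℕ) : ℝ) * coef (k + 1) (f p) + if k = 0 then deriv innerCut (f p) else 0) •
        (covector m df.toLinearMap * (Ω p ^ k * φ p)) +
      coef k (f p) • (Ω p ^ k * dform φ (S) p)) := by
    unfold kernel
    rw [dform_sum _ (fun k _ => SmoothNear.smul (hcf k) (hG k)) hp hS]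
    refine Finset.sum_congr rfl fun k _ => ?_
    have e1 := dform_smul (hcf k) (hG k) hp hS
    have e2 := dform_mul (hΩ.fpow k) hφ hp hS (he.pow k)
    have e3 := dform_pow hΩ hp hS he hdΩ k
    rw [e3, zero_mul, zero_add] at e2
    rw [hd, ContinuousLinearMap.toLinearMap_smul, covector_smul, real_smul_mul, e2] at e1
    exact e1
  have h2 : momAt Ξ (kernel (n + 1) f Ω φ p) = ∑ k ∈ Finset.range (n + 1),
      coef k (f p) • (-((k : ℝ) • (covector m df.toLinearMap * (Ω p ^ (k - 1) * φ p))) +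
        Ω p ^ k * momAt Ξ (φ p)) := by
    rw [kernel, ← momLin_apply, map_sum]
    refine Finset.sum_congr rfl fun k _ => ?_
    have e1 := momAt_mul Ξ (he.pow k) (φ p)
    rw [momAt_pow Ξ he hmΩ, neg_mul, real_smul_mul, mul_assoc] at e1
    rw [LinearMap.map_smul, momLin_apply, e1]
  let b : ℕ → EForm m (V) := fun k =>
    ((k : ℝ) * coef k (f p)) • (covector m df.toLinearMap * (Ω p ^ (k - 1) * φ p))
  have h3 : ∑ k ∈ Finset.range (n + 1), (b k - b (k + 1)) = 0 := by
    rw [Finset.sum_range_sub']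
    simp only [b, Nat.add_sub_cancel, hn, zero_mul, mul_zero, smul_zero, Nat.cast_zero, zero_smul,
      sub_zero]
  have h4 : ∑ k ∈ Finset.range (n + 1), (if k = 0 then deriv innerCut (f p) else 0) •
      (covector m df.toLinearMap * (Ω p ^ k * φ p)) =
      deriv innerCut (f p) • (covector m df.toLinearMap * φ p) := by
    rw [Finset.sum_eq_single 0]
    · simp
    · intro k _ hk; rw [if_neg hk, zero_smul]
    · simp
  have h5 : ε = -(dform φ (S) p - momAt Ξ (φ p)) := by rw [hDφ, neg_neg]
  rw [h1, h2, ← Finset.sum_sub_distrib, ← h4, ← Finset.sum_sub_distrib, ← sub_eq_zero,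
    ← Finset.sum_sub_distrib, ← h3]
  refine Finset.sum_congr rfl fun k _ => ?_
  simp only [b, Nat.add_sub_cancel, h5, mul_neg, mul_sub, smul_sub, smul_add, smul_neg, add_smul,
    neg_mul, neg_smul, smul_smul]
  rw [mul_comm (coef k (f p)) (k : ℝ)]
  abel

end EForm

namespace EForm

variable {m : ℕ} {V : Type} [NormedAddCommGroup V] [NormedSpace ℝ V] [FiniteDimensional ℝ V]
  {S : Set V} {r : ℕ} {f : V × Fib r → ℝ} {Ω φ : V × Fib r → EForm m (V × Fib r)}

theorem fibreCompact_kernel (hf : IsFibreQuadratic f S)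
    (hΩ : ∀ p ∈ tube S r, SmoothNear Ω (tube S r) p)
    (hφ : ∀ p : V × Fib r, p.1 ∈ S → p.2 ≠ 0 → SmoothNear φ (tube S r) p) {ψ : V → ℝ}
    (hψ : ∀ x ∈ S, CNear ψ S x)
    (hpos : ∀ x ∈ S, (∀ v, v ≠ 0 → 0 < f (x, v)) ∨ ∃ U, IsOpen U ∧ x ∈ U ∧ ∀ y ∈ U ∩ S, ψ y = 0)
    (N : ℕ) : FibreCompact (fun p => ψ p.1 • kernel N f Ω φ p) S := by
  simp only [kernel, Finset.smul_sum]
  exact FibreCompact.sum _ fun k _ => fibreCompact_cutoff hf (contDiff_coef k)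
    (fun t ht => coef_of_le ht) (fun t ht => coef_of_ge ht)
    (fun p hp hv => ((hΩ p hp).fpow k).fmul (hφ p hp hv)) hψ hpos

theorem fibreCompact_kernel_one (hf : IsFibreQuadratic f S)
    (hΩ : ∀ p ∈ tube S r, SmoothNear Ω (tube S r) p)
    (hφ : ∀ p : V × Fib r, p.1 ∈ S → p.2 ≠ 0 → SmoothNear φ (tube S r) p)
    (hpos : ∀ x ∈ S, ∀ v, v ≠ 0 → 0 < f (x, v)) (N : ℕ) : FibreCompact (kernel N f Ω φ) S := by
  have := fibreCompact_kernel hf hΩ hφ (ψ := fun _ => 1) (fun x _ => CNear.const 1)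
    (fun x hx => Or.inl (hpos x hx)) N
  simpa using this

/-! ### Homogeneity -/

/-- The differential of multiplication by `s` in the fibres. -/
noncomputable abbrev dil (V : Type) [AddCommGroup V] [Module ℝ V] (r : ℕ) (s : ℝ) :
    V × Fib r →ₗ[ℝ] V × Fib r :=
  LinearMap.prodMap LinearMap.id (s • LinearMap.id)

omit [FiniteDimensional ℝ V] in
theorem fibreTop_dil (s : ℝ) (ψ : EForm m (V × Fib r)) :
    TBundle.fibreTop (pull (dil V r s) ψ) = s ^ r • TBundle.fibreTop ψ := by
  rw [fibreTop_pull (dil V r s) LinearMap.id (s • LinearMap.id) (fun _ => rfl)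
    (fun u => by simp), pull_id, LinearMap.det_smul]
  simp

theorem continuousOn_slice {F : V × Fib r → ℝ} {x : V} (hx : x ∈ S)
    (hF : ∀ p : V × Fib r, p.1 ∈ S → p.2 ≠ 0 → CNear F (tube S r) p) :
    ContinuousOn (fun v => F (x, v)) {0}ᶜ := by
  intro v hv
  have h1 := (hF (x, v) hx hv).continuousWithinAt hx
  exact (ContinuousWithinAt.comp (f := fun v : Fib r => (x, v)) (s := {0}ᶜ) h1
    (by fun_prop) fun w _ => hx)

theorem topPow_hom {x : V} (hΩ : ∀ s : ℝ, 0 < s → ∀ v,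
    pull (dil V r s) (Ω (x, s • v)) = s ^ 2 • Ω (x, v)) (k : ℕ) {s : ℝ} (hs : 0 < s) (v : Fib r) :
    s ^ r • TBundle.fibreTop (Ω (x, s • v) ^ k) =
      s ^ (2 * k) • TBundle.fibreTop (Ω (x, v) ^ k) := by
  rw [← fibreTop_dil, pull_pow, hΩ s hs, smul_pow, ← pow_mul, ← fibreTopLin_apply, map_smul,
    fibreTopLin_apply]

/-- The fibre integrals of the powers of `Ω` against the two weights agree. -/
theorem hasVIntegral_topPow (hr : 0 < r) (hf : IsFibreQuadratic f S)
    (hpos : ∀ x ∈ S, ∀ v, v ≠ 0 → 0 < f (x, v))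
    (hΩ : ∀ p ∈ tube S r, SmoothNear Ω (tube S r) p)
    (hom : ∀ x ∈ S, ∀ s : ℝ, 0 < s → ∀ v, pull (dil V r s) (Ω (x, s • v)) = s ^ 2 • Ω (x, v))
    {x : V} (hx : x ∈ S) (k : ℕ) :
    ∃ y : EForm m V,
      HasVIntegral volume (fun v => coef k (f (x, v)) • TBundle.fibreTop (Ω (x, v) ^ k)) y ∧
      HasVIntegral volume (fun v => (Real.exp (-f (x, v)) * (k.factorial : ℝ)⁻¹) •
        TBundle.fibreTop (Ω (x, v) ^ k)) y := by
  cases k with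
  | zero =>
    refine ⟨0, ?_⟩
    have : TBundle.fibreTop (1 : EForm m (V × Fib r)) = 0 := by
      rw [← pull_real_one (LinearMap.fst ℝ V (Fib r)), fibreTop_pull_fst hr]
    simp only [pow_zero, this, smul_zero]
    exact ⟨HasVIntegral.zero, HasVIntegral.zero⟩
  | succ k =>
    have hF : FibreCompact (fun p => (1 : ℝ) • coef (k + 1) (f p) • Ω p ^ (k + 1)) S :=
      fibreCompact_cutoff (ψ := fun _ => 1) hf (contDiff_coef (k + 1)) (fun t ht => coef_of_le ht)
        (fun t ht => coef_of_ge ht) (fun p hp hv => (hΩ p hp).fpow (k + 1))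
        (fun x _ => CNear.const 1) (fun x hx => Or.inl (hpos x hx))
    have h1 := hasVIntegral_fpush hF hx
    simp only [one_smul] at h1
    have h1 : HasVIntegral volume
        (fun v => coef (k + 1) (f (x, v)) • TBundle.fibreTop (Ω (x, v) ^ (k + 1)))
        (fpush (fun p => coef (k + 1) (f p) • Ω p ^ (k + 1)) x) := by
      simpa only [← fibreTopLin_apply, map_smul] using h1
    refine ⟨_, h1, fun L => ?_⟩
    obtain ⟨n, rfl⟩ : ∃ n, r = n + 1 := ⟨r - 1, by omega⟩
    have hΦc : ContinuousOn (fun v => L (TBundle.fibreTop (Ω (x, v) ^ (k + 1)))) {0}ᶜ := by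
      refine continuousOn_slice (F := fun p => L (TBundle.fibreTop (Ω p ^ (k + 1)))) hx fun p hp _ => ?_
      have := (((hΩ p hp).fpow (k + 1)).lin (fibreTopLin m V (n + 1))).functional L
      simpa only [fibreTopLin_apply] using this
    have hΦh : ∀ s : ℝ, 0 < s → ∀ v : Fib (n + 1), v ≠ 0 →
        s ^ (n + 1) * L (TBundle.fibreTop (Ω (x, s • v) ^ (k + 1))) =
          s ^ (2 * (k + 1)) * L (TBundle.fibreTop (Ω (x, v) ^ (k + 1))) := by
      intro s hs v _
      rw [← smul_eq_mul, ← map_smul, topPow_hom (hom x hx) (k + 1) hs, map_smul, smul_eq_mul]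
    have hQc : ContinuousOn (fun v => f (x, v)) {0}ᶜ :=
      (slice_contDiff hf.contDiffOn hx).continuous.continuousOn
    have key := fun (g : ℝ → ℝ) (hg : Continuous g) hgi => integral_homogeneous (k := k) hΦc hΦh hQc
      (fun s hs v _ => hf.hom x hx s hs v) (hpos x hx) (g := g) hg hgi
    have e1 := key (weight (k + 1)) (contDiff_weight _).continuous
      (integrableOn_of_vanishing (contDiff_weight _).continuous
        (fun t ht => weight_of_ge_three ht) k).1
    have e2 := key (fun t => Real.exp (-t) * ((k + 1).factorial : ℝ)⁻¹) (by fun_prop)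
      (integral_exp_weight k).1
    rw [integral_weight] at e1
    rw [(integral_exp_weight k).2] at e2
    simp only [map_smul, smul_eq_mul]
    refine ⟨e2.1, e2.2.trans (e1.2.symm.trans ?_)⟩
    rw [← (h1 L).2]
    simp only [map_smul, smul_eq_mul, coef_succ]

/-- The fibre integral of the derivative of the inner cutoff against an angular form. -/
theorem hasVIntegral_angular (hS : UniqueDiffOn ℝ S) (hr : 0 < r) (hf : IsFibreQuadratic f S)
    (hpos : ∀ x ∈ S, ∀ v, v ≠ 0 → 0 < f (x, v))
    (hφ : ∀ p : V × Fib r, p.1 ∈ S → p.2 ≠ 0 → SmoothNear φ (tube S r) p)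
    (hdil : ∀ x ∈ S, ∀ s : ℝ, 0 < s → ∀ v, v ≠ 0 → pull (dil V r s) (φ (x, s • v)) = φ (x, v))
    (hrad : ∀ x ∈ S, ∀ v, v ≠ 0 → contract ((0, v) : V × Fib r) (φ (x, v)) = 0)
    {x : V} (hx : x ∈ S) {y : EForm m V}
    (hy : HasVIntegral (volume : Measure (Fib r)).toSphere
      (fun v : Metric.sphere (0 : Fib r) 1 =>
        TBundle.fibreTop (covector m (TBundle.radialCovector V v.1) * φ (x, v.1))) y) :
    HasVIntegral volume (fun v => deriv innerCut (f (x, v)) • TBundle.fibreTop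
      (covector m (fderivWithin ℝ f (tube S r) (x, v)).toLinearMap * φ (x, v))) y := by
  obtain ⟨n, rfl⟩ : ∃ n, r = n + 1 := ⟨r - 1, by omega⟩
  have hU := uniqueDiffOn_over (r := n + 1) hS
  have hsphere : ∀ v : Metric.sphere (0 : Fib (n + 1)) 1, TBundle.fibreTop
      (covector m (fderivWithin ℝ f (tube S (n + 1)) (x, v.1)).toLinearMap * φ (x, v.1)) =
      (2 * f (x, v.1)) •
        TBundle.fibreTop (covector m (TBundle.radialCovector V v.1) * φ (x, v.1)) := by
    intro v
    have hv1 : ‖v.1‖ = 1 := by simp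
    have hv0 : v.1 ≠ 0 := fun h => by rw [h] at hv1; simp at hv1
    have h0 := hrad x hx v.1 hv0
    rw [← sub_eq_zero, ← fibreTopLin_apply, ← fibreTopLin_apply, ← map_smul, ← map_sub,
      fibreTopLin_apply]
    refine fibreTop_eq_zero v.1 hv0 _ ?_
    rw [← contractBilin_apply, map_sub, map_smul, contractBilin_apply, contractBilin_apply,
      contract_covector_mul, contract_covector_mul, h0, mul_zero, mul_zero, sub_zero, sub_zero]
    have h1 : TBundle.radialCovector V v.1 ((0, v.1) : V × Fib (n + 1)) = 1 := by
      simp [TBundle.radialCovector]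
    have h2 : (fderivWithin ℝ f (tube S (n + 1)) (x, v.1)).toLinearMap ((0, v.1) : V × Fib (n + 1)) =
        2 * f (x, v.1) := hf.euler hx v.1
    rw [h1, h2, one_smul, sub_self]
  have hdf : ∀ s : ℝ, 0 < s → ∀ v, (fderivWithin ℝ f (tube S (n + 1)) (x, s • v)).toLinearMap ∘ₗ
      dil V (n + 1) s = s ^ 2 • (fderivWithin ℝ f (tube S (n + 1)) (x, v)).toLinearMap := by
    intro s hs v
    let A : V × Fib (n + 1) →L[ℝ] V × Fib (n + 1) :=
      (ContinuousLinearMap.fst ℝ V _).prod (s • ContinuousLinearMap.snd ℝ V _)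
    have h1 : HasFDerivWithinAt f (fderivWithin ℝ f (tube S (n + 1)) (x, s • v)) (tube S (n + 1))
        (A (x, v)) := ((hf.smooth (x, s • v) hx).differentiableWithinAt hx).hasFDerivWithinAt
    have h2 := h1.comp (x, v) (A.hasFDerivAt.hasFDerivWithinAt (s := tube S (n + 1)))
      (fun p hp => hp)
    have h3 := (((hf.smooth (x, v) hx).differentiableWithinAt hx).hasFDerivWithinAt).const_mul (s ^ 2)
    have h4 := h2.congr (f₁ := fun p => s ^ 2 * f p)
      (fun p hp => (hf.hom p.1 hp s hs p.2).symm)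
      (hf.hom x hx s hs v).symm
    have h5 := (hU (x, v) hx).eq h4 h3
    exact congrArg (fun B => B.toLinearMap) h5
  intro L
  set Φ : Fib (n + 1) → ℝ := fun v => L (TBundle.fibreTop
    (covector m (fderivWithin ℝ f (tube S (n + 1)) (x, v)).toLinearMap * φ (x, v))) with hΦ
  have hΦc : ContinuousOn Φ {0}ᶜ := by
    refine continuousOn_slice (F := fun p => L (TBundle.fibreTop
      (covector m (fderivWithin ℝ f (tube S (n + 1)) p).toLinearMap * φ p))) hx fun p hp hv => ?_
    have h1 : SmoothNear (fderivWithin ℝ f (tube S (n + 1))) (tube S (n + 1)) p :=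
      SmoothNear.of_cnear ((hf.smooth p hp).fderivWithin hU)
    have h2 := h1.lin (covectorLin m (V × Fib (n + 1)) ∘ₗ ContinuousLinearMap.coeLM ℝ)
    have h3 := ((h2.fmul (hφ p hp hv)).lin (fibreTopLin m V (n + 1))).functional L
    simp only [fibreTopLin_apply] at h3
    exact h3
  have hΦh : ∀ s : ℝ, 0 < s → ∀ v : Fib (n + 1), v ≠ 0 →
      s ^ (n + 1) * Φ (s • v) = s ^ (2 * (0 + 1)) * Φ v := by
    intro s hs v hv
    simp only [hΦ]
    rw [← smul_eq_mul, ← map_smul, ← fibreTop_dil, pull_mul, pull_covector, hdf s hs,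
      hdil x hx s hs v hv, ← covectorLin_apply, map_smul, smul_mul_assoc, ← fibreTopLin_apply,
      map_smul, map_smul, smul_eq_mul, fibreTopLin_apply, covectorLin_apply]
  have hQc : ContinuousOn (fun v => f (x, v)) {0}ᶜ :=
    (slice_contDiff hf.contDiffOn hx).continuous.continuousOn
  have key := integral_homogeneous (k := 0) hΦc hΦh hQc
      (fun s hs v _ => hf.hom x hx s hs v) (hpos x hx) continuous_deriv_innerCut
      integral_deriv_innerCut.1
  simp only [map_smul, smul_eq_mul]
  refine ⟨key.1, key.2.trans ?_⟩
  rw [integral_deriv_innerCut.2, ← (hy L).2, ← integral_mul_const]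
  refine integral_congr_ae (Eventually.of_forall fun v => ?_)
  have hv0 : v.1 ≠ 0 := fun h => by
    have hv1 : ‖v.1‖ = 1 := by simp
    rw [h] at hv1; simp at hv1
  have h1 := (hpos x hx v.1 hv0).ne'
  simp only [hΦ, hsphere v, map_smul, smul_eq_mul, zero_add, pow_one]
  field_simp

set_option maxHeartbeats 1000000 in
/-- The fibre integral of the kernel is a primitive of the difference of `1` and the product of
the Segre form with the Euler form. -/
theorem cartan_fpush_kernel (hS : GoodSet S) (hconv : LocallyConvexSet S) (hr : 0 < r)
    (hf : IsFibreQuadratic f S) (hpos : ∀ x ∈ S, ∀ v, v ≠ 0 → 0 < f (x, v))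
    (hΩ : ∀ p ∈ tube S r, SmoothNear Ω (tube S r) p)
    (hom : ∀ x ∈ S, ∀ s : ℝ, 0 < s → ∀ v, pull (dil V r s) (Ω (x, s • v)) = s ^ 2 • Ω (x, v))
    (he : ∀ p ∈ tube S r, IsEven (Ω p)) (hdΩ : ∀ p ∈ tube S r, dform Ω (tube S r) p = 0)
    {Ξ : V × Fib r → Fin m → V × Fib r} {ξ : V → Fin m → V} (hΞ : ∀ p j, (Ξ p j).1 = ξ p.1 j)
    (hmΩ : ∀ p ∈ tube S r,
      momAt (Ξ p) (Ω p) = -covector m (fderivWithin ℝ f (tube S r) p).toLinearMap)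
    (hφ : ∀ p : V × Fib r, p.1 ∈ S → p.2 ≠ 0 → SmoothNear φ (tube S r) p)
    (hdil : ∀ x ∈ S, ∀ s : ℝ, 0 < s → ∀ v, v ≠ 0 → pull (dil V r s) (φ (x, s • v)) = φ (x, v))
    (hrad : ∀ x ∈ S, ∀ v, v ≠ 0 → contract ((0, v) : V × Fib r) (φ (x, v)) = 0)
    {e : V → EForm m V} (hDφ : ∀ p : V × Fib r, p.1 ∈ S → p.2 ≠ 0 →
      dform φ (tube S r) p - momAt (Ξ p) (φ p) = -pull (LinearMap.fst ℝ V (Fib r)) (e p.1))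
    {x : V} (hx : x ∈ S) (hy : HasVIntegral (volume : Measure (Fib r)).toSphere
      (fun v : Metric.sphere (0 : Fib r) 1 =>
        TBundle.fibreTop (covector m (TBundle.radialCovector V v.1) * φ (x, v.1))) 1)
    {n : ℕ} (hn : ∀ p ∈ tube S r, Ω p ^ n = 0) :
    ∃ σ : EForm m V, HasVIntegral volume (fun v => TBundle.fibreTop (Real.exp (-f (x, v)) •
        ∑ k ∈ Finset.range n, (k.factorial : ℝ)⁻¹ • Ω (x, v) ^ k)) σ ∧
      dform (fpush (kernel (n + 1) f Ω φ)) S x - momAt (ξ x) (fpush (kernel (n + 1) f Ω φ) x) =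
        (-1 : ℝ) ^ r • (1 - σ * e x) := by
  have hU := hS.uniqueDiffOn
  have hUT := uniqueDiffOn_over (r := r) hU
  have hK := fibreCompact_kernel_one hf hΩ hφ hpos (n + 1)
  choose y hy1 hy2 using fun k => hasVIntegral_topPow hr hf hpos hΩ hom hx k
  have hyn : y n = 0 := by
    refine (hy1 n).unique ?_
    refine HasVIntegral.zero.congr (Eventually.of_forall fun v => ?_)
    simp only [hn (x, v) hx]
    rw [← fibreTopLin_apply, map_zero, smul_zero]
  refine ⟨∑ k ∈ Finset.range n, y k, ?_, ?_⟩
  · refine (HasVIntegral.sum (Finset.range n) fun k _ => hy2 k).congr (Eventually.of_forall fun v => ?_)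
    simp only [← fibreTopLin_apply, map_smul, map_sum, Finset.smul_sum, smul_smul]
  · have h1 := hasVIntegral_dform hK hU hconv hx
    have h2 : HasVIntegral volume (fun v => TBundle.fibreTop (momAt (Ξ (x, v))
        (kernel (n + 1) f Ω φ (x, v)))) ((-1 : ℝ) ^ r • momAt (ξ x) (fpush (kernel (n + 1) f Ω φ) x)) := by
      have := (hasVIntegral_fpush hK hx).map ((-1 : ℝ) ^ r • momLin (ξ x))
      refine this.congr (Eventually.of_forall fun v => ?_)
      simp only [fibreTop_momAt, hΞ]
      rfl
    have h3 : HasVIntegral volume (fun v => TBundle.fibreTop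
        (dform (kernel (n + 1) f Ω φ) (tube S r) (x, v) -
          momAt (Ξ (x, v)) (kernel (n + 1) f Ω φ (x, v))))
        ((-1 : ℝ) ^ r • (dform (fpush (kernel (n + 1) f Ω φ)) S x -
          momAt (ξ x) (fpush (kernel (n + 1) f Ω φ) x))) := by
      rw [smul_sub]
      refine (h1.sub h2).congr (Eventually.of_forall fun v => ?_)
      simp only [← fibreTopLin_apply, map_sub]
    have h4 := (hasVIntegral_angular hU hr hf hpos hφ hdil hrad hx hy).sub
      ((HasVIntegral.sum (Finset.range (n + 1)) fun k _ => hy1 k).map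
        (mulRightLin (e x)))
    have h5 : HasVIntegral (M := EForm m V) volume (fun v => TBundle.fibreTop
        (dform (kernel (n + 1) f Ω φ) (tube S r) (x, v) -
          momAt (Ξ (x, v)) (kernel (n + 1) f Ω φ (x, v))))
        ((1 : EForm m V) - (∑ k ∈ Finset.range n, y k) * e x) := by
      have e1 : (1 : EForm m V) - mulRightLin (e x) (∑ k ∈ Finset.range (n + 1), y k) =
          1 - (∑ k ∈ Finset.range n, y k) * e x := by
        rw [Finset.sum_range_succ, hyn, add_zero, mulRightLin_apply]
      rw [← e1]
      refine h4.congr ?_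
      obtain ⟨r', rfl⟩ : ∃ r', r = r' + 1 := ⟨r - 1, by omega⟩
      filter_upwards [compl_mem_ae_iff.mpr (measure_singleton (0 : Fib (r' + 1)))] with v hv
      have hv : v ≠ 0 := hv
      have hxv : (x, v) ∈ tube S (r' + 1) := hx
      rw [cartan_kernel hUT hxv (hf.smooth _ hxv) (hΩ _ hxv) (hφ _ hx hv) (he _ hxv) (hdΩ _ hxv) (hmΩ _ hxv)
        (hDφ _ hx hv) (hn _ hxv), ← fibreTopLin_apply, map_sub, map_smul, map_sum,
        fibreTopLin_apply, mulRightLin_apply, Finset.sum_mul]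
      congr 1
      refine Finset.sum_congr rfl fun k _ => ?_
      rw [map_smul, fibreTopLin_apply, fibreTop_mul_pull_fst, real_smul_mul]
    have h6 := h3.unique h5
    rw [← h6, smul_smul, ← mul_pow]
    simp

end EForm

end

section

namespace EForm

section flow

variable {m : ℕ} {V : Type} [NormedAddCommGroup V] [NormedSpace ℝ V] [FiniteDimensional ℝ V]
  {S : Set V} {x : V}

theorem _root_.GoodSet.snd_preimage {W : Type*} [NormedAddCommGroup W] [NormedSpace ℝ W]
    (hS : GoodSet S) : GoodSet {p : W × V | p.2 ∈ S} := by
  have h : {p : W × V | p.2 ∈ S} = Set.univ ×ˢ S := by ext p; simp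
  rw [h]
  exact ⟨uniqueDiffOn_univ.prod hS.uniqueDiffOn, by
    rw [interior_prod_eq, interior_univ, closure_prod_eq, closure_univ]
    exact Set.prod_mono_right hS.subset_closure⟩

omit [FiniteDimensional ℝ V] in
theorem form_sub_sub_cancel (a b : EForm m V) : a - b - a = -b := by abel

omit [FiniteDimensional ℝ V] in
theorem sum_smul_neg_one (γ : Fin m → V →ₗ[ℝ] EqRing m) :
    ∑ j, lam j • -(one (γ j) : EForm m V) = -one (∑ j, lam j • γ j) := by
  have h : (one (∑ j, lam j • γ j) : EForm m V) = ∑ j, lam j • one (γ j) := by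
    have := map_sum (ExteriorAlgebra.ι (EqRing m)) (fun j => lam j • γ j) Finset.univ
    refine this.trans (Finset.sum_congr rfl fun j _ => LinearMap.map_smul _ _ _)
  rw [h, ← Finset.sum_neg_distrib]
  exact Finset.sum_congr rfl fun j _ => form_smul_neg _ _

/-- Cartan's formula for a one-form invariant under a flow. -/
theorem vderiv_flow_invariant (hS : GoodSet S) (hx : x ∈ S) {Θ : (Fin m → ℝ) × V → V}
    {O : Set ((Fin m → ℝ) × V)} (hO : IsOpen O) (hxO : (0, x) ∈ O)
    (hΘ : ContDiffOn ℝ ∞ Θ (O ∩ {p | p.2 ∈ S})) (hmaps : ∀ p ∈ O ∩ {p | p.2 ∈ S}, Θ p ∈ S)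
    (h0 : Θ (0, x) = x) {β : V → V →ₗ[ℝ] EqRing m} (hβ : SmoothNear β S x) {g : V → EqRing m}
    (hg : SmoothNear g S x) {τ : (Fin m → ℝ)}
    (hβx : ∀ p ∈ O ∩ {p | p.2 ∈ S}, ∀ u, β (Θ p) (fderivWithin ℝ Θ {p | p.2 ∈ S} p (0, u)) = β p.2 u)
    (hβτ : ∀ p ∈ O ∩ {p | p.2 ∈ S}, β (Θ p) (fderivWithin ℝ Θ {p | p.2 ∈ S} p (τ, 0)) = g p.2)
    {w : V} (hτ0 : fderivWithin ℝ Θ {p | p.2 ∈ S} (0, x) (τ, 0) = w)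
    (hx0 : ∀ u, fderivWithin ℝ Θ {p | p.2 ∈ S} (0, x) (0, u) = u) (u : V) :
    vderiv β S x w u = vderiv β S x u w - vderiv g S x u := by
  set T : Set ((Fin m → ℝ) × V) := {p | p.2 ∈ S} with hT
  have hGT : GoodSet T := hS.snd_preimage
  have hU := hGT.uniqueDiffOn
  have hxT : ((0 : Fin m → ℝ), x) ∈ T := hx
  have hΘn : CNear Θ T (0, x) := ⟨O, hO, hxO, hΘ⟩
  have hdΘ := hΘn.fderivWithin hU
  have hsΘ : ∀ e, SmoothNear (fun p => fderivWithin ℝ Θ T p e) T (0, x) := fun e =>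
    SmoothNear.of_cnear (hdΘ.clm_apply (CNear.const e))
  have hβΘ : SmoothNear (fun p => β (Θ p)) T (0, x) :=
    SmoothNear.comp hΘn hxT (by rw [h0]; exact hβ) hO hxO hmaps
  have hvΘ : ∀ e, vderiv (fun p => β (Θ p)) T (0, x) e = vderiv β S x (fderivWithin ℝ Θ T (0, x) e) := by
    intro e
    have := vderiv_comp hΘn hxT hU hS.uniqueDiffOn (F := β) (by rw [h0]; exact hβ) hO hxO hmaps e
    rw [this, h0]
  have hnear : ∀ᶠ p in 𝓝[T] (0, x), p ∈ O ∩ T := by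
    filter_upwards [self_mem_nhdsWithin, mem_nhdsWithin_of_mem_nhds (hO.mem_nhds hxO)] with p a b
    exact ⟨b, a⟩
  -- derivative in the direction of the flow
  have h1 : vderiv (fun p => β (Θ p) (fderivWithin ℝ Θ T p (0, u))) T (0, x) (τ, 0) = 0 := by
    have hc : (fun p => β (Θ p) (fderivWithin ℝ Θ T p (0, u))) =ᶠ[𝓝[T] (0, x)] fun p => β p.2 u :=
      hnear.mono fun p hp => hβx p hp u
    rw [vderiv_congr hxT hc]
    have h2 := vderiv_comp (Θ := fun p : (Fin m → ℝ) × V => p.2) (S := T) (T := S) (x := (0, x))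
      (CNear.of_contDiff contDiff_snd) hxT hU hS.uniqueDiffOn (F := fun y => β y u)
      (hβ.lin (LinearMap.applyₗ u)) isOpen_univ trivial (fun y hy => hy.2) (τ, 0)
    rw [h2, fderivWithin_snd (hU _ hxT)]
    have h3 := vderiv_lin (LinearMap.applyₗ (R := ℝ) (M₂ := EqRing m) u) hβ hx hS.uniqueDiffOn 0
    simp only [LinearMap.applyₗ_apply_apply] at h3
    change vderiv (fun y => β y u) S x 0 = 0
    have h4 : vderiv β S x 0 = 0 := map_zero (vderivLin β hβ hx hS.uniqueDiffOn)
    rw [h3, h4, LinearMap.zero_apply]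
  have h4 : vderiv (fun p => β (Θ p) (fderivWithin ℝ Θ T p (τ, 0))) T (0, x) (0, u) =
      vderiv g S x u := by
    have hc : (fun p => β (Θ p) (fderivWithin ℝ Θ T p (τ, 0))) =ᶠ[𝓝[T] (0, x)] fun p => g p.2 :=
      hnear.mono fun p hp => hβτ p hp
    rw [vderiv_congr hxT hc]
    have h2 := vderiv_comp (Θ := fun p : (Fin m → ℝ) × V => p.2) (S := T) (T := S) (x := (0, x))
      (CNear.of_contDiff contDiff_snd) hxT hU hS.uniqueDiffOn (F := g)
      hg isOpen_univ trivial (fun y hy => hy.2) (0, u)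
    rw [h2, fderivWithin_snd (hU _ hxT)]
    rfl
  have h5 := vderiv_bilin (evalBilin m V) hβΘ (hsΘ (0, u)) hxT hU (τ, 0)
  have h6 := vderiv_bilin (evalBilin m V) hβΘ (hsΘ (τ, 0)) hxT hU (0, u)
  have hsym := vderiv_symm (SmoothNear.of_cnear hΘn) hxT hGT (0, u) (τ, 0)
  have hv : ∀ e, ∀ p ∈ O ∩ T, vderiv Θ T p e = fderivWithin ℝ Θ T p e := fun e p hp =>
    vderiv_cnear ⟨O, hO, hp.1, hΘ⟩ hp.2 hU e
  rw [vderiv_congr hxT (hnear.mono fun p hp => hv (0, u) p hp),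
    vderiv_congr hxT (hnear.mono fun p hp => hv (τ, 0) p hp)] at hsym
  simp only [evalBilin, LinearMap.id_apply, hvΘ, hτ0, hx0, h0] at h5 h6
  rw [h1] at h5
  rw [h4, ← hsym] at h6
  rw [h6, eq_neg_of_add_eq_zero_left h5.symm]
  abel

/-- The moment of the exterior derivative of an invariant one-form. -/
theorem momAt_dform_one (hS : GoodSet S) (hx : x ∈ S) {Θ : (Fin m → ℝ) × V → V}
    {O : Set ((Fin m → ℝ) × V)} (hO : IsOpen O) (hxO : (0, x) ∈ O)
    (hΘ : ContDiffOn ℝ ∞ Θ (O ∩ {p | p.2 ∈ S})) (hmaps : ∀ p ∈ O ∩ {p | p.2 ∈ S}, Θ p ∈ S)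
    (h0 : Θ (0, x) = x) {β : V → V →ₗ[ℝ] EqRing m} (hβ : SmoothNear β S x) {ξ : V → Fin m → V}
    (hξ : ∀ j, CNear (fun y => ξ y j) S x)
    (hβx : ∀ p ∈ O ∩ {p | p.2 ∈ S}, ∀ u, β (Θ p) (fderivWithin ℝ Θ {p | p.2 ∈ S} p (0, u)) = β p.2 u)
    (hβτ : ∀ p ∈ O ∩ {p | p.2 ∈ S}, ∀ j,
      β (Θ p) (fderivWithin ℝ Θ {p | p.2 ∈ S} p (Pi.single j 1, 0)) = β p.2 (ξ p.2 j))
    (hτ0 : ∀ j, fderivWithin ℝ Θ {p | p.2 ∈ S} (0, x) (Pi.single j 1, 0) = ξ x j)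
    (hx0 : ∀ u, fderivWithin ℝ Θ {p | p.2 ∈ S} (0, x) (0, u) = u) {f : V → ℝ} (hf : CNear f S x)
    (hfβ : ∀ y ∈ S, ∑ j, lam j * β y (ξ y j) = algebraMap ℝ (EqRing m) (f y)) :
    momAt (ξ x) (dform (fun y => one (β y)) S x) = -covector m (fderivWithin ℝ f S x).toLinearMap := by
  have hU := hS.uniqueDiffOn
  have hg : ∀ j, SmoothNear (fun y => β y (ξ y j)) S x := fun j =>
    hβ.bilin (evalBilin m V) (SmoothNear.of_cnear (hξ j))
  have hflow : ∀ j u, vderiv β S x (ξ x j) u =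
      vderiv β S x u (ξ x j) - vderiv (fun y => β y (ξ y j)) S x u := fun j u =>
    vderiv_flow_invariant hS hx hO hxO hΘ hmaps h0 hβ (hg j) hβx (fun p hp => hβτ p hp j) (hτ0 j) hx0 u
  have hsum : ∀ u, ∑ j, lam j * vderiv (fun y => β y (ξ y j)) S x u =
      algebraMap ℝ (EqRing m) (fderivWithin ℝ f S x u) := by
    intro u
    have h1 : ∀ j, vderiv (fun y => lam j * β y (ξ y j)) S x u =
        lam j * vderiv (fun y => β y (ξ y j)) S x u := fun j =>
      vderiv_lin (LinearMap.mulLeft ℝ (lam j)) (hg j) hx hU u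
    simp only [← h1]
    have h2 := vderiv_sum (F := fun j y => lam j * β y (ξ y j)) Finset.univ
      (fun j _ => (hg j).lin (LinearMap.mulLeft ℝ (lam j))) hx hU u
    rw [← h2, vderiv_congr (F := fun y => Algebra.linearMap ℝ (EqRing m) (f y)) hx
        (eventually_nhdsWithin_of_forall hfβ), vderiv_lin _ (SmoothNear.self hf) hx hU,
      vderiv_real hf hx hU]
    rfl
  have hbasis : ∀ j, contract (ξ x j) (dform (fun y => one (β y)) S x) =
      one (vderiv β S x (ξ x j)) - ∑ b, covector m ((Module.finBasis ℝ V).coord b) *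
        algebraMap (EqRing m) (EForm m V) (vderiv β S x (Module.finBasis ℝ V b) (ξ x j)) := by
    intro j
    rw [dform_one hβ hx hU]
    have h1 := map_sum (contractBilin m V (ξ x j)) (fun b => covector m ((Module.finBasis ℝ V).coord b) *
        one (vderiv β S x (Module.finBasis ℝ V b))) Finset.univ
    refine h1.trans ?_
    have h2 : ∀ b, contractBilin m V (ξ x j) (covector m ((Module.finBasis ℝ V).coord b) *
        one (vderiv β S x (Module.finBasis ℝ V b))) =
        (Module.finBasis ℝ V).coord b (ξ x j) • oneLin m V (vderiv β S x (Module.finBasis ℝ V b)) -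
        covector m ((Module.finBasis ℝ V).coord b) *
        algebraMap (EqRing m) (EForm m V) (vderiv β S x (Module.finBasis ℝ V b) (ξ x j)) := fun b => by
      change contract _ _ = _
      rw [contract_covector_mul, contract_one]; rfl
    rw [Finset.sum_congr rfl fun b _ => h2 b, Finset.sum_sub_distrib]
    congr 1
    rw [← oneLin_apply]
    have h3 : vderiv β S x (ξ x j) = ∑ b, (Module.finBasis ℝ V).coord b (ξ x j) •
        vderiv β S x (Module.finBasis ℝ V b) := by
      conv_lhs => rw [← (Module.finBasis ℝ V).sum_repr (ξ x j)]
      exact (map_sum (vderivLin β hβ hx hU) _ _).trans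
        (Finset.sum_congr rfl fun b _ => map_smul (vderivLin β hβ hx hU) _ _)
    rw [h3, map_sum]
    simp only [map_smul]
  have hone : ∀ γ : V →ₗ[ℝ] EqRing m, ∑ b, covector m ((Module.finBasis ℝ V).coord b) *
      algebraMap (EqRing m) (EForm m V) (γ (Module.finBasis ℝ V b)) = one γ := by
    intro γ
    have h1 : ∀ b, covector m ((Module.finBasis ℝ V).coord b) *
        algebraMap (EqRing m) (EForm m V) (γ (Module.finBasis ℝ V b)) =
        ExteriorAlgebra.ι (EqRing m) (γ (Module.finBasis ℝ V b) •
          ((Algebra.linearMap ℝ (EqRing m)) ∘ₗ (Module.finBasis ℝ V).coord b)) := fun b => by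
      rw [LinearMap.map_smul, ← Algebra.commutes, ← Algebra.smul_def]
      rfl
    rw [Finset.sum_congr rfl fun b _ => h1 b, ← map_sum]
    refine congrArg (ExteriorAlgebra.ι (EqRing m)) ((Module.finBasis ℝ V).ext fun b => ?_)
    rw [LinearMap.sum_apply, Finset.sum_eq_single b]
    · simp
    · intro c _ hc
      simp [hc.symm]
    · simp
  have h7 : ∀ j, contract (ξ x j) (dform (fun y => one (β y)) S x) =
      -one ((vderivLin (fun y => β y (ξ y j)) (hg j) hx hU)) := by
    intro j
    have e1 : vderiv β S x (ξ x j) = ((vderivLin β hβ hx hU).flip (ξ x j)) -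
        vderivLin (fun y => β y (ξ y j)) (hg j) hx hU := LinearMap.ext fun u => hflow j u
    have e2 := hone ((vderivLin β hβ hx hU).flip (ξ x j))
    have e4 : ∀ γ δ : V →ₗ[ℝ] EqRing m, (one (γ - δ) : EForm m V) = one γ - one δ := fun γ δ =>
      map_sub (ExteriorAlgebra.ι (EqRing m)) γ δ
    refine (hbasis j).trans ?_
    rw [e1, e4, ← e2]
    exact form_sub_sub_cancel _ _
  unfold momAt
  simp only [h7]
  rw [sum_smul_neg_one]
  refine congrArg (fun γ => -ExteriorAlgebra.ι (EqRing m) γ) (LinearMap.ext fun u => ?_)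
  rw [LinearMap.sum_apply]
  exact hsum u

end flow

end EForm

end

section

variable {m : ℕ} {X : TGroupoid m}

namespace TGroupoid

/-- Arrows depending continuously on a parameter are determined by their weights and sources. -/
theorem IsOrbifold.eventually_eq (hX : X.IsOrbifold) {P : Type*} [TopologicalSpace P] {S : Set P}
    {p : P} (hp : p ∈ S) {L L' : P → X.Arr} (hL : ContinuousWithinAt L S p) (hL' : ContinuousWithinAt L' S p)
    (h0 : L p = L' p)
    (h : ∀ᶠ q in 𝓝[S] p, (X.wt (L q).2, (L q).1.1) = (X.wt (L' q).2, (L' q).1.1)) :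
    ∀ᶠ q in 𝓝[S] p, L q = L' q := by
  obtain ⟨f, hf, hfe⟩ := hX.etale (L p)
  have h1 := hL.eventually (f.open_source.mem_nhds hf)
  have h2 := hL'.eventually (f.open_source.mem_nhds (h0 ▸ hf))
  filter_upwards [h, h1, h2] with q hq h1 h2
  refine f.injOn h1 h2 ?_
  rw [← hfe]
  exact hq

theorem arr_ext {x y y' : X.Obj} {a : x ⟶ y} {a' : x ⟶ y'}
    (h : (⟨(x, y), a⟩ : X.Arr) = ⟨(x, y'), a'⟩) : y = y' := by
  have := congrArg (fun c : X.Arr => c.1.2) h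
  exact this

theorem pt_eq {i : X.ι} {u v : X.V i} {hu : u ∈ X.dom i} {hv : v ∈ X.dom i}
    (h : (⟨i, u, hu⟩ : X.Obj) = ⟨i, v, hv⟩) : u = v := by
  rw [ChartSystem.Obj.mk.injEq] at h
  exact eq_of_heq h.2

theorem arr_cases {i k : X.ι} {u u' : X.V i} {v v' : X.V k} {hu : u ∈ X.dom i} {hu' : u' ∈ X.dom i}
    {hv : v ∈ X.dom k} {hv' : v' ∈ X.dom k} {b : (⟨i, u, hu⟩ : X.Obj) ⟶ ⟨k, v, hv⟩}
    {c : (⟨i, u', hu'⟩ : X.Obj) ⟶ ⟨k, v', hv'⟩}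
    (h : (⟨(⟨i, u, hu⟩, ⟨k, v, hv⟩), b⟩ : X.Arr) = ⟨(⟨i, u', hu'⟩, ⟨k, v', hv'⟩), c⟩) :
    u = u' ∧ v = v' ∧ HEq b c := by
  rw [Sigma.mk.injEq, Prod.mk.injEq] at h
  exact ⟨pt_eq h.1.1, pt_eq h.1.2, h.2⟩

theorem jac_congr {i k : X.ι} {u u' : X.V i} {v v' : X.V k} {hu : u ∈ X.dom i} {hu' : u' ∈ X.dom i}
    {hv : v ∈ X.dom k} {hv' : v' ∈ X.dom k} {b : (⟨i, u, hu⟩ : X.Obj) ⟶ ⟨k, v, hv⟩}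
    {c : (⟨i, u', hu'⟩ : X.Obj) ⟶ ⟨k, v', hv'⟩}
    (h : (⟨(⟨i, u, hu⟩, ⟨k, v, hv⟩), b⟩ : X.Arr) = ⟨(⟨i, u', hu'⟩, ⟨k, v', hv'⟩), c⟩) :
    (X.jac b : X.V i →L[ℝ] X.V k) = X.jac c := by
  obtain ⟨rfl, rfl, h⟩ := arr_cases h
  obtain rfl := eq_of_heq h
  rfl

theorem _root_.TBundle.act_congr (E : TBundle X) {i k : X.ι} {u u' : X.V i} {v v' : X.V k} {hu : u ∈ X.dom i}
    {hu' : u' ∈ X.dom i} {hv : v ∈ X.dom k} {hv' : v' ∈ X.dom k} {b : (⟨i, u, hu⟩ : X.Obj) ⟶ ⟨k, v, hv⟩}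
    {c : (⟨i, u', hu'⟩ : X.Obj) ⟶ ⟨k, v', hv'⟩}
    (h : (⟨(⟨i, u, hu⟩, ⟨k, v, hv⟩), b⟩ : X.Arr) = ⟨(⟨i, u', hu'⟩, ⟨k, v', hv'⟩), c⟩) :
    (E.act b : Fib (E.rank i) →L[ℝ] Fib (E.rank k)) = E.act c := by
  obtain ⟨rfl, rfl, h⟩ := arr_cases h
  obtain rfl := eq_of_heq h
  rfl

/-- The points of `(Fin m → ℝ) × V i` above a chart. -/
abbrev param (X : TGroupoid m) (i : X.ι) : Set ((Fin m → ℝ) × X.V i) := {p | p.2 ∈ X.dom i}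

theorem IsSection.target {x y : X.Obj} {a : x ⟶ y} {U L Θ} (h : X.IsSection a U L Θ) :
    Θ (0, x.pt) = y.pt := by
  obtain ⟨hU, -, h0, -, harr⟩ := h
  obtain ⟨hΘ, b, hb, -⟩ := harr _ (mem_of_mem_nhds hU) x.mem
  exact pt_eq (arr_ext (hb.symm.trans h0))

/-- Two sections agree near a point where they take the same value. -/
theorem IsSection.shift (hX : X.IsOrbifold) {x y : X.Obj} {a : x ⟶ y} {U L Θ}
    (h : X.IsSection a U L Θ) {p : (Fin m → ℝ) × X.V x.chart} (hpU : U ∈ 𝓝 p)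
    (hp : p.2 ∈ X.dom x.chart) {hΘ : Θ p ∈ X.dom y.chart}
    {b : (⟨x.chart, p.2, hp⟩ : X.Obj) ⟶ (⟨y.chart, Θ p, hΘ⟩ : X.Obj)}
    (hb : L p = ⟨(⟨x.chart, p.2, hp⟩, ⟨y.chart, Θ p, hΘ⟩), b⟩)
    (hwt : X.wt b = fun j => Circle.exp (p.1 j) * X.wt a j) {U' L' Θ'}
    (h' : X.IsSection b U' L' Θ') :
    ∀ᶠ q in 𝓝[X.param x.chart] p, L q = L' (q.1 - p.1, q.2) ∧ Θ q = Θ' (q.1 - p.1, q.2) ∧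
      q ∈ U ∧ (q.1 - p.1, q.2) ∈ U' := by
  obtain ⟨-, hL, -, -, harr⟩ := h
  obtain ⟨hU', hL', hb', -, harr'⟩ := h'
  set σ : (Fin m → ℝ) × X.V x.chart → (Fin m → ℝ) × X.V x.chart := fun q => (q.1 - p.1, q.2)
  have hσ : Continuous σ := by fun_prop
  have hσp : σ p = (0, p.2) := by simp [σ]
  have hn1 : ∀ᶠ q in 𝓝[X.param x.chart] p, q ∈ U := mem_nhdsWithin_of_mem_nhds hpU
  have hn2 : ∀ᶠ q in 𝓝[X.param x.chart] p, σ q ∈ U' := by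
    refine mem_nhdsWithin_of_mem_nhds (hσ.continuousAt.preimage_mem_nhds ?_)
    rw [hσp]; exact hU'
  have hn3 : ∀ᶠ q in 𝓝[X.param x.chart] p, q ∈ X.param x.chart := self_mem_nhdsWithin
  have hc : ContinuousWithinAt L (X.param x.chart) p := by
    have := hL p ⟨mem_of_mem_nhds hpU, hp⟩
    rwa [ContinuousWithinAt, Set.inter_comm, nhdsWithin_inter_of_mem' (mem_nhdsWithin_of_mem_nhds hpU)] at this
  have hc' : ContinuousWithinAt (fun q => L' (σ q)) (X.param x.chart) p := by
    have h1 := hL' (σ p) ⟨by rw [hσp]; exact mem_of_mem_nhds hU', hp⟩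
    have h2 : ContinuousWithinAt (fun q => L' (σ q)) (σ ⁻¹' U' ∩ X.param x.chart) p :=
      ContinuousWithinAt.comp (t := U' ∩ X.param x.chart) h1 hσ.continuousWithinAt fun q hq => ⟨hq.1, hq.2⟩
    rw [ContinuousWithinAt, Set.inter_comm] at h2
    exact h2.mono_left (nhdsWithin_inter_of_mem' (t := σ ⁻¹' U') hn2).ge
  have heq := hX.eventually_eq (S := X.param x.chart) hp hc hc' (by
      rw [hb, hσp, hb']) (by
    filter_upwards [hn1, hn2, hn3] with q h1 h2 h3
    obtain ⟨_, c, hc, hwc⟩ := harr q h1 h3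
    obtain ⟨_, c', hc', hwc'⟩ := harr' (σ q) h2 h3
    rw [hc, hc']
    refine Prod.ext ?_ rfl
    change X.wt c = X.wt c'
    rw [hwc, hwc', hwt]
    funext j
    change _ = Circle.exp (q.1 j - p.1 j) * _
    rw [← mul_assoc, ← Circle.exp_add, sub_add_cancel])
  filter_upwards [heq, hn1, hn2, hn3] with q h0 h1 h2 h3
  obtain ⟨_, c, hc, hwc⟩ := harr q h1 h3
  obtain ⟨_, c', hc', hwc'⟩ := harr' (σ q) h2 h3
  exact ⟨h0, pt_eq (arr_ext (hc.symm.trans (h0.trans hc'))), h1, h2⟩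

end TGroupoid

namespace TBundle

/-- A smooth family of arrows near `a`, with its action on the fibres of `E`. -/
structure IsFlow (E : TBundle X) {x y : X.Obj} (a : x ⟶ y) (U : Set ((Fin m → ℝ) × X.V x.chart))
    (L : (Fin m → ℝ) × X.V x.chart → X.Arr) (Θ : (Fin m → ℝ) × X.V x.chart → X.V y.chart)
    (Ψ : (Fin m → ℝ) × X.V x.chart → (Fib (E.rank x.chart) →L[ℝ] Fib (E.rank y.chart))) : Prop where
  isOpen : IsOpen U
  isSection : X.IsSection a U L Θ
  smooth_act : ContDiffOn ℝ ∞ Ψ (U ∩ X.param x.chart)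
  arrow : ∀ p ∈ U, ∀ hp : p.2 ∈ X.dom x.chart, ∃ (hΘ : Θ p ∈ X.dom y.chart)
    (b : (⟨x.chart, p.2, hp⟩ : X.Obj) ⟶ (⟨y.chart, Θ p, hΘ⟩ : X.Obj)),
    L p = ⟨(⟨x.chart, p.2, hp⟩, ⟨y.chart, Θ p, hΘ⟩), b⟩ ∧
    (X.wt b = fun j => Circle.exp (p.1 j) * X.wt a j) ∧
    E.act (y := ⟨y.chart, Θ p, hΘ⟩) b = Ψ p ∧
    HasFDerivWithinAt Θ
      ((X.jac b).comp (ContinuousLinearMap.snd ℝ (Fin m → ℝ) (X.V x.chart)) +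
        ∑ j, ((ContinuousLinearMap.proj (R := ℝ) j).comp
          (ContinuousLinearMap.fst ℝ (Fin m → ℝ) (X.V x.chart))).smulRight
            (X.fund y.chart j (Θ p))) (X.param x.chart) p ∧
    HasFDerivWithinAt Ψ
      ((E.dact (y := ⟨y.chart, Θ p, hΘ⟩) b).comp (ContinuousLinearMap.snd ℝ (Fin m → ℝ) (X.V x.chart)) +
        ∑ j, ((ContinuousLinearMap.proj (R := ℝ) j).comp
          (ContinuousLinearMap.fst ℝ (Fin m → ℝ) (X.V x.chart))).smulRight
            ((E.inf y.chart j (Θ p)).comp (E.act (y := ⟨y.chart, Θ p, hΘ⟩) b))) (X.param x.chart) p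

theorem _root_.HasFDerivWithinAt.shift {V W : Type*} [NormedAddCommGroup V] [NormedSpace ℝ V] [NormedAddCommGroup W]
    [NormedSpace ℝ W] {P : Type*} [NormedAddCommGroup P] [NormedSpace ℝ P] {S : Set V} {p : P × V}
    {F F' : P × V → W} {D : P × V →L[ℝ] W} {U' : Set (P × V)} (hU' : U' ∈ 𝓝 (0, p.2))
    (h : HasFDerivWithinAt F' D (U' ∩ {q | q.2 ∈ S}) (0, p.2)) (hp : p.2 ∈ S)
    (hF : ∀ᶠ q in 𝓝[{q | q.2 ∈ S}] p, F q = F' (q.1 - p.1, q.2)) :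
    HasFDerivWithinAt F D {q | q.2 ∈ S} p := by
  have h1 : HasFDerivWithinAt F' D {q | q.2 ∈ S} (0, p.2) := by
    rw [Set.inter_comm] at h
    exact (hasFDerivWithinAt_inter hU').mp h
  have h2 : HasFDerivWithinAt (fun q : P × V => (q.1 - p.1, q.2)) (ContinuousLinearMap.id ℝ (P × V))
      {q | q.2 ∈ S} p := by
    have := ((hasFDerivAt_id (𝕜 := ℝ) p).sub_const (p.1, 0)).hasFDerivWithinAt (s := {q : P × V | q.2 ∈ S})
    exact this.congr (fun q _ => Prod.ext rfl (sub_zero q.2).symm) (Prod.ext rfl (sub_zero p.2).symm)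
  have h3 : HasFDerivWithinAt F' D {q | q.2 ∈ S} ((fun q : P × V => (q.1 - p.1, q.2)) p) := by
    simpa using h1
  have h4 := h3.comp p h2 (fun q hq => hq)
  rw [ContinuousLinearMap.comp_id] at h4
  exact h4.congr_of_eventuallyEq hF (hF.self_of_nhdsWithin hp)

theorem exists_flow (hX : X.IsOrbifold) {E : TBundle X} (hE : E.IsSmooth) {x y : X.Obj} (a : x ⟶ y) :
    ∃ U L Θ Ψ, E.IsFlow a U L Θ Ψ := by
  obtain ⟨U, L, Θ, hsec, Ψ, hΨ, hact, -⟩ := hE a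
  obtain ⟨hU, hL, hL0, hΘ, harr⟩ := id hsec
  have hsub : interior U ∩ X.param x.chart ⊆ U ∩ X.param x.chart :=
    Set.inter_subset_inter_left _ interior_subset
  refine ⟨interior U, L, Θ, Ψ, isOpen_interior, ⟨interior_mem_nhds.mpr hU, hL.mono hsub, hL0,
    hΘ.mono hsub, fun p hp => harr p (interior_subset hp)⟩, hΨ.mono hsub, fun p hpU hp => ?_⟩
  have hpU' : U ∈ 𝓝 p := mem_interior_iff_mem_nhds.mp hpU
  obtain ⟨hΘp, b, hb, hwt⟩ := harr p (interior_subset hpU) hp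
  refine ⟨hΘp, b, hb, hwt, hact p (interior_subset hpU) hp hΘp b hb, ?_, ?_⟩
  · obtain ⟨U', L', Θ', hsec', hd⟩ := hX.smooth b
    have h1 := hsec.shift hX hpU' hp hb hwt hsec'
    exact HasFDerivWithinAt.shift hsec'.1 hd hp (h1.mono fun q hq => hq.2.1)
  · obtain ⟨U', L', Θ', hsec', Ψ', hΨ', hact', hd⟩ := hE b
    have h1 := hsec.shift hX hpU' hp hb hwt hsec'
    refine HasFDerivWithinAt.shift hsec'.1 hd hp ?_
    filter_upwards [h1, self_mem_nhdsWithin] with q hq hqd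
    obtain ⟨hΘq, c, hc, -⟩ := harr q hq.2.2.1 hqd
    obtain ⟨hΘq', c', hc', -⟩ := hsec'.2.2.2.2 _ hq.2.2.2 hqd
    rw [← hact q hq.2.2.1 hqd hΘq c hc, ← hact' _ hq.2.2.2 hqd hΘq' c' hc']
    exact E.act_congr (hc.symm.trans (hq.1.trans hc'))


variable {E : TBundle X} {x y : X.Obj} {a : x ⟶ y} {U : Set ((Fin m → ℝ) × X.V x.chart)}
  {L : (Fin m → ℝ) × X.V x.chart → X.Arr} {Θ : (Fin m → ℝ) × X.V x.chart → X.V y.chart}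
  {Ψ : (Fin m → ℝ) × X.V x.chart → (Fib (E.rank x.chart) →L[ℝ] Fib (E.rank y.chart))}

namespace IsFlow

theorem mem (h : E.IsFlow a U L Θ Ψ) : (0, x.pt) ∈ U := mem_of_mem_nhds h.isSection.1

theorem mapsTo (h : E.IsFlow a U L Θ Ψ) {p} (hp : p ∈ U ∩ X.param x.chart) : Θ p ∈ X.dom y.chart :=
  (h.arrow p hp.1 hp.2).1

theorem target (h : E.IsFlow a U L Θ Ψ) : Θ (0, x.pt) = y.pt := h.isSection.target

theorem cnear (h : E.IsFlow a U L Θ Ψ) {p} (hp : p ∈ U) : CNear Θ (X.param x.chart) p :=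
  ⟨U, h.isOpen, hp, h.isSection.2.2.2.1⟩

theorem cnear_act (h : E.IsFlow a U L Θ Ψ) {p} (hp : p ∈ U) : CNear Ψ (X.param x.chart) p :=
  ⟨U, h.isOpen, hp, h.smooth_act⟩

theorem act_eq (h : E.IsFlow a U L Θ Ψ) : Ψ (0, x.pt) = E.act a := by
  obtain ⟨hΘ, b, hb, -, hact, -⟩ := h.arrow _ h.mem x.mem
  rw [← hact]
  exact E.act_congr (hb.symm.trans h.isSection.2.2.1)

end IsFlow

end TBundle

/-- Linearly independent functionals take arbitrary values. -/
theorem exists_clm_apply_eq {V κ : Type*} [NormedAddCommGroup V] [NormedSpace ℝ V] [Fintype κ]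
    {w : κ → V →L[ℝ] ℝ} (hw : LinearIndependent ℝ w) (t : κ → ℝ) : ∃ v, ∀ k, w k v = t k := by
  classical
  set A : V →ₗ[ℝ] κ → ℝ := LinearMap.pi fun k => (w k).toLinearMap
  suffices h : LinearMap.range A = ⊤ by
    obtain ⟨v, hv⟩ := LinearMap.range_eq_top.mp h t
    exact ⟨v, fun k => congrFun hv k⟩
  by_contra h
  obtain ⟨f, hf, hle⟩ := Submodule.exists_le_ker_of_lt_top _ (lt_top_iff_ne_top.mpr h)
  refine hf ?_
  have hz : ∑ k, f (Pi.single k 1) • w k = 0 := by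
    ext v
    have h1 : f (A v) = 0 := hle ⟨v, rfl⟩
    rw [LinearMap.pi_apply_eq_sum_univ f (A v)] at h1
    rw [sum_apply, zero_apply, ← h1]
    refine Finset.sum_congr rfl fun k _ => ?_
    have h3 : (fun j => if k = j then (1 : ℝ) else 0) = Pi.single k 1 := by
      ext j; simp [Pi.single_apply, eq_comm]
    rw [h3]
    exact mul_comm _ _
  have h2 := Fintype.linearIndependent_iff.mp hw _ hz
  exact LinearMap.pi_ext' fun k => LinearMap.ext_ring (by simpa using h2 k)

namespace TGroupoid.IsOrbifold

theorem goodSet_dom (hX : X.IsOrbifold) (i : X.ι) : GoodSet (X.dom i) := by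
  obtain ⟨O, hO, h⟩ := hX.dom_open i
  have := hX.finite_faces i
  rw [h]
  refine GoodSet.of_convex ?_ ?_ hO
  · have : {v | ∀ k, 0 ≤ X.wall i k v} = ⋂ k, {v | 0 ≤ X.wall i k v} := by ext; simp
    rw [this]
    exact convex_iInter fun k => convex_halfSpace_ge (X.wall i k).isLinear 0
  · cases nonempty_fintype (X.Face i)
    obtain ⟨v, hv⟩ := exists_clm_apply_eq (hX.walls_indep i) fun _ => 1
    refine ⟨v, mem_interior.mpr ⟨{w | ∀ k, 0 < X.wall i k w}, fun w hw k => (hw k).le, ?_, fun k => by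
      rw [hv]; exact one_pos⟩⟩
    simp only [Set.ofPred_forall]
    exact isOpen_iInter_of_finite fun k => isOpen_lt continuous_const (X.wall i k).continuous

theorem locallyConvex_dom (hX : X.IsOrbifold) (i : X.ι) : LocallyConvexSet (X.dom i) := by
  obtain ⟨O, hO, h⟩ := hX.dom_open i
  intro x hx
  rw [h] at hx ⊢
  obtain ⟨ε, hε, hb⟩ := Metric.isOpen_iff.mp hO x hx.1
  refine ⟨Metric.ball x ε, Metric.isOpen_ball, Metric.mem_ball_self hε, ?_⟩
  rw [← Set.inter_assoc, Set.inter_eq_left.mpr hb]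
  refine (convex_ball x ε).inter ?_
  have : {v | ∀ k, 0 ≤ X.wall i k v} = ⋂ k, {v | 0 ≤ X.wall i k v} := by ext; simp
  rw [this]
  exact convex_iInter fun k => convex_halfSpace_ge (X.wall i k).isLinear 0

/-- The point of a chart with given coordinates depends continuously on them. -/
theorem continuous_mk (X : TGroupoid m) (i : X.ι) :
    Continuous fun u : X.dom i => (⟨i, u.1, u.2⟩ : X.Obj) := by
  refine continuous_induced_rng.mpr ?_
  exact continuous_sigmaMk (σ := fun i => X.dom i)

end TGroupoid.IsOrbifold

end

section

variable {m : ℕ} {X : TGroupoid m}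

namespace TGroupoid

open Classical in
/-- The composition of arrows (the first arrow if they are not composable). -/
noncomputable def compArr (a b : X.Arr) : X.Arr :=
  if h : a.1.2 = b.1.1 then ⟨(a.1.1, b.1.2), a.2 ≫ eqToHom h ≫ b.2⟩ else a

theorem compArr_mk {x y z : X.Obj} (a : x ⟶ y) (b : y ⟶ z) :
    compArr (⟨(x, y), a⟩ : X.Arr) ⟨(y, z), b⟩ = ⟨(x, z), a ≫ b⟩ := by
  simp [compArr]

theorem IsOrbifold.continuousWithinAt_compArr (hX : X.IsOrbifold) {P : Type*} [TopologicalSpace P]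
    {S : Set P} {p : P} (hp : p ∈ S) {f g : P → X.Arr} (hf : ContinuousWithinAt f S p)
    (hg : ContinuousWithinAt g S p) (h : ∀ q ∈ S, (f q).1.2 = (g q).1.1) :
    ContinuousWithinAt (fun q => compArr (f q) (g q)) S p := by
  rw [continuousWithinAt_iff_continuousAt_domRestrict _ hp] at hf hg ⊢
  have h1 : ContinuousAt (fun q : S => (⟨(f q, g q), h q q.2⟩ :
      {c : X.Arr × X.Arr // c.1.1.2 = c.2.1.1})) ⟨p, hp⟩ := by
    refine Topology.IsInducing.subtypeVal.continuousAt_iff.mpr ?_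
    exact hf.prodMk hg
  have h2 := hX.continuous_comp.continuousAt.comp h1
  refine h2.congr (Eventually.of_forall fun q => ?_)
  simp only [Set.domRestrict_apply, compArr, dif_pos (h q q.2)]
  rfl

end TGroupoid

namespace TBundle

theorem paramDeriv_apply {W Y : Type*} [NormedAddCommGroup W] [NormedSpace ℝ W] [NormedAddCommGroup Y]
    [NormedSpace ℝ Y] (A : W →L[ℝ] Y) (c : Fin m → Y) (p : (Fin m → ℝ) × W) :
    (A.comp (ContinuousLinearMap.snd ℝ (Fin m → ℝ) W) +
        ∑ j, ((ContinuousLinearMap.proj (R := ℝ) j).comp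
          (ContinuousLinearMap.fst ℝ (Fin m → ℝ) W)).smulRight (c j)) p = A p.2 + ∑ j, p.1 j • c j := by
  simp [sum_apply, add_apply]

theorem paramDeriv_single {W Y : Type*} [NormedAddCommGroup W] [NormedSpace ℝ W] [NormedAddCommGroup Y]
    [NormedSpace ℝ Y] (A : W →L[ℝ] Y) (c : Fin m → Y) (j : Fin m) :
    (A.comp (ContinuousLinearMap.snd ℝ (Fin m → ℝ) W) +
        ∑ j, ((ContinuousLinearMap.proj (R := ℝ) j).comp
          (ContinuousLinearMap.fst ℝ (Fin m → ℝ) W)).smulRight (c j)) (Pi.single j 1, 0) = c j := by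
  rw [paramDeriv_apply, map_zero, zero_add, Finset.sum_eq_single j]
  · simp
  · intro k _ hk; simp [hk]
  · simp

theorem paramDeriv_zero {W Y : Type*} [NormedAddCommGroup W] [NormedSpace ℝ W] [NormedAddCommGroup Y]
    [NormedSpace ℝ Y] (A : W →L[ℝ] Y) (c : Fin m → Y) (w : W) :
    (A.comp (ContinuousLinearMap.snd ℝ (Fin m → ℝ) W) +
        ∑ j, ((ContinuousLinearMap.proj (R := ℝ) j).comp
          (ContinuousLinearMap.fst ℝ (Fin m → ℝ) W)).smulRight (c j)) (0, w) = A w := by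
  rw [paramDeriv_apply]
  simp

variable {E : TBundle X} {x y : X.Obj} {a : x ⟶ y} {U : Set ((Fin m → ℝ) × X.V x.chart)}
  {L : (Fin m → ℝ) × X.V x.chart → X.Arr} {Θ : (Fin m → ℝ) × X.V x.chart → X.V y.chart}
  {Ψ : (Fin m → ℝ) × X.V x.chart → (Fib (E.rank x.chart) →L[ℝ] Fib (E.rank y.chart))}

theorem dact_congr (E : TBundle X) {i k : X.ι} {u u' : X.V i} {v v' : X.V k} {hu : u ∈ X.dom i}
    {hu' : u' ∈ X.dom i} {hv : v ∈ X.dom k} {hv' : v' ∈ X.dom k} {b : (⟨i, u, hu⟩ : X.Obj) ⟶ ⟨k, v, hv⟩}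
    {c : (⟨i, u', hu'⟩ : X.Obj) ⟶ ⟨k, v', hv'⟩}
    (h : (⟨(⟨i, u, hu⟩, ⟨k, v, hv⟩), b⟩ : X.Arr) = ⟨(⟨i, u', hu'⟩, ⟨k, v', hv'⟩), c⟩) :
    (E.dact b : X.V i →L[ℝ] (Fib (E.rank i) →L[ℝ] Fib (E.rank k))) = E.dact c := by
  obtain ⟨rfl, rfl, h⟩ := TGroupoid.arr_cases h
  obtain rfl := eq_of_heq h
  rfl

theorem uniqueDiffOn_param (hX : X.IsOrbifold) (i : X.ι) : UniqueDiffOn ℝ (X.param i) :=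
  (hX.goodSet_dom i).snd_preimage.uniqueDiffOn

/-- Along the flow of an identity, arrows of weight one are identities. -/
theorem IsFlow.eventually_id (hX : X.IsOrbifold) {x : X.Obj} {U L Θ Ψ} (h : E.IsFlow (𝟙 x) U L Θ Ψ) :
    ∀ᶠ u in 𝓝[X.dom x.chart] x.pt, (0, u) ∈ U ∧ Θ (0, u) = u ∧ Ψ (0, u) = ContinuousLinearMap.id ℝ _ := by
  have hmk : Continuous fun u : X.dom x.chart => ((0 : Fin m → ℝ), u.1) := by fun_prop
  have hU : ∀ᶠ u in 𝓝 (⟨x.pt, x.mem⟩ : X.dom x.chart), (0, u.1) ∈ U :=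
    hmk.continuousAt.preimage_mem_nhds (h.isOpen.mem_nhds h.mem)
  have h1 : ContinuousWithinAt (fun u : X.dom x.chart => L (0, u.1)) Set.univ ⟨x.pt, x.mem⟩ := by
    rw [continuousWithinAt_univ]
    have hL := h.isSection.2.1 (0, x.pt) ⟨h.mem, x.mem⟩
    have := ContinuousWithinAt.comp (t := U ∩ X.param x.chart)
      (s := {u : X.dom x.chart | (0, u.1) ∈ U}) (x := ⟨x.pt, x.mem⟩) hL
      hmk.continuousWithinAt fun u hu => ⟨hu, u.2⟩
    exact this.continuousAt hU
  have h2 : Continuous fun u : X.dom x.chart => (⟨(_, _), 𝟙 (⟨x.chart, u.1, u.2⟩ : X.Obj)⟩ : X.Arr) :=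
    hX.continuous_one.comp (TGroupoid.IsOrbifold.continuous_mk X x.chart)
  have h3 := hX.eventually_eq (Set.mem_univ _) h1 h2.continuousWithinAt h.isSection.2.2.1 (by
    rw [nhdsWithin_univ]
    filter_upwards [hU] with u hu
    obtain ⟨_, b, hb, hwt, -⟩ := h.arrow (0, u.1) hu u.2
    rw [hb]
    refine Prod.ext ?_ rfl
    change X.wt b = X.wt (𝟙 _)
    rw [hwt, X.wt_id, X.wt_id]
    funext j
    simp)
  rw [nhdsWithin_univ] at h3
  refine (eventually_nhds_subtype_iff (X.dom x.chart) ⟨x.pt, x.mem⟩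
    fun u => (0, u) ∈ U ∧ Θ (0, u) = u ∧ Ψ (0, u) = ContinuousLinearMap.id ℝ _).mp ?_
  filter_upwards [h3, hU] with u hu hU
  obtain ⟨_, b, hb, hwt, hact, -⟩ := h.arrow (0, u.1) hU u.2
  have h4 := hb.symm.trans hu
  refine ⟨hU, TGroupoid.pt_eq (TGroupoid.arr_ext h4), ?_⟩
  rw [← hact, E.act_congr h4, E.act_id]

theorem eventually_fund (hX : X.IsOrbifold) (hE : E.IsSmooth) (x : X.Obj) :
    ∃ U L Θ Ψ, E.IsFlow (𝟙 x) U L Θ Ψ ∧ ∀ᶠ u in 𝓝[X.dom x.chart] x.pt, (0, u) ∈ U ∧ Θ (0, u) = u ∧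
      Ψ (0, u) = ContinuousLinearMap.id ℝ _ ∧ ∀ j,
      fderivWithin ℝ Θ (X.param x.chart) (0, u) (Pi.single j 1, 0) = X.fund x.chart j u ∧
      fderivWithin ℝ Ψ (X.param x.chart) (0, u) (Pi.single j 1, 0) = E.inf x.chart j u := by
  obtain ⟨U, L, Θ, Ψ, h⟩ := exists_flow hX hE (𝟙 x)
  refine ⟨U, L, Θ, Ψ, h, ?_⟩
  filter_upwards [h.eventually_id hX, self_mem_nhdsWithin] with u hu hud
  refine ⟨hu.1, hu.2.1, hu.2.2, fun j => ?_⟩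
  obtain ⟨_, b, hb, hwt, hact, hΘ, hΨ⟩ := h.arrow (0, u) hu.1 hud
  have hUD := uniqueDiffOn_param hX x.chart (0, u) hud
  rw [hΘ.fderivWithin hUD, hΨ.fderivWithin hUD, paramDeriv_single, paramDeriv_single, hact, hu.2.1, hu.2.2]
  exact ⟨rfl, ContinuousLinearMap.comp_id _⟩

theorem cnear_fund (hX : X.IsOrbifold) (hE : E.IsSmooth) {i : X.ι} {u : X.V i} (hu : u ∈ X.dom i)
    (j : Fin m) : CNear (X.fund i j) (X.dom i) u ∧ CNear (E.inf i j) (X.dom i) u := by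
  obtain ⟨U, L, Θ, Ψ, h, hev⟩ := eventually_fund hX hE ⟨i, u, hu⟩
  obtain ⟨O, hO, huO, hsub⟩ := mem_nhdsWithin.mp hev
  have hmk : CNear (fun w : X.V i => ((0 : Fin m → ℝ), w)) (X.dom i) u :=
    CNear.of_contDiff (contDiff_const.prodMk contDiff_id)
  have hUD := uniqueDiffOn_param hX i
  constructor
  · have h1 := ((h.cnear h.mem).fderivWithin hUD).clm_apply (CNear.const (Pi.single j 1, 0))
    exact (CNear.comp hmk hu h1 isOpen_univ trivial fun w hw => hw.2).congr hO huO
      fun w hw => ((hsub hw).2.2.2 j).1.symm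
  · have h1 := ((h.cnear_act h.mem).fderivWithin hUD).clm_apply (CNear.const (Pi.single j 1, 0))
    exact (CNear.comp hmk hu h1 isOpen_univ trivial fun w hw => hw.2).congr hO huO
      fun w hw => ((hsub hw).2.2.2 j).2.symm

/-- The flow of an arrow is the flow of the identity at its source followed by the arrow. -/
theorem IsFlow.eventually_comp (hX : X.IsOrbifold) {x y : X.Obj} {a : x ⟶ y} {U₀ L₀ Θ₀ Ψ₀}
    (h₀ : E.IsFlow (𝟙 x) U₀ L₀ Θ₀ Ψ₀) {U L Θ Ψ} (h : E.IsFlow a U L Θ Ψ) :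
    ∀ᶠ τ in 𝓝 (0 : Fin m → ℝ), Θ₀ (τ, x.pt) ∈ X.dom x.chart ∧ Θ (τ, x.pt) = Θ (0, Θ₀ (τ, x.pt)) ∧
      Ψ (τ, x.pt) = (Ψ (0, Θ₀ (τ, x.pt))).comp (Ψ₀ (τ, x.pt)) := by
  have hmk : Continuous fun τ : Fin m → ℝ => (τ, x.pt) := by fun_prop
  have hU₀ : ∀ᶠ τ in 𝓝 (0 : Fin m → ℝ), (τ, x.pt) ∈ U₀ :=
    hmk.continuousAt.preimage_mem_nhds (h₀.isOpen.mem_nhds h₀.mem)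
  have hU : ∀ᶠ τ in 𝓝 (0 : Fin m → ℝ), (τ, x.pt) ∈ U :=
    hmk.continuousAt.preimage_mem_nhds (h.isOpen.mem_nhds h.mem)
  have hcont : ∀ {W : Type} [TopologicalSpace W] {y : X.Obj} {F : (Fin m → ℝ) × X.V x.chart → W}
      {U : Set ((Fin m → ℝ) × X.V x.chart)}, (∀ᶠ τ in 𝓝 (0 : Fin m → ℝ), (τ, x.pt) ∈ U) →
      ContinuousOn F (U ∩ X.param x.chart) → ContinuousAt (fun τ => F (τ, x.pt)) 0 := by
    intro W _ y F U hU hF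
    have := ContinuousWithinAt.comp (t := U ∩ X.param x.chart)
      (s := {τ : Fin m → ℝ | (τ, x.pt) ∈ U}) (x := 0) (hF (0, x.pt) ⟨hU.self_of_nhds, x.mem⟩)
      hmk.continuousWithinAt fun τ hτ => ⟨hτ, x.mem⟩
    exact this.continuousAt hU
  have hΘ₀ : ContinuousAt (fun τ => ((0 : Fin m → ℝ), Θ₀ (τ, x.pt))) 0 :=
    continuousAt_const.prodMk (hcont (y := x) hU₀ h₀.isSection.2.2.2.1.continuousOn)
  have hUΘ : ∀ᶠ τ in 𝓝 (0 : Fin m → ℝ), ((0 : Fin m → ℝ), Θ₀ (τ, x.pt)) ∈ U := by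
    refine hΘ₀.preimage_mem_nhds (h.isOpen.mem_nhds ?_)
    rw [h₀.target]; exact h.mem
  set S := {τ : Fin m → ℝ | (τ, x.pt) ∈ U₀ ∧ (τ, x.pt) ∈ U ∧ ((0 : Fin m → ℝ), Θ₀ (τ, x.pt)) ∈ U} with hS
  have hSn : S ∈ 𝓝 (0 : Fin m → ℝ) := hU₀.and (hU.and hUΘ)
  have h0S := mem_of_mem_nhds hSn
  have hdom : ∀ τ ∈ S, Θ₀ (τ, x.pt) ∈ X.dom x.chart := fun τ hτ => h₀.mapsTo ⟨hτ.1, x.mem⟩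
  have hL' : ContinuousWithinAt (fun τ => L (0, Θ₀ (τ, x.pt))) S 0 := by
    refine ContinuousWithinAt.comp (t := U ∩ X.param x.chart) ?_ hΘ₀.continuousWithinAt
      fun τ hτ => ⟨hτ.2.2, hdom τ hτ⟩
    exact h.isSection.2.1 _ ⟨h0S.2.2, hdom 0 h0S⟩
  have hc := hX.continuousWithinAt_compArr h0S
    (hcont (y := x) hU₀ h₀.isSection.2.1).continuousWithinAt hL' (fun τ hτ => by
      obtain ⟨_, b, hb, -⟩ := h₀.arrow _ hτ.1 x.mem
      obtain ⟨_, c, hc, -⟩ := h.arrow _ hτ.2.2 (hdom τ hτ)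
      rw [hb, hc])
  have hev := hX.eventually_eq h0S (hcont (y := x) hU h.isSection.2.1).continuousWithinAt hc (by
      simp only [h₀.isSection.2.2.1, h₀.target, h.isSection.2.2.1]
      rw [TGroupoid.compArr_mk, Category.id_comp]) (by
    filter_upwards [self_mem_nhdsWithin] with τ hτ
    obtain ⟨_, b, hb, hbw, -⟩ := h₀.arrow _ hτ.1 x.mem
    obtain ⟨_, c, hc, hcw, -⟩ := h.arrow _ hτ.2.2 (hdom τ hτ)
    obtain ⟨_, d, hd, hdw, -⟩ := h.arrow _ hτ.2.1 x.mem
    rw [hb, hc, hd, TGroupoid.compArr_mk]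
    refine Prod.ext ?_ rfl
    change X.wt d = X.wt (b ≫ c)
    rw [X.wt_comp, hdw, hbw, hcw, X.wt_id]
    funext j
    simp [mul_comm])
  rw [nhdsWithin_eq_nhds.mpr hSn] at hev
  filter_upwards [hev, hSn] with τ hτe hτ
  refine ⟨hdom τ hτ, ?_⟩
  obtain ⟨_, b, hb, -, hba, -⟩ := h₀.arrow _ hτ.1 x.mem
  obtain ⟨_, c, hc, -, hca, -⟩ := h.arrow _ hτ.2.2 (hdom τ hτ)
  obtain ⟨_, d, hd, -, hda, -⟩ := h.arrow _ hτ.2.1 x.mem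
  rw [hb, hc, hd, TGroupoid.compArr_mk] at hτe
  refine ⟨TGroupoid.pt_eq (TGroupoid.arr_ext hτe), ?_⟩
  rw [← hba, ← hca, ← hda, E.act_congr hτe, E.act_comp]

theorem IsFlow.hasFDerivWithinAt (h : E.IsFlow a U L Θ Ψ) :
    HasFDerivWithinAt Θ
      ((X.jac a).comp (ContinuousLinearMap.snd ℝ (Fin m → ℝ) (X.V x.chart)) +
        ∑ j, ((ContinuousLinearMap.proj (R := ℝ) j).comp
          (ContinuousLinearMap.fst ℝ (Fin m → ℝ) (X.V x.chart))).smulRight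
            (X.fund y.chart j y.pt)) (X.param x.chart) (0, x.pt) ∧
    HasFDerivWithinAt Ψ
      ((E.dact a).comp (ContinuousLinearMap.snd ℝ (Fin m → ℝ) (X.V x.chart)) +
        ∑ j, ((ContinuousLinearMap.proj (R := ℝ) j).comp
          (ContinuousLinearMap.fst ℝ (Fin m → ℝ) (X.V x.chart))).smulRight
            ((E.inf y.chart j y.pt).comp (E.act a))) (X.param x.chart) (0, x.pt) := by
  obtain ⟨hΘ, b, hb, -, -, h1, h2⟩ := h.arrow _ h.mem x.mem
  have h3 := hb.symm.trans h.isSection.2.2.1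
  have e1 := TGroupoid.jac_congr h3
  have e2 := E.act_congr h3
  have e3 := E.dact_congr h3
  have e4 : ∀ j, X.fund y.chart j (Θ (0, x.pt)) = X.fund y.chart j y.pt := fun j => by rw [h.target]
  have e5 : ∀ j, E.inf y.chart j (Θ (0, x.pt)) = E.inf y.chart j y.pt := fun j => by rw [h.target]
  simp only [e1, e4] at h1
  simp only [e2, e3, e5] at h2
  exact ⟨h1, h2⟩

theorem IsFlow.hasDerivAt (h : E.IsFlow a U L Θ Ψ) (j : Fin m) :
    HasDerivAt (fun t : ℝ => Θ (t • Pi.single j 1, x.pt)) (X.fund y.chart j y.pt) 0 ∧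
    HasDerivAt (fun t : ℝ => Ψ (t • Pi.single j 1, x.pt)) ((E.inf y.chart j y.pt).comp (E.act a)) 0 := by
  have h1 : HasDerivAt (fun t : ℝ => (t • (Pi.single j 1 : Fin m → ℝ), x.pt)) (Pi.single j 1, 0) 0 := by
    have := ((hasDerivAt_id (0 : ℝ)).smul_const (Pi.single j 1 : Fin m → ℝ)).prodMk
      (hasDerivAt_const (0 : ℝ) x.pt)
    simpa using this
  have h0 : ((0 : ℝ) • (Pi.single j 1 : Fin m → ℝ), x.pt) = (0, x.pt) := by rw [zero_smul]
  obtain ⟨h2, h3⟩ := h.hasFDerivWithinAt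
  rw [← h0] at h2 h3
  have h4 := h2.comp_hasDerivAt (0 : ℝ) h1 (Eventually.of_forall fun t => x.mem)
  have h5 := h3.comp_hasDerivAt (0 : ℝ) h1 (Eventually.of_forall fun t => x.mem)
  rw [paramDeriv_single] at h4 h5
  exact ⟨h4, h5⟩

theorem jac_fund_and_inf (hX : X.IsOrbifold) (hE : E.IsSmooth) {x y : X.Obj} (a : x ⟶ y) (j : Fin m) :
    X.jac a (X.fund x.chart j x.pt) = X.fund y.chart j y.pt ∧
    (E.act a).comp (E.inf x.chart j x.pt) + E.dact a (X.fund x.chart j x.pt) =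
      (E.inf y.chart j y.pt).comp (E.act a) := by
  obtain ⟨U₀, L₀, Θ₀, Ψ₀, h₀⟩ := exists_flow hX hE (𝟙 x)
  obtain ⟨U, L, Θ, Ψ, h⟩ := exists_flow hX hE a
  have hline : Tendsto (fun t : ℝ => t • (Pi.single j 1 : Fin m → ℝ)) (𝓝 0) (𝓝 0) := by
    have : Continuous fun t : ℝ => t • (Pi.single j 1 : Fin m → ℝ) := by fun_prop
    simpa using this.tendsto 0
  have hev := hline.eventually (h₀.eventually_comp hX h)
  obtain ⟨hΘ₀, hΨ₀⟩ := h₀.hasDerivAt j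
  obtain ⟨hΘ, hΨ⟩ := h.hasDerivAt j
  have hc : HasDerivAt (fun t : ℝ => ((0 : Fin m → ℝ), Θ₀ (t • Pi.single j 1, x.pt)))
      (0, X.fund x.chart j x.pt) 0 := (hasDerivAt_const _ _).prodMk hΘ₀
  have hc0 : ((0 : Fin m → ℝ), Θ₀ ((0 : ℝ) • Pi.single j 1, x.pt)) = (0, x.pt) := by
    rw [zero_smul, h₀.target]
  obtain ⟨h2, h3⟩ := h.hasFDerivWithinAt
  rw [← hc0] at h2 h3
  have h4 := h2.comp_hasDerivAt (0 : ℝ) hc (hev.mono fun t ht => ht.1)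
  have h5 := h3.comp_hasDerivAt (0 : ℝ) hc (hev.mono fun t ht => ht.1)
  rw [paramDeriv_zero] at h4 h5
  have h6 := h5.clm_comp hΨ₀
  constructor
  · exact h4.unique (hΘ.congr_of_eventuallyEq (hev.mono fun t ht => ht.2.1.symm))
  · have := h6.unique (hΨ.congr_of_eventuallyEq (hev.mono fun t ht => ht.2.2.symm))
    have h7 : Ψ₀ ((0 : ℝ) • Pi.single j 1, x.pt) = ContinuousLinearMap.id ℝ _ := by
      rw [zero_smul, h₀.act_eq, E.act_id]
    have h8 : Ψ (0, Θ₀ ((0 : ℝ) • Pi.single j 1, x.pt)) = E.act a := by rw [hc0, h.act_eq]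
    rw [Function.comp_apply, h7, h8, E.act_id] at this
    rw [← this, add_comm]
    rfl

end TBundle

end

section

variable {m : ℕ} {X : TGroupoid m}

namespace TBundle

/-- The differential of the action of `a` on the total space at the vector `v`. -/
noncomputable abbrev tjac (E : TBundle X) {x y : X.Obj} (a : x ⟶ y) (v : Fib (E.rank x.chart)) :
    X.V x.chart × Fib (E.rank x.chart) →L[ℝ] X.V y.chart × Fib (E.rank y.chart) :=
  ((X.jac a).comp (ContinuousLinearMap.fst ℝ _ _)).prod
    ((E.act a).comp (ContinuousLinearMap.snd ℝ _ _) +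
      ((E.dact a).flip v).comp (ContinuousLinearMap.fst ℝ _ _))

theorem tjac_apply (E : TBundle X) {x y : X.Obj} (a : x ⟶ y) (v : Fib (E.rank x.chart)) (p) :
    E.tjac a v p = (X.jac a p.1, E.act a p.2 + E.dact a p.1 v) := rfl

/-- The fundamental vector fields of the total space. -/
abbrev tfund (E : TBundle X) (i : X.ι) (p : X.V i × Fib (E.rank i)) (j : Fin m) :
    X.V i × Fib (E.rank i) := (X.fund i j p.1, E.inf i j p.1 p.2)

variable {E : TBundle X}

theorem tjac_tfund (hX : X.IsOrbifold) (hE : E.IsSmooth) {x y : X.Obj} (a : x ⟶ y)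
    (v : Fib (E.rank x.chart)) (j : Fin m) :
    E.tjac a v (E.tfund x.chart (x.pt, v) j) = E.tfund y.chart (y.pt, E.act a v) j := by
  obtain ⟨h1, h2⟩ := jac_fund_and_inf hX hE a j
  refine Prod.ext h1 ?_
  exact congrArg (fun A => A v) h2

theorem cnear_tfund (hX : X.IsOrbifold) (hE : E.IsSmooth) {i : X.ι} {p : X.V i × Fib (E.rank i)}
    (hp : p.1 ∈ X.dom i) (j : Fin m) :
    CNear (fun p => E.tfund i p j) (tube (X.dom i) (E.rank i)) p := by
  obtain ⟨h1, h2⟩ := cnear_fund hX hE hp j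
  have hfst : CNear (fun p : X.V i × Fib (E.rank i) => p.1) (tube (X.dom i) (E.rank i)) p :=
    CNear.of_contDiff contDiff_fst
  exact (CNear.comp hfst hp h1 isOpen_univ trivial fun q hq => hq.2).pair
    ((CNear.comp hfst hp h2 isOpen_univ trivial fun q hq => hq.2).clm_apply
      (CNear.of_contDiff contDiff_snd))

/-- The flow on the total space. -/
def totalFlow {V V' : Type} {r r' : ℕ} (Θ : (Fin m → ℝ) × V → V')
    (Ψ : (Fin m → ℝ) × V → (Fib r →L[ℝ] Fib r')) (p : (Fin m → ℝ) × (V × Fib r)) : V' × Fib r' :=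
  (Θ (p.1, p.2.1), Ψ (p.1, p.2.1) p.2.2)

namespace IsFlow

variable {x y : X.Obj} {a : x ⟶ y} {U : Set ((Fin m → ℝ) × X.V x.chart)}
  {L : (Fin m → ℝ) × X.V x.chart → X.Arr} {Θ : (Fin m → ℝ) × X.V x.chart → X.V y.chart}
  {Ψ : (Fin m → ℝ) × X.V x.chart → (Fib (E.rank x.chart) →L[ℝ] Fib (E.rank y.chart))}

theorem total (h : E.IsFlow a U L Θ Ψ)
    {p : (Fin m → ℝ) × (X.V x.chart × Fib (E.rank x.chart))} (hpU : (p.1, p.2.1) ∈ U)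
    (hp : p.2.1 ∈ X.dom x.chart) : ∃ (hΘ : Θ (p.1, p.2.1) ∈ X.dom y.chart)
    (b : (⟨x.chart, p.2.1, hp⟩ : X.Obj) ⟶ (⟨y.chart, Θ (p.1, p.2.1), hΘ⟩ : X.Obj)),
    L (p.1, p.2.1) = ⟨(⟨x.chart, p.2.1, hp⟩, ⟨y.chart, Θ (p.1, p.2.1), hΘ⟩), b⟩ ∧
    E.act (y := ⟨y.chart, Θ (p.1, p.2.1), hΘ⟩) b = Ψ (p.1, p.2.1) ∧
    HasFDerivWithinAt (totalFlow Θ Ψ)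
      ((E.tjac (y := ⟨y.chart, Θ (p.1, p.2.1), hΘ⟩) b p.2.2).comp (ContinuousLinearMap.snd ℝ (Fin m → ℝ) _) +
        ∑ j, ((ContinuousLinearMap.proj (R := ℝ) j).comp
          (ContinuousLinearMap.fst ℝ (Fin m → ℝ) _)).smulRight
            (E.tfund y.chart (totalFlow Θ Ψ p) j))
      {p | p.2 ∈ tube (X.dom x.chart) (E.rank x.chart)} p := by
  obtain ⟨hΘ, b, hb, -, hact, h1, h2⟩ := h.arrow (p.1, p.2.1) hpU hp
  refine ⟨hΘ, b, hb, hact, ?_⟩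
  set κ : (Fin m → ℝ) × (X.V x.chart × Fib (E.rank x.chart)) →L[ℝ] (Fin m → ℝ) × X.V x.chart :=
    (ContinuousLinearMap.fst ℝ _ _).prod ((ContinuousLinearMap.fst ℝ _ _).comp (ContinuousLinearMap.snd ℝ _ _))
  have hκ : HasFDerivWithinAt (fun p : (Fin m → ℝ) × (X.V x.chart × Fib (E.rank x.chart)) => (p.1, p.2.1)) κ
      {p | p.2 ∈ tube (X.dom x.chart) (E.rank x.chart)} p := κ.hasFDerivWithinAt
  have hv : HasFDerivWithinAt (fun p : (Fin m → ℝ) × (X.V x.chart × Fib (E.rank x.chart)) => p.2.2)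
      ((ContinuousLinearMap.snd ℝ _ _).comp (ContinuousLinearMap.snd ℝ _ _))
      {p | p.2 ∈ tube (X.dom x.chart) (E.rank x.chart)} p :=
    ((ContinuousLinearMap.snd ℝ (X.V x.chart) (Fib (E.rank x.chart))).comp
      (ContinuousLinearMap.snd ℝ (Fin m → ℝ) _)).hasFDerivWithinAt
  have h3 := HasFDerivWithinAt.comp (t := X.param x.chart) p h1 hκ fun q hq => hq
  have h4 := HasFDerivWithinAt.comp (t := X.param x.chart) p h2 hκ fun q hq => hq
  have h5 := h3.prodMk (h4.clm_apply hv)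
  refine HasFDerivWithinAt.congr_fderiv h5 (ContinuousLinearMap.ext fun w => ?_)
  rw [paramDeriv_apply]
  refine Prod.ext ?_ ?_
  · have e := paramDeriv_apply (X.jac b) (fun j => X.fund y.chart j (Θ (p.1, p.2.1))) (κ w)
    refine e.trans ?_
    simp [κ, totalFlow, Prod.fst_sum]
  · have e := paramDeriv_apply (E.dact (y := ⟨y.chart, Θ (p.1, p.2.1), hΘ⟩) b)
      (fun j => (E.inf y.chart j (Θ (p.1, p.2.1))).comp (E.act (y := ⟨y.chart, Θ (p.1, p.2.1), hΘ⟩) b)) (κ w)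
    have e' := congrArg (fun A => A p.2.2) e
    have e2 : Ψ (p.1, p.2.1) w.2.2 + (E.dact (y := ⟨y.chart, Θ (p.1, p.2.1), hΘ⟩) b w.2.1 +
        ∑ j, w.1 j • (E.inf y.chart j (Θ (p.1, p.2.1))).comp
          (E.act (y := ⟨y.chart, Θ (p.1, p.2.1), hΘ⟩) b)) p.2.2 =
        (E.tjac (y := ⟨y.chart, Θ (p.1, p.2.1), hΘ⟩) b p.2.2 w.2 +
          ∑ j, w.1 j • E.tfund y.chart (totalFlow Θ Ψ p) j).2 := by
      rw [tjac_apply, Prod.snd_add, Prod.snd_sum, add_apply, sum_apply, ← add_assoc, hact]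
      rfl
    refine Eq.trans ?_ e2
    exact congrArg (Ψ (p.1, p.2.1) w.2.2 + ·) e'

theorem contDiffOn_total (h : E.IsFlow a U L Θ Ψ) : ContDiffOn ℝ ∞ (totalFlow Θ Ψ)
    ({p | (p.1, p.2.1) ∈ U} ∩ {p | p.2 ∈ tube (X.dom x.chart) (E.rank x.chart)}) := by
  have hκ : ContDiffOn ℝ ∞ (fun p : (Fin m → ℝ) × (X.V x.chart × Fib (E.rank x.chart)) => (p.1, p.2.1))
    ({p | (p.1, p.2.1) ∈ U} ∩ {p | p.2 ∈ tube (X.dom x.chart) (E.rank x.chart)}) :=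
    ContDiff.contDiffOn (by fun_prop)
  have h1 := h.isSection.2.2.2.1.comp hκ fun p hp => hp
  have h2 := h.smooth_act.comp hκ fun p hp => hp
  exact h1.prodMk (h2.clm_apply (ContDiff.contDiffOn (by fun_prop)))

theorem isOpen_total (h : E.IsFlow a U L Θ Ψ) :
    IsOpen {p : (Fin m → ℝ) × (X.V x.chart × Fib (E.rank x.chart)) | (p.1, p.2.1) ∈ U} :=
  h.isOpen.preimage (by fun_prop)

end IsFlow

end TBundle

end

section

variable {m : ℕ} {X : TGroupoid m} {E : TBundle X}

namespace TBundle

theorem tjac_congr (E : TBundle X) {i k : X.ι} {u u' : X.V i} {v v' : X.V k} {hu : u ∈ X.dom i}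
    {hu' : u' ∈ X.dom i} {hv : v ∈ X.dom k} {hv' : v' ∈ X.dom k} {b : (⟨i, u, hu⟩ : X.Obj) ⟶ ⟨k, v, hv⟩}
    {c : (⟨i, u', hu'⟩ : X.Obj) ⟶ ⟨k, v', hv'⟩}
    (h : (⟨(⟨i, u, hu⟩, ⟨k, v, hv⟩), b⟩ : X.Arr) = ⟨(⟨i, u', hu'⟩, ⟨k, v', hv'⟩), c⟩)
    (w : Fib (E.rank i)) :
    (E.tjac b w : X.V i × Fib (E.rank i) →L[ℝ] X.V k × Fib (E.rank k)) = E.tjac c w := by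
  obtain ⟨rfl, rfl, h⟩ := TGroupoid.arr_cases h
  obtain rfl := eq_of_heq h
  rfl

theorem _root_.HasFDerivWithinAt.at_zero {W Y : Type*} [NormedAddCommGroup W] [NormedSpace ℝ W]
    [NormedAddCommGroup Y] [NormedSpace ℝ Y] {A : W →L[ℝ] Y} {c : Fin m → Y} {S : Set W} {x : W}
    {F : (Fin m → ℝ) × W → Y} (h : HasFDerivWithinAt F
      (A.comp (ContinuousLinearMap.snd ℝ (Fin m → ℝ) W) +
        ∑ j, ((ContinuousLinearMap.proj (R := ℝ) j).comp
          (ContinuousLinearMap.fst ℝ (Fin m → ℝ) W)).smulRight (c j)) {p | p.2 ∈ S} (0, x)) :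
    HasFDerivWithinAt (fun q => F (0, q)) A S x := by
  have h1 : HasFDerivWithinAt (fun q : W => ((0 : Fin m → ℝ), q)) (ContinuousLinearMap.inr ℝ _ _) S x :=
    (hasFDerivAt_prodMk_right (0 : Fin m → ℝ) x).hasFDerivWithinAt
  have h2 := HasFDerivWithinAt.comp (t := {p : (Fin m → ℝ) × W | p.2 ∈ S}) x h h1 fun q hq => hq
  refine h2.congr_fderiv (ContinuousLinearMap.ext fun w => ?_)
  rw [ContinuousLinearMap.comp_apply, ContinuousLinearMap.inr_apply]
  exact paramDeriv_zero A c w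

theorem goodSet_tube (hX : X.IsOrbifold) (i : X.ι) : GoodSet (tube (X.dom i) (E.rank i)) :=
  (hX.goodSet_dom i).tube

namespace IsFlow

variable {x y : X.Obj} {a : x ⟶ y} {U : Set ((Fin m → ℝ) × X.V x.chart)}
  {L : (Fin m → ℝ) × X.V x.chart → X.Arr} {Θ : (Fin m → ℝ) × X.V x.chart → X.V y.chart}
  {Ψ : (Fin m → ℝ) × X.V x.chart → (Fib (E.rank x.chart) →L[ℝ] Fib (E.rank y.chart))}

theorem totalFlow_zero (h : E.IsFlow a U L Θ Ψ) (v : Fib (E.rank x.chart)) :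
    totalFlow Θ Ψ (0, (x.pt, v)) = (y.pt, E.act a v) := by
  unfold totalFlow; rw [h.target, h.act_eq]

/-- The flow at time zero. -/
theorem total_zero (h : E.IsFlow a U L Θ Ψ) {p : X.V x.chart × Fib (E.rank x.chart)}
    (hpU : (0, p.1) ∈ U) (hp : p.1 ∈ X.dom x.chart) : ∃ (hΘ : Θ (0, p.1) ∈ X.dom y.chart)
    (b : (⟨x.chart, p.1, hp⟩ : X.Obj) ⟶ (⟨y.chart, Θ (0, p.1), hΘ⟩ : X.Obj)),
    L (0, p.1) = ⟨(⟨x.chart, p.1, hp⟩, ⟨y.chart, Θ (0, p.1), hΘ⟩), b⟩ ∧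
    E.act (y := ⟨y.chart, Θ (0, p.1), hΘ⟩) b = Ψ (0, p.1) ∧
    HasFDerivWithinAt (fun q => totalFlow Θ Ψ (0, q))
      (E.tjac (x := ⟨x.chart, p.1, hp⟩) (y := ⟨y.chart, Θ (0, p.1), hΘ⟩) b p.2) (tube (X.dom x.chart) (E.rank x.chart)) p := by
  obtain ⟨hΘ, b, hb, hact, hd⟩ := h.total (p := (0, p)) hpU hp
  refine ⟨hΘ, b, hb, hact, ?_⟩
  exact hd.at_zero

end IsFlow

/-- `β` is a one-form on the total space invariant under all arrows. -/
def IsInvariant (E : TBundle X)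
    (β : ∀ i, X.V i × Fib (E.rank i) → (X.V i × Fib (E.rank i) →ₗ[ℝ] EqRing m)) : Prop :=
  ∀ {x y : X.Obj} (a : x ⟶ y) (v : Fib (E.rank x.chart)),
    β y.chart (y.pt, E.act a v) ∘ₗ (E.tjac a v).toLinearMap = β x.chart (x.pt, v)

theorem dform_one_invariant (hX : X.IsOrbifold) (hE : E.IsSmooth)
    {β : ∀ i, X.V i × Fib (E.rank i) → (X.V i × Fib (E.rank i) →ₗ[ℝ] EqRing m)}
    (hβ : ∀ i, ∀ p ∈ tube (X.dom i) (E.rank i), SmoothNear (β i) (tube (X.dom i) (E.rank i)) p)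
    (hinv : E.IsInvariant β) {x y : X.Obj} (a : x ⟶ y) (v : Fib (E.rank x.chart)) :
    EForm.pull (E.tjac a v).toLinearMap (EForm.dform (fun p => EForm.one (β y.chart p))
      (tube (X.dom y.chart) (E.rank y.chart)) (y.pt, E.act a v)) =
    EForm.dform (fun p => EForm.one (β x.chart p)) (tube (X.dom x.chart) (E.rank x.chart)) (x.pt, v) := by
  obtain ⟨U, L, Θ, Ψ, h⟩ := exists_flow hX hE a
  have hUD : UniqueDiffOn ℝ (tube (X.dom x.chart) (E.rank x.chart)) := (goodSet_tube hX _).uniqueDiffOn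
  have hinc : Continuous fun q : X.V x.chart × Fib (E.rank x.chart) => ((0 : Fin m → ℝ), q) := by fun_prop
  have hO : IsOpen {q : X.V x.chart × Fib (E.rank x.chart) | (0, q.1) ∈ U} :=
    h.isOpen.preimage (by fun_prop)
  have hc : CNear (fun q => totalFlow Θ Ψ (0, q)) (tube (X.dom x.chart) (E.rank x.chart)) (x.pt, v) :=
    ⟨_, hO, h.mem, h.contDiffOn_total.comp (ContDiff.contDiffOn (by fun_prop)) fun q hq => hq⟩
  have hz := h.totalFlow_zero v
  have hdir := EForm.dform_one_pull (m := m) hc (show (x.pt, v) ∈ tube _ _ from x.mem) (goodSet_tube hX _)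
    (goodSet_tube (E := E) hX y.chart).uniqueDiffOn hO h.mem (fun q hq => h.mapsTo ⟨hq.1, hq.2⟩)
    (β := β y.chart) (by rw [hz]; exact hβ _ _ y.mem) (γ := β x.chart) (hβ _ _ x.mem) (fun q hq => by
      obtain ⟨hΘ, b, hb, hact, hd⟩ := h.total_zero hq.1 hq.2
      rw [hd.fderivWithin (hUD q hq.2)]
      have := hinv b q.2
      rw [← this, hact]
      rfl)
  obtain ⟨hΘ, b, hb, hact, hd⟩ := h.total_zero (p := (x.pt, v)) h.mem x.mem
  rw [hdir, hd.fderivWithin (hUD (x.pt, v) x.mem), hz,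
    E.tjac_congr (hb.symm.trans h.isSection.2.2.1)]

theorem momAt_dform_one_invariant (hX : X.IsOrbifold) (hE : E.IsSmooth)
    {β : ∀ i, X.V i × Fib (E.rank i) → (X.V i × Fib (E.rank i) →ₗ[ℝ] EqRing m)}
    (hβ : ∀ i, ∀ p ∈ tube (X.dom i) (E.rank i), SmoothNear (β i) (tube (X.dom i) (E.rank i)) p)
    (hinv : E.IsInvariant β) {i : X.ι} {f : X.V i × Fib (E.rank i) → ℝ}
    {p : X.V i × Fib (E.rank i)} (hp : p.1 ∈ X.dom i)
    (hf : CNear f (tube (X.dom i) (E.rank i)) p)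
    (hfβ : ∀ p ∈ tube (X.dom i) (E.rank i),
      ∑ j, lam j * β i p (E.tfund i p j) = algebraMap ℝ (EqRing m) (f p)) :
    EForm.momAt (E.tfund i p) (EForm.dform (fun p => EForm.one (β i p)) (tube (X.dom i) (E.rank i)) p) =
      -EForm.covector m (fderivWithin ℝ f (tube (X.dom i) (E.rank i)) p).toLinearMap := by
  obtain ⟨U, L, Θ, Ψ, h⟩ := exists_flow hX hE (𝟙 (⟨i, p.1, hp⟩ : X.Obj))
  have hUD : UniqueDiffOn ℝ {q : (Fin m → ℝ) × (X.V i × Fib (E.rank i)) | q.2 ∈ tube (X.dom i) (E.rank i)} :=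
    (goodSet_tube (E := E) hX i).snd_preimage.uniqueDiffOn
  have hz : totalFlow Θ Ψ (0, p) = p := by
    have := h.totalFlow_zero p.2
    rw [E.act_id] at this
    exact this
  refine EForm.momAt_dform_one (goodSet_tube (E := E) hX i) hp h.isOpen_total h.mem h.contDiffOn_total
    (fun q hq => h.mapsTo ⟨hq.1, hq.2⟩) hz (hβ i p hp)
    (fun j => cnear_tfund hX hE hp j) ?_ ?_ ?_ ?_ hf hfβ
  · intro q hq u
    obtain ⟨hΘ, b, hb, hact, hd⟩ := h.total hq.1 hq.2
    rw [hd.fderivWithin (hUD q hq.2), paramDeriv_zero]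
    have := hinv b q.2.2
    rw [hact] at this
    exact congrArg (fun A => A u) this
  · intro q hq j
    obtain ⟨hΘ, b, hb, hact, hd⟩ := h.total hq.1 hq.2
    rw [hd.fderivWithin (hUD q hq.2), paramDeriv_single]
    have h1 := hinv b q.2.2
    have h2 := tjac_tfund hX hE b q.2.2 j
    rw [hact] at h1 h2
    have h3 := congrArg (fun A => A (E.tfund i q.2 j)) h1
    refine Eq.trans ?_ h3
    exact congrArg (β i (totalFlow Θ Ψ q)) h2.symm
  · intro j
    obtain ⟨hΘ, b, hb, hact, hd⟩ := h.total (p := (0, p)) h.mem hp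
    rw [hd.fderivWithin (hUD (0, p) hp), paramDeriv_single, hz]
  · intro u
    obtain ⟨hΘ, b, hb, hact, hd⟩ := h.total (p := (0, p)) h.mem hp
    rw [hd.fderivWithin (hUD (0, p) hp), paramDeriv_zero,
      E.tjac_congr (hb.symm.trans h.isSection.2.2.1), tjac_apply, X.jac_id, E.act_id, E.dact_id]
    refine Prod.ext rfl ?_
    change u.2 + (0 : Fib (E.rank i)) = u.2
    exact add_zero _

end TBundle

end

section

theorem TBundle.detSign_eq {r : ℕ} (A : Fib r →L[ℝ] Fib r) :
    TBundle.detSign A = ((SignType.sign (LinearMap.det A.toLinearMap) : SignType) : ℝ) := by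
  rw [TBundle.detSign, dif_pos rfl]
  congr 2
  rw [← LinearMap.det_toMatrix (EuclideanSpace.basisFun (Fin r) ℝ).toBasis]
  congr 1

theorem HasVIntegral.comp_linear {r : ℕ} {M : Type*} [AddCommGroup M] [Module ℝ M] {F : Fib r → M} {y : M}
    (h : HasVIntegral volume F y) (A : Fib r →L[ℝ] Fib r) (hA : LinearMap.det A.toLinearMap ≠ 0) :
    HasVIntegral volume (fun v => |LinearMap.det A.toLinearMap| • F (A v)) y := by
  set e : Fib r ≃L[ℝ] Fib r := (LinearMap.equivOfDetNeZero A.toLinearMap hA).toContinuousLinearEquiv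
  have heA : ∀ v, e v = A v := fun v => rfl
  have hemb : MeasurableEmbedding fun v => A v := e.toHomeomorph.measurableEmbedding
  have hmap := Measure.map_linearMap_addHaar_eq_smul_addHaar (volume : Measure (Fib r)) hA
  have hd : 0 < |LinearMap.det A.toLinearMap| := abs_pos.mpr hA
  intro L
  have hcomp : (fun v => L (|LinearMap.det A.toLinearMap| • F (A v))) =
      fun v => |LinearMap.det A.toLinearMap| * ((fun w => L (F w)) ∘ fun v => A v) v := by
    funext v; rw [map_smul, smul_eq_mul]; rfl
  have hm : Measure.map (fun v => A v) (volume : Measure (Fib r)) =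
      ENNReal.ofReal |(LinearMap.det A.toLinearMap)⁻¹| • volume := hmap
  rw [hcomp]
  constructor
  · refine Integrable.const_mul (hemb.integrable_map_iff.mp ?_) _
    rw [hm]
    exact (h L).1.smul_measure ENNReal.ofReal_ne_top
  · have := hemb.integral_map (μ := volume) fun w => L (F w)
    rw [hm, integral_smul_measure, (h L).2, ENNReal.toReal_ofReal (abs_nonneg _)] at this
    rw [integral_const_mul]
    simp only [Function.comp]
    rw [← this, smul_eq_mul, ← mul_assoc, abs_inv, mul_inv_cancel₀ hd.ne', one_mul]

namespace EForm

variable {m : ℕ} {V W : Type} [NormedAddCommGroup V] [NormedSpace ℝ V] [FiniteDimensional ℝ V]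
  [NormedAddCommGroup W] [NormedSpace ℝ W] [FiniteDimensional ℝ W]

omit [FiniteDimensional ℝ V] [FiniteDimensional ℝ W] in
theorem pull_kernel {J : V →ₗ[ℝ] W} {f : V → ℝ} {f' : W → ℝ} {Ω φ : V → EForm m V} {Ω' φ' : W → EForm m W}
    {p : V} {p' : W} (N : ℕ) {c : ℝ} (hf : f' p' = f p) (hΩ : pull J (Ω' p') = Ω p)
    (hφ : f p ≤ 1 ∨ pull J (φ' p') = c • φ p) :
    pull J (kernel N f' Ω' φ' p') = c • kernel N f Ω φ p := by
  unfold kernel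
  rw [pull_sum, Finset.smul_sum]
  refine Finset.sum_congr rfl fun k _ => ?_
  rw [pull_real_smul, hf, pull_mul, pull_pow, hΩ]
  rcases hφ with h | h
  · rw [coef_of_le h, zero_smul, zero_smul, smul_zero]
  · rw [h, mul_smul_comm, smul_comm]

theorem pull_smul_kernel {r s : ℕ} {J : V × Fib r →ₗ[ℝ] W × Fib s} {S : Set V} {f : V × Fib r → ℝ}
    {f' : W × Fib s → ℝ} {Ω φ : V × Fib r → EForm m (V × Fib r)} {Ω' φ' : W × Fib s → EForm m (W × Fib s)}
    (hQ : IsFibreQuadratic f S) {x : V} (hx : x ∈ S) {v : Fib r} {p' : W × Fib s} {N N' : ℕ} {c t t' : ℝ}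
    (hN : N' = N) (ht : t' = t) (hf : f' p' = f (x, v)) (hΩ : pull J (Ω' p') = Ω (x, v))
    (hφ : v ≠ 0 → pull J (φ' p') = c • φ (x, v)) :
    pull J (t' • kernel N' f' Ω' φ' p') = c • t • kernel N f Ω φ (x, v) := by
  rw [pull_real_smul, ht, hN, smul_comm]
  congr 1
  refine pull_kernel N hf hΩ ?_
  rcases eq_or_ne v 0 with rfl | hv
  · left
    rw [hQ.zero hx]
    exact zero_le_one
  · exact Or.inr (hφ hv)

theorem hasVIntegral_fpush_pull {r s : ℕ} {A : Fib r →L[ℝ] Fib s} (hA : Function.Bijective A)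
    {J : Fib r → (V × Fib r →ₗ[ℝ] W × Fib s)} {B : V →ₗ[ℝ] W} (hJ : ∀ v p, (J v p).1 = B p.1)
    (hJA : ∀ v u, J v (0, u) = (0, A u)) {K : V × Fib r → EForm m (V × Fib r)}
    {K' : W × Fib s → EForm m (W × Fib s)} {x : V} {y : W}
    (hK : ∀ v, pull (J v) (K' (y, A v)) = TBundle.detSign A • K (x, v))
    (hy : HasVIntegral volume (fun v => TBundle.fibreTop (K' (y, v))) (fpush K' y)) :
    HasVIntegral volume (fun v => TBundle.fibreTop (K (x, v))) (pull B (fpush K' y)) := by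
  obtain rfl : r = s := by
    have := (LinearEquiv.ofBijective A.toLinearMap hA).finrank_eq
    simpa using this
  have hdet : LinearMap.det A.toLinearMap ≠ 0 := by
    have := LinearEquiv.isUnit_det' (LinearEquiv.ofBijective A.toLinearMap hA)
    exact this.ne_zero
  refine ((hy.map (pullLin m B)).comp_linear A hdet).congr (Eventually.of_forall fun v => ?_)
  have h1 := fibreTop_pull (J v) B A.toLinearMap (hJ v) (fun u => hJA v u) (K' (y, A v))
  rw [hK, ← fibreTopLin_apply, map_smul, fibreTopLin_apply, TBundle.detSign_eq] at h1
  have h2 : ((SignType.sign (LinearMap.det A.toLinearMap) : SignType) : ℝ) *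
      ((SignType.sign (LinearMap.det A.toLinearMap) : SignType) : ℝ) = 1 := by
    rcases lt_or_gt_of_ne hdet with h | h
    · rw [sign_neg h]; simp
    · rw [sign_pos h]; simp
  have h3 : |LinearMap.det A.toLinearMap| =
      ((SignType.sign (LinearMap.det A.toLinearMap) : SignType) : ℝ) * LinearMap.det A.toLinearMap := by
    rw [sign_mul_self]
  change _ = |LinearMap.det A.toLinearMap| • pull B (TBundle.fibreTop (K' (y, A v)))
  rw [h3, mul_smul]
  refine Eq.trans ?_ (congrArg (fun z => ((SignType.sign (LinearMap.det A.toLinearMap) : SignType) : ℝ) • z) h1)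
  simp only [smul_smul, h2, one_smul]

theorem pull_fpush {r s : ℕ} {A : Fib r →L[ℝ] Fib s} (hA : Function.Bijective A)
    {J : Fib r → (V × Fib r →ₗ[ℝ] W × Fib s)} {B : V →ₗ[ℝ] W} (hJ : ∀ v p, (J v p).1 = B p.1)
    (hJA : ∀ v u, J v (0, u) = (0, A u)) {S : Set V} {T : Set W} {K : V × Fib r → EForm m (V × Fib r)}
    {K' : W × Fib s → EForm m (W × Fib s)} {x : V} {y : W} (hx : x ∈ S) (hy : y ∈ T)
    (h : ∀ v, pull (J v) (K' (y, A v)) = TBundle.detSign A • K (x, v))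
    (hK : FibreCompact K S) (hK' : FibreCompact K' T) : pull B (fpush K' y) = fpush K x :=
  (hasVIntegral_fpush_pull hA hJ hJA h (hasVIntegral_fpush hK' hy)).unique (hasVIntegral_fpush hK hx)

theorem pull_fpush_kernel {r s : ℕ} {A : Fib r →L[ℝ] Fib s} (hA : Function.Bijective A)
    {J : Fib r → (V × Fib r →ₗ[ℝ] W × Fib s)} {B : V →ₗ[ℝ] W} (hJ : ∀ v p, (J v p).1 = B p.1)
    (hJA : ∀ v u, J v (0, u) = (0, A u)) {S : Set V} {T : Set W} {f : V × Fib r → ℝ}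
    {f' : W × Fib s → ℝ} {Ω φ : V × Fib r → EForm m (V × Fib r)} {Ω' φ' : W × Fib s → EForm m (W × Fib s)}
    {ψ : V → ℝ} {ψ' : W → ℝ} (hQ : IsFibreQuadratic f S) {x : V} {y : W} (hx : x ∈ S) (hy : y ∈ T) {N N' : ℕ}
    (hN : N' = N) (hψ : ψ' y = ψ x) (hf : ∀ v, f' (y, A v) = f (x, v))
    (hΩ : ∀ v, pull (J v) (Ω' (y, A v)) = Ω (x, v))
    (hφ : ∀ v, v ≠ 0 → pull (J v) (φ' (y, A v)) = TBundle.detSign A • φ (x, v))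
    (hK : FibreCompact (fun p => ψ p.1 • kernel N f Ω φ p) S)
    (hK' : FibreCompact (fun p => ψ' p.1 • kernel N' f' Ω' φ' p) T) :
    pull B (fpush (fun p => ψ' p.1 • kernel N' f' Ω' φ' p) y) = fpush (fun p => ψ p.1 • kernel N f Ω φ p) x :=
  pull_fpush hA hJ hJA hx hy (fun v => pull_smul_kernel hQ hx hN hψ (hf v) (hΩ v) (hφ v)) hK hK'

end EForm

variable {m : ℕ} {X : TGroupoid m} {E : TBundle X}

namespace TBundle

theorem act_bijective (E : TBundle X) {x y : X.Obj} (a : x ⟶ y) : Function.Bijective (E.act a) := by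
  refine Function.bijective_iff_has_inverse.mpr ⟨E.act (Groupoid.inv a), fun v => ?_, fun v => ?_⟩
  · rw [← ContinuousLinearMap.comp_apply, ← E.act_comp, Groupoid.comp_inv, E.act_id]; rfl
  · rw [← ContinuousLinearMap.comp_apply, ← E.act_comp, Groupoid.inv_comp, E.act_id]; rfl

theorem tjac_vertical (E : TBundle X) {x y : X.Obj} (a : x ⟶ y) (v u : Fib (E.rank x.chart)) :
    E.tjac a v (0, u) = (0, E.act a u) := by
  refine Prod.ext (map_zero (X.jac a)) ?_
  change E.act a u + E.dact a 0 v = E.act a u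
  rw [map_zero]
  exact add_zero _

theorem IsSphereForm.smoothNear {φ : E.total.RawForm} (hφ : E.IsSphereForm φ) {i : X.ι}
    {p : X.V i × Fib (E.rank i)} (hp : p.1 ∈ X.dom i) (hp2 : p.2 ≠ 0) :
    SmoothNear (V := X.V i × Fib (E.rank i)) (M := EForm m (X.V i × Fib (E.rank i))) (φ i)
      (tube (X.dom i) (E.rank i)) p := by
  have h := smoothNear_iff.mp (hφ.form.smooth i) p ⟨hp, hp2⟩
  have hO : IsOpen {p : X.V i × Fib (E.rank i) | p.2 ≠ 0} := isOpen_ne_fun continuous_snd continuous_const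
  refine SmoothNear.of_inter_open (V := X.V i × Fib (E.rank i)) hO hp2 ?_
  exact h.mono fun q hq => ⟨hq.2, hq.1⟩

theorem IsSphereForm.invariant {φ : E.total.RawForm} (hφ : E.IsSphereForm φ) {x y : X.Obj} (a : x ⟶ y)
    {v : Fib (E.rank x.chart)} (hv : v ≠ 0) :
    EForm.pull (V := X.V x.chart × Fib (E.rank x.chart)) (W := X.V y.chart × Fib (E.rank y.chart))
      (E.tjac a v).toLinearMap (φ y.chart (y.pt, E.act a v)) =
      E.orient a • (φ x.chart (x.pt, v) : EForm m (X.V x.chart × Fib (E.rank x.chart))) :=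
  hφ.form.invariant (x := ⟨x.chart, (x.pt, v), x.mem⟩) (y := ⟨y.chart, (y.pt, E.act a v), y.mem⟩)
    (show E.TotalHom _ _ from ⟨a, rfl⟩) ⟨x.mem, hv⟩
    ⟨y.mem, fun h => hv ((E.act_bijective a).1 (h.trans (map_zero (E.act a)).symm))⟩

/-- The form on the base obtained by integrating a cut off kernel over the fibres. -/
noncomputable def pushKernel (E : TBundle X) (N : X.ι → ℕ) (ψ : ∀ i, X.V i → ℝ)
    (Q : ∀ i, X.V i × Fib (E.rank i) → ℝ)
    (β : ∀ i, X.V i × Fib (E.rank i) → (X.V i × Fib (E.rank i) →ₗ[ℝ] EqRing m))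
    (φ : E.total.RawForm) : X.RawForm := fun i =>
  EForm.fpush fun p : X.V i × Fib (E.rank i) => ψ i p.1 • EForm.kernel (N i) (Q i)
    (EForm.dform (fun p => EForm.one (β i p)) (tube (X.dom i) (E.rank i))) (φ i) p

variable {N : X.ι → ℕ} {ψ : ∀ i, X.V i → ℝ} {Q : ∀ i, X.V i × Fib (E.rank i) → ℝ}
  {β : ∀ i, X.V i × Fib (E.rank i) → (X.V i × Fib (E.rank i) →ₗ[ℝ] EqRing m)}
  {φ : E.total.RawForm}

theorem fibreCompact_pushKernel (hX : X.IsOrbifold)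
    (hβ : ∀ i, ∀ p ∈ tube (X.dom i) (E.rank i), SmoothNear (β i) (tube (X.dom i) (E.rank i)) p)
    (hQ : ∀ i, IsFibreQuadratic (Q i) (X.dom i)) (hφ : E.IsSphereForm φ)
    (hψ : ∀ i, ∀ x ∈ X.dom i, CNear (ψ i) (X.dom i) x)
    (hpos : ∀ i, ∀ x ∈ X.dom i, (∀ v, v ≠ 0 → 0 < Q i (x, v)) ∨
      ∃ U, IsOpen U ∧ x ∈ U ∧ ∀ y ∈ U ∩ X.dom i, ψ i y = 0) (i : X.ι) :
    FibreCompact (fun p : X.V i × Fib (E.rank i) => ψ i p.1 • EForm.kernel (N i) (Q i)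
      (EForm.dform (fun p => EForm.one (β i p)) (tube (X.dom i) (E.rank i))) (φ i) p) (X.dom i) :=
  EForm.fibreCompact_kernel (hQ i)
    (fun p hp => EForm.smoothNear_dform ((hβ i p hp).lin (EForm.oneLin m _)) (goodSet_tube hX i).uniqueDiffOn)
    (fun p hp hv => hφ.smoothNear hp hv) (hψ i) (hpos i) (N i)

theorem pull_pushKernel (hX : X.IsOrbifold) (hE : E.IsSmooth)
    (hβ : ∀ i, ∀ p ∈ tube (X.dom i) (E.rank i), SmoothNear (β i) (tube (X.dom i) (E.rank i)) p)
    (hN : ∀ {x y : X.Obj}, (x ⟶ y) → N y.chart = N x.chart)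
    (hinv : E.IsInvariant β) (hQ : ∀ i, IsFibreQuadratic (Q i) (X.dom i))
    (hQinv : ∀ {x y : X.Obj} (a : x ⟶ y) (v : Fib (E.rank x.chart)),
      Q y.chart (y.pt, E.act a v) = Q x.chart (x.pt, v)) (hφ : E.IsSphereForm φ)
    (hψ : ∀ i, ∀ x ∈ X.dom i, CNear (ψ i) (X.dom i) x)
    (hψinv : ∀ {x y : X.Obj}, (x ⟶ y) → ψ y.chart y.pt = ψ x.chart x.pt)
    (hpos : ∀ i, ∀ x ∈ X.dom i, (∀ v, v ≠ 0 → 0 < Q i (x, v)) ∨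
      ∃ U, IsOpen U ∧ x ∈ U ∧ ∀ y ∈ U ∩ X.dom i, ψ i y = 0) {x y : X.Obj} (a : x ⟶ y) :
    EForm.pull (X.jac a).toLinearMap (E.pushKernel N ψ Q β φ y.chart y.pt) =
      E.pushKernel N ψ Q β φ x.chart x.pt := by
  have hφinv := fun (v : Fib (E.rank x.chart)) (hv : v ≠ 0) => hφ.invariant a hv
  have h1 := fibreCompact_pushKernel (N := N) hX hβ hQ hφ hψ hpos x.chart
  have h2 := fibreCompact_pushKernel (N := N) hX hβ hQ hφ hψ hpos y.chart
  exact EForm.pull_fpush_kernel (E.act_bijective a) (J := fun v => (E.tjac a v).toLinearMap)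
    (B := (X.jac a).toLinearMap) (fun v p => rfl) (fun v u => E.tjac_vertical a v u)
    (S := X.dom x.chart) (T := X.dom y.chart) (f := Q x.chart) (f' := Q y.chart)
    (Ω := EForm.dform (fun p => EForm.one (β x.chart p)) (tube (X.dom x.chart) (E.rank x.chart)))
    (Ω' := EForm.dform (fun p => EForm.one (β y.chart p)) (tube (X.dom y.chart) (E.rank y.chart)))
    (φ := φ x.chart) (φ' := φ y.chart) (ψ := ψ x.chart) (ψ' := ψ y.chart) (hQ x.chart) x.mem y.mem
    (hN a) (hψinv a) (fun v => hQinv a v) (fun v => dform_one_invariant hX hE hβ hinv a v) hφinv h1 h2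

theorem isForm_pushKernel (hX : X.IsOrbifold) (hE : E.IsSmooth)
    (hβ : ∀ i, ∀ p ∈ tube (X.dom i) (E.rank i), SmoothNear (β i) (tube (X.dom i) (E.rank i)) p)
    (hN : ∀ {x y : X.Obj}, (x ⟶ y) → N y.chart = N x.chart)
    (hinv : E.IsInvariant β) (hQ : ∀ i, IsFibreQuadratic (Q i) (X.dom i))
    (hQinv : ∀ {x y : X.Obj} (a : x ⟶ y) (v : Fib (E.rank x.chart)),
      Q y.chart (y.pt, E.act a v) = Q x.chart (x.pt, v)) (hφ : E.IsSphereForm φ)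
    (hψ : ∀ i, ∀ x ∈ X.dom i, CNear (ψ i) (X.dom i) x)
    (hψinv : ∀ {x y : X.Obj}, (x ⟶ y) → ψ y.chart y.pt = ψ x.chart x.pt)
    (hpos : ∀ i, ∀ x ∈ X.dom i, (∀ v, v ≠ 0 → 0 < Q i (x, v)) ∨
      ∃ U, IsOpen U ∧ x ∈ U ∧ ∀ y ∈ U ∩ X.dom i, ψ i y = 0) :
    X.IsForm (E.pushKernel N ψ Q β φ) where
  smooth i := smoothNear_iff.mpr fun x hx =>
    EForm.smoothNear_fpush (fibreCompact_pushKernel hX hβ hQ hφ hψ hpos i) (hX.goodSet_dom i).uniqueDiffOn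
      (hX.locallyConvex_dom i) hx
  invariant {x y} a _ _ := by
    rw [one_smul]
    exact pull_pushKernel hX hE hβ hN hinv hQ hQinv hφ hψ hψinv hpos a

end TBundle

end

section

theorem vlim_spec {α M : Type*} [AddCommGroup M] [Module ℝ M] {l : Filter α} [l.NeBot] {F : α → M} {y : M}
    (h : ∀ L : M →ₗ[ℝ] ℝ, Tendsto (fun a => L (F a)) l (𝓝 (L y))) : vlim l F = y := by
  have hex : ∃ y : M, ∀ L : M →ₗ[ℝ] ℝ, Tendsto (fun a => L (F a)) l (𝓝 (L y)) := ⟨y, h⟩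
  rw [vlim, dif_pos hex]
  exact ext_functional fun L => tendsto_nhds_unique (hex.choose_spec L) (h L)

theorem EForm.algebraMap_real {m : ℕ} {V : Type} [AddCommGroup V] [Module ℝ V] (c : ℝ) :
    algebraMap ℝ (EForm m V) c = algebraMap (EqRing m) (EForm m V) (algebraMap ℝ (EqRing m) c) :=
  IsScalarTower.algebraMap_apply ℝ (EqRing m) (EForm m V) c

/-- A real functional on the coefficients taking the value `1` on the constant `1`. -/
theorem EqRing.exists_functional (m : ℕ) :
    ∃ ℓ : EqRing m →ₗ[ℝ] ℝ, ∀ c : ℝ, ℓ (algebraMap ℝ (EqRing m) c) = c := by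
  have h1 : (1 : EqRing m) ≠ 0 := one_ne_zero
  obtain ⟨L, hL⟩ : ∃ L : EqRing m →ₗ[ℝ] ℝ, L 1 ≠ 0 := by
    by_contra! h
    exact h1 (ext_functional fun L => by rw [h L, map_zero])
  refine ⟨(L 1)⁻¹ • L, fun c => ?_⟩
  rw [Algebra.algebraMap_eq_smul_one, map_smul, LinearMap.smul_apply, smul_eq_mul, smul_eq_mul,
    inv_mul_cancel₀ hL, mul_one]

variable {m : ℕ} {X : TGroupoid m} {E : TBundle X}

namespace TBundle


/-- A limit of the form defining the homogeneous components is homogeneous. -/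
theorem _root_.EForm.vlim_homogeneous {V : Type} [NormedAddCommGroup V] [NormedSpace ℝ V] {r : ℕ}
    (g : V × Fib r → EForm m (V × Fib r)) (x : V) (v : Fib r) (k : ℕ) {u : ℝ} (hu : 0 < u) :
    EForm.pull (EForm.dil V r u) (vlim atTop fun s : ℝ => s ^ k •
        EForm.pull (EForm.dil V r s⁻¹) (g (x, s⁻¹ • u • v))) =
      u ^ k • vlim atTop fun s : ℝ => s ^ k • EForm.pull (EForm.dil V r s⁻¹) (g (x, s⁻¹ • v)) := by
  set F : Fib r → ℝ → EForm m (V × Fib r) := fun v s =>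
    s ^ k • EForm.pull (EForm.dil V r s⁻¹) (g (x, s⁻¹ • v)) with hF
  have hdil : ∀ a b : ℝ, ∀ ψ : EForm m (V × Fib r), EForm.pull (EForm.dil V r a) (EForm.pull (EForm.dil V r b) ψ) =
      EForm.pull (EForm.dil V r (b * a)) ψ := fun a b ψ => by
    rw [EForm.pull_pull]
    congr 1
    refine LinearMap.ext fun p => Prod.ext rfl ?_
    change b • a • p.2 = (b * a) • p.2
    rw [mul_smul]
  have key : ∀ (w : Fib r) (c : ℝ), 0 < c → ∀ s : ℝ, 0 < s →
      EForm.pull (EForm.dil V r c) (F (c • w) (c * s)) = c ^ k • F w s := by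
    intro w c hc s hs
    have e : (c * s)⁻¹ * c = s⁻¹ := by field_simp
    simp only [hF]
    rw [EForm.pull_real_smul, hdil, smul_smul, e, smul_smul, mul_pow]
  have hlim : ∀ (w : Fib r) (c : ℝ), 0 < c → ∀ y : EForm m (V × Fib r),
      (∀ L : EForm m (V × Fib r) →ₗ[ℝ] ℝ, Tendsto (fun s => L (F (c • w) s)) atTop (𝓝 (L y))) →
      ∀ L : EForm m (V × Fib r) →ₗ[ℝ] ℝ, Tendsto (fun s => L (c ^ k • F w s)) atTop
        (𝓝 (L (EForm.pull (EForm.dil V r c) y))) := by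
    intro w c hc y hy L
    have h1 := (hy (L ∘ₗ EForm.pullLin m (EForm.dil V r c))).comp (tendsto_id.const_mul_atTop hc)
    refine h1.congr' ?_
    filter_upwards [eventually_gt_atTop 0] with s hs
    rw [← key w c hc s hs]
    rfl
  by_cases hex : ∃ y : EForm m (V × Fib r), ∀ L : EForm m (V × Fib r) →ₗ[ℝ] ℝ,
      Tendsto (fun s => L (F (u • v) s)) atTop (𝓝 (L y))
  · obtain ⟨y, hy⟩ := hex
    have h1 := hlim v u hu y hy
    have hu' : u ^ k ≠ 0 := pow_ne_zero _ hu.ne'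
    have h2 : ∀ L : EForm m (V × Fib r) →ₗ[ℝ] ℝ, Tendsto (fun s => L (F v s)) atTop
        (𝓝 (L ((u ^ k)⁻¹ • EForm.pull (EForm.dil V r u) y))) := by
      intro L
      have := h1 ((u ^ k)⁻¹ • L)
      simpa [smul_eq_mul, hu'] using this
    change EForm.pull (EForm.dil V r u) (vlim atTop (F (u • v))) = u ^ k • vlim atTop (F v)
    rw [vlim_spec hy, vlim_spec h2, smul_smul, mul_inv_cancel₀ hu', one_smul]
  · have hex' : ¬ ∃ y : EForm m (V × Fib r), ∀ L : EForm m (V × Fib r) →ₗ[ℝ] ℝ,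
        Tendsto (fun s => L (F v s)) atTop (𝓝 (L y)) := by
      rintro ⟨y, hy⟩
      refine hex ?_
      have e : v = u⁻¹ • u • v := by rw [smul_smul, inv_mul_cancel₀ hu.ne', one_smul]
      rw [e] at hy
      have h1 := hlim (u • v) u⁻¹ (inv_pos.mpr hu) y hy
      have hu' : (u⁻¹) ^ k ≠ 0 := pow_ne_zero _ (inv_pos.mpr hu).ne'
      refine ⟨((u⁻¹) ^ k)⁻¹ • EForm.pull (EForm.dil V r u⁻¹) y, fun L => ?_⟩
      have := h1 (((u⁻¹) ^ k)⁻¹ • L)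
      simp only [LinearMap.smul_apply, map_smul, smul_eq_mul, mul_inv_cancel_left₀ hu'] at this ⊢
      exact this
    change EForm.pull (EForm.dil V r u) (vlim atTop (F (u • v))) = u ^ k • vlim atTop (F v)
    rw [vlim, vlim, dif_neg hex, dif_neg hex', EForm.pull_zero, smul_zero]

theorem IsQuadratic.pull_dil {q : E.total.RawForm} (hq : E.IsQuadratic q) {i : X.ι} {x : X.V i}
    (hx : x ∈ X.dom i) (v : Fib (E.rank i)) {u : ℝ} (hu : 0 < u) :
    EForm.pull (EForm.dil (X.V i) (E.rank i) u) (q i (x, u • v) : EForm m (X.V i × Fib (E.rank i))) =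
      u ^ 2 • (q i (x, v) : EForm m (X.V i × Fib (E.rank i))) := by
  have h1 := hq i (x, u • v) hx
  have h2 := hq i (x, v) hx
  rw [homPart] at h1 h2
  rw [← h1, ← h2]
  exact EForm.vlim_homogeneous (fun p => (q - ∑ j : Fin 2, E.homPart q j) i p) x v 2 hu

theorem IsLocalizing.exists_one {q : E.total.RawForm} (hq : E.IsLocalizing q) {i : X.ι}
    {p : X.V i × Fib (E.rank i)} (hp : p.1 ∈ X.dom i) :
    EForm.one (EForm.degOne (q i p : EForm m (X.V i × Fib (E.rank i)))) =
      (q i p : EForm m (X.V i × Fib (E.rank i))) := by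
  obtain ⟨n, ζ, c, η, h, hsum⟩ := hq.decomposition
  have h1 : ∃ β : X.V i × Fib (E.rank i) →ₗ[ℝ] EqRing m,
      (q i p : EForm m (X.V i × Fib (E.rank i))) = EForm.one β := by
    choose β hβ using fun k => (h k).2.2.2 i p hp
    refine ⟨∑ k, c k • ((Algebra.linearMap ℝ (EqRing m)) ∘ₗ β k), ?_⟩
    have e := hsum i p hp
    refine e.trans ?_
    refine Eq.trans ?_ (map_sum (ExteriorAlgebra.ι (EqRing m)) _ _).symm
    refine Finset.sum_congr rfl fun k _ => ?_
    rw [LinearMap.map_smul, hβ k]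
    rfl
  obtain ⟨β, hβ⟩ := h1
  rw [hβ, EForm.degOne_one]

theorem degOne_invariant {q : E.total.RawForm} (hq : E.total.IsForm q) :
    E.IsInvariant fun i p => EForm.degOne (q i p : EForm m (X.V i × Fib (E.rank i))) := by
  intro x y a v
  have h := hq.invariant (x := ⟨x.chart, (x.pt, v), x.mem⟩) (y := ⟨y.chart, (y.pt, E.act a v), y.mem⟩)
    (show E.TotalHom _ _ from ⟨a, rfl⟩) x.mem y.mem
  rw [one_smul] at h
  have h2 : EForm.pull (E.tjac a v).toLinearMap
      (q y.chart (y.pt, E.act a v) : EForm m (X.V y.chart × Fib (E.rank y.chart))) =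
      (q x.chart (x.pt, v) : EForm m (X.V x.chart × Fib (E.rank x.chart))) := h
  rw [← EForm.degOne_pull, h2]

theorem degOne_smoothNear {q : E.total.RawForm} (hq : E.total.IsForm q) {i : X.ι}
    {p : X.V i × Fib (E.rank i)} (hp : p ∈ tube (X.dom i) (E.rank i)) :
    SmoothNear (fun p => EForm.degOne (q i p : EForm m (X.V i × Fib (E.rank i))))
      (tube (X.dom i) (E.rank i)) p := by
  have h := smoothNear_iff.mp (hq.smooth i) p hp
  exact SmoothNear.lin (V := X.V i × Fib (E.rank i)) (M := EForm m (X.V i × Fib (E.rank i)))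
    (N := X.V i × Fib (E.rank i) →ₗ[ℝ] EqRing m) (EForm.degOneLin m (X.V i × Fib (E.rank i))) h

end TBundle

end

section

variable {m : ℕ} {X : TGroupoid m} {E : TBundle X}

theorem vderiv_const_smul {V M : Type*} [NormedAddCommGroup V] [NormedSpace ℝ V] [AddCommGroup M]
    [Module ℝ M] {S : Set V} {x : V} {F : V → M} (hF : SmoothNear F S x) (hx : x ∈ S)
    (hS : UniqueDiffOn ℝ S) (c : ℝ) (v : V) : vderiv (fun y => c • F y) S x v = c • vderiv F S x v :=
  vderiv_lin (LinearMap.lsmul ℝ M c) hF hx hS v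

theorem EForm.dform_const_smul {V : Type} [NormedAddCommGroup V] [NormedSpace ℝ V] [FiniteDimensional ℝ V]
    {S : Set V} {x : V} {F : V → EForm m V} (hF : SmoothNear F S x) (hx : x ∈ S)
    (hS : UniqueDiffOn ℝ S) (c : ℝ) :
    EForm.dform (fun y => c • F y) S x = c • EForm.dform F S x := by
  unfold EForm.dform
  rw [Finset.smul_sum]
  refine Finset.sum_congr rfl fun b _ => ?_
  rw [vderiv_const_smul hF hx hS, mul_smul_comm]

theorem EForm.momAt_one {V : Type} [AddCommGroup V] [Module ℝ V] (ξ : Fin m → V) (β : V →ₗ[ℝ] EqRing m) :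
    EForm.momAt ξ (EForm.one β) = algebraMap (EqRing m) (EForm m V) (∑ j, lam j * β (ξ j)) := by
  unfold EForm.momAt
  rw [map_sum]
  refine Finset.sum_congr rfl fun j _ => ?_
  rw [EForm.contract_one, map_mul, EForm.form_smul_def]

theorem EForm.algebraMap_injective (m : ℕ) (V : Type) [AddCommGroup V] [Module ℝ V] :
    Function.Injective (algebraMap (EqRing m) (EForm m V)) := fun a b h => by
  rw [← EForm.degZero_algebraMap (V := V) a, h, EForm.degZero_algebraMap]

instance EForm.nontrivial (m : ℕ) (V : Type) [AddCommGroup V] [Module ℝ V] : Nontrivial (EForm m V) :=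
  (EForm.algebraMap_injective m V).nontrivial

namespace TBundle

/-- The part of degree one of a form on the total space. -/
noncomputable def oneForm (E : TBundle X) (q : E.total.RawForm) (i : X.ι) (p : X.V i × Fib (E.rank i)) :
    X.V i × Fib (E.rank i) →ₗ[ℝ] EqRing m := EForm.degOne (q i p : EForm m (X.V i × Fib (E.rank i)))

/-- The moment of the part of degree one. -/
noncomputable def oneMoment (E : TBundle X) (q : E.total.RawForm) (i : X.ι)
    (p : X.V i × Fib (E.rank i)) : EqRing m := ∑ j, lam j * E.oneForm q i p (E.tfund i p j)

/-- The moment of a localizing form. -/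
noncomputable def momentFun (E : TBundle X) (q : E.total.RawForm) (i : X.ι)
    (p : X.V i × Fib (E.rank i)) : ℝ := E.total.realValue (E.total.moment q) i p

theorem smoothNear_oneForm {q : E.total.RawForm} (hq : E.total.IsForm q) (i : X.ι) :
    ∀ p ∈ tube (X.dom i) (E.rank i), SmoothNear (E.oneForm q i) (tube (X.dom i) (E.rank i)) p :=
  fun _ hp => degOne_smoothNear hq hp

theorem isInvariant_oneForm {q : E.total.RawForm} (hq : E.total.IsForm q) : E.IsInvariant (E.oneForm q) :=
  fun a v => degOne_invariant hq a v

theorem oneMoment_invariant (hX : X.IsOrbifold) (hE : E.IsSmooth) {q : E.total.RawForm} (hq : E.total.IsForm q)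
    {x y : X.Obj} (a : x ⟶ y) (v : Fib (E.rank x.chart)) :
    E.oneMoment q y.chart (y.pt, E.act a v) = E.oneMoment q x.chart (x.pt, v) := by
  refine Finset.sum_congr rfl fun j _ => ?_
  rw [← isInvariant_oneForm hq a v, ← tjac_tfund hX hE a v j]
  rfl

theorem smoothNear_oneMoment (hX : X.IsOrbifold) (hE : E.IsSmooth) {q : E.total.RawForm}
    (hq : E.total.IsForm q) (i : X.ι) {p : X.V i × Fib (E.rank i)} (hp : p ∈ tube (X.dom i) (E.rank i)) :
    SmoothNear (E.oneMoment q i) (tube (X.dom i) (E.rank i)) p :=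
  SmoothNear.sum _ fun j _ => SmoothNear.lin (LinearMap.mulLeft ℝ (lam j))
    (SmoothNear.bilin (EForm.evalBilin m (X.V i × Fib (E.rank i))) (smoothNear_oneForm hq i p hp)
      (SmoothNear.of_cnear (cnear_tfund hX hE hp j)))

namespace IsLocalizing

variable {q : E.total.RawForm}

theorem moment_eq (hloc : E.IsLocalizing q) {i : X.ι} {p : X.V i × Fib (E.rank i)} (hp : p.1 ∈ X.dom i) :
    (E.total.moment q i p : EForm m (X.V i × Fib (E.rank i))) =
      algebraMap (EqRing m) (EForm m (X.V i × Fib (E.rank i))) (E.oneMoment q i p) := by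
  have h1 : (E.total.moment q i p : EForm m (X.V i × Fib (E.rank i))) =
    EForm.momAt (E.tfund i p) (q i p : EForm m (X.V i × Fib (E.rank i))) := rfl
  rw [h1, ← hloc.exists_one hp, EForm.momAt_one]
  rfl

theorem momentFun_spec (hloc : E.IsLocalizing q) {i : X.ι} {p : X.V i × Fib (E.rank i)}
    (hp : p.1 ∈ X.dom i) : 0 ≤ E.momentFun q i p ∧ (E.momentFun q i p = 0 ↔ p.2 = 0) ∧
      E.oneMoment q i p = algebraMap ℝ (EqRing m) (E.momentFun q i p) := by
  obtain ⟨r, h0, hr, h⟩ := hloc.moment_real i p hp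
  have h1 : E.total.moment q i p = algebraMap ℝ (EForm m (X.V i × Fib (E.rank i))) r := h
  have hex : ∃ r : ℝ, E.total.moment q i p = algebraMap ℝ (EForm m (E.total.V i)) r := ⟨r, h⟩
  have h2 : E.momentFun q i p = r := by
    have h3 := hex.choose_spec
    rw [momentFun, TGroupoid.realValue, dif_pos hex]
    exact EForm.real_algebraMap_injective (h3.symm.trans h)
  rw [h2]
  refine ⟨h0, hr, EForm.algebraMap_injective m (X.V i × Fib (E.rank i)) ?_⟩
  rw [← hloc.moment_eq hp, h1, EForm.algebraMap_real]

theorem momentFun_pos (hloc : E.IsLocalizing q) {i : X.ι} {x : X.V i} (hx : x ∈ X.dom i) {v : Fib (E.rank i)}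
    (hv : v ≠ 0) : 0 < E.momentFun q i (x, v) := by
  obtain ⟨h0, hr, -⟩ := hloc.momentFun_spec (p := (x, v)) hx
  exact lt_of_le_of_ne h0 fun h => hv (hr.mp h.symm)

theorem momentFun_invariant (hX : X.IsOrbifold) (hE : E.IsSmooth) (hq : E.total.IsForm q)
    (hloc : E.IsLocalizing q) {x y : X.Obj} (a : x ⟶ y) (v : Fib (E.rank x.chart)) :
    E.momentFun q y.chart (y.pt, E.act a v) = E.momentFun q x.chart (x.pt, v) := by
  have h := oneMoment_invariant hX hE hq a v
  rw [(hloc.momentFun_spec y.mem).2.2, (hloc.momentFun_spec x.mem).2.2] at h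
  exact (algebraMap ℝ (EqRing m)).injective h

theorem oneForm_dil (hquad : E.IsQuadratic q) {i : X.ι} {x : X.V i} (hx : x ∈ X.dom i) {s : ℝ} (hs : 0 < s)
    (v : Fib (E.rank i)) : E.oneForm q i (x, s • v) ∘ₗ EForm.dil (X.V i) (E.rank i) s =
      s ^ 2 • E.oneForm q i (x, v) := by
  have h := congrArg (EForm.degOneLin m (X.V i × Fib (E.rank i))) (hquad.pull_dil hx v hs)
  rw [map_smul] at h
  exact (EForm.degOne_pull _ _).symm.trans h

theorem isFibreQuadratic (hX : X.IsOrbifold) (hE : E.IsSmooth) (hq : E.total.IsForm q)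
    (hquad : E.IsQuadratic q) (hloc : E.IsLocalizing q) (i : X.ι) :
    IsFibreQuadratic (E.momentFun q i) (X.dom i) where
  smooth p hp := by
    obtain ⟨ℓ, hℓ⟩ := EqRing.exists_functional m
    refine ((smoothNear_oneMoment hX hE hq i hp).functional ℓ).congr isOpen_univ trivial fun y hy => ?_
    rw [(hloc.momentFun_spec hy.2).2.2, hℓ]
  hom x hx s hs v := by
    have h1 : E.oneMoment q i (x, s • v) = s ^ 2 • E.oneMoment q i (x, v) := by
      unfold oneMoment
      rw [Finset.smul_sum]
      refine Finset.sum_congr rfl fun j _ => ?_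
      have h2 : E.tfund i (x, s • v) j = EForm.dil (X.V i) (E.rank i) s (E.tfund i (x, v) j) :=
        Prod.ext rfl (map_smul (E.inf i j x) s v)
      have h3 := congrArg (fun A => A (E.tfund i (x, v) j)) (oneForm_dil hquad hx hs v)
      rw [h2, ← mul_smul_comm]
      exact congrArg (lam j * ·) h3
    rw [(hloc.momentFun_spec (p := (x, s • v)) hx).2.2, (hloc.momentFun_spec (p := (x, v)) hx).2.2,
      Algebra.smul_def, ← map_mul] at h1
    exact (algebraMap ℝ (EqRing m)).injective h1

theorem pull_dil_dform (hX : X.IsOrbifold) (hq : E.total.IsForm q) (hquad : E.IsQuadratic q) {i : X.ι}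
    {x : X.V i} (hx : x ∈ X.dom i) {s : ℝ} (hs : 0 < s) (v : Fib (E.rank i)) :
    EForm.pull (EForm.dil (X.V i) (E.rank i) s) (EForm.dform (fun p => EForm.one (E.oneForm q i p))
      (tube (X.dom i) (E.rank i)) (x, s • v)) =
    s ^ 2 • EForm.dform (fun p => EForm.one (E.oneForm q i p)) (tube (X.dom i) (E.rank i)) (x, v) := by
  set A : X.V i × Fib (E.rank i) →L[ℝ] X.V i × Fib (E.rank i) :=
    (ContinuousLinearMap.id ℝ _).prodMap (s • ContinuousLinearMap.id ℝ _) with hA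
  have hG : GoodSet (tube (X.dom i) (E.rank i)) := goodSet_tube hX i
  have hs1 := smoothNear_oneForm hq i (x, v) hx
  have hs2 : SmoothNear (fun p => s ^ 2 • E.oneForm q i p) (tube (X.dom i) (E.rank i)) (x, v) :=
    SmoothNear.smul (CNear.const (s ^ 2)) hs1
  have h := EForm.dform_one_pull (m := m) (Θ := fun p => A p) (S := tube (X.dom i) (E.rank i))
    (x := (x, v)) (T := tube (X.dom i) (E.rank i)) (CNear.of_contDiff A.contDiff) hx hG hG.uniqueDiffOn isOpen_univ
    trivial (fun p hp => hp.2) (β := E.oneForm q i) (smoothNear_oneForm hq i _ hx)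
    (γ := fun p => s ^ 2 • E.oneForm q i p) hs2 (fun p hp => by
      rw [A.hasFDerivWithinAt.fderivWithin (hG.uniqueDiffOn p hp.2)]
      exact (oneForm_dil hquad hp.2 hs p.2).symm)
  rw [A.hasFDerivWithinAt.fderivWithin (hG.uniqueDiffOn (x, v) hx)] at h
  refine h.symm.trans ?_
  have h2 := EForm.dform_one hs2 hx hG.uniqueDiffOn
  refine h2.trans ?_
  rw [EForm.dform_one hs1 hx hG.uniqueDiffOn, Finset.smul_sum]
  refine Finset.sum_congr rfl fun b _ => ?_
  rw [vderiv_const_smul hs1 hx hG.uniqueDiffOn, ← mul_smul_comm]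
  exact congrArg _ (map_smul (EForm.oneLin m _) (s ^ 2) _)

end IsLocalizing


/-- The dimension of the total space over a chart. -/
noncomputable def totalDim (E : TBundle X) (i : X.ι) : ℕ := Module.finrank ℝ (X.V i × Fib (E.rank i))

theorem _root_.TGroupoid.jac_bijective (X : TGroupoid m) {x y : X.Obj} (a : x ⟶ y) : Function.Bijective (X.jac a) := by
  refine Function.bijective_iff_has_inverse.mpr ⟨X.jac (Groupoid.inv a), fun v => ?_, fun v => ?_⟩
  · rw [← ContinuousLinearMap.comp_apply, ← X.jac_comp, Groupoid.comp_inv, X.jac_id]; rfl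
  · rw [← ContinuousLinearMap.comp_apply, ← X.jac_comp, Groupoid.inv_comp, X.jac_id]; rfl

theorem rank_eq (E : TBundle X) {x y : X.Obj} (a : x ⟶ y) : E.rank y.chart = E.rank x.chart := by
  have := (LinearEquiv.ofBijective (E.act a).toLinearMap (E.act_bijective a)).finrank_eq
  simpa using this.symm

theorem totalDim_eq (E : TBundle X) {x y : X.Obj} (a : x ⟶ y) : E.totalDim y.chart = E.totalDim x.chart := by
  have h1 := (LinearEquiv.ofBijective (X.jac a).toLinearMap (X.jac_bijective a)).finrank_eq
  have h2 := E.rank_eq a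
  unfold totalDim
  rw [Module.finrank_prod, Module.finrank_prod, h1]
  simp [h2]

variable {q φ : E.total.RawForm} {e : X.RawForm}

theorem IsAngularForm.hasVIntegral (hφ : E.IsAngularForm φ e) {i : X.ι} {x : X.V i} (hx : x ∈ X.dom i) :
    HasVIntegral (volume : Measure (Fib (E.rank i))).toSphere
      (fun v : Metric.sphere (0 : Fib (E.rank i)) 1 => fibreTop (V := X.V i)
        (EForm.covector m (radialCovector (X.V i) v.1) * φ i (x, v.1))) 1 := by
  have h := hφ.integral_one i x hx
  by_cases hex : ∃ y : EForm m (X.V i), HasVIntegral (volume : Measure (Fib (E.rank i))).toSphere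
      (fun v : Metric.sphere (0 : Fib (E.rank i)) 1 => fibreTop (V := X.V i)
        (EForm.covector m (radialCovector (X.V i) v.1) * φ i (x, v.1))) y
  · rw [← h]
    exact HasVIntegral.vintegral hex
  · rw [sphereIntegral, vintegral, dif_neg hex] at h
    exact absurd h zero_ne_one

theorem IsAngularForm.rank_pos (hφ : E.IsAngularForm φ e) {i : X.ι} {x : X.V i} (hx : x ∈ X.dom i) :
    0 < E.rank i := by
  by_contra h
  have h0 : E.rank i = 0 := by omega
  have hint := hφ.hasVIntegral hx
  have hempty : IsEmpty (Metric.sphere (0 : Fib (E.rank i)) 1) := by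
    refine ⟨fun v => ?_⟩
    have hsub : Subsingleton (Fib (E.rank i)) := by rw [h0]; infer_instance
    have := v.2
    rw [hsub.elim v.1 0] at this
    simp at this
  have h1 : (1 : EForm m (X.V i)) = 0 :=
    hint.unique (HasVIntegral.zero.congr (Eventually.of_forall fun v => (hempty.false v).elim))
  exact one_ne_zero h1

theorem dform_oneForm_pow (hX : X.IsOrbifold) (hq : E.total.IsForm q) {i : X.ι} {p : X.V i × Fib (E.rank i)}
    (hp : p ∈ tube (X.dom i) (E.rank i)) {n : ℕ} (hn : E.totalDim i + 1 ≤ n) :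
    EForm.dform (fun p => EForm.one (E.oneForm q i p)) (tube (X.dom i) (E.rank i)) p ^ n = 0 :=
  EForm.dform_one_pow_eq_zero (smoothNear_oneForm hq i p hp) hp (goodSet_tube hX i).uniqueDiffOn hn

theorem IsLocalizing.cartan_fpush (hX : X.IsOrbifold) (hE : E.IsSmooth) (hq : E.total.IsForm q)
    (hquad : E.IsQuadratic q) (hloc : E.IsLocalizing q) (hφ : E.IsAngularForm φ e) {i : X.ι} {x : X.V i}
    (hx : x ∈ X.dom i) :
    ∃ σ : EForm m (X.V i), HasVIntegral volume (fun v => fibreTop (Real.exp (-E.momentFun q i (x, v)) •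
        ∑ k ∈ Finset.range (E.totalDim i + 1), (k.factorial : ℝ)⁻¹ •
          EForm.dform (fun p => EForm.one (E.oneForm q i p)) (tube (X.dom i) (E.rank i)) (x, v) ^ k)) σ ∧
      EForm.dform (EForm.fpush (EForm.kernel (E.totalDim i + 2) (E.momentFun q i)
        (EForm.dform (fun p => EForm.one (E.oneForm q i p)) (tube (X.dom i) (E.rank i))) (φ i))) (X.dom i) x -
        EForm.momAt (fun j => X.fund i j x) (EForm.fpush (EForm.kernel (E.totalDim i + 2) (E.momentFun q i)
        (EForm.dform (fun p => EForm.one (E.oneForm q i p)) (tube (X.dom i) (E.rank i))) (φ i)) x) =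
        (-1 : ℝ) ^ E.rank i • (1 - σ * e i x) := by
  have hUT := (goodSet_tube (E := E) hX i).uniqueDiffOn
  have hQ := hloc.isFibreQuadratic hX hE hq hquad i
  refine EForm.cartan_fpush_kernel (hX.goodSet_dom i) (hX.locallyConvex_dom i) (hφ.rank_pos hx) hQ
    (fun x hx v hv => hloc.momentFun_pos hx hv)
    (fun p hp => EForm.smoothNear_dform ((smoothNear_oneForm hq i p hp).lin (EForm.oneLin m _)) hUT)
    (fun x hx s hs v => IsLocalizing.pull_dil_dform hX hq hquad hx hs v)
    (fun p hp => EForm.isEven_dform_one (smoothNear_oneForm hq i p hp) hp hUT)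
    (fun p hp => EForm.dform_dform ((smoothNear_oneForm hq i p hp).lin (EForm.oneLin m _)) hp (goodSet_tube hX i))
    (Ξ := fun p j => E.tfund i p j) (ξ := fun x j => X.fund i j x) (fun p j => rfl)
    (fun p hp => momAt_dform_one_invariant hX hE (smoothNear_oneForm hq) (isInvariant_oneForm hq) hp
      (hQ.smooth p hp) (fun p hp => (hloc.momentFun_spec hp).2.2))
    (fun p hp hv => hφ.sphere_form.smoothNear hp hv) (fun x hx s hs v hv => ?_) (fun x hx v hv => ?_)
    (fun p hp hv => ?_) hx (hφ.hasVIntegral hx) (fun p hp => dform_oneForm_pow hX hq hp le_rfl)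
  · exact hφ.sphere_form.dilation s hs i (x, v) ⟨hx, hv⟩
  · exact hφ.sphere_form.radial i (x, v) ⟨hx, hv⟩
  · have h := hφ.differential i p ⟨hp, hv⟩
    have hO : IsOpen {p : X.V i × Fib (E.rank i) | p.2 ≠ 0} := isOpen_ne_fun continuous_snd continuous_const
    have hset : (E.punctured i : Set (X.V i × Fib (E.rank i))) = {p | p.2 ≠ 0} ∩ tube (X.dom i) (E.rank i) := by
      ext p; exact and_comm
    have h1 : E.total.cartanD E.punctured φ i p = (EForm.dform (φ i) (E.punctured i) p -
      EForm.momAt (E.tfund i p) (φ i p) : EForm m (X.V i × Fib (E.rank i))) := rfl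
    have h2 := EForm.dform_congr_set (m := m) (F := φ i) (S := tube (X.dom i) (E.rank i)) hO (show p ∈ _ from hv)
    rw [h1, hset, h2] at h
    exact h

end TBundle

end

section

variable {m : ℕ} {X : TGroupoid m} {E : TBundle X}

namespace EForm

theorem fpush_const_smul {V : Type} [NormedAddCommGroup V] [NormedSpace ℝ V] [FiniteDimensional ℝ V] {r : ℕ}
    {K : V × Fib r → EForm m (V × Fib r)} {S : Set V} (hK : FibreCompact K S) (c : ℝ) {x : V} (hx : x ∈ S) :
    fpush (fun p => c • K p) x = c • fpush K x := by
  refine HasVIntegral.eq ?_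
  have := (hasVIntegral_fpush hK hx).map (LinearMap.lsmul ℝ (EForm m V) c)
  refine this.congr (Eventually.of_forall fun v => ?_)
  change TBundle.fibreTop (c • K (x, v)) = c • TBundle.fibreTop (K (x, v))
  rw [← fibreTopLin_apply, map_smul, fibreTopLin_apply]

theorem dform_sub_momAt_const_smul {V : Type} [NormedAddCommGroup V] [NormedSpace ℝ V] [FiniteDimensional ℝ V]
    {S : Set V} {x : V} {F G : V → EForm m V} (hF : SmoothNear F S x) (hx : x ∈ S)
    (hS : UniqueDiffOn ℝ S) (c : ℝ) (hG : ∀ y ∈ S, G y = c • F y) (ξ : Fin m → V) :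
    dform G S x - momAt ξ (G x) = c • (dform F S x - momAt ξ (F x)) := by
  rw [dform_congr hx (eventually_nhdsWithin_of_forall hG), dform_const_smul hF hx hS, hG x hx, smul_sub]
  congr 1
  exact map_smul (momLin ξ) c (F x)

end EForm

namespace TBundle

variable {q φ : E.total.RawForm} {e : X.RawForm}

/-- The primitive of `σ e - 1`. -/
noncomputable def primitive (E : TBundle X) (q φ : E.total.RawForm) : X.RawForm :=
  E.pushKernel (fun i => E.totalDim i + 2) (fun i _ => (-1) ^ (E.rank i + 1)) (E.momentFun q) (E.oneForm q) φ

theorem isForm_primitive (hX : X.IsOrbifold) (hE : E.IsSmooth) (hq : E.total.IsForm q)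
    (hquad : E.IsQuadratic q) (hloc : E.IsLocalizing q) (hφ : E.IsSphereForm φ) :
    X.IsForm (E.primitive q φ) :=
  isForm_pushKernel hX hE (smoothNear_oneForm hq) (fun a => by rw [E.totalDim_eq a]) (isInvariant_oneForm hq)
    (hloc.isFibreQuadratic hX hE hq hquad) (fun a v => hloc.momentFun_invariant hX hE hq a v) hφ
    (fun i x _ => CNear.const _) (fun a => by rw [E.rank_eq a])
    (fun i x hx => Or.inl fun v hv => hloc.momentFun_pos hx hv)

theorem expD_eq (hloc : E.IsLocalizing q) {i : X.ι} {x : X.V i} (hx : x ∈ X.dom i) (v : Fib (E.rank i)) :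
    (E.total.expD E.total.dom q i (x, v) : EForm m (X.V i × Fib (E.rank i))) =
      Real.exp (-E.momentFun q i (x, v)) • ∑ k ∈ Finset.range (E.totalDim i + 1), (k.factorial : ℝ)⁻¹ •
        EForm.dform (fun p => EForm.one (E.oneForm q i p)) (tube (X.dom i) (E.rank i)) (x, v) ^ k := by
  have h1 : (E.total.extD E.total.dom q i (x, v) : EForm m (X.V i × Fib (E.rank i))) =
      EForm.dform (fun p => EForm.one (E.oneForm q i p)) (tube (X.dom i) (E.rank i)) (x, v) :=
    EForm.dform_congr (m := m) (V := X.V i × Fib (E.rank i)) (S := tube (X.dom i) (E.rank i)) (x := (x, v)) hx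
      (eventually_nhdsWithin_of_forall fun p hp => (hloc.exists_one hp).symm)
  rw [← h1]
  rfl

theorem segre_mul_eq (hX : X.IsOrbifold) (hE : E.IsSmooth) (hq : E.total.IsForm q)
    (hquad : E.IsQuadratic q) (hloc : E.IsLocalizing q) (hφ : E.IsAngularForm φ e) :
    E.FibreIntegrable (E.total.expD E.total.dom q) ∧
      ∀ i, ∀ x ∈ X.dom i, E.segre q i x * e i x = 1 + X.cartanD X.dom (E.primitive q φ) i x := by
  have key : ∀ i, ∀ x ∈ X.dom i, ∃ σ : EForm m (X.V i), HasVIntegral (volume : Measure (Fib (E.rank i)))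
      (fun v => fibreTop (V := X.V i) (E.total.expD E.total.dom q i (x, v))) σ ∧
      σ * e i x = 1 + X.cartanD X.dom (E.primitive q φ) i x := by
    intro i x hx
    obtain ⟨σ, hσ, hD⟩ := hloc.cartan_fpush hX hE hq hquad hφ hx
    refine ⟨σ, hσ.congr (Eventually.of_forall fun v => congrArg fibreTop (expD_eq hloc hx v)), ?_⟩
    have hK := EForm.fibreCompact_kernel_one (hloc.isFibreQuadratic hX hE hq hquad i)
      (Ω := EForm.dform (fun p => EForm.one (E.oneForm q i p)) (tube (X.dom i) (E.rank i)))
      (fun p hp => EForm.smoothNear_dform ((smoothNear_oneForm hq i p hp).lin (EForm.oneLin m _))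
        (goodSet_tube hX i).uniqueDiffOn) (fun p hp hv => hφ.sphere_form.smoothNear hp hv)
      (fun x hx v hv => hloc.momentFun_pos hx hv) (E.totalDim i + 2)
    have hS := (hX.goodSet_dom i).uniqueDiffOn
    have h1 := EForm.dform_sub_momAt_const_smul (EForm.smoothNear_fpush hK hS (hX.locallyConvex_dom i) hx) hx hS
      ((-1) ^ (E.rank i + 1)) (G := E.primitive q φ i) (fun y hy => EForm.fpush_const_smul hK _ hy)
      (fun j => X.fund i j x)
    have h2 : X.cartanD X.dom (E.primitive q φ) i x = EForm.dform (E.primitive q φ i) (X.dom i) x -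
      EForm.momAt (fun j => X.fund i j x) (E.primitive q φ i x) := rfl
    rw [h2, h1, hD, smul_smul, ← pow_add, show E.rank i + 1 + E.rank i = 2 * E.rank i + 1 by ring, pow_succ,
      pow_mul]
    simp
  refine ⟨fun i x hx => ?_, fun i x hx => ?_⟩
  · obtain ⟨σ, hσ, -⟩ := key i x hx
    exact ⟨σ, hσ⟩
  · obtain ⟨σ, hσ, h⟩ := key i x hx
    have : E.segre q i x = σ := hσ.eq
    rw [this, h]

end TBundle

end

section

/-- An isomorphism of quadrants permutes the walls. -/
theorem exists_wall_comp_eq {V W κ κ' : Type*} [NormedAddCommGroup V] [NormedSpace ℝ V]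
    [NormedAddCommGroup W] [NormedSpace ℝ W] [Fintype κ] [Fintype κ'] {w : κ → V →L[ℝ] ℝ}
    {w' : κ' → W →L[ℝ] ℝ} (hw : LinearIndependent ℝ w) (hw' : LinearIndependent ℝ w') {A : Set κ}
    {A' : Set κ'} {J : V →L[ℝ] W} {J' : W →L[ℝ] V} (hJ' : ∀ u, J' (J u) = u) (hJ'' : ∀ u, J (J' u) = u)
    (h : ∀ u, (∀ k ∈ A, 0 ≤ w k u) → ∀ k ∈ A', 0 ≤ w' k (J u))
    (h' : ∀ u, (∀ k ∈ A', 0 ≤ w' k u) → ∀ k ∈ A, 0 ≤ w k (J' u)) {k : κ} (hk : k ∈ A) :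
    ∃ k' ∈ A', ∃ c : ℝ, 0 < c ∧ ∀ u, w' k' (J u) = c * w k u := by
  classical
  obtain ⟨b, hb⟩ := exists_clm_apply_eq hw (Pi.single k 1)
  have hbk : w k b = 1 := by rw [hb, Pi.single_eq_same]
  have hbl : ∀ l, l ≠ k → w l b = 0 := fun l hl => by rw [hb, Pi.single_eq_of_ne hl]
  have hbA : ∀ l ∈ A, 0 ≤ w l b := fun l _ => by
    by_cases e : l = k
    · subst e; rw [hbk]; exact zero_le_one
    · rw [hbl l e]
  obtain ⟨k', hk', hc⟩ : ∃ k' ∈ A', 0 < w' k' (J b) := by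
    by_contra! hne
    have h1 := h' (-J b) (fun l hl => by
      rw [map_neg]; linarith [hne l hl]) k hk
    rw [map_neg, hJ', map_neg, hbk] at h1
    linarith
  refine ⟨k', hk', w' k' (J b), hc, ?_⟩
  obtain ⟨b', hb'⟩ := exists_clm_apply_eq hw' (Pi.single k' 1)
  have hsub : ∀ u, (∀ l ∈ A, 0 ≤ w l u) → ∀ l ∈ A, 0 ≤ w l u - w' k' (J u) * w l (J' b') := by
    intro u hu l hl
    have h1 := h' (J u - w' k' (J u) • b') (fun l hl => by
      rw [map_sub, map_smul, hb', smul_eq_mul]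
      by_cases e : l = k'
      · subst e; simp
      · rw [Pi.single_eq_of_ne e, mul_zero, sub_zero]; exact h u hu l hl) l hl
    rwa [map_sub, map_smul, hJ', map_sub, map_smul, smul_eq_mul] at h1
  have hpos : ∀ l ∈ A, 0 ≤ w l (J' b') := h' b' fun l _ => by
    rw [hb']; by_cases e : l = k'
    · subst e; simp
    · rw [Pi.single_eq_of_ne e]
  have hl0 : ∀ l ∈ A, l ≠ k → w l (J' b') = 0 := fun l hl e => by
    have h1 := hsub b hbA l hl
    rw [hbl l e] at h1
    have h2 := hpos l hl
    nlinarith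
  have hface : ∀ u, (∀ l ∈ A, 0 ≤ w l u) → w k u = 0 → w' k' (J u) = 0 := by
    intro u hu huk
    by_contra hne
    have hd : 0 < w' k' (J u) := lt_of_le_of_ne (h u hu k' hk') (Ne.symm hne)
    have h1 := hsub u hu k hk
    rw [huk] at h1
    have h2 : w k (J' b') = 0 := le_antisymm (by nlinarith [hpos k hk]) (hpos k hk)
    have h3 := h (-J' b') (fun l hl => by
      rw [map_neg]
      by_cases e : l = k
      · subst e; rw [h2, neg_zero]
      · rw [hl0 l hl e, neg_zero]) k' hk'
    rw [map_neg, hJ'', map_neg, hb', Pi.single_eq_same] at h3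
    linarith
  have hker : ∀ u, w k u = 0 → w' k' (J u) = 0 := by
    intro u hu
    obtain ⟨e, he⟩ := exists_clm_apply_eq hw fun l => if l = k then 0 else 1
    have hek : w k e = 0 := by rw [he, if_pos rfl]
    have h1 : ∀ l ∈ A, 0 ≤ w l ((∑ l, |w l u|) • e) := fun l _ => by
      rw [map_smul, he, smul_eq_mul]
      have : 0 ≤ ∑ l, |w l u| := Finset.sum_nonneg fun l _ => abs_nonneg _
      split_ifs <;> simp [this]
    have h2 : ∀ l ∈ A, 0 ≤ w l (u + (∑ l, |w l u|) • e) := fun l _ => by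
      rw [map_add, map_smul, he, smul_eq_mul]
      by_cases e : l = k
      · subst e; simp [hu]
      · rw [if_neg e, mul_one]
        have : |w l u| ≤ ∑ l, |w l u| :=
          Finset.single_le_sum (f := fun l => |w l u|) (fun l _ => abs_nonneg _) (Finset.mem_univ l)
        have h3 := neg_abs_le (w l u)
        linarith
    have h3 := hface _ h1 (by rw [map_smul, hek, smul_zero])
    have h4 := hface _ h2 (by rw [map_add, map_smul, hek, smul_zero, hu, add_zero])
    rwa [map_add, map_add, h3, add_zero] at h4
  intro u
  have h1 := hker (u - w k u • b) (by rw [map_sub, map_smul, hbk, smul_eq_mul, mul_one, sub_self])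
  rw [map_sub, map_sub, map_smul, map_smul, smul_eq_mul] at h1
  linarith

namespace TGroupoid

variable {m : ℕ} {X : TGroupoid m}

theorem IsOrbifold.wall_nonneg (hX : X.IsOrbifold) {i : X.ι} {u : X.V i} (hu : u ∈ X.dom i) (k : X.Face i) :
    0 ≤ X.wall i k u := by
  obtain ⟨O, -, h⟩ := hX.dom_open i
  rw [h] at hu
  exact hu.2 k

/-- Vectors of the tangent cone of a quadrant point into the chart. -/
theorem IsOrbifold.eventually_mem_dom (hX : X.IsOrbifold) {i : X.ι} {p : X.V i} (hp : p ∈ X.dom i) {u : X.V i}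
    (hu : ∀ k, X.wall i k p = 0 → 0 ≤ X.wall i k u) : ∀ᶠ t in 𝓝[≥] (0 : ℝ), p + t • u ∈ X.dom i := by
  obtain ⟨O, hO, h⟩ := hX.dom_open i
  have := hX.finite_faces i
  have hc : Continuous fun t : ℝ => p + t • u := by fun_prop
  have hO' : ∀ᶠ t in 𝓝[≥] (0 : ℝ), p + t • u ∈ O := by
    refine mem_nhdsWithin_of_mem_nhds (hc.continuousAt.preimage_mem_nhds (hO.mem_nhds ?_))
    rw [zero_smul, add_zero]
    rw [h] at hp
    exact hp.1
  have hw : ∀ᶠ t in 𝓝[≥] (0 : ℝ), ∀ k, 0 ≤ X.wall i k (p + t • u) := by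
    rw [eventually_all]
    intro k
    rcases (hX.wall_nonneg hp k).eq_or_lt with e | e
    · filter_upwards [self_mem_nhdsWithin] with t ht
      rw [map_add, ← e, zero_add, map_smul]
      exact mul_nonneg ht (hu k e.symm)
    · refine mem_nhdsWithin_of_mem_nhds ?_
      have h1 : ContinuousAt (fun t : ℝ => X.wall i k (p + t • u)) 0 := by fun_prop
      filter_upwards [h1.eventually (lt_mem_nhds (a := 0) (by simpa using e))] with t ht using ht.le
  filter_upwards [hO', hw] with t h1 h2
  rw [h]
  exact ⟨h1, h2⟩

/-- Differentials of arrows preserve tangent cones. -/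
theorem IsOrbifold.wall_jac_nonneg (hX : X.IsOrbifold) {x y : X.Obj} (a : x ⟶ y) {u : X.V x.chart}
    (hu : ∀ k, X.wall x.chart k x.pt = 0 → 0 ≤ X.wall x.chart k u) {k : X.Face y.chart}
    (hk : X.wall y.chart k y.pt = 0) : 0 ≤ X.wall y.chart k (X.jac a u) := by
  obtain ⟨U, L, Θ, hsec, hd⟩ := hX.smooth a
  have hev := hX.eventually_mem_dom x.mem hu
  have hc : Continuous fun t : ℝ => ((0 : Fin m → ℝ), x.pt + t • u) := by fun_prop
  have hU : ∀ᶠ t in 𝓝[≥] (0 : ℝ), ((0 : Fin m → ℝ), x.pt + t • u) ∈ U := by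
    refine mem_nhdsWithin_of_mem_nhds (hc.continuousAt.preimage_mem_nhds ?_)
    rw [zero_smul, add_zero]
    exact hsec.1
  have hcd : HasDerivWithinAt (fun t : ℝ => ((0 : Fin m → ℝ), x.pt + t • u)) (0, u)
      {t | (0 ≤ t) ∧ ((0 : Fin m → ℝ), x.pt + t • u) ∈ U ∧ x.pt + t • u ∈ X.dom x.chart} 0 := by
    have h1 : HasDerivAt (fun t : ℝ => x.pt + t • u) u 0 := by
      simpa using ((hasDerivAt_id (0 : ℝ)).smul_const u).const_add x.pt
    exact ((hasDerivAt_const (0 : ℝ) (0 : Fin m → ℝ)).prodMk h1).hasDerivWithinAt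
  have h0 : ((0 : Fin m → ℝ), x.pt + (0 : ℝ) • u) = (0, x.pt) := by rw [zero_smul, add_zero]
  rw [← h0] at hd
  have h2 := hd.comp_hasDerivWithinAt (0 : ℝ) hcd fun t ht => by exact ⟨ht.2.1, ht.2.2⟩
  rw [TBundle.paramDeriv_zero] at h2
  have hn : {t | (0 ≤ t) ∧ ((0 : Fin m → ℝ), x.pt + t • u) ∈ U ∧ x.pt + t • u ∈ X.dom x.chart} ∈ 𝓝[≥] (0 : ℝ) := by
    filter_upwards [hU, hev, self_mem_nhdsWithin] with t h1 h2 h3 using ⟨h3, h1, h2⟩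
  have h3 := (h2.mono_of_mem_nhdsWithin hn)
  have h4 := (X.wall y.chart k).hasFDerivAt.comp_hasDerivWithinAt (0 : ℝ) h3
  have h5 := hasDerivWithinAt_iff_tendsto_slope.mp h4
  have : (𝓝[Set.Ici (0 : ℝ) \ {0}] 0).NeBot := by
    have e : Set.Ici (0 : ℝ) \ {0} = Set.Ioi 0 := by ext t; simp [lt_iff_le_and_ne, eq_comm]
    rw [e]; infer_instance
  refine ge_of_tendsto h5 ?_
  filter_upwards [nhdsWithin_mono _ Set.sdiff_subset hn, self_mem_nhdsWithin] with t ht ht'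
  obtain ⟨hΘ, -⟩ := hsec.2.2.2.2 _ ht.2.1 ht.2.2
  have h6 : (X.wall y.chart k) (Θ (0, x.pt + (0 : ℝ) • u)) = 0 := by rw [h0, hsec.target, hk]
  rw [slope_def_field]
  simp only [Function.comp_apply]
  rw [h6, sub_zero, sub_zero]
  exact div_nonneg (hX.wall_nonneg hΘ k) ht.1

/-- The walls through the source of an arrow correspond to walls through its target. -/
theorem IsOrbifold.exists_wall (hX : X.IsOrbifold) {x y : X.Obj} (a : x ⟶ y) {k : X.Face x.chart}
    (hk : X.wall x.chart k x.pt = 0) : ∃ k' : X.Face y.chart, X.wall y.chart k' y.pt = 0 ∧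
      ∃ c : ℝ, 0 < c ∧ ∀ u, X.wall y.chart k' (X.jac a u) = c * X.wall x.chart k u := by
  have := hX.finite_faces x.chart
  have := hX.finite_faces y.chart
  cases nonempty_fintype (X.Face x.chart)
  cases nonempty_fintype (X.Face y.chart)
  refine exists_wall_comp_eq (hX.walls_indep x.chart) (hX.walls_indep y.chart)
    (A := {k | X.wall x.chart k x.pt = 0}) (A' := {k | X.wall y.chart k y.pt = 0}) (J := X.jac a)
    (J' := X.jac (Groupoid.inv a)) (fun u => ?_) (fun u => ?_)
    (fun u hu k hk => hX.wall_jac_nonneg a hu hk) (fun u hu k hk => hX.wall_jac_nonneg _ hu hk) hk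
  · rw [← ContinuousLinearMap.comp_apply, ← X.jac_comp, Groupoid.comp_inv, X.jac_id]; rfl
  · rw [← ContinuousLinearMap.comp_apply, ← X.jac_comp, Groupoid.inv_comp, X.jac_id]; rfl

/-- The point of the boundary given by a point of a wall. -/
def toBoundary (x : X.Obj) (k : X.Face x.chart) (hk : X.wall x.chart k x.pt = 0) : X.boundaryCharts.Obj :=
  ⟨⟨x.chart, k⟩, ⟨x.pt, hk⟩, x.mem⟩

end TGroupoid

end

section

variable {m : ℕ} {X : TGroupoid m}

namespace TGroupoid

/-- The sum of `β` over the targets of the arrows of weight `g` out of `z`. -/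
noncomputable def arrowSum (β : ∀ i, X.V i → ℝ) (g : Fin m → Circle) (z : X.Obj) : ℝ :=
  ∑ᶠ c : {c : Σ y, (z ⟶ y) // X.wt c.2 = g}, β c.1.1.chart c.1.1.pt

theorem arrowSum_comp (β : ∀ i, X.V i → ℝ) {z w : X.Obj} (a : z ⟶ w) (g : Fin m → Circle) :
    arrowSum β g w = arrowSum β (g * X.wt a) z := by
  refine finsum_eq_of_bijective (fun c => ⟨⟨c.1.1, a ≫ c.1.2⟩, by rw [X.wt_comp, c.2]⟩) ⟨?_, ?_⟩
    fun c => rfl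
  · rintro ⟨⟨y, c⟩, hc⟩ ⟨⟨y', c'⟩, hc'⟩ h
    simp only [Subtype.mk.injEq, Sigma.mk.injEq] at h ⊢
    obtain ⟨rfl, h⟩ := h
    refine ⟨rfl, heq_of_eq ?_⟩
    have h1 := eq_of_heq h
    exact (cancel_epi a).mp h1
  · rintro ⟨⟨y, c⟩, hc⟩
    refine ⟨⟨⟨y, Groupoid.inv a ≫ c⟩, ?_⟩, ?_⟩
    · have h1 : a ≫ Groupoid.inv a ≫ c = c := by rw [← Category.assoc, Groupoid.comp_inv, Category.id_comp]
      have h2 := X.wt_comp a (Groupoid.inv a ≫ c)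
      rw [h1] at h2
      change X.wt c = g * X.wt a at hc
      exact mul_right_cancel (h2.symm.trans hc)
    · simp only [Subtype.mk.injEq, Sigma.mk.injEq, heq_eq_eq, true_and]
      rw [← Category.assoc, Groupoid.comp_inv, Category.id_comp]

theorem arrowSum_nonneg {β : ∀ i, X.V i → ℝ} (hβ : ∀ i u, 0 ≤ β i u) (g : Fin m → Circle) (z : X.Obj) :
    0 ≤ arrowSum β g z := finsum_nonneg fun _ => hβ _ _

namespace IsOrbifold

theorem t2Space_obj (hX : X.IsOrbifold) : T2Space X.Obj := by
  have := hX.hausdorff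
  exact T2Space.of_injective_continuous (fun x y h => congrArg (fun a : X.Arr => a.1.1) h) hX.continuous_one

theorem finite_arrows (hX : X.IsOrbifold) {K : Set X.Obj} (hK : _root_.IsCompact K) (z : X.Obj)
    (g : Fin m → Circle) : Finite {c : Σ y, (z ⟶ y) // X.wt c.2 = g ∧ c.1 ∈ K} := by
  set S : Set X.Arr := (fun a : X.Arr => a.1) ⁻¹' ({z} ×ˢ K) ∩
    (fun a : X.Arr => (X.wt a.2, a.1.1)) ⁻¹' (Set.univ ∩ (Prod.fst ⁻¹' {g})) with hS
  have hc : _root_.IsCompact S := by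
    refine (hX.proper.isCompact_preimage (isCompact_singleton.prod hK)).inter_right ?_
    exact (isClosed_univ.inter (isClosed_singleton.preimage continuous_fst)).preimage hX.etale.continuous
  have hd : IsDiscrete S := by
    refine (hX.etale.isLocalHomeomorphOn (s := S)).isDiscrete_of_image ?_
    have : (fun a : X.Arr => (X.wt a.2, a.1.1)) '' S ⊆ {(g, z)} := by
      rintro _ ⟨a, ha, rfl⟩
      have h1 : a.1.1 = z := ha.1.1
      have h2 : X.wt a.2 = g := ha.2.2
      simp [h1, h2]
    exact (Set.subsingleton_singleton.anti this).isDiscrete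
  have hf : Finite S := (hc.finite hd).to_subtype
  refine Finite.of_injective (β := S) (fun c => ⟨⟨(z, c.1.1), c.1.2⟩, ⟨rfl, c.2.2⟩, trivial, c.2.1⟩) ?_
  rintro ⟨⟨y, c⟩, hc⟩ ⟨⟨y', c'⟩, hc'⟩ h
  have h' := congrArg Subtype.val h
  simp only [Subtype.mk.injEq, Sigma.mk.injEq, Prod.mk.injEq, true_and] at h' ⊢
  exact h'

theorem _root_.Circle.exp_pi_continuous : Continuous fun τ : Fin m → ℝ => fun j => Circle.exp (τ j) :=
  continuous_pi fun j => Circle.exp.continuous.comp (continuous_apply j)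

open Classical in
/-- The function `arrowSum` in coordinates. -/
noncomputable def _root_.TGroupoid.arrowSumAt (X : TGroupoid m) (β : ∀ i, X.V i → ℝ) (i : X.ι)
    (p : (Fin m → ℝ) × X.V i) : ℝ :=
  if h : p.2 ∈ X.dom i then arrowSum β (fun j => Circle.exp (p.1 j)) ⟨i, p.2, h⟩ else 0

theorem _root_.TGroupoid.IsSection.continuousWithinAt_shift {x y : X.Obj} {a : x ⟶ y} {U L Θ}
    (h : X.IsSection a U L Θ) (τ₀ : Fin m → ℝ) :
    ContinuousWithinAt (fun q : (Fin m → ℝ) × X.V x.chart => L (q.1 - τ₀, q.2)) (X.param x.chart) (τ₀, x.pt) := by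
  have hσ : Continuous fun q : (Fin m → ℝ) × X.V x.chart => (q.1 - τ₀, q.2) := by fun_prop
  have e : (fun q : (Fin m → ℝ) × X.V x.chart => (q.1 - τ₀, q.2)) (τ₀, x.pt) = (0, x.pt) := by simp
  have hU : ∀ᶠ q in 𝓝[X.param x.chart] (τ₀, x.pt), (q.1 - τ₀, q.2) ∈ U := by
    refine mem_nhdsWithin_of_mem_nhds (hσ.continuousAt.preimage_mem_nhds ?_)
    have e' := congrArg (fun z => U ∈ 𝓝 z) e
    exact e'.mpr h.1
  have h1 : ContinuousWithinAt L (U ∩ X.param x.chart)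
      ((fun q : (Fin m → ℝ) × X.V x.chart => (q.1 - τ₀, q.2)) (τ₀, x.pt)) := by
    rw [e]; exact h.2.1 _ ⟨mem_of_mem_nhds h.1, x.mem⟩
  have h2 := ContinuousWithinAt.comp (t := U ∩ X.param x.chart)
    (s := {q : (Fin m → ℝ) × X.V x.chart | (q.1 - τ₀, q.2) ∈ U} ∩ X.param x.chart) h1
    hσ.continuousWithinAt fun q hq => ⟨hq.1, hq.2⟩
  rw [ContinuousWithinAt, Set.inter_comm] at h2
  exact h2.mono_left (nhdsWithin_inter_of_mem' hU).ge

/-- Arrows with weights and sources near given ones and with targets in a compact set are near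
arrows with the given weight and source. -/
theorem exists_nhds_arrows (hX : X.IsOrbifold) {K : Set X.Obj} (hK : _root_.IsCompact K) (x : X.Obj)
    (g : Fin m → Circle) (N : {c : Σ y, (x ⟶ y) // X.wt c.2 = g ∧ c.1 ∈ K} → Set X.Arr)
    (hN : ∀ c, N c ∈ 𝓝 (⟨(x, c.1.1), c.1.2⟩ : X.Arr)) :
    ∃ W ∈ 𝓝 (g, x), ∀ a : X.Arr, (X.wt a.2, a.1.1) ∈ W → a.1.2 ∈ K → ∃ c, a ∈ N c := by
  have key : {a : X.Arr | ∃ c, a ∈ N c} ∈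
      comap (fun a : X.Arr => (X.wt a.2, a.1.1)) (𝓝 (g, x)) ⊓ 𝓟 {a | a.1.2 ∈ K} := by
    rw [mem_iff_ultrafilter]
    intro 𝒰 h𝒰
    have h1 : Tendsto (fun a : X.Arr => (X.wt a.2, a.1.1)) 𝒰 (𝓝 (g, x)) :=
      tendsto_iff_comap.mpr (h𝒰.trans inf_le_left)
    have h2 : {a : X.Arr | a.1.2 ∈ K} ∈ 𝒰 := le_principal_iff.mp (h𝒰.trans inf_le_right)
    obtain ⟨y, hyK, hy⟩ := hK.ultrafilter_le_nhds (𝒰.map fun a => a.1.2) (by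
      rw [Ultrafilter.coe_map, le_principal_iff]; exact h2)
    have h3 : Tendsto (fun a : X.Arr => a.1) 𝒰 (𝓝 (x, y)) := by
      rw [nhds_prod_eq]
      exact ((continuous_snd.tendsto _).comp h1).prodMk hy
    obtain ⟨c, hc, hcU⟩ := hX.proper.ultrafilter_le_nhds_of_tendsto h3
    obtain ⟨⟨x', y'⟩, c⟩ := c
    obtain ⟨rfl, rfl⟩ := Prod.mk.inj hc
    have h4 : X.wt c = g := by
      have := hX.t2Space_obj
      have h5 := ((hX.etale.continuous.tendsto _).mono_left hcU)
      exact congrArg Prod.fst (tendsto_nhds_unique h5 h1)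
    filter_upwards [hcU (hN ⟨⟨_, c⟩, h4, hyK⟩)] with a ha using ⟨_, ha⟩
  obtain ⟨S, hS, T, hT, h⟩ := mem_inf_iff.mp key
  obtain ⟨W, hW, hWS⟩ := mem_comap.mp hS
  refine ⟨W, hW, fun a ha haK => ?_⟩
  have : a ∈ S ∩ T := ⟨hWS ha, hT haK⟩
  rw [← h] at this
  exact this

theorem eventually_mk (X : TGroupoid m) {x : X.Obj} {τ₀ : Fin m → ℝ} {W : Set ((Fin m → Circle) × X.Obj)}
    (hW : W ∈ 𝓝 ((fun j => Circle.exp (τ₀ j)), x)) : ∀ᶠ p in 𝓝[X.param x.chart] (τ₀, x.pt),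
      ∀ h : p.2 ∈ X.dom x.chart, ((fun j => Circle.exp (p.1 j)), (⟨x.chart, p.2, h⟩ : X.Obj)) ∈ W := by
  have hm : Continuous fun p : X.param x.chart =>
      ((fun j => Circle.exp (p.1.1 j)), (⟨x.chart, p.1.2, p.2⟩ : X.Obj)) := by
    refine (Circle.exp_pi_continuous.comp (continuous_fst.comp continuous_subtype_val)).prodMk ?_
    exact (continuous_mk X x.chart).comp (f := fun p : X.param x.chart => (⟨p.1.2, p.2⟩ : X.dom x.chart))
      (by fun_prop)
  have h1 := (eventually_nhds_subtype_iff (X.param x.chart) ⟨(τ₀, x.pt), x.mem⟩ fun p =>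
      ∀ h : p.2 ∈ X.dom x.chart, ((fun j => Circle.exp (p.1 j)), (⟨x.chart, p.2, h⟩ : X.Obj)) ∈ W).mp (by
    filter_upwards [hm.continuousAt.preimage_mem_nhds hW] with p hp h using hp)
  exact h1

theorem cnear_arrowSumAt (hX : X.IsOrbifold) {K : Set X.Obj} (hK : _root_.IsCompact K) {β : ∀ i, X.V i → ℝ}
    (hβ : ∀ i, ContDiff ℝ ∞ (β i)) (hβK : ∀ y : X.Obj, β y.chart y.pt ≠ 0 → y ∈ K) (x : X.Obj)
    (τ₀ : Fin m → ℝ) : CNear (X.arrowSumAt β x.chart) (X.param x.chart) (τ₀, x.pt) := by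
  classical
  set g : Fin m → Circle := fun j => Circle.exp (τ₀ j) with hg
  have hfin := hX.finite_arrows hK x g
  have := Fintype.ofFinite {c : Σ y, (x ⟶ y) // X.wt c.2 = g ∧ c.1 ∈ K}
  have := hX.hausdorff
  choose U L Θ hsec hd using fun c : {c : Σ y, (x ⟶ y) // X.wt c.2 = g ∧ c.1 ∈ K} => hX.smooth c.1.2
  choose e he hee using fun c : {c : Σ y, (x ⟶ y) // X.wt c.2 = g ∧ c.1 ∈ K} =>
    hX.etale (⟨(x, c.1.1), c.1.2⟩ : X.Arr)
  obtain ⟨W, hW, hWN⟩ := hX.exists_nhds_arrows hK x g (fun c => (e c).source)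
    fun c => (e c).open_source.mem_nhds (he c)
  set σ : (Fin m → ℝ) × X.V x.chart → (Fin m → ℝ) × X.V x.chart := fun q => (q.1 - τ₀, q.2) with hσd
  have hσ : Continuous σ := by fun_prop
  have hσ0 : σ (τ₀, x.pt) = (0, x.pt) := by simp [σ]
  have hc : ∀ c, ContinuousWithinAt (fun q => L c (σ q)) (X.param x.chart) (τ₀, x.pt) :=
    fun c => (hsec c).continuousWithinAt_shift τ₀
  have hval : ∀ c, L c (σ (τ₀, x.pt)) = ⟨(x, c.1.1), c.1.2⟩ := fun c => by rw [hσ0]; exact (hsec c).2.2.1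
  have e1 : ∀ c, ∀ᶠ p in 𝓝 (τ₀, x.pt), σ p ∈ interior (U c) := fun c =>
    hσ.continuousAt.preimage_mem_nhds (by rw [hσ0]; exact interior_mem_nhds.mpr (hsec c).1)
  have e2 : ∀ c, ∀ᶠ p in 𝓝[X.param x.chart] (τ₀, x.pt), L c (σ p) ∈ (e c).source := fun c =>
    (hc c).eventually ((e c).open_source.mem_nhds (by
      have h0 := he c
      rw [← hval] at h0
      exact h0))
  have e3 : ∀ᶠ p in 𝓝[X.param x.chart] (τ₀, x.pt), ∀ c c', c ≠ c' → L c (σ p) ≠ L c' (σ p) := by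
    rw [eventually_all]; intro c
    rw [eventually_all]; intro c'
    by_cases hcc : c = c'
    · exact Eventually.of_forall fun p h => absurd hcc h
    · have hne : L c (σ (τ₀, x.pt)) ≠ L c' (σ (τ₀, x.pt)) := by
        rw [hval, hval]
        intro h
        refine hcc (Subtype.ext ?_)
        obtain ⟨⟨y, c⟩, h1⟩ := c
        obtain ⟨⟨y', c'⟩, h1'⟩ := c'
        simp only [Sigma.mk.injEq, Prod.mk.injEq, true_and] at h ⊢
        exact h
      have h2 := ((hc c).prodMk (hc c')).eventually (isClosed_diagonal.isOpen_compl.mem_nhds hne)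
      exact h2.mono fun p hp _ => hp
  have e4 := eventually_mk X hW
  obtain ⟨O, hO, hpO, hsub⟩ := mem_nhdsWithin.mp ((eventually_all.mpr e2).and (e3.and e4))
  have hO1 : IsOpen (O ∩ ⋂ c, σ ⁻¹' (interior (U c))) :=
    hO.inter (isOpen_iInter_of_finite fun c => isOpen_interior.preimage hσ)
  have hp1 : (τ₀, x.pt) ∈ O ∩ ⋂ c, σ ⁻¹' (interior (U c)) :=
    ⟨hpO, Set.mem_iInter.mpr fun c => (e1 c).self_of_nhds⟩
  have hsm : CNear (fun p => ∑ c, β c.1.1.chart (Θ c (σ p))) (X.param x.chart) (τ₀, x.pt) := by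
    refine CNear.sum _ fun c _ => CNear.post (hβ _) ?_
    refine ⟨σ ⁻¹' (interior (U c)), isOpen_interior.preimage hσ, (e1 c).self_of_nhds, ?_⟩
    refine (hsec c).2.2.2.1.comp (ContDiff.contDiffOn (by fun_prop)) fun p hp => ?_
    exact ⟨interior_subset hp.1, hp.2⟩
  refine hsm.congr hO1 hp1 fun p hp => ?_
  obtain ⟨hp2, hp3, hp4⟩ := hsub ⟨hp.1.1, hp.2⟩
  have hpU : ∀ c, σ p ∈ U c := fun c => interior_subset (Set.mem_iInter.mp hp.1.2 c)
  have hpd : p.2 ∈ X.dom x.chart := hp.2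
  rw [arrowSumAt, dif_pos hpd]
  choose hΘ b hb hbw using fun c => (hsec c).2.2.2.2 (σ p) (hpU c) hpd
  have hbw' : ∀ c, X.wt (b c) = fun j => Circle.exp (p.1 j) := fun c => by
    rw [hbw, c.2.1]
    funext j
    rw [hg, ← Circle.exp_add]
    congr 1
    simp [σ]
  set J : {c : Σ y, (x ⟶ y) // X.wt c.2 = g ∧ c.1 ∈ K} →
      {c : Σ y, ((⟨x.chart, p.2, hpd⟩ : X.Obj) ⟶ y) // X.wt c.2 = fun j => Circle.exp (p.1 j)} :=
    fun c => ⟨⟨_, b c⟩, hbw' c⟩ with hJ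
  have hJinj : Function.Injective J := by
    intro c c' h
    by_contra hne
    refine hp3 c c' hne ?_
    rw [hb, hb]
    have h1 := congrArg (fun z => (⟨(⟨x.chart, p.2, hpd⟩, z.1.1), z.1.2⟩ : X.Arr)) h
    exact h1
  have h1 : arrowSum β (fun j => Circle.exp (p.1 j)) ⟨x.chart, p.2, hpd⟩ =
      ∑ᶠ c ∈ Set.range J, β c.1.1.chart c.1.1.pt := by
    rw [arrowSum, ← finsum_mem_univ]
    refine finsum_mem_inter_support_eq' _ _ _ fun c hcs => ⟨fun _ => ?_, fun _ => trivial⟩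
    obtain ⟨d, hd⟩ := hWN ⟨(_, c.1.1), c.1.2⟩ (by
      have := hp4 hpd
      rwa [← c.2] at this) (hβK _ hcs)
    have h2 : L d (σ p) = ⟨(_, c.1.1), c.1.2⟩ := by
      refine (e d).injOn (hp2 d) hd ?_
      rw [← hee, hb]
      refine Prod.ext ?_ rfl
      exact (hbw' d).trans c.2.symm
    rw [hb] at h2
    refine ⟨d, Subtype.ext ?_⟩
    obtain ⟨⟨y, c⟩, hc⟩ := c
    simp only [Sigma.mk.injEq, Prod.mk.injEq] at h2
    simp only [hJ, Sigma.mk.injEq]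
    exact ⟨h2.1.2, h2.2⟩
  rw [h1, finsum_mem_range hJinj, finsum_eq_sum_of_fintype]

/-! ### Averaging over the torus -/

/-- The arguments of the coordinates of a torus element. -/
noncomputable def _root_.Circle.argPi (g : Fin m → Circle) : Fin m → ℝ := fun j => Complex.arg (g j)

theorem _root_.Circle.exp_argPi (g : Fin m → Circle) : (fun j => Circle.exp (Circle.argPi g j)) = g :=
  funext fun j => Circle.exp_arg (g j)

theorem _root_.Circle.coe_continuous : Continuous fun z : Circle => (z : ℂ) := continuous_subtype_val

/-- The image of the invariant measure of the torus under the argument map. -/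
theorem exists_torus_measure (m : ℕ) : ∃ (μ : Measure (Fin m → ℝ)) (K : Set (Fin m → ℝ)),
    IsFiniteMeasure μ ∧ _root_.IsCompact K ∧ μ Kᶜ = 0 ∧
    (∀ (F : (Fin m → Circle) → ℝ) (g : Fin m → Circle), Continuous F →
      ∫ τ, F ((fun j => Circle.exp (τ j)) * g) ∂μ = ∫ τ, F (fun j => Circle.exp (τ j)) ∂μ) ∧
    ∀ N ∈ 𝓝 (0 : Fin m → ℝ), 0 < μ N := by
  let _ : MeasurableSpace Circle := borel _
  have : BorelSpace Circle := ⟨rfl⟩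
  set h : Measure (Fin m → Circle) := Measure.haar
  have hfin : IsFiniteMeasure h := inferInstance
  have harg : Measurable (Circle.argPi : (Fin m → Circle) → Fin m → ℝ) := by
    refine measurable_pi_lambda _ fun j => Complex.measurable_arg.comp ?_
    exact (Circle.coe_continuous.comp (continuous_apply j)).measurable
  refine ⟨h.map Circle.argPi, Set.pi Set.univ fun _ => Set.Icc (-Real.pi) Real.pi,
    Measure.isFiniteMeasure_map _ _, isCompact_univ_pi fun _ => isCompact_Icc, ?_, ?_, ?_⟩
  · rw [Measure.map_apply harg (MeasurableSet.univ_pi fun _ => measurableSet_Icc).compl]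
    convert measure_empty (μ := h)
    ext g
    simp only [Set.preimage_compl, Set.mem_compl_iff, Set.mem_preimage, Set.mem_pi, Set.mem_univ, true_imp_iff,
      Set.mem_empty_iff_false, iff_false, not_not]
    exact fun j => ⟨(Complex.neg_pi_lt_arg _).le, Complex.arg_le_pi _⟩
  · intro F g hF
    have hexp : Continuous fun τ : Fin m → ℝ => fun j => Circle.exp (τ j) := Circle.exp_pi_continuous
    have h1 : Continuous fun τ : Fin m → ℝ => F ((fun j => Circle.exp (τ j)) * g) :=
      hF.comp (hexp.mul continuous_const)
    have h2 : Continuous fun τ : Fin m → ℝ => F (fun j => Circle.exp (τ j)) := hF.comp hexp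
    rw [integral_map harg.aemeasurable h1.aestronglyMeasurable,
      integral_map harg.aemeasurable h2.aestronglyMeasurable]
    simp only [Circle.exp_argPi]
    simp only [mul_comm _ g]
    exact integral_mul_left_eq_self F g
  · intro N hN
    obtain ⟨O, hON, hO, h0⟩ := mem_nhds_iff.mp hN
    refine lt_of_lt_of_le ?_ (measure_mono hON)
    rw [Measure.map_apply harg hO.measurableSet]
    refine h.measure_pos_of_mem_nhds (x := 1) ?_
    have hc : ContinuousAt ((Circle.argPi : (Fin m → Circle) → Fin m → ℝ)) 1 := by
      refine continuousAt_pi.mpr fun j => ?_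
      have h1 : ContinuousAt Complex.arg ((1 : Fin m → Circle) j : ℂ) := by
        refine Complex.continuousAt_arg ?_
        simp
      have h2 : Continuous fun g : Fin m → Circle => (g j : ℂ) := Circle.coe_continuous.comp (continuous_apply j)
      exact ContinuousAt.comp (g := Complex.arg) h1 h2.continuousAt
    refine hc.preimage_mem_nhds (hO.mem_nhds ?_)
    convert h0
    funext j
    simp [Circle.argPi]

/-- An invariant smooth function on the charts. -/
structure _root_.TGroupoid.IsInvariantFunction (X : TGroupoid m) (B : ∀ i, X.V i → ℝ) : Prop where
  smooth : ∀ i, ContDiffOn ℝ ∞ (B i) (X.dom i)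
  invariant : ∀ {x y : X.Obj} (a : x ⟶ y), B y.chart y.pt = B x.chart x.pt

/-- Averages of functions with compact support over the arrows. -/
theorem exists_average (hX : X.IsOrbifold) {K : Set X.Obj} (hK : _root_.IsCompact K) {β : ∀ i, X.V i → ℝ}
    (hβ : ∀ i, ContDiff ℝ ∞ (β i)) (hβK : ∀ y : X.Obj, β y.chart y.pt ≠ 0 → y ∈ K) (hβ0 : ∀ i u, 0 ≤ β i u) :
    ∃ B : ∀ i, X.V i → ℝ, X.IsInvariantFunction B ∧ (∀ i u, 0 ≤ B i u) ∧
      (∀ x : X.Obj, 0 < β x.chart x.pt → 0 < B x.chart x.pt) ∧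
      ∀ x : X.Obj, (∀ y ∈ K, IsEmpty (x ⟶ y)) → B x.chart x.pt = 0 := by
  obtain ⟨μ, Q, hμ, hQ, hμQ, hinv, hpos⟩ := exists_torus_measure m
  have hres : μ.restrict Q = μ := Measure.restrict_eq_self_of_ae_mem (by
    rw [ae_iff]; exact hμQ)
  have hsm : ∀ i, ContDiffOn ℝ ∞ (X.arrowSumAt β i) (X.param i) := fun i =>
    CNear.contDiffOn fun p hp => hX.cnear_arrowSumAt hK hβ hβK ⟨i, p.2, hp⟩ p.1
  have hcont : ∀ x : X.Obj, Continuous fun τ : Fin m → ℝ => X.arrowSumAt β x.chart (τ, x.pt) := fun x =>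
    (hsm x.chart).continuousOn.comp_continuous (by fun_prop) fun τ => x.mem
  have hat : ∀ (x : X.Obj) (τ : Fin m → ℝ), X.arrowSumAt β x.chart (τ, x.pt) =
      arrowSum β (fun j => Circle.exp (τ j)) x := fun x τ => dif_pos x.mem
  have hat0 : ∀ i p, 0 ≤ X.arrowSumAt β i p := fun i p => by
    rw [arrowSumAt]; split_ifs
    · exact arrowSum_nonneg hβ0 _ _
    · exact le_rfl
  have hcontT : ∀ x : X.Obj, Continuous fun g => arrowSum β g x := fun x => by
    have hq : Topology.IsQuotientMap fun τ : Fin m → ℝ => fun j => Circle.exp (τ j) := by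
      have h1 : IsOpenQuotientMap (Circle.exp : ℝ → Circle) :=
        ⟨fun z => ⟨_, Circle.exp_arg z⟩, Circle.exp.continuous, isLocalHomeomorph_circleExp.isOpenMap⟩
      exact (IsOpenQuotientMap.piMap fun _ : Fin m => h1).isQuotientMap
    rw [hq.continuous_iff]
    exact (hcont x).congr fun τ => hat x τ
  refine ⟨fun i u => ∫ τ, X.arrowSumAt β i (τ, u) ∂μ, ⟨fun i => ?_, fun {x y} a => ?_⟩,
    fun i u => integral_nonneg fun τ => hat0 _ _, fun x hx => ?_, fun x hx => ?_⟩
  · have h1 : ContDiffOn ℝ ∞ (fun p : X.V i × (Fin m → ℝ) => X.arrowSumAt β i (p.2, p.1))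
        (X.dom i ×ˢ Set.univ) := (hsm i).comp (ContDiff.contDiffOn (by fun_prop)) fun p hp => hp.1
    have h2 := _root_.contDiffOn_integral (μ := μ) (hX.goodSet_dom i).uniqueDiffOn (hX.locallyConvex_dom i) hQ h1
    rwa [hres] at h2
  · simp only [hat]
    simp only [arrowSum_comp β a]
    exact hinv (fun g => arrowSum β g x) (X.wt a) (hcontT x)
  · have hint : Integrable (fun τ : Fin m → ℝ => X.arrowSumAt β x.chart (τ, x.pt)) μ := by
      rw [← hres]
      exact (hcont x).continuousOn.integrableOn_compact hQ
    rw [integral_pos_iff_support_of_nonneg (fun τ => hat0 _ _) hint]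
    refine hpos _ ?_
    have h0 : 0 < X.arrowSumAt β x.chart (0, x.pt) := by
      rw [hat]
      have e : (fun j => Circle.exp ((0 : Fin m → ℝ) j)) = X.wt (𝟙 x) := by
        rw [X.wt_id]; funext j; simp
      rw [e]
      have hf : Set.Finite (Function.support fun c : {c : Σ y, (x ⟶ y) // X.wt c.2 = X.wt (𝟙 x)} =>
          β c.1.1.chart c.1.1.pt) := by
        have := hX.finite_arrows hK x (X.wt (𝟙 x))
        refine (Set.finite_range fun c : {c : Σ y, (x ⟶ y) // X.wt c.2 = X.wt (𝟙 x) ∧ c.1 ∈ K} =>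
          (⟨c.1, c.2.1⟩ : {c : Σ y, (x ⟶ y) // X.wt c.2 = X.wt (𝟙 x)})).subset fun c hc => ?_
        exact ⟨⟨c.1, c.2, hβK _ hc⟩, rfl⟩
      exact finsum_pos (fun c => hβ0 _ _) ⟨⟨⟨x, 𝟙 x⟩, rfl⟩, hx⟩ hf
    filter_upwards [(hcont x).continuousAt.eventually (lt_mem_nhds h0)] with τ hτ using hτ.ne'
  · simp only [hat]
    refine (integral_congr_ae (Eventually.of_forall fun τ => ?_)).trans (integral_zero _ _)
    refine finsum_eq_zero_of_forall_eq_zero fun c => ?_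
    by_contra hne
    exact (hx _ (hβK _ hne)).false c.1.2

end IsOrbifold

end TGroupoid

end

section

variable {m : ℕ}

namespace TGroupoid

variable {X : TGroupoid m}

/-- Open sets of objects in coordinates. -/
theorem exists_isOpen_chart {S : Set X.Obj} (hS : IsOpen S) (i : X.ι) :
    ∃ O : Set (X.V i), IsOpen O ∧ ∀ u (hu : u ∈ X.dom i), u ∈ O ↔ (⟨i, u, hu⟩ : X.Obj) ∈ S := by
  obtain ⟨O, hO, h⟩ := isOpen_induced_iff.mp (hS.preimage (IsOrbifold.continuous_mk X i))
  refine ⟨O, hO, fun u hu => ?_⟩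
  exact Set.ext_iff.mp h ⟨u, hu⟩

theorem isOpen_obj {S : Set X.Obj} (hS : ∀ x ∈ S, ∃ O : Set (X.V x.chart), IsOpen O ∧ x.pt ∈ O ∧
    ∀ u (hu : u ∈ X.dom x.chart), u ∈ O → (⟨x.chart, u, hu⟩ : X.Obj) ∈ S) : IsOpen S := by
  refine isOpen_induced_iff.mpr ⟨{p : Σ i, X.dom i | (⟨p.1, p.2.1, p.2.2⟩ : X.Obj) ∈ S}, ?_, rfl⟩
  rw [isOpen_sigma_iff]
  intro i
  rw [isOpen_iff_mem_nhds]
  intro u hu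
  obtain ⟨O, hO, huO, h⟩ := hS _ hu
  filter_upwards [(hO.preimage continuous_subtype_val).mem_nhds huO] with v hv using h v.1 v.2 hv

/-- The function `B` vanishes near the points outside of `S`. -/
def VanishesOff (B : ∀ i, X.V i → ℝ) (S : Set X.Obj) : Prop :=
  ∀ x ∉ S, ∃ O : Set (X.V x.chart), IsOpen O ∧ x.pt ∈ O ∧ ∀ u ∈ O ∩ X.dom x.chart, B x.chart u = 0

theorem IsOrbifold.exists_bump (hX : X.IsOrbifold) {S : Set X.Obj} (hS : IsOpen S)
    (hinv : ∀ {x y : X.Obj} (_ : x ⟶ y), y ∈ S → x ∈ S) {z : X.Obj} (hz : z ∈ S) :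
    ∃ B : ∀ i, X.V i → ℝ, X.IsInvariantFunction B ∧ (∀ i u, 0 ≤ B i u) ∧ 1 < B z.chart z.pt ∧
      VanishesOff B S := by
  classical
  obtain ⟨O, hO, hdom⟩ := hX.dom_open z.chart
  obtain ⟨O', hO', hOS⟩ := exists_isOpen_chart hS z.chart
  have hzO : z.pt ∈ O ∩ O' := ⟨(hdom ▸ z.mem : z.pt ∈ O ∩ _).1, (hOS _ z.mem).mpr hz⟩
  obtain ⟨ε, hε, hball⟩ := Metric.nhds_basis_closedBall.mem_iff.mp ((hO.inter hO').mem_nhds hzO)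
  let b : ContDiffBump z.pt := ⟨ε / 2, ε, half_pos hε, half_lt_self hε⟩
  have hC : _root_.IsCompact {u : X.dom z.chart | u.1 ∈ Metric.closedBall z.pt ε} := by
    rw [Subtype.isCompact_iff]
    have : Subtype.val '' {u : X.dom z.chart | u.1 ∈ Metric.closedBall z.pt ε} =
        Metric.closedBall z.pt ε ∩ ⋂ k, {v | 0 ≤ X.wall z.chart k v} := by
      ext u
      simp only [Set.mem_image, Set.mem_inter_iff, Set.mem_iInter]
      constructor
      · rintro ⟨v, hv, rfl⟩
        exact ⟨hv, fun k => hX.wall_nonneg v.2 k⟩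
      · rintro ⟨h1, h2⟩
        exact ⟨⟨u, by rw [hdom]; exact ⟨(hball h1).1, h2⟩⟩, h1, rfl⟩
    rw [this]
    exact (isCompact_closedBall _ _).inter_right
      (isClosed_iInter fun k => isClosed_le continuous_const (X.wall z.chart k).continuous)
  set K : Set X.Obj := (fun u : X.dom z.chart => (⟨z.chart, u.1, u.2⟩ : X.Obj)) ''
    {u : X.dom z.chart | u.1 ∈ Metric.closedBall z.pt ε} with hKd
  have hK : _root_.IsCompact K := hC.image (continuous_mk X z.chart)
  have hKS : K ⊆ S := by
    rintro _ ⟨u, hu, rfl⟩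
    exact (hOS _ u.2).mp (hball hu).2
  set β : ∀ i, X.V i → ℝ := Function.update (fun _ _ => 0) z.chart b with hβd
  have hβz : β z.chart = b := Function.update_self _ _ _
  have hβne : ∀ i, i ≠ z.chart → β i = fun _ => 0 := fun i hi => Function.update_of_ne hi _ _
  have hβ : ∀ i, ContDiff ℝ ∞ (β i) := fun i => by
    by_cases h : i = z.chart
    · subst h; rw [hβz]; exact b.contDiff
    · rw [hβne i h]; exact contDiff_const
  have hβ0 : ∀ i u, 0 ≤ β i u := fun i u => by
    by_cases h : i = z.chart
    · subst h; rw [hβz]; exact b.nonneg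
    · rw [hβne i h]
  have hβK : ∀ y : X.Obj, β y.chart y.pt ≠ 0 → y ∈ K := by
    rintro ⟨i, u, hu⟩ hy
    simp only at hy
    by_cases h : i = z.chart
    · subst h
      rw [hβz] at hy
      have h1 : u ∈ Function.support b := hy
      rw [b.support_eq] at h1
      exact ⟨⟨u, hu⟩, Metric.ball_subset_closedBall h1, rfl⟩
    · rw [hβne i h] at hy; exact absurd rfl hy
  obtain ⟨B, hB, hB0, hBpos, hBz⟩ := hX.exists_average hK hβ hβK hβ0
  have hzpos := hBpos z (by rw [hβz]; exact b.pos_of_mem_ball (Metric.mem_ball_self hε))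
  have hC' : IsClosed (Set.range fun a : X.Arr => a.1) := hX.proper.isClosedMap.isClosed_range
  refine ⟨fun i u => 2 / B z.chart z.pt * B i u, ⟨fun i => contDiffOn_const.mul (hB.smooth i), fun a => ?_⟩,
    fun i u => mul_nonneg (by positivity) (hB0 i u), ?_, fun x hx => ?_⟩
  · simp only [hB.invariant a]
  · change 1 < 2 / B z.chart z.pt * B z.chart z.pt
    rw [div_mul_cancel₀ _ hzpos.ne']; exact one_lt_two
  · obtain ⟨u, v, hu, hv, hxu, hKv, huv⟩ := generalized_tube_lemma (isCompact_singleton (x := x)) hK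
      hC'.isOpen_compl (by
        rintro ⟨x', y⟩ ⟨rfl, hy⟩ ⟨a, ha⟩
        obtain ⟨⟨p, q⟩, a⟩ := a
        obtain ⟨rfl, rfl⟩ := Prod.mk.inj ha
        exact hx (hinv a (hKS hy)))
    obtain ⟨O₁, hO₁, h1⟩ := exists_isOpen_chart hu x.chart
    refine ⟨O₁, hO₁, (h1 _ x.mem).mpr (hxu rfl), fun w hw => ?_⟩
    have h2 := hBz ⟨x.chart, w, hw.2⟩ fun y hy => ⟨fun a =>
      huv (Set.mk_mem_prod ((h1 _ hw.2).mp hw.1) (hKv hy)) ⟨⟨(_, _), a⟩, rfl⟩⟩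
    change B x.chart w = 0 at h2
    simp only [h2, mul_zero]

/-- Arrows out of the boundary are arrows of the boundary. -/
theorem IsOrbifold.exists_boundary_arrow (hX : X.IsOrbifold) {x : X.boundaryCharts.Obj} {y : X.Obj}
    (a : X.ofBoundary x ⟶ y) : ∃ (k : X.Face y.chart) (hk : X.wall y.chart k y.pt = 0)
      (b : X.BoundaryHom x (X.toBoundary y k hk)), b.arrow = a := by
  obtain ⟨k, hk, hc⟩ := hX.exists_wall a (k := x.chart.2) x.pt.2
  exact ⟨k, hk, ⟨a, hc⟩, rfl⟩

/-- The set of objects with an arrow of weight one into an open set is open. -/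
theorem IsOrbifold.isOpen_saturation (hX : X.IsOrbifold) {N : Set X.Obj} (hN : IsOpen N) :
    IsOpen {y : X.Obj | ∃ x ∈ N, ∃ a : y ⟶ x, X.wt a = 1} := by
  refine isOpen_obj ?_
  rintro y ⟨x, hx, a, ha⟩
  obtain ⟨U, L, Θ, hsec, -⟩ := hX.smooth a
  obtain ⟨O, hO, hON⟩ := exists_isOpen_chart hN x.chart
  have hmk : Continuous fun u : X.V y.chart => ((0 : Fin m → ℝ), u) := by fun_prop
  have h1 : ∀ᶠ u in 𝓝[X.dom y.chart] y.pt, (0, u) ∈ U :=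
    mem_nhdsWithin_of_mem_nhds (hmk.continuousAt.preimage_mem_nhds hsec.1)
  have h2 : ContinuousWithinAt (fun u => Θ (0, u)) ({u | (0, u) ∈ U} ∩ X.dom y.chart) y.pt :=
    ContinuousWithinAt.comp (t := U ∩ X.param y.chart)
      (hsec.2.2.2.1.continuousOn _ ⟨mem_of_mem_nhds hsec.1, y.mem⟩) hmk.continuousWithinAt fun u hu => hu
  rw [ContinuousWithinAt, Set.inter_comm] at h2
  have h3 := (h2.mono_left (nhdsWithin_inter_of_mem' h1).ge).eventually (hO.mem_nhds (by
    rw [hsec.target]; exact (hON _ x.mem).mpr hx))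
  obtain ⟨O', hO', hyO', hsub⟩ := mem_nhdsWithin.mp (h1.and h3)
  refine ⟨O', hO', hyO', fun u hu huO => ?_⟩
  obtain ⟨h4, h5⟩ := hsub ⟨huO, hu⟩
  obtain ⟨hΘ, b, -, hb⟩ := hsec.2.2.2.2 (0, u) h4 hu
  refine ⟨_, (hON _ hΘ).mp h5, b, ?_⟩
  rw [hb, ha]
  funext j
  simp

end TGroupoid

namespace OrbMap

variable {X Y : TGroupoid m}

theorem invariant_img {g : OrbMap X Y} {B : ∀ i, Y.V i → ℝ} (hB : Y.IsInvariantFunction B) {w w' : g.Cov}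
    (a : g.ref w ⟶ g.ref w') :
    B (g.tgtChart w'.1) (g.f w'.1 w'.2.1) = B (g.tgtChart w.1) (g.f w.1 w.2.1) := hB.invariant (g.map a)

/-- An invariant function exceeding `1` at the image of a point does so nearby. -/
theorem exists_isOpen_one_lt {g : OrbMap X Y} (hg : g.IsSmooth) {B : ∀ i, Y.V i → ℝ}
    (hB : Y.IsInvariantFunction B) {x : X.Obj} {w : g.Cov} (hwx : g.ref w = x)
    (hw : 1 < B (g.tgtChart w.1) (g.f w.1 w.2.1)) :
    ∃ O : Set (X.V x.chart), IsOpen O ∧ x.pt ∈ O ∧ ∀ w' : g.Cov, ∀ u (hu : u ∈ X.dom x.chart),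
      g.ref w' = ⟨x.chart, u, hu⟩ → u ∈ O → 1 < B (g.tgtChart w'.1) (g.f w'.1 w'.2.1) := by
  subst hwx
  obtain ⟨O', hO', hO⟩ := hg.isOpen w.1
  have h1 : ContinuousWithinAt (fun u => B (g.tgtChart w.1) (g.f w.1 u)) (g.O w.1) w.2.1 :=
    ((hB.smooth _).continuousOn.comp (hg.smooth w.1).continuousOn (g.mapsTo w.1)) _ w.2.2
  obtain ⟨O₂, hO₂, hwO₂, hsub⟩ := mem_nhdsWithin.mp (h1.eventually (lt_mem_nhds hw))
  have hwO' := (Set.ext_iff.mp hO _).mp w.2.2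
  refine ⟨O' ∩ O₂, hO'.inter hO₂, ⟨hwO'.1, hwO₂⟩, fun w' u hu hw' huO => ?_⟩
  have huO' : u ∈ g.O w.1 := by rw [hO]; exact ⟨huO.1, hu⟩
  have h2 : 1 < B (g.tgtChart w.1) (g.f w.1 u) := hsub ⟨huO.2, huO'⟩
  exact lt_of_lt_of_eq h2 (invariant_img hB (w := ⟨w.1, u, huO'⟩) (w' := w') (eqToHom hw'.symm)).symm

/-- Cutoff functions near the image of the boundary of a compact orbifold. -/
theorem exists_cutoff (hX : X.IsOrbifold) (hc : X.IsCompact) (hY : Y.IsOrbifold) {g : OrbMap X.boundary Y}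
    (hg : g.IsSmooth) {S : Set Y.Obj} (hS : IsOpen S) (hinv : ∀ {x y : Y.Obj} (_ : x ⟶ y), y ∈ S → x ∈ S)
    (hgS : ∀ w, g.img w ∈ S) : ∃ ψ : ∀ i, Y.V i → ℝ, Y.IsInvariantFunction ψ ∧
      (∀ w : g.Cov, ψ (g.tgtChart w.1) (g.f w.1 w.2.1) = 1) ∧ TGroupoid.VanishesOff ψ S := by
  classical
  choose B hB hB0 hB1 hBS using fun w : g.Cov => hY.exists_bump hS hinv (hgS w)
  have hloc : ∀ x : X.Obj, ∃ N : Set X.Obj, IsOpen N ∧ x ∈ N ∧ ∃ F : Finset g.Cov,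
      ∀ w' : g.Cov, X.ofBoundary (g.ref w') ∈ N → ∃ w ∈ F, 1 < B w (g.tgtChart w'.1) (g.f w'.1 w'.2.1) := by
    intro x
    have := hX.finite_faces x.chart
    cases nonempty_fintype (X.Face x.chart)
    have hk : ∀ k : X.Face x.chart, ∃ O : Set (X.V x.chart), IsOpen O ∧ x.pt ∈ O ∧ ∃ w : Option g.Cov,
        ∀ u (hu : u ∈ X.dom x.chart) (hku : X.wall x.chart k u = 0), u ∈ O → ∀ w' : g.Cov,
          g.ref w' = X.toBoundary ⟨x.chart, u, hu⟩ k hku →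
            ∃ w₀ ∈ w, 1 < B w₀ (g.tgtChart w'.1) (g.f w'.1 w'.2.1) := by
      intro k
      by_cases hkx : X.wall x.chart k x.pt = 0
      · obtain ⟨w, hw⟩ := hg.cover (X.toBoundary x k hkx)
        obtain ⟨O, hO, hwO, h⟩ := exists_isOpen_one_lt hg (hB w) hw (hB1 w)
        obtain ⟨O', hO', hOO⟩ := isOpen_induced_iff.mp hO
        subst hOO
        exact ⟨O', hO', hwO, some w, fun u hu hku huO w' hw' => ⟨w, rfl, h w' ⟨u, hku⟩ hu hw' huO⟩⟩
      · exact ⟨{u | X.wall x.chart k u ≠ 0}, isOpen_ne_fun (X.wall x.chart k).continuous continuous_const, hkx,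
          none, fun u hu hku huO => absurd hku huO⟩
    choose O hO hxO w hw using hk
    refine ⟨{y | ∃ h : y.chart = x.chart, ∀ k, h ▸ y.pt ∈ O k}, TGroupoid.isOpen_obj ?_, ⟨rfl, hxO⟩,
      Finset.univ.biUnion fun k => (w k).toFinset, fun w' hw' => ?_⟩
    · rintro ⟨i, u, hu⟩ ⟨h, huO⟩
      simp only at h
      subst h
      exact ⟨⋂ k, O k, isOpen_iInter_of_finite hO, Set.mem_iInter.mpr huO, fun v hv hvO => ⟨rfl, Set.mem_iInter.mp hvO⟩⟩
    · rcases hr : g.ref w' with ⟨⟨i, k⟩, ⟨u, hku⟩, hu⟩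
      rw [hr] at hw'
      obtain ⟨h, huO⟩ := hw'
      change i = x.chart at h
      subst h
      obtain ⟨w₀, hw₀, h1⟩ := hw k u hu hku (huO k) w' hr
      exact ⟨w₀, Finset.mem_biUnion.mpr ⟨k, Finset.mem_univ _, by simpa using hw₀⟩, h1⟩
  choose N hN hxN F hF using hloc
  have hequiv : Equivalence fun x y : X.Obj => ∃ a : x ⟶ y, X.wt a = 1 :=
    ⟨fun x => ⟨𝟙 x, X.wt_id x⟩, fun {x y} ⟨a, ha⟩ => ⟨Groupoid.inv a, by
      have h1 := X.wt_comp a (Groupoid.inv a)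
      rw [Groupoid.comp_inv, X.wt_id, ha, mul_one] at h1
      exact h1.symm⟩, fun {x y z} ⟨a, ha⟩ ⟨b, hb⟩ => ⟨a ≫ b, by rw [X.wt_comp, ha, hb, mul_one]⟩⟩
  have hcs : CompactSpace (Quot fun x y : X.Obj => ∃ a : x ⟶ y, X.wt a = 1) := hc
  obtain ⟨T, hT⟩ := isCompact_univ.elim_finite_subcover
    (fun x : X.Obj => {p : Quot fun x y : X.Obj => ∃ a : x ⟶ y, X.wt a = 1 | ∃ x' ∈ N x, Quot.mk _ x' = p})
    (fun x => by
      rw [isOpen_coinduced]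
      convert hX.isOpen_saturation (hN x) using 1
      ext y
      simp only [Set.mem_preimage, Set.mem_ofPred_eq]
      refine exists_congr fun x' => and_congr_right fun _ => ?_
      rw [hequiv.quot_mk_eq_iff]
      exact ⟨hequiv.symm, hequiv.symm⟩)
    (fun p _ => by
      obtain ⟨x, rfl⟩ := Quot.exists_rep p
      exact Set.mem_iUnion.mpr ⟨x, x, hxN x, rfl⟩)
  have hfin : ∀ w' : g.Cov, ∃ w ∈ T.biUnion F, 1 < B w (g.tgtChart w'.1) (g.f w'.1 w'.2.1) := by
    intro w'
    have h1 := hT (Set.mem_univ (Quot.mk _ (X.ofBoundary (g.ref w'))))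
    simp only [Set.mem_iUnion] at h1
    obtain ⟨x, hxT, x', hx', he⟩ := h1
    rw [hequiv.quot_mk_eq_iff] at he
    obtain ⟨a, ha⟩ := hequiv.symm he
    obtain ⟨k, hk, b, -⟩ := hX.exists_boundary_arrow a
    obtain ⟨w'', hw''⟩ := hg.cover (X.toBoundary x' k hk)
    obtain ⟨w, hwF, hw⟩ := hF x w'' (by rw [hw'']; exact hx')
    refine ⟨w, Finset.mem_biUnion.mpr ⟨x, hxT, hwF⟩, lt_of_lt_of_eq hw ?_⟩
    exact invariant_img (hB w) (w := w') (w' := w'') ((show g.ref w' ⟶ X.toBoundary x' k hk from b) ≫ eqToHom hw''.symm)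
  refine ⟨fun i u => Real.smoothTransition (∑ w ∈ T.biUnion F, B w i u), ⟨fun i => ?_, fun {x y} a => ?_⟩,
    fun w' => ?_, fun x hx => ?_⟩
  · exact Real.smoothTransition.contDiff.comp_contDiffOn (ContDiffOn.sum fun w _ => (hB w).smooth i)
  · exact congrArg Real.smoothTransition (Finset.sum_congr rfl fun w _ => (hB w).invariant a)
  · obtain ⟨w, hw, h1⟩ := hfin w'
    exact Real.smoothTransition.one_of_one_le (h1.le.trans
      (Finset.single_le_sum (f := fun w => B w (g.tgtChart w'.1) (g.f w'.1 w'.2.1)) (fun w _ => hB0 w _ _) hw))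
  · choose O hO hxO h0 using fun w => hBS w x hx
    refine ⟨⋂ w ∈ T.biUnion F, O w, isOpen_biInter_finset fun w _ => hO w, Set.mem_iInter₂.mpr fun w _ => hxO w,
      fun u hu => Real.smoothTransition.zero_of_nonpos (le_of_eq (Finset.sum_eq_zero fun w hw => ?_))⟩
    exact h0 w u ⟨Set.mem_iInter₂.mp hu.1 w hw, hu.2⟩

end OrbMap

end

section

variable {m : ℕ} {X : TGroupoid m} {E : TBundle X}

namespace TGroupoid

theorem IsOrbifold.goodSet_boundary (hX : X.IsOrbifold) (c : X.boundaryCharts.ι) :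
    GoodSet (X.boundaryCharts.dom c) := by
  obtain ⟨O, hO, h⟩ := hX.dom_open c.1
  have := hX.finite_faces c.1
  cases nonempty_fintype (X.Face c.1)
  classical
  set Q : Set (X.wall c.1 c.2).ker := {v | ∀ k, 0 ≤ X.wall c.1 k v.1} with hQ
  have hQ' : Q = ⋂ k, {v | 0 ≤ (X.wall c.1 k).comp (X.wall c.1 c.2).ker.subtypeL v} := by
    ext; simp [hQ]
  have e : X.boundaryCharts.dom c = Subtype.val ⁻¹' O ∩ Q := by
    ext v
    change v.1 ∈ X.dom c.1 ↔ _
    rw [h]; rfl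
  rw [e]
  refine GoodSet.of_convex ?_ ?_ (hO.preimage continuous_subtype_val)
  · rw [hQ']
    exact convex_iInter fun k =>
      convex_halfSpace_ge ((X.wall c.1 k).comp (X.wall c.1 c.2).ker.subtypeL).isLinear 0
  · obtain ⟨v, hv⟩ := exists_clm_apply_eq (hX.walls_indep c.1) fun k => if k = c.2 then 0 else 1
    have hvk : v ∈ (X.wall c.1 c.2).ker := by
      have := hv c.2
      rwa [if_pos rfl] at this
    refine ⟨⟨v, hvk⟩, mem_interior.mpr ⟨{w | ∀ k : {k : X.Face c.1 // k ≠ c.2},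
      0 < (X.wall c.1 k.1).comp (X.wall c.1 c.2).ker.subtypeL w}, fun w hw k => ?_, ?_, fun k => ?_⟩⟩
    · by_cases hk : k = c.2
      · subst hk; exact le_of_eq (Eq.symm w.2)
      · exact (hw ⟨k, hk⟩).le
    · simp only [Set.ofPred_forall]
      exact isOpen_iInter_of_finite fun k => isOpen_lt continuous_const (ContinuousLinearMap.continuous _)
    · change 0 < X.wall c.1 k.1 v
      rw [hv, if_neg k.2]; exact one_pos

end TGroupoid

namespace TBundle

/-- Along a flow the walls through its starting point are preserved. -/
theorem IsFlow.eventually_wall (hX : X.IsOrbifold) {x : X.Obj} {U L Θ Ψ} (h : E.IsFlow (𝟙 x) U L Θ Ψ)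
    {k : X.Face x.chart} (hk : X.wall x.chart k x.pt = 0) :
    ∀ᶠ τ in 𝓝 (0 : Fin m → ℝ), (τ, x.pt) ∈ U ∧ ∃ (hΘ : Θ (τ, x.pt) ∈ X.dom x.chart)
      (b : x ⟶ (⟨x.chart, Θ (τ, x.pt), hΘ⟩ : X.Obj)),
      L (τ, x.pt) = ⟨(x, ⟨x.chart, Θ (τ, x.pt), hΘ⟩), b⟩ ∧ (X.wt b = fun j => Circle.exp (τ j)) ∧
      E.act (y := ⟨x.chart, Θ (τ, x.pt), hΘ⟩) b = Ψ (τ, x.pt) ∧ X.wall x.chart k (Θ (τ, x.pt)) = 0 ∧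
      ∃ c : ℝ, 0 < c ∧ ∀ u, X.wall x.chart k (X.jac b u) = c * X.wall x.chart k u := by
  classical
  have := hX.finite_faces x.chart
  cases nonempty_fintype (X.Face x.chart)
  have hUD := uniqueDiffOn_param hX x.chart
  have hmk : Continuous fun τ : Fin m → ℝ => (τ, x.pt) := by fun_prop
  have hU : ∀ᶠ τ in 𝓝 (0 : Fin m → ℝ), (τ, x.pt) ∈ U :=
    hmk.continuousAt.preimage_mem_nhds (h.isOpen.mem_nhds h.mem)
  have hD : ContinuousAt (fun τ : Fin m → ℝ => fderivWithin ℝ Θ (X.param x.chart) (τ, x.pt)) 0 := by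
    have h1 := ((h.cnear h.mem).fderivWithin hUD).continuousWithinAt x.mem
    have h2 := ContinuousWithinAt.comp (t := X.param x.chart) (s := Set.univ) (x := (0 : Fin m → ℝ)) h1
      hmk.continuousWithinAt fun τ _ => x.mem
    rwa [continuousWithinAt_univ] at h2
  choose e he using fun k' : X.Face x.chart => exists_clm_apply_eq (hX.walls_indep x.chart) (Pi.single k' 1)
  have h0 := h.hasFDerivWithinAt.1.fderivWithin (hUD _ x.mem)
  have hne : ∀ᶠ τ in 𝓝 (0 : Fin m → ℝ), ∀ k' : X.Face x.chart,
      X.wall x.chart k' (fderivWithin ℝ Θ (X.param x.chart) (τ, x.pt) (0, e k')) ≠ 0 := by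
    rw [eventually_all]
    intro k'
    have hc : ContinuousAt (fun τ : Fin m → ℝ =>
        X.wall x.chart k' (fderivWithin ℝ Θ (X.param x.chart) (τ, x.pt) (0, e k'))) 0 :=
      (X.wall x.chart k').continuous.continuousAt.comp (hD.clm_apply continuousAt_const)
    refine hc.eventually_ne ?_
    rw [h0, paramDeriv_zero, X.jac_id, ContinuousLinearMap.id_apply, he, Pi.single_eq_same]
    exact one_ne_zero
  filter_upwards [hU, hne] with τ hτ hτn
  obtain ⟨hΘ, b, hb, hwt, hact, hd, -⟩ := h.arrow (τ, x.pt) hτ x.mem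
  refine ⟨hτ, hΘ, b, hb, ?_, hact, ?_⟩
  · rw [hwt, X.wt_id]; funext j; simp
  obtain ⟨k', hk', c, hc, hcu⟩ := hX.exists_wall (x := x) (y := ⟨x.chart, Θ (τ, x.pt), hΘ⟩) b hk
  have hkk : k' = k := by
    by_contra hne
    refine hτn k' ?_
    rw [hd.fderivWithin (hUD _ x.mem), paramDeriv_zero]
    refine (hcu _).trans ?_
    rw [he, Pi.single_eq_of_ne (Ne.symm hne), mul_zero]
  subst hkk
  exact ⟨hk', c, hc, hcu⟩

theorem fund_mem_ker (hX : X.IsOrbifold) (hE : E.IsSmooth) {x : X.Obj} {k : X.Face x.chart}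
    (hk : X.wall x.chart k x.pt = 0) (j : Fin m) : X.fund x.chart j x.pt ∈ (X.wall x.chart k).ker := by
  obtain ⟨U, L, Θ, Ψ, h⟩ := exists_flow hX hE (𝟙 x)
  have hline : Tendsto (fun t : ℝ => t • (Pi.single j 1 : Fin m → ℝ)) (𝓝 0) (𝓝 0) := by
    have : Continuous fun t : ℝ => t • (Pi.single j 1 : Fin m → ℝ) := by fun_prop
    simpa using this.tendsto 0
  have h1 := (X.wall x.chart k).hasFDerivAt.comp_hasDerivAt (0 : ℝ) (h.hasDerivAt j).1
  have h2 : HasDerivAt (fun _ : ℝ => (0 : ℝ)) (X.wall x.chart k (X.fund x.chart j x.pt)) 0 := by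
    refine h1.congr_of_eventuallyEq ?_
    filter_upwards [hline.eventually (h.eventually_wall hX hk)] with t ht
    obtain ⟨-, _, _, -, -, -, h0, -⟩ := ht
    exact h0.symm
  exact h2.unique (hasDerivAt_const _ _)

end TBundle

namespace OrbMap

variable {Y : TGroupoid m}

theorem mk_map_eq (g : OrbMap X.boundary Y) {w w' : g.Cov} (b : g.ref w ⟶ g.ref w') (hw : w' = w)
    (hb : (⟨(X.ofBoundary (g.ref w), X.ofBoundary (g.ref w')), b.arrow⟩ : X.Arr) =
      ⟨(X.ofBoundary (g.ref w), X.ofBoundary (g.ref w)), 𝟙 (X.ofBoundary (g.ref w))⟩) :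
    (⟨(g.img w, g.img w'), g.map b⟩ : Y.Arr) = ⟨(g.img w, g.img w), 𝟙 (g.img w)⟩ := by
  subst hw
  have h1 : b.arrow = 𝟙 _ := by
    rw [Sigma.mk.injEq] at hb
    exact eq_of_heq hb.2
  have h2 : b = 𝟙 (g.ref w') := TGroupoid.BoundaryHom.ext h1
  rw [h2, g.map_id]

theorem continuous_mk_map {g : OrbMap X.boundary Y} (hg : g.IsSmooth) {T : Type*} [TopologicalSpace T]
    (w : g.Cov) {u : T → X.boundary.V (g.chart w.1)} (hu : ∀ t, u t ∈ g.O w.1)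
    (b : ∀ t, g.ref w ⟶ g.ref ⟨w.1, u t, hu t⟩) (hcu : Continuous u)
    (hcb : Continuous fun t => (⟨(X.ofBoundary (g.ref w), X.ofBoundary (g.ref ⟨w.1, u t, hu t⟩)), (b t).arrow⟩ : X.Arr)) :
    Continuous fun t => (⟨(g.img w, g.img ⟨w.1, u t, hu t⟩), g.map (b t)⟩ : Y.Arr) := by
  let : TopologicalSpace X.boundary.Arr := X.boundary.arrTop
  have h0 : Continuous fun t => ((w, ⟨w.1, u t, hu t⟩) : g.Cov × g.Cov) :=
    continuous_const.prodMk ((continuous_sigmaMk (σ := fun a => g.O a)).comp (hcu.subtype_mk hu))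
  have h2 : Continuous fun t => ((g.ref w, g.ref ⟨w.1, u t, hu t⟩) : X.boundary.Obj × X.boundary.Obj) :=
    continuous_const.prodMk ((TGroupoid.IsOrbifold.continuous_mk X.boundary (g.chart w.1)).comp
      (hcu.subtype_mk fun t => g.subset_dom _ (hu t)))
  have h3 : Continuous fun t => (⟨(g.ref w, g.ref ⟨w.1, u t, hu t⟩), b t⟩ : X.boundary.Arr) :=
    continuous_induced_rng.mpr (h2.prodMk hcb)
  have h1 : Continuous fun t => (⟨(w, ⟨w.1, u t, hu t⟩), b t⟩ : g.CovArr) :=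
    continuous_induced_rng.mpr (h0.prodMk h3)
  exact hg.continuous_map.comp h1

end OrbMap

namespace CartesianMap

variable {Y : TGroupoid m} {E' : TBundle Y} {g : OrbMap X.boundary Y}

/-- The map of total spaces intertwines the flows. -/
theorem eventually_tot_flow (hX : X.IsOrbifold) (hY : Y.IsOrbifold) (hg : g.IsSmooth)
    (h : CartesianMap E.boundary E' g) (w : g.Cov) {U L Θ Ψ}
    (hf : E.IsFlow (𝟙 (X.ofBoundary (g.ref w))) U L Θ Ψ) {U' L' Θ' Ψ'}
    (hf' : E'.IsFlow (𝟙 (g.img w)) U' L' Θ' Ψ') :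
    ∀ᶠ τ in 𝓝 (0 : Fin m → ℝ), ∃ u : X.boundary.V (g.chart w.1), u ∈ g.O w.1 ∧ u.1 = Θ (τ, w.2.1.1) ∧
      g.f w.1 u = Θ' (τ, g.f w.1 w.2.1) ∧ ∀ v, h.lin w.1 u (Ψ (τ, w.2.1.1) v) =
        Ψ' (τ, g.f w.1 w.2.1) (h.lin w.1 w.2.1 v) := by
  have hk0 : X.wall (g.chart w.1).1 (g.chart w.1).2 w.2.1.1 = 0 :=
    (show (X.wall (g.chart w.1).1 (g.chart w.1).2).ker from w.2.1).2
  have hwall := hf.eventually_wall hX (k := (g.chart w.1).2) hk0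
  obtain ⟨O', hO', hO⟩ := hg.isOpen w.1
  obtain ⟨O₁, hO₁, hOO⟩ := isOpen_induced_iff.mp hO'
  subst hOO
  have hmk : Continuous fun τ : Fin m → ℝ => (τ, (X.ofBoundary (g.ref w)).pt) := by fun_prop
  have hmk' : Continuous fun τ : Fin m → ℝ => (τ, g.f w.1 w.2.1) := by fun_prop
  have hxO : w.2.1.1 ∈ O₁ := ((Set.ext_iff.mp hO _).mp w.2.2).1
  have hU' : ∀ᶠ τ in 𝓝 (0 : Fin m → ℝ), (τ, g.f w.1 w.2.1) ∈ U' :=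
    hmk'.continuousAt.preimage_mem_nhds (hf'.isOpen.mem_nhds hf'.mem)
  have hΘO : ∀ᶠ τ in 𝓝 (0 : Fin m → ℝ), Θ (τ, w.2.1.1) ∈ O₁ := by
    have h1 := (hf.cnear hf.mem).continuousWithinAt (X.ofBoundary (g.ref w)).mem
    have h2 := ContinuousWithinAt.comp (t := X.param (g.chart w.1).1) (s := Set.univ) (x := (0 : Fin m → ℝ)) h1
      hmk.continuousWithinAt fun τ _ => (X.ofBoundary (g.ref w)).mem
    rw [continuousWithinAt_univ] at h2
    refine h2.preimage_mem_nhds (hO₁.mem_nhds ?_)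
    have e : Θ (0, w.2.1.1) = w.2.1.1 := hf.target
    exact (congrArg (· ∈ O₁) e).mpr hxO
  set T : Set (Fin m → ℝ) := {τ | ((τ, w.2.1.1) ∈ U ∧ ∃ (hΘ : Θ (τ, w.2.1.1) ∈ X.dom (g.chart w.1).1)
      (b : X.ofBoundary (g.ref w) ⟶ (⟨(g.chart w.1).1, Θ (τ, w.2.1.1), hΘ⟩ : X.Obj)),
      L (τ, w.2.1.1) = ⟨(_, _), b⟩ ∧ (X.wt b = fun j => Circle.exp (τ j)) ∧
      E.act (y := ⟨(g.chart w.1).1, Θ (τ, w.2.1.1), hΘ⟩) b = Ψ (τ, w.2.1.1) ∧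
      X.wall (g.chart w.1).1 (g.chart w.1).2 (Θ (τ, w.2.1.1)) = 0 ∧
      ∃ c : ℝ, 0 < c ∧ ∀ u, X.wall (g.chart w.1).1 (g.chart w.1).2 (X.jac b u) =
        c * X.wall (g.chart w.1).1 (g.chart w.1).2 u) ∧
      (τ, g.f w.1 w.2.1) ∈ U' ∧ Θ (τ, w.2.1.1) ∈ O₁} with hT
  have hTn : T ∈ 𝓝 (0 : Fin m → ℝ) := hwall.and (hU'.and hΘO)
  have h0T : (0 : Fin m → ℝ) ∈ T := mem_of_mem_nhds hTn
  choose hΘd b hb hbw hba hb0 hbc using fun τ : T => τ.2.1.2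
  set u : T → X.boundary.V (g.chart w.1) := fun τ => ⟨Θ (τ.1, w.2.1.1), hb0 τ⟩ with hud
  have hu : ∀ τ, u τ ∈ g.O w.1 := fun τ => by
    rw [hO]
    exact ⟨τ.2.2.2, hΘd τ⟩
  set B : ∀ τ : T, g.ref w ⟶ g.ref ⟨w.1, u τ, hu τ⟩ := fun τ => ⟨b τ, hbc τ⟩ with hB
  have hmkT : Continuous fun τ : T => (τ.1, w.2.1.1) := hmk.comp continuous_subtype_val
  have hcu : Continuous u := by
    refine Continuous.subtype_mk ?_ _
    exact hf.isSection.2.2.2.1.continuousOn.comp_continuous hmkT fun τ => ⟨τ.2.1.1, (X.ofBoundary (g.ref w)).mem⟩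
  have hcb : Continuous fun τ : T => (⟨(X.ofBoundary (g.ref w), X.ofBoundary (g.ref ⟨w.1, u τ, hu τ⟩)),
      (B τ).arrow⟩ : X.Arr) :=
    (hf.isSection.2.1.comp_continuous hmkT fun τ => ⟨τ.2.1.1, (X.ofBoundary (g.ref w)).mem⟩).congr fun τ => hb τ
  have hcont := OrbMap.continuous_mk_map hg w hu B hcu hcb
  have hcont' : Continuous fun τ : T => L' (τ.1, g.f w.1 w.2.1) :=
    hf'.isSection.2.1.comp_continuous (hmk'.comp continuous_subtype_val) fun τ => ⟨τ.2.2.1, (g.img w).mem⟩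
  have hu0 : u ⟨0, h0T⟩ = w.2.1 := Subtype.ext hf.target
  have h00 := g.mk_map_eq (w := w) (w' := ⟨w.1, u ⟨0, h0T⟩, hu _⟩) (B ⟨0, h0T⟩)
    (Sigma.ext rfl (heq_of_eq (Subtype.ext hu0))) ((hb ⟨0, h0T⟩).symm.trans hf.isSection.2.2.1)
  have hev := hY.eventually_eq (S := Set.univ) (Set.mem_univ (⟨0, h0T⟩ : T)) hcont'.continuousWithinAt
    hcont.continuousWithinAt (hf'.isSection.2.2.1.trans h00.symm) (Eventually.of_forall fun τ => by
      obtain ⟨_, c, hc, hcw, -⟩ := hf'.arrow _ τ.2.2.1 (g.img w).mem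
      have e1 : Y.wt c = Y.wt (g.map (B τ)) := by
        rw [hcw, g.wt_map, Y.wt_id]
        refine Eq.trans ?_ (hbw τ).symm
        funext j; simp
      exact (congrArg (fun a : Y.Arr => (Y.wt a.2, a.1.1)) hc).trans (Prod.ext e1 rfl))
  rw [nhdsWithin_univ] at hev
  have hev' : ∀ᶠ τ in 𝓝 (0 : Fin m → ℝ), ∀ h : τ ∈ T, L' (τ, g.f w.1 w.2.1) =
      ⟨(g.img w, g.img ⟨w.1, u ⟨τ, h⟩, hu ⟨τ, h⟩⟩), g.map (B ⟨τ, h⟩)⟩ := by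
    have h1 := (eventually_nhds_subtype_iff T ⟨0, h0T⟩ fun τ => ∀ h : τ ∈ T, L' (τ, g.f w.1 w.2.1) =
      ⟨(g.img w, g.img ⟨w.1, u ⟨τ, h⟩, hu ⟨τ, h⟩⟩), g.map (B ⟨τ, h⟩)⟩).mp (hev.mono fun τ hτ _ => hτ)
    rwa [nhdsWithin_eq_nhds.mpr hTn] at h1
  filter_upwards [hev', hTn] with τ h1 hτ
  refine ⟨u ⟨τ, hτ⟩, hu _, rfl, ?_⟩
  obtain ⟨_, c, hc, -, hca, -⟩ := hf'.arrow (τ, g.f w.1 w.2.1) hτ.2.1 (g.img w).mem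
  have h2 := hc.symm.trans (h1 hτ)
  refine ⟨(TGroupoid.pt_eq (TGroupoid.arr_ext h2)).symm, fun v => ?_⟩
  have h3 := E'.act_congr h2
  have h4 := congrArg (fun A => A v) (h.equivariant (B ⟨τ, hτ⟩))
  rw [← hca, h3, ← hba ⟨τ, hτ⟩]
  exact h4.symm

end CartesianMap

end

section

variable {m : ℕ} {X : TGroupoid m} {E : TBundle X}

theorem TBundle.IsFlow.hasDerivAt_act_apply {x : X.Obj} {U L Θ Ψ} (h : E.IsFlow (𝟙 x) U L Θ Ψ) (j : Fin m)
    (v : Fib (E.rank x.chart)) :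
    HasDerivAt (fun t : ℝ => Ψ (t • Pi.single j 1, x.pt) v) (E.inf x.chart j x.pt v) 0 := by
  have h1 := (h.hasDerivAt j).2.clm_apply (hasDerivAt_const (0 : ℝ) v)
  rwa [E.act_id, map_zero, add_zero, ContinuousLinearMap.comp_id] at h1

namespace OrbMap

variable {Y : TGroupoid m} {g : OrbMap X.boundary Y}

theorem goodSet_cover (hX : X.IsOrbifold) (hg : g.IsSmooth) (a : g.κ) : GoodSet (g.O a) := by
  obtain ⟨O, hO, h⟩ := hg.isOpen a
  rw [h]
  exact (hX.goodSet_boundary (g.chart a)).inter_open hO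

end OrbMap

namespace CartesianMap

variable {Y : TGroupoid m} {E' : TBundle Y} {g : OrbMap X.boundary Y}

theorem cnear_tot (hg : g.IsSmooth) (h : CartesianMap E.boundary E' g) (a : g.κ)
    {p : X.boundary.V (g.chart a) × Fib (E.boundary.rank (g.chart a))}
    (hp : p ∈ tube (g.O a) (E.boundary.rank (g.chart a))) :
    CNear (h.tot a) (tube (g.O a) (E.boundary.rank (g.chart a))) p := by
  have h1 : ContDiffOn ℝ ∞ (fun p => g.f a p.1) (tube (g.O a) (E.boundary.rank (g.chart a))) :=
    (hg.smooth a).comp contDiff_fst.contDiffOn fun p hp => hp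
  have h2 : ContDiffOn ℝ ∞ (fun p => h.lin a p.1 p.2) (tube (g.O a) (E.boundary.rank (g.chart a))) :=
    ((h.smooth a).comp contDiff_fst.contDiffOn fun p hp => hp).clm_apply contDiff_snd.contDiffOn
  exact CNear.of_contDiffOn (h1.prodMk h2)

/-- The map of total spaces intertwines the fundamental vector fields. -/
theorem fderivWithin_tot_tfund (hX : X.IsOrbifold) (hE : E.IsSmooth) (hY : Y.IsOrbifold) (hE' : E'.IsSmooth)
    (hg : g.IsSmooth) (h : CartesianMap E.boundary E' g) (w : g.Cov)
    (v : Fib (E.boundary.rank (g.chart w.1))) (j : Fin m)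
    {u : (X.wall (g.chart w.1).1 (g.chart w.1).2).ker} (hu : u.1 = X.fund (g.chart w.1).1 j (X.ofBoundary (g.ref w)).pt) :
    fderivWithin ℝ (h.tot w.1) (tube (g.O w.1) (E.boundary.rank (g.chart w.1))) (w.2.1, v)
      (u, E.inf (g.chart w.1).1 j (X.ofBoundary (g.ref w)).pt v) =
      E'.tfund (g.tgtChart w.1) (h.tot w.1 (w.2.1, v)) j := by
  obtain ⟨U, L, Θ, Ψ, hf⟩ := TBundle.exists_flow hX hE (𝟙 (X.ofBoundary (g.ref w)))
  obtain ⟨U', L', Θ', Ψ', hf'⟩ := TBundle.exists_flow hY hE' (𝟙 (g.img w))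
  obtain ⟨P₀, hP₀⟩ := LinearMap.exists_leftInverse_of_injective
    (X.wall (g.chart w.1).1 (g.chart w.1).2).ker.subtype (Submodule.ker_subtype _)
  set P := P₀.toContinuousLinearMap
  have hP : ∀ k : (X.wall (g.chart w.1).1 (g.chart w.1).2).ker, P k.1 = k := fun k => congrArg (fun f => f k) hP₀
  have hline : Tendsto (fun t : ℝ => t • (Pi.single j 1 : Fin m → ℝ)) (𝓝 0) (𝓝 0) := by
    have : Continuous fun t : ℝ => t • (Pi.single j 1 : Fin m → ℝ) := by fun_prop
    simpa using this.tendsto 0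
  have hev := hline.eventually (h.eventually_tot_flow hX hY hg w hf hf')
  have hΘ0 : Θ (0, (X.ofBoundary (g.ref w)).pt) = (X.ofBoundary (g.ref w)).pt := hf.target
  have hΨ0 : Ψ (0, (X.ofBoundary (g.ref w)).pt) = ContinuousLinearMap.id ℝ _ := hf.act_eq.trans (E.act_id _)
  have hΘ0' : Θ' (0, (g.img w).pt) = (g.img w).pt := hf'.target
  have hΨ0' : Ψ' (0, (g.img w).pt) = ContinuousLinearMap.id ℝ _ := hf'.act_eq.trans (E'.act_id _)
  set γ : ℝ → (X.wall (g.chart w.1).1 (g.chart w.1).2).ker × Fib (E.rank (g.chart w.1).1) := fun t =>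
    (P (Θ (t • Pi.single j 1, (X.ofBoundary (g.ref w)).pt)), Ψ (t • Pi.single j 1, (X.ofBoundary (g.ref w)).pt) v)
    with hγd
  have h1 := (P.hasFDerivAt.comp_hasDerivAt (0 : ℝ) (hf.hasDerivAt j).1).prodMk (hf.hasDerivAt_act_apply j v)
  have h1' := (hf'.hasDerivAt j).1.prodMk (hf'.hasDerivAt_act_apply j (h.lin w.1 w.2.1 v))
  have h0 : γ 0 = (w.2.1, v) := by
    refine Prod.ext ?_ ?_
    · simp only [hγd, zero_smul]
      exact (congrArg P hΘ0).trans (hP w.2.1)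
    · simp only [hγd, zero_smul]
      rw [hΨ0]; rfl
  have hu' : P (X.fund (g.chart w.1).1 j (X.ofBoundary (g.ref w)).pt) = u := by rw [← hu, hP]
  have h2 : HasDerivAt γ (u, E.inf (g.chart w.1).1 j (X.ofBoundary (g.ref w)).pt v) 0 :=
    HasDerivAt.congr_deriv h1 (Prod.ext hu' rfl)
  have hd := (h.cnear_tot hg w.1 (p := (w.2.1, v)) w.2.2).differentiableWithinAt w.2.2
  have hPu : ∀ t : ℝ, ∀ u' : (X.wall (g.chart w.1).1 (g.chart w.1).2).ker,
      u'.1 = Θ (t • Pi.single j 1, (X.ofBoundary (g.ref w)).pt) →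
      P (Θ (t • Pi.single j 1, (X.ofBoundary (g.ref w)).pt)) = u' := fun t u' h => by rw [← h, hP]
  have hγ : ∀ᶠ t in 𝓝 (0 : ℝ), γ t ∈ tube (g.O w.1) (E.boundary.rank (g.chart w.1)) := by
    filter_upwards [hev] with t ⟨u', hu', hΘ, _⟩
    exact (congrArg (· ∈ g.O w.1) (hPu t u' hΘ)).mpr hu'
  have h3 := hd.hasFDerivWithinAt.comp_hasDerivAt_of_eq (0 : ℝ) h2 hγ h0.symm
  refine h3.unique (HasDerivAt.congr_of_eventuallyEq (HasDerivAt.congr_deriv h1' ?_) ?_)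
  · exact Prod.ext rfl rfl
  · filter_upwards [hev] with t ⟨u', hu', hΘ, hg', hl⟩
    have e : P (Θ (t • Pi.single j 1, (X.ofBoundary (g.ref w)).pt)) = u' := hPu t u' hΘ
    change h.tot w.1 (P (Θ (t • Pi.single j 1, (X.ofBoundary (g.ref w)).pt)),
      Ψ (t • Pi.single j 1, (X.ofBoundary (g.ref w)).pt) v) = _
    exact (congrArg (fun z => h.tot w.1 (z, _)) e).trans (Prod.ext hg' (hl v))

end CartesianMap

end

section

section hessian

variable {V : Type} [NormedAddCommGroup V] [NormedSpace ℝ V] {r : ℕ} {f : V × Fib r → ℝ} {S : Set V}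

/-- The quadratic part of `f` in the direction of the fibre. -/
noncomputable def fibreHessian (f : V × Fib r → ℝ) (S : Set V) (p : V × Fib r) : ℝ :=
  2⁻¹ * fderivWithin ℝ (fun p => fderivWithin ℝ f (tube S r) p) (tube S r) (p.1, 0) (0, p.2) (0, p.2)

theorem isFibreQuadratic_fibreHessian (hS : GoodSet S) (hf : ∀ p ∈ tube S r, CNear f (tube S r) p) :
    IsFibreQuadratic (fibreHessian f S) S where
  smooth p hp := by
    have hU := (hS.tube (r := r)).uniqueDiffOn
    have h0 : (p.1, (0 : Fib r)) ∈ tube S r := hp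
    have h1 := CNear.comp (Θ := fun p : V × Fib r => (p.1, (0 : Fib r))) (x := p) (CNear.of_contDiff (by fun_prop)) hp
      (((hf _ h0).fderivWithin hU).fderivWithin hU) isOpen_univ trivial fun y hy => hy.2
    have h2 : CNear (fun p : V × Fib r => ((0 : V), p.2)) (tube S r) p := CNear.of_contDiff (by fun_prop)
    exact (CNear.const (2⁻¹ : ℝ)).mul ((h1.clm_apply h2).clm_apply h2)
  hom x hx s hs v := by
    have : ((0 : V), s • v) = s • ((0 : V), v) := by simp
    unfold fibreHessian
    simp only [this, map_smul, smul_eq_mul, smul_apply]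
    ring

theorem hasDerivAt_slice (hf : ContDiffOn ℝ ∞ f (tube S r)) {x : V} (hx : x ∈ S) (v : Fib r) (t : ℝ) :
    HasDerivAt (fun t : ℝ => f (x, t • v)) (fderivWithin ℝ f (tube S r) (x, t • v) (0, v)) t := by
  have h1 := (hasDerivAt_id t).smul_const v
  rw [one_smul] at h1
  have h2 := slice_hasFDerivAt hf hx (t • v)
  exact HasFDerivAt.comp_hasDerivAt (l := fun v => f (x, v)) t h2 h1

theorem fibreHessian_eq (hS : GoodSet S) (hf : ∀ p ∈ tube S r, CNear f (tube S r) p) {x : V} (hx : x ∈ S)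
    (v : Fib r) : HasDerivAt (deriv fun t : ℝ => f (x, t • v)) (2 * fibreHessian f S (x, v)) 0 := by
  have hU := (hS.tube (r := r)).uniqueDiffOn
  have e : (deriv fun t : ℝ => f (x, t • v)) = fun t => fderivWithin ℝ f (tube S r) (x, t • v) (0, v) :=
    funext fun t => (hasDerivAt_slice (CNear.contDiffOn hf) hx v t).deriv
  have h1 := (((hf (x, (0 : Fib r)) hx).fderivWithin hU).differentiableWithinAt hx).hasFDerivWithinAt
  have h2 : HasDerivAt (fun t : ℝ => (x, t • v)) (0, v) 0 := by
    have := (hasDerivAt_const (0 : ℝ) x).prodMk ((hasDerivAt_id (0 : ℝ)).smul_const v)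
    rwa [one_smul] at this
  have h3 := h1.comp_hasDerivAt_of_eq (0 : ℝ) h2 (Eventually.of_forall fun t => hx) (by simp)
  have h4 := h3.clm_apply (hasDerivAt_const (0 : ℝ) ((0 : V), v))
  rw [e]
  refine h4.congr_deriv ?_
  simp only [fibreHessian, map_zero, add_zero]
  ring

theorem fibreHessian_congr {V' : Type} [NormedAddCommGroup V'] [NormedSpace ℝ V'] {r' : ℕ}
    {f' : V' × Fib r' → ℝ} {S' : Set V'} (hS : GoodSet S) (hf : ∀ p ∈ tube S r, CNear f (tube S r) p)
    (hS' : GoodSet S') (hf' : ∀ p ∈ tube S' r', CNear f' (tube S' r') p) {x : V} (hx : x ∈ S) {v : Fib r}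
    {x' : V'} (hx' : x' ∈ S') {v' : Fib r'} (h : ∀ t : ℝ, f' (x', t • v') = f (x, t • v)) :
    fibreHessian f' S' (x', v') = fibreHessian f S (x, v) := by
  have h1 := fibreHessian_eq hS' hf' hx' v'
  rw [funext h] at h1
  exact mul_left_cancel₀ two_ne_zero (h1.unique (fibreHessian_eq hS hf hx v))

theorem IsFibreQuadratic.fibreHessian_eq (hS : GoodSet S) (hf : IsFibreQuadratic f S) {x : V} (hx : x ∈ S)
    (v : Fib r) : fibreHessian f S (x, v) = f (x, v) := by
  have h1 := (_root_.fibreHessian_eq hS hf.smooth hx v).hasDerivWithinAt (s := Set.Ici 0)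
  have h2 : ∀ t : ℝ, 0 < t → deriv (fun t : ℝ => f (x, t • v)) t = 2 * f (x, v) * t := fun t ht => by
    have h3 : HasDerivAt (fun t : ℝ => t ^ 2 * f (x, v)) (2 * f (x, v) * t) t := by
      refine ((hasDerivAt_pow 2 t).mul_const (f (x, v))).congr_deriv ?_
      push_cast; ring
    refine (h3.congr_of_eventuallyEq ?_).deriv
    filter_upwards [lt_mem_nhds ht] with s hs using hf.hom x hx s hs v
  have h0 : deriv (fun t : ℝ => f (x, t • v)) 0 = 0 := by
    have h3 : Tendsto (deriv fun t : ℝ => f (x, t • v)) (𝓝[>] 0) (𝓝 (deriv (fun t : ℝ => f (x, t • v)) 0)) :=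
      (_root_.fibreHessian_eq hS hf.smooth hx v).continuousAt.tendsto.mono_left nhdsWithin_le_nhds
    have h4 : Tendsto (fun t : ℝ => 2 * f (x, v) * t) (𝓝[>] 0) (𝓝 0) := by
      have : Continuous fun t : ℝ => 2 * f (x, v) * t := by fun_prop
      simpa using (this.tendsto 0).mono_left nhdsWithin_le_nhds
    refine tendsto_nhds_unique h3 (h4.congr' ?_)
    filter_upwards [self_mem_nhdsWithin] with t ht using (h2 t ht).symm
  have h3 : HasDerivWithinAt (deriv fun t : ℝ => f (x, t • v)) (2 * f (x, v)) (Set.Ici 0) 0 := by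
    have h4 : HasDerivAt (fun t : ℝ => 2 * f (x, v) * t) (2 * f (x, v)) 0 := by
      simpa using (hasDerivAt_id (0 : ℝ)).const_mul (2 * f (x, v))
    refine h4.hasDerivWithinAt.congr (fun t ht => ?_) (by rw [h0, mul_zero])
    rcases eq_or_lt_of_le (show (0 : ℝ) ≤ t from ht) with rfl | ht
    · rw [h0, mul_zero]
    · exact h2 t ht
  exact mul_left_cancel₀ two_ne_zero ((uniqueDiffOn_Ici (0 : ℝ) 0 Set.self_mem_Ici).eq_deriv _ h1 h3)

end hessian

variable {m : ℕ} {X : TGroupoid m} {E : TBundle X}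

namespace TBundle

variable {q : E.total.RawForm}

/-- The real part of the moment of a form. -/
noncomputable def realMoment (E : TBundle X) (q : E.total.RawForm) (i : X.ι) (p : X.V i × Fib (E.rank i)) : ℝ :=
  (EqRing.exists_functional m).choose (E.oneMoment q i p)

/-- The quadratic part of the moment of a form. -/
noncomputable def quadMoment (E : TBundle X) (q : E.total.RawForm) (i : X.ι) : X.V i × Fib (E.rank i) → ℝ :=
  fibreHessian (E.realMoment q i) (X.dom i)

theorem cnear_realMoment (hX : X.IsOrbifold) (hE : E.IsSmooth) (hq : E.total.IsForm q) (i : X.ι)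
    (p : X.V i × Fib (E.rank i)) (hp : p ∈ tube (X.dom i) (E.rank i)) :
    CNear (E.realMoment q i) (tube (X.dom i) (E.rank i)) p :=
  (smoothNear_oneMoment hX hE hq i hp).functional _

theorem isFibreQuadratic_quadMoment (hX : X.IsOrbifold) (hE : E.IsSmooth) (hq : E.total.IsForm q) (i : X.ι) :
    IsFibreQuadratic (E.quadMoment q i) (X.dom i) :=
  isFibreQuadratic_fibreHessian (hX.goodSet_dom i) (cnear_realMoment hX hE hq i)

theorem quadMoment_invariant (hX : X.IsOrbifold) (hE : E.IsSmooth) (hq : E.total.IsForm q)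
    {x y : X.Obj} (a : x ⟶ y) (v : Fib (E.rank x.chart)) :
    E.quadMoment q y.chart (y.pt, E.act a v) = E.quadMoment q x.chart (x.pt, v) := by
  refine fibreHessian_congr (hX.goodSet_dom _) (cnear_realMoment hX hE hq _) (hX.goodSet_dom _)
    (cnear_realMoment hX hE hq _) x.mem y.mem fun t => ?_
  have h1 : (y.pt, t • E.act a v) = (y.pt, E.act a (t • v)) := Prod.ext rfl (map_smul _ _ _).symm
  have h2 := (congrArg (E.oneMoment q y.chart) h1).trans (oneMoment_invariant hX hE hq a (t • v))
  exact congrArg (EqRing.exists_functional m).choose h2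

/-- The points over which the quadratic part of the moment is positive. -/
def posSet (E : TBundle X) (q : E.total.RawForm) : Set X.Obj :=
  {x | ∀ v : Fib (E.rank x.chart), v ≠ 0 → 0 < E.quadMoment q x.chart (x.pt, v)}

theorem isOpen_posSet (hX : X.IsOrbifold) (hE : E.IsSmooth) (hq : E.total.IsForm q) : IsOpen (E.posSet q) := by
  refine TGroupoid.isOpen_obj fun x hx => ?_
  obtain ⟨U, hU, hxU, c, hc, h⟩ := (isFibreQuadratic_quadMoment hX hE hq x.chart).lower_bound x.mem hx
  refine ⟨U, hU, hxU, fun u hu huU v hv => ?_⟩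
  exact lt_of_lt_of_le (mul_pos hc (pow_pos (norm_pos_iff.mpr hv) 2)) (h u ⟨huU, hu⟩ v)

theorem posSet_invariant (hX : X.IsOrbifold) (hE : E.IsSmooth) (hq : E.total.IsForm q)
    {x y : X.Obj} (a : x ⟶ y) (hy : y ∈ E.posSet q) : x ∈ E.posSet q := fun v hv => by
  rw [← quadMoment_invariant hX hE hq a]
  exact hy _ fun h => hv ((E.act_bijective a).1 (h.trans (map_zero _).symm))

end TBundle

namespace BoundaryCondition

variable {B : BoundaryCondition E} {q : E.total.RawForm} {q' : B.E'.total.RawForm}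

/-- The inclusion of a wall. -/
noncomputable def wallIncl (B : BoundaryCondition E) (a : B.g.κ) :
    X.boundary.V (B.g.chart a) × Fib (E.boundary.rank (B.g.chart a)) →L[ℝ]
      X.V (B.g.chart a).1 × Fib (E.rank (B.g.chart a).1) :=
  (X.wall (B.g.chart a).1 (B.g.chart a).2).ker.subtypeL.prodMap (ContinuousLinearMap.id ℝ _)

theorem oneForm_eq (hqq : ∀ a, ∀ x ∈ B.g.O a, ∀ v, restrictTotal q (B.g.chart a) (x, v) = B.h.pullTot q' a (x, v))
    (w : B.g.Cov) (v : Fib (E.boundary.rank (B.g.chart w.1))) :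
    E.oneForm q (B.g.chart w.1).1 (B.wallIncl w.1 (w.2.1, v)) ∘ₗ (B.wallIncl w.1).toLinearMap =
      B.E'.oneForm q' (B.g.tgtChart w.1) (B.h.tot w.1 (w.2.1, v)) ∘ₗ
        (fderivWithin ℝ (B.h.tot w.1) (tube (B.g.O w.1) (E.boundary.rank (B.g.chart w.1))) (w.2.1, v)).toLinearMap :=
  (EForm.degOne_pull _ _).symm.trans ((congrArg EForm.degOne (hqq w.1 w.2.1 w.2.2 v)).trans (EForm.degOne_pull _ _))

theorem oneMoment_eq (hX : X.IsOrbifold) (hE : E.IsSmooth)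
    (hqq : ∀ a, ∀ x ∈ B.g.O a, ∀ v, restrictTotal q (B.g.chart a) (x, v) = B.h.pullTot q' a (x, v))
    (w : B.g.Cov) (v : Fib (E.boundary.rank (B.g.chart w.1))) :
    B.E'.oneMoment q' (B.g.tgtChart w.1) (B.h.tot w.1 (w.2.1, v)) =
      E.oneMoment q (B.g.chart w.1).1 (B.wallIncl w.1 (w.2.1, v)) := by
  refine Finset.sum_congr rfl fun j _ => ?_
  have hk0 : X.wall (B.g.chart w.1).1 (B.g.chart w.1).2 (X.ofBoundary (B.g.ref w)).pt = 0 :=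
    (show (X.wall (B.g.chart w.1).1 (B.g.chart w.1).2).ker from w.2.1).2
  have hk := TBundle.fund_mem_ker (x := X.ofBoundary (B.g.ref w)) hX hE hk0 j
  have h1 := B.h.fderivWithin_tot_tfund hX hE B.isOrbifold B.smooth_bundle B.smooth_map w v j (u := ⟨_, hk⟩) rfl
  have h2 := congrArg (fun A => A (⟨_, hk⟩, E.inf (B.g.chart w.1).1 j (X.ofBoundary (B.g.ref w)).pt v))
    (oneForm_eq hqq w v)
  exact congrArg (lam j * ·) ((congrArg _ h1.symm).trans h2.symm)

theorem quadMoment_eq (hX : X.IsOrbifold) (hE : E.IsSmooth) (hq : E.total.IsForm q)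
    (hquad : E.IsQuadratic q) (hloc : E.IsLocalizing q) (hq' : B.E'.total.IsForm q')
    (hqq : ∀ a, ∀ x ∈ B.g.O a, ∀ v, restrictTotal q (B.g.chart a) (x, v) = B.h.pullTot q' a (x, v))
    (w : B.g.Cov) (v : Fib (E.boundary.rank (B.g.chart w.1))) :
    B.E'.quadMoment q' (B.g.tgtChart w.1) (B.h.tot w.1 (w.2.1, v)) =
      E.momentFun q (B.g.chart w.1).1 (B.wallIncl w.1 (w.2.1, v)) := by
  have hx := (X.ofBoundary (B.g.ref w)).mem
  have hQ := hloc.isFibreQuadratic hX hE hq hquad (B.g.chart w.1).1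
  refine Eq.trans ?_ (hQ.fibreHessian_eq (hX.goodSet_dom _) hx v)
  refine fibreHessian_congr (x := (X.ofBoundary (B.g.ref w)).pt) (v := v) (hX.goodSet_dom _) hQ.smooth (B.isOrbifold.goodSet_dom _)
    (TBundle.cnear_realMoment B.isOrbifold B.smooth_bundle hq' _) hx (B.g.img w).mem fun t => ?_
  have h1 : B.h.tot w.1 (w.2.1, t • v) = (B.g.f w.1 w.2.1, t • B.h.lin w.1 w.2.1 v) := Prod.ext rfl (map_smul _ _ _)
  have h2 := oneMoment_eq hX hE hqq w (t • v)
  have h3 := (hloc.momentFun_spec (p := ((X.ofBoundary (B.g.ref w)).pt, t • v)) hx).2.2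
  have h4 := (congrArg (B.E'.oneMoment q' (B.g.tgtChart w.1)) h1.symm).trans (h2.trans h3)
  exact (congrArg _ h4).trans ((EqRing.exists_functional m).choose_spec _)

theorem img_mem_posSet (hX : X.IsOrbifold) (hE : E.IsSmooth) (hq : E.total.IsForm q)
    (hquad : E.IsQuadratic q) (hloc : E.IsLocalizing q) (hq' : B.E'.total.IsForm q')
    (hqq : ∀ a, ∀ x ∈ B.g.O a, ∀ v, restrictTotal q (B.g.chart a) (x, v) = B.h.pullTot q' a (x, v))
    (w : B.g.Cov) : B.g.img w ∈ B.E'.posSet q' := fun u hu => by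
  obtain ⟨v, hv⟩ := (B.h.bijective w.1 w.2.1 w.2.2).2 u
  have h1 := quadMoment_eq hX hE hq hquad hloc hq' hqq w v
  have h2 : 0 < E.momentFun q (B.g.chart w.1).1 (B.wallIncl w.1 (w.2.1, v)) :=
    hloc.momentFun_pos (X.ofBoundary (B.g.ref w)).mem fun h => hu
      (hv.symm.trans ((congrArg (B.h.lin w.1 w.2.1) h).trans (map_zero _)))
  rw [← h1] at h2
  exact (congrArg (fun u => 0 < B.E'.quadMoment q' (B.g.tgtChart w.1) (B.g.f w.1 w.2.1, u)) hv).mp h2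

end BoundaryCondition

end

section

namespace TBundle

theorem detSign_mul_self {r s : ℕ} {A : Fib r →L[ℝ] Fib s} (hA : Function.Bijective A) :
    detSign A * detSign A = 1 := by
  have h : r = s := by
    have := (LinearEquiv.ofBijective A.toLinearMap hA).finrank_eq
    simpa using this
  subst h
  have h1 : LinearMap.det A.toLinearMap ≠ 0 :=
    (LinearEquiv.isUnit_det' (LinearEquiv.ofBijective A.toLinearMap hA)).ne_zero
  rw [detSign_eq]
  rcases lt_or_gt_of_ne h1 with h2 | h2
  · rw [sign_neg h2]; simp
  · rw [sign_pos h2]; simp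

theorem detSign_id (r : ℕ) : detSign (ContinuousLinearMap.id ℝ (Fib r)) = 1 := by
  rw [detSign_eq]
  have : LinearMap.det (ContinuousLinearMap.id ℝ (Fib r)).toLinearMap = 1 := LinearMap.det_id
  rw [this, sign_one]
  rfl

end TBundle

namespace EForm

variable {m : ℕ} {V W W' : Type} [NormedAddCommGroup V] [NormedSpace ℝ V] [FiniteDimensional ℝ V]
  [NormedAddCommGroup W] [NormedSpace ℝ W] [FiniteDimensional ℝ W]
  [NormedAddCommGroup W'] [NormedSpace ℝ W'] [FiniteDimensional ℝ W'] {r s : ℕ}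

theorem hasFDerivWithinAt_bundleMap {O : Set V} {g : V → W'} {l : V → Fib r →L[ℝ] Fib s} {x : V} {v : Fib r}
    (hg : DifferentiableWithinAt ℝ g O x) (hl : DifferentiableWithinAt ℝ l O x) :
    ∃ D : V →L[ℝ] Fib s, HasFDerivWithinAt (fun p : V × Fib r => (g p.1, l p.1 p.2))
      (((fderivWithin ℝ g O x).comp (ContinuousLinearMap.fst ℝ V (Fib r))).prod
        (D.comp (ContinuousLinearMap.fst ℝ V (Fib r)) + (l x).comp (ContinuousLinearMap.snd ℝ V (Fib r))))
      (tube O r) (x, v) := by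
  have hfst : HasFDerivWithinAt (fun p : V × Fib r => p.1) (ContinuousLinearMap.fst ℝ V (Fib r)) (tube O r) (x, v) :=
    hasFDerivAt_fst.hasFDerivWithinAt
  have h1 := hg.hasFDerivWithinAt.comp (x, v) hfst fun p hp => hp
  have h2 := (hl.hasFDerivWithinAt.comp (x, v) hfst fun p hp => hp).clm_apply
    (hasFDerivAt_snd (𝕜 := ℝ) (p := (x, v))).hasFDerivWithinAt
  refine ⟨(fderivWithin ℝ l O x).flip v, (h1.prodMk h2).congr_fderiv ?_⟩
  refine ContinuousLinearMap.ext fun p => Prod.ext rfl ?_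
  exact add_comm _ _

/-- Two fibre integrals of kernels agree after pullback if the data do. -/
theorem pull_fpush_kernel_eq {O : Set V} {T : Set W} {T' : Set W'} (hO : GoodSet O) (hT : GoodSet T)
    (hT' : GoodSet T') {i : V →L[ℝ] W} (hi : ∀ x ∈ O, i x ∈ T) {g : V → W'} {l : V → Fib r →L[ℝ] Fib s}
    (hg : ContDiffOn ℝ ∞ g O) (hl : ContDiffOn ℝ ∞ l O) (hgT : ∀ x ∈ O, g x ∈ T')
    {f : W × Fib r → ℝ} (hf : IsFibreQuadratic f T) (hpos : ∀ x ∈ T, ∀ v, v ≠ 0 → 0 < f (x, v))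
    {f' : W' × Fib s → ℝ}
    {β : W × Fib r → (W × Fib r →ₗ[ℝ] EqRing m)} {β' : W' × Fib s → (W' × Fib s →ₗ[ℝ] EqRing m)}
    (hβ : ∀ p ∈ tube T r, SmoothNear β (tube T r) p) (hβ' : ∀ p ∈ tube T' s, SmoothNear β' (tube T' s) p)
    (hββ : ∀ p ∈ tube O r, β (i p.1, p.2) ∘ₗ (i.prodMap (ContinuousLinearMap.id ℝ (Fib r))).toLinearMap =
      β' (g p.1, l p.1 p.2) ∘ₗ
        (fderivWithin ℝ (fun p : V × Fib r => (g p.1, l p.1 p.2)) (tube O r) p).toLinearMap)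
    {φ : W × Fib r → EForm m (W × Fib r)} {φ' : W' × Fib s → EForm m (W' × Fib s)}
    (hφ : ∀ p : W × Fib r, p.1 ∈ T → p.2 ≠ 0 → SmoothNear φ (tube T r) p)
    {x : V} (hx : x ∈ O) (hlx : Function.Bijective (l x))
    (hff : ∀ v, f' (g x, l x v) = f (i x, v))
    (hφφ : ∀ v, v ≠ 0 → pull (i.prodMap (ContinuousLinearMap.id ℝ (Fib r))).toLinearMap (φ (i x, v)) =
      TBundle.detSign (l x) • pull
        (fderivWithin ℝ (fun p : V × Fib r => (g p.1, l p.1 p.2)) (tube O r) (x, v)).toLinearMap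
        (φ' (g x, l x v)))
    {ψ : W → ℝ} {ψ' : W' → ℝ} (hψ : ψ' (g x) = ψ (i x)) {N N' : ℕ} (hN : N' = N)
    (hK : FibreCompact (fun p => ψ p.1 • kernel N f (dform (fun p => one (β p)) (tube T r)) φ p) T)
    (hK' : FibreCompact (fun p => ψ' p.1 • kernel N' f' (dform (fun p => one (β' p)) (tube T' s)) φ' p) T') :
    pull i.toLinearMap (fpush (fun p => ψ p.1 • kernel N f (dform (fun p => one (β p)) (tube T r)) φ p) (i x)) =
      pull (fderivWithin ℝ g O x).toLinearMap
        (fpush (fun p => ψ' p.1 • kernel N' f' (dform (fun p => one (β' p)) (tube T' s)) φ' p) (g x)) := by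
  set I := i.prodMap (ContinuousLinearMap.id ℝ (Fib r)) with hI
  set h : V × Fib r → W' × Fib s := fun p => (g p.1, l p.1 p.2) with hh
  have hOG := hO.tube (r := r)
  have hOU := hOG.uniqueDiffOn
  have hIm : ∀ p ∈ tube O r, I p ∈ tube T r := fun p hp => hi p.1 hp
  have hhm : ∀ p ∈ tube O r, h p ∈ tube T' s := fun p hp => hgT p.1 hp
  have hIc : ∀ p, CNear (fun p => I p) (tube O r) p := fun p => CNear.of_contDiff I.contDiff
  have hhc : ∀ p, CNear h (tube O r) p := fun p => CNear.of_contDiffOn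
    ((hg.comp contDiff_fst.contDiffOn fun p hp => hp).prodMk
      ((hl.comp contDiff_fst.contDiffOn fun p hp => hp).clm_apply contDiff_snd.contDiffOn))
  have hID : ∀ p ∈ tube O r, fderivWithin ℝ (fun p => I p) (tube O r) p = I := fun p hp =>
    I.hasFDerivWithinAt.fderivWithin (hOU p hp)
  set γ : V × Fib r → (V × Fib r →ₗ[ℝ] EqRing m) := fun p => β (I p) ∘ₗ I.toLinearMap with hγ
  have hγs : ∀ p ∈ tube O r, SmoothNear γ (tube O r) p := fun p hp => by
    have h1 := SmoothNear.comp (hIc p) hp (hβ (I p) (hIm p hp)) isOpen_univ trivial fun y hy => hIm y hy.2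
    exact h1.lin (N := V × Fib r →ₗ[ℝ] EqRing m) (LinearMap.lcomp ℝ (EqRing m) I.toLinearMap)
  have hfm : IsFibreQuadratic (fun p => f (I p)) O :=
    ⟨fun p hp => CNear.comp (hIc p) hp (hf.smooth (I p) (hIm p hp)) isOpen_univ trivial fun y hy => hIm y hy.2,
      fun x hx s hs v => hf.hom (i x) (hi x hx) s hs v⟩
  have hφm : ∀ p : V × Fib r, p.1 ∈ O → p.2 ≠ 0 →
      SmoothNear (fun p => pull I.toLinearMap (φ (I p))) (tube O r) p := fun p hp hv =>
    (SmoothNear.comp (hIc p) hp (hφ (I p) (hi _ hp) hv) isOpen_univ trivial fun y hy => hIm y hy.2).lin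
      (pullLin m I.toLinearMap)
  have hKm : FibreCompact (fun p => (fun _ => ψ (i x)) p.1 • kernel N (fun p => f (I p))
      (dform (fun p => one (γ p)) (tube O r)) (fun p => pull I.toLinearMap (φ (I p))) p) O :=
    fibreCompact_kernel hfm (fun p hp => smoothNear_dform ((hγs p hp).lin (oneLin m _)) hOU) hφm
      (fun x _ => CNear.const _) (fun x hx => Or.inl fun v hv => hpos _ (hi x hx) v hv) N
  have e1 := pull_fpush_kernel (A := ContinuousLinearMap.id ℝ (Fib r)) Function.bijective_id
    (J := fun _ => I.toLinearMap) (B := i.toLinearMap) (fun v p => rfl)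
    (fun v u => Prod.ext (map_zero i) rfl) (S := O) (T := T) (f := fun p => f (I p)) (f' := f)
    (Ω := dform (fun p => one (γ p)) (tube O r)) (Ω' := dform (fun p => one (β p)) (tube T r))
    (φ := fun p => pull I.toLinearMap (φ (I p))) (φ' := φ) (ψ := fun _ => ψ (i x)) (ψ' := ψ) hfm hx (hi x hx)
    (N := N) (N' := N) rfl rfl (fun v => rfl)
    (fun v => by
      have h1 := dform_one_pull (m := m) (Θ := fun p => I p) (x := (x, v)) (hIc _) hx hOG hT.tube.uniqueDiffOn
        isOpen_univ trivial (fun y hy => hIm y hy.2) (hβ _ (hIm (x, v) hx)) (hγs (x, v) hx)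
        (fun y hy => by rw [hID y hy.2])
      rw [hID (x, v) hx] at h1
      exact h1.symm)
    (fun v hv => by rw [TBundle.detSign_id, one_smul]; rfl) hKm hK
  have hJ : ∀ v p, (fderivWithin ℝ h (tube O r) (x, v) p).1 = fderivWithin ℝ g O x p.1 ∧
      ∀ u, fderivWithin ℝ h (tube O r) (x, v) (0, u) = (0, l x u) := fun v p => by
    obtain ⟨D, hD⟩ := hasFDerivWithinAt_bundleMap (r := r) (v := v) ((hg x hx).differentiableWithinAt (by simp))
      ((hl x hx).differentiableWithinAt (by simp))
    rw [hD.fderivWithin (hOU (x, v) hx)]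
    refine ⟨rfl, fun u => Prod.ext (map_zero (fderivWithin ℝ g O x)) ?_⟩
    change D 0 + l x u = l x u
    rw [map_zero, zero_add]
  have e2 := pull_fpush_kernel (A := l x) hlx
    (J := fun v => (fderivWithin ℝ h (tube O r) (x, v)).toLinearMap) (B := (fderivWithin ℝ g O x).toLinearMap)
    (fun v p => (hJ v p).1) (fun v u => (hJ v 0).2 u) (S := O) (T := T') (f := fun p => f (I p)) (f' := f')
    (Ω := dform (fun p => one (γ p)) (tube O r)) (Ω' := dform (fun p => one (β' p)) (tube T' s))
    (φ := fun p => pull I.toLinearMap (φ (I p))) (φ' := φ') (ψ := fun _ => ψ (i x)) (ψ' := ψ') hfm hx (hgT x hx)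
    hN hψ hff
    (fun v => (dform_one_pull (m := m) (Θ := h) (x := (x, v)) (hhc _) hx hOG hT'.tube.uniqueDiffOn
        isOpen_univ trivial (fun y hy => hhm y hy.2) (hβ' _ (hhm (x, v) hx)) (hγs (x, v) hx)
        (fun y hy => hββ y hy.2)).symm)
    (fun v hv => by
      have h1 := hφφ v hv
      change _ = TBundle.detSign (l x) • pull I.toLinearMap (φ (i x, v))
      rw [h1, smul_smul, TBundle.detSign_mul_self hlx, one_smul]) hKm hK'
  exact e1.trans e2.symm

end EForm

variable {m : ℕ} {X : TGroupoid m} {E : TBundle X}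

namespace BoundaryCondition

variable {B : BoundaryCondition E} {q φ : E.total.RawForm}

theorem totalDim_add_two (hX : X.IsOrbifold) (w : B.g.Cov) :
    E.totalDim (B.g.chart w.1).1 + 2 = B.dim + 3 := by
  have h1 : Module.finrank ℝ (X.wall (B.g.chart w.1).1 (B.g.chart w.1).2).ker + E.rank (B.g.chart w.1).1 = B.dim :=
    B.totalDim (B.g.chart w.1) ⟨_, (B.g.ref w).mem⟩
  have h2 : (X.wall (B.g.chart w.1).1 (B.g.chart w.1).2).toLinearMap ≠ 0 := fun h =>
    (hX.walls_indep (B.g.chart w.1).1).ne_zero (B.g.chart w.1).2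
      (ContinuousLinearMap.ext fun v => congrArg (fun f => f v) h)
  have h3 := Module.Dual.finrank_ker_add_one_of_ne_zero h2
  have h4 : E.totalDim (B.g.chart w.1).1 = Module.finrank ℝ (X.V (B.g.chart w.1).1) + E.rank (B.g.chart w.1).1 := by
    unfold TBundle.totalDim
    rw [Module.finrank_prod]
    simp
  have h5 : Module.finrank ℝ (X.wall (B.g.chart w.1).1 (B.g.chart w.1).2).toLinearMap.ker =
    Module.finrank ℝ (X.wall (B.g.chart w.1).1 (B.g.chart w.1).2).ker := rfl
  omega

theorem rank_eq (w : B.g.Cov) : B.E'.rank (B.g.tgtChart w.1) = E.rank (B.g.chart w.1).1 := by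
  have := (LinearEquiv.ofBijective (B.h.lin w.1 w.2.1).toLinearMap (B.h.bijective w.1 w.2.1 w.2.2)).finrank_eq
  simpa using this.symm

/-- The primitive is pulled back on the boundary. -/
theorem isPulledBack_primitive (hX : X.IsOrbifold) (hE : E.IsSmooth) (hc : X.IsCompact) (hq : E.total.IsForm q)
    (hquad : E.IsQuadratic q) (hloc : E.IsLocalizing q) (hφ : E.IsSphereForm φ) (hBq : B.Satisfies q)
    (hBφ : B.SatisfiesSphere φ) : B.IsPulledBack (E.primitive q φ) := by
  obtain ⟨q', hq', hqq⟩ := hBq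
  obtain ⟨φ', hφ', hφφ⟩ := hBφ
  obtain ⟨χ, hχ, hχ1, hχ0⟩ := OrbMap.exists_cutoff hX hc B.isOrbifold B.smooth_map
    (S := B.E'.posSet q')
    (TBundle.isOpen_posSet B.isOrbifold B.smooth_bundle hq')
    (fun a hy => TBundle.posSet_invariant B.isOrbifold B.smooth_bundle hq' a hy)
    (fun w => img_mem_posSet hX hE hq hquad hloc hq' hqq w)
  have hQ' := TBundle.isFibreQuadratic_quadMoment B.isOrbifold B.smooth_bundle hq'
  have hψ : ∀ i, ∀ x ∈ B.Z'.dom i, CNear (fun x => (-1 : ℝ) ^ (B.E'.rank i + 1) * χ i x) (B.Z'.dom i) x :=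
    fun i x hx => (CNear.const _).mul (CNear.of_contDiffOn (hχ.smooth i))
  have hpos : ∀ i, ∀ x ∈ B.Z'.dom i, (∀ v, v ≠ 0 → 0 < B.E'.quadMoment q' i (x, v)) ∨
      ∃ U, IsOpen U ∧ x ∈ U ∧ ∀ y ∈ U ∩ B.Z'.dom i, (-1 : ℝ) ^ (B.E'.rank i + 1) * χ i y = 0 := fun i x hx => by
    by_cases h : (⟨i, x, hx⟩ : B.Z'.Obj) ∈ B.E'.posSet q'
    · exact Or.inl h
    · obtain ⟨O, hO, hxO, h0⟩ := hχ0 _ h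
      exact Or.inr ⟨O, hO, hxO, fun y hy => by rw [h0 y hy, mul_zero]⟩
  refine ⟨B.E'.pushKernel (fun _ => B.dim + 3) (fun i x => (-1) ^ (B.E'.rank i + 1) * χ i x)
    (B.E'.quadMoment q') (B.E'.oneForm q') φ', TBundle.isForm_pushKernel B.isOrbifold B.smooth_bundle
    (TBundle.smoothNear_oneForm hq') (fun _ => rfl) (TBundle.isInvariant_oneForm hq') hQ'
    (fun a v => TBundle.quadMoment_invariant B.isOrbifold B.smooth_bundle hq' a v) hφ' hψ
    (fun a => by rw [B.E'.rank_eq a, hχ.invariant a]) hpos, fun a x hx => ?_⟩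
  have hQ := hloc.isFibreQuadratic hX hE hq hquad
  have hK := TBundle.fibreCompact_pushKernel (N := fun i => E.totalDim i + 2)
    (ψ := fun i _ => (-1) ^ (E.rank i + 1)) hX (TBundle.smoothNear_oneForm hq) hQ hφ
    (fun i x _ => CNear.const _) (fun i x hx => Or.inl fun v hv => hloc.momentFun_pos hx hv)
  have hK' := TBundle.fibreCompact_pushKernel (N := fun _ => B.dim + 3) B.isOrbifold
    (TBundle.smoothNear_oneForm hq') hQ' hφ' hψ hpos
  exact EForm.pull_fpush_kernel_eq (m := m) (r := E.rank (B.g.chart a).1) (s := B.E'.rank (B.g.tgtChart a))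
    (O := B.g.O a) (T := X.dom (B.g.chart a).1) (T' := B.Z'.dom (B.g.tgtChart a))
    (B.g.goodSet_cover hX B.smooth_map a) (hX.goodSet_dom _) (B.isOrbifold.goodSet_dom _)
    (i := (X.wall (B.g.chart a).1 (B.g.chart a).2).ker.subtypeL) (fun x hx => B.g.subset_dom a hx)
    (g := B.g.f a) (l := B.h.lin a) (B.smooth_map.smooth a) (B.h.smooth a) (fun x hx => B.g.mapsTo a hx)
    (f := E.momentFun q (B.g.chart a).1) (hQ _) (fun x hx v hv => hloc.momentFun_pos hx hv)
    (f' := B.E'.quadMoment q' (B.g.tgtChart a)) (β := E.oneForm q (B.g.chart a).1)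
    (β' := B.E'.oneForm q' (B.g.tgtChart a)) (TBundle.smoothNear_oneForm hq _) (TBundle.smoothNear_oneForm hq' _)
    (fun p hp => oneForm_eq hqq ⟨a, p.1, hp⟩ p.2) (φ := φ (B.g.chart a).1) (φ' := φ' (B.g.tgtChart a))
    (fun p hp hv => hφ.smoothNear hp hv) (x := x) hx (B.h.bijective a x hx)
    (fun v => quadMoment_eq hX hE hq hquad hloc hq' hqq ⟨a, x, hx⟩ v) (fun v hv => hφφ a x hx v hv)
    (ψ := fun _ => (-1) ^ (E.rank (B.g.chart a).1 + 1))
    (ψ' := fun x => (-1) ^ (B.E'.rank (B.g.tgtChart a) + 1) * χ (B.g.tgtChart a) x)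
    (by
      have h1 : χ (B.g.tgtChart a) (B.g.f a x) = 1 := hχ1 ⟨a, x, hx⟩
      have h2 : B.E'.rank (B.g.tgtChart a) = E.rank (B.g.chart a).1 := rank_eq ⟨a, x, hx⟩
      simp only [h1, h2, mul_one])
    (N := E.totalDim (B.g.chart a).1 + 2) (N' := B.dim + 3) (totalDim_add_two hX ⟨a, x, hx⟩).symm
    (hK _) (hK' _)

end BoundaryCondition

end

theorem mainTheorem11 (m : ℕ) (Z : TGroupoid m) (hZ : Z.IsOrbifold)
    (E : TBundle Z) (hE : E.IsSmooth)
    (q : E.total.RawForm) (hq : E.total.IsForm q) (hquad : E.IsQuadratic q)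
    (hloc : E.IsLocalizing q)
    (φ : E.total.RawForm) (e : Z.RawForm) (hφ : E.IsAngularForm φ e) :
    E.FibreIntegrable (E.total.expD E.total.dom q) ∧
    (∃ ε : Z.RawForm, Z.IsForm ε ∧
      ∀ i, ∀ x ∈ Z.dom i, E.segre q i x * e i x = 1 + Z.cartanD Z.dom ε i x) ∧
    (Z.IsCompact → ∀ B : BoundaryCondition E, B.Satisfies q → B.SatisfiesSphere φ →
      ∃ ε : Z.RawForm, Z.IsForm ε ∧
        (∀ i, ∀ x ∈ Z.dom i, E.segre q i x * e i x = 1 + Z.cartanD Z.dom ε i x) ∧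
        B.IsPulledBack ε) := by
  obtain ⟨h1, h2⟩ := TBundle.segre_mul_eq hZ hE hq hquad hloc hφ
  have h3 := TBundle.isForm_primitive hZ hE hq hquad hloc hφ.sphere_form
  exact ⟨h1, ⟨_, h3, h2⟩, fun hc B hB hB' => ⟨_, h3, h2,
    BoundaryCondition.isPulledBack_primitive hZ hE hc hq hquad hloc hφ.sphere_form hB hB'⟩⟩
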